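/- Let $M$ be a smooth manifold, $n\in\mathbb{N}$, and let $(\mathbf{E}=\bigoplus_{i=-n}^{-1}E_i\to M,\ \mu)$ be an $n$-coalgebra bundle: the $E_i$ are smooth real vector bundles of finite rank and $\mu:\mathbf{E}\to\mathbf{E}\otimes\mathbf{E}$ is a degree-preserving smooth vector bundle map over $\mathrm{id}_M$ which is coassociative and graded cocommutative, i.e. invariant under the graded flip $e\otimes e'\mapsto(-1)^{|e||e'|}e'\otimes e$. Put $\mu^0=\mathrm{id}$, $\mu^{k+1}=(\mathrm{id}\otimes\mu^{k})\circ\mu:\mathbf{E}\to\mathbf{E}^{\otimes (k+2)}$, and let $\mathbf{K}^\mu\subseteq\mathbf{E}\otimes\mathbf{E}$ consist of all $e$ with $$\tau\cdot(\mu^k\otimes\mu^l)(e)=\tau'\cdot(\mu^{k'}\otimes\mu^{l'})(e)$$ for all $k+l=k'+l'$ and all permutations $\tau,\tau'\in S_{k+l+2}$ (acting with Koszul signs). Assume that $(\mathbf{E},\mu)$ is admissible: $\operatorname{im}(\mu|_{E_i})=K^\mu_i$ (the degree $i$ part of $\mathbf K^\mu$) for $i=-n,\dots,-2$; write $\mu_i=\mu|_{E_i}$.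 Let $\mathcal{M}=\mathcal{F}(\mathbf{E},\mu)=(M,C_{\mathcal{M}})$, where $C_{\mathcal{M}}=\Gamma_{\mathrm{Sym}\,\mathbf{E}^*}/\mathcal{I}_\mu$ and $\mathcal{I}_\mu$ is the sheaf of ideals generated by $\omega\cdot\eta-\mu^*(\omega,\eta)$ for homogeneous sections $\omega,\eta$ of $\mathbf{E}^*$ with $|\omega|+|\eta|\le n$. For $U\subseteq M$ open, let $\mathcal{T}^k_{\mathcal{M}}(U)$ be the set of degree $k$ vector fields on $\mathcal M|_U$: the $\mathbb{R}$-linear maps $X:C_{\mathcal{M}}(U)\to C_{\mathcal{M}}(U)$ of degree $k$ with $X(fg)=X(f)g+(-1)^{k|f|}fX(g)$ for $f$ homogeneous. Let $\mathbf{E}^*_{\mathbb{R}}=\mathbb{R}_M\oplus\bigoplus_{i=1}^nE_{-i}^*$ (degrees $0,\dots,n$), with the multiplication $m$ given by $\mu^*$ and scalar multiplication. A degree $k$ derivation of $\mathbf{E}^*_{\mathbb{R}}|_U$ is a degree $k$ operator $D$ on $\Gamma(U,\mathbf{E}^*_{\mathbb{R}})$ such that $D(fe)=X(f)e+fD(e)$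 for some smooth vector field $X$ on $U$ (the symbol); these are the sections of a bundle $\mathrm{Der}(\mathbf{E}^*_{\mathbb{R}})_k$, whose fibre at $x$ consists of the degree $k$ derivations at $x$, i.e. the $\mathbb{R}$-linear maps $\delta:\Gamma(\mathbf{E}^*_{\mathbb{R}})\to(\mathbf{E}^*_{\mathbb{R}})_x$ of degree $k$ with $\delta(fe)=v(f)e(x)+f(x)\delta(e)$ for some $v\in T_xM$. The derivation $D$ is compatible with $m$ if $$D(m(e,e'))=m(D(e),e')+(-1)^{k|e|}m(e,D(e'))\qquad\text{for homogeneous } e,e' \text{ with } |e|+|e'|\le n,$$ and $\mathrm{Der}(\mathbf{E}^*_{\mathbb{R}},m)_k\subseteq\mathrm{Der}(\mathbf{E}^*_{\mathbb{R}})_k$ consists of the derivations at points that satisfy the same identity. Then the canonical maps $\Gamma_{(\mathbf{E}^*_{\mathbb{R}})_i}\to C^i_{\mathcal{M}}$, $0\le i\le n$, are isomorphisms, and for each $k=-n,\dots,0$: 1. $\mathrm{Der}(\mathbf{E}^*_{\mathbb{R}},m)_k$ is a smooth subbundle (of constant rank) of $\mathrm{Der}(\mathbf{E}^*_{\mathbb{R}})_k$,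 and its sections over any open $U$ are exactly the degree $k$ derivations of $\mathbf{E}^*_{\mathbb{R}}|_U$ compatible with $m$. 2. Vector fields restrict uniquely to open subsets, and $$\mathcal{T}^k_{\mathcal{M}}=\Gamma_{\mathrm{Der}(\mathbf{E}^*_{\mathbb{R}},m)_k},$$ that is, restricting the action of a vector field on $C_\mathcal{M}$ to $\Gamma_{\mathbf{E}^*_{\mathbb{R}}}$ gives, for each open $U$, an isomorphism of $C^\infty(U)$-modules $\mathcal{T}^k_{\mathcal{M}}(U)\to\Gamma(U,\mathrm{Der}(\mathbf{E}^*_{\mathbb{R}},m)_k)$, compatible with restriction to open subsets. In particular, if $n\ge1$, then $\ker\mu_{-n}$ is a smooth subbundle (of constant rank) of $E_{-n}$ and $\mathcal{T}^{-n}_{\mathcal{M}}=\Gamma_{\ker\mu_{-n}}$: there are isomorphisms of $C^\infty(U)$-modules $\mathcal{T}^{-n}_{\mathcal{M}}(U)\cong\Gamma(U,\ker\mu_{-n})$, $X\leftrightarrow s$, compatible with restriction, with $X(e)=\langle e,s\rangle$ for $e\in\Gamma(U,E_{-n}^*)$ and $X=0$ on $\Gamma(U,(\mathbf{E}^*_{\mathbb{R}})_i)$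 for $i<n$. -/

import Mathlib

open Bundle TopologicalSpace
open scoped Manifold ContDiff TensorProduct

set_option linter.unusedSectionVars false

noncomputable section

namespace NManifold

/-! ### Linear algebra of one fibre

A negatively graded vector space `⊕_{i=1}^n V_{-i}` is a family `V : Fin n → Type*`, the index
`i : Fin n` standing for the degree `-(i + 1)`; its total space is `∀ i, V i`. -/

section Fibre

variable {n : ℕ} {V : Fin n → Type*} [∀ i, AddCommGroup (V i)] [∀ i, Module ℝ (V i)]

/-- The component `𝐕 ⊗ 𝐕 → V i ⊗ V j`. -/
def comp₂ (V : Fin n → Type*) [∀ i, AddCommGroup (V i)] [∀ i, Module ℝ (V i)] (i j : Fin n) :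
    (∀ i, V i) ⊗[ℝ] (∀ i, V i) →ₗ[ℝ] V i ⊗[ℝ] V j :=
  TensorProduct.map (LinearMap.proj i) (LinearMap.proj j)

/-- The subspace of `𝐕 ⊗ 𝐕` of elements of degree `-q`. -/
def tensorDeg (V : Fin n → Type*) [∀ i, AddCommGroup (V i)] [∀ i, Module ℝ (V i)] (q : ℕ) :
    Set ((∀ i, V i) ⊗[ℝ] (∀ i, V i)) :=
  {e | ∀ i j : Fin n, (i.val + 1) + (j.val + 1) ≠ q → comp₂ V i j e = 0}

/-- The Koszul sign of `v_0 ⊗ ⋯ ⊗ v_{r-1} ↦ v_{τ 0} ⊗ ⋯ ⊗ v_{τ (r-1)}`, where `v_a` is homogeneous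
of index `δ a`: a factor `(-1)^{|v||w|}` for each pair whose order is reversed. -/
def koszulSign {r : ℕ} (δ : Fin r → Fin n) (τ : Equiv.Perm (Fin r)) : ℝ :=
  ∏ a : Fin r, ∏ b : Fin r,
    if a < b ∧ τ b < τ a then (-1) ^ (((δ (τ a)).val + 1) * ((δ (τ b)).val + 1)) else 1

/-- The graded braiding action of the symmetric group on `⊗^r 𝐕`: on homogeneous elements,
`τ · (v_0 ⊗ ⋯ ⊗ v_{r-1}) = ε(τ) v_{τ 0} ⊗ ⋯ ⊗ v_{τ (r-1)}`. -/
def braiding (V : Fin n → Type*) [∀ i, AddCommGroup (V i)] [∀ i, Module ℝ (V i)] {r : ℕ}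
    (τ : Equiv.Perm (Fin r)) : (⨂[ℝ]^r (∀ i, V i)) →ₗ[ℝ] (⨂[ℝ]^r (∀ i, V i)) :=
  ∑ δ : Fin r → Fin n, koszulSign δ τ •
    ((PiTensorProduct.reindex ℝ (fun _ : Fin r => ∀ i, V i) τ.symm).toLinearMap ∘ₗ
      PiTensorProduct.map (fun a => LinearMap.single ℝ V (δ a) ∘ₗ LinearMap.proj (δ a)))

/-- The identification `𝐕 ≃ ⊗^1 𝐕`. -/
def tensorOne (V : Fin n → Type*) [∀ i, AddCommGroup (V i)] [∀ i, Module ℝ (V i)] :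
    (∀ i, V i) →ₗ[ℝ] (⨂[ℝ]^1 (∀ i, V i)) :=
  (PiTensorProduct.subsingletonEquiv (R := ℝ) (s := fun _ => ∀ i, V i) (0 : Fin 1)).symm.toLinearMap

/-- The iterated comultiplication `μ^k : 𝐕 → ⊗^{k+1} 𝐕`,
`μ^k = (id ⊗ ⋯ ⊗ id ⊗ μ) ∘ ⋯ ∘ (id ⊗ μ) ∘ μ`, that is `μ^0 = id`, `μ^{k+1} = (id ⊗ μ^k) ∘ μ`. -/
def iterComul (μ : (∀ i, V i) →ₗ[ℝ] (∀ i, V i) ⊗[ℝ] (∀ i, V i)) :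
    (k : ℕ) → (∀ i, V i) →ₗ[ℝ] (⨂[ℝ]^(k + 1) (∀ i, V i))
  | 0 => tensorOne V
  | k + 1 =>
    (TensorPower.cast ℝ (∀ i, V i) (Nat.add_comm 1 (k + 1))).toLinearMap ∘ₗ
      (TensorPower.mulEquiv (R := ℝ) (M := ∀ i, V i)).toLinearMap ∘ₗ
        TensorProduct.map (tensorOne V) (iterComul μ k) ∘ₗ μ

/-- `μ^k ⊗ μ^l : 𝐕 ⊗ 𝐕 → ⊗^{(k+1)+(l+1)} 𝐕`. -/
def iterComulTensor (μ : (∀ i, V i) →ₗ[ℝ] (∀ i, V i) ⊗[ℝ] (∀ i, V i)) (k l : ℕ) :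
    (∀ i, V i) ⊗[ℝ] (∀ i, V i) →ₗ[ℝ] (⨂[ℝ]^((k + 1) + (l + 1)) (∀ i, V i)) :=
  (TensorPower.mulEquiv (R := ℝ) (M := ∀ i, V i)).toLinearMap ∘ₗ
    TensorProduct.map (iterComul μ k) (iterComul μ l)

/-- The space `𝐊^μ ⊆ 𝐕 ⊗ 𝐕` of all `e` with
`τ · (μ^k ⊗ μ^l)(e) = τ' · (μ^{k'} ⊗ μ^{l'})(e)` whenever `k + l = k' + l'`. -/
def kSpace (μ : (∀ i, V i) →ₗ[ℝ] (∀ i, V i) ⊗[ℝ] (∀ i, V i)) :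
    Set ((∀ i, V i) ⊗[ℝ] (∀ i, V i)) :=
  {e | ∀ (r k l k' l' : ℕ) (h : (k + 1) + (l + 1) = r) (h' : (k' + 1) + (l' + 1) = r)
    (τ τ' : Equiv.Perm (Fin r)),
    braiding V τ (TensorPower.cast ℝ (∀ i, V i) h (iterComulTensor μ k l e)) =
      braiding V τ' (TensorPower.cast ℝ (∀ i, V i) h' (iterComulTensor μ k' l' e))}

/-- Evaluation of an element of the graded dual on the total space. -/
def dualEval (ξ : ∀ i, Module.Dual ℝ (V i)) : (∀ i, V i) →ₗ[ℝ] ℝ :=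
  ∑ i, ξ i ∘ₗ LinearMap.proj i

/-- The dual multiplication `μ^*(ξ, η) = (ξ ⊗ η) ∘ μ` on the graded dual. -/
def dualMul (μ : (∀ i, V i) →ₗ[ℝ] (∀ i, V i) ⊗[ℝ] (∀ i, V i))
    (ξ η : ∀ i, Module.Dual ℝ (V i)) : ∀ i, Module.Dual ℝ (V i) := fun p =>
  LinearMap.mul' ℝ ℝ ∘ₗ TensorProduct.map (dualEval ξ) (dualEval η) ∘ₗ μ ∘ₗ LinearMap.single ℝ V p

/-- The extended dual `ℝ ⊕ 𝐕^*`, graded in degrees `0, …, n`: the summand `ℝ` has degree `0`, the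
dual of `V i` has degree `i + 1`. -/
abbrev ExtDual (V : Fin n → Type*) [∀ i, AddCommGroup (V i)] [∀ i, Module ℝ (V i)] : Type _ :=
  ℝ × (∀ i, Module.Dual ℝ (V i))

/-- The elements of degree `a` of the extended dual (only `0` unless `0 ≤ a ≤ n`). -/
def ExtDual.IsHomog (a : ℤ) (w : ExtDual V) : Prop :=
  (a ≠ 0 → w.1 = 0) ∧ ∀ i : Fin n, (i.val : ℤ) + 1 ≠ a → w.2 i = 0

/-- The multiplication `m` of the extended algebra: `μ^*` together with scalar multiplication. -/
def extMul (μ : (∀ i, V i) →ₗ[ℝ] (∀ i, V i) ⊗[ℝ] (∀ i, V i)) (w w' : ExtDual V) : ExtDual V :=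
  (w.1 * w'.1, w.1 • w'.2 + w'.1 • w.2 + dualMul μ w.2 w'.2)

theorem dualMul_add_left (μ : (∀ i, V i) →ₗ[ℝ] (∀ i, V i) ⊗[ℝ] (∀ i, V i))
    (ξ ξ' η : ∀ i, Module.Dual ℝ (V i)) : dualMul μ (ξ + ξ') η = dualMul μ ξ η + dualMul μ ξ' η := by
  have h : dualEval (ξ + ξ') = dualEval ξ + dualEval ξ' := by
    simp [dualEval, LinearMap.add_comp, Finset.sum_add_distrib]
  funext p
  simp only [dualMul, h, TensorProduct.map_add_left, LinearMap.add_comp, LinearMap.comp_add,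
    Pi.add_apply]

theorem dualMul_add_right (μ : (∀ i, V i) →ₗ[ℝ] (∀ i, V i) ⊗[ℝ] (∀ i, V i))
    (ξ η η' : ∀ i, Module.Dual ℝ (V i)) : dualMul μ ξ (η + η') = dualMul μ ξ η + dualMul μ ξ η' := by
  have h : dualEval (η + η') = dualEval η + dualEval η' := by
    simp [dualEval, LinearMap.add_comp, Finset.sum_add_distrib]
  funext p
  simp only [dualMul, h, TensorProduct.map_add_right, LinearMap.add_comp, LinearMap.comp_add,
    Pi.add_apply]

theorem dualMul_smul_left (μ : (∀ i, V i) →ₗ[ℝ] (∀ i, V i) ⊗[ℝ] (∀ i, V i)) (c : ℝ)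
    (ξ η : ∀ i, Module.Dual ℝ (V i)) : dualMul μ (c • ξ) η = c • dualMul μ ξ η := by
  have h : dualEval (c • ξ) = c • dualEval ξ := by
    simp [dualEval, LinearMap.smul_comp, Finset.smul_sum]
  funext p
  simp only [dualMul, h, TensorProduct.map_smul_left, LinearMap.smul_comp, LinearMap.comp_smul,
    Pi.smul_apply]

theorem dualMul_smul_right (μ : (∀ i, V i) →ₗ[ℝ] (∀ i, V i) ⊗[ℝ] (∀ i, V i)) (c : ℝ)
    (ξ η : ∀ i, Module.Dual ℝ (V i)) : dualMul μ ξ (c • η) = c • dualMul μ ξ η := by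
  have h : dualEval (c • η) = c • dualEval η := by
    simp [dualEval, LinearMap.smul_comp, Finset.smul_sum]
  funext p
  simp only [dualMul, h, TensorProduct.map_smul_right, LinearMap.smul_comp, LinearMap.comp_smul,
    Pi.smul_apply]

theorem extMul_add_left (μ : (∀ i, V i) →ₗ[ℝ] (∀ i, V i) ⊗[ℝ] (∀ i, V i)) (a b c : ExtDual V) :
    extMul μ (a + b) c = extMul μ a c + extMul μ b c := by
  refine Prod.ext (add_mul _ _ _) ?_
  simp only [extMul, Prod.fst_add, Prod.snd_add, add_smul, smul_add, dualMul_add_left]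
  abel

theorem extMul_add_right (μ : (∀ i, V i) →ₗ[ℝ] (∀ i, V i) ⊗[ℝ] (∀ i, V i)) (a b c : ExtDual V) :
    extMul μ a (b + c) = extMul μ a b + extMul μ a c := by
  refine Prod.ext (mul_add _ _ _) ?_
  simp only [extMul, Prod.fst_add, Prod.snd_add, add_smul, smul_add, dualMul_add_right]
  abel

theorem extMul_smul_left (μ : (∀ i, V i) →ₗ[ℝ] (∀ i, V i) ⊗[ℝ] (∀ i, V i)) (r : ℝ)
    (a b : ExtDual V) : extMul μ (r • a) b = r • extMul μ a b := by
  refine Prod.ext (mul_assoc _ _ _) ?_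
  simp only [extMul, Prod.smul_fst, Prod.smul_snd, smul_add, dualMul_smul_left, smul_smul,
    smul_eq_mul, mul_comm]

theorem extMul_smul_right (μ : (∀ i, V i) →ₗ[ℝ] (∀ i, V i) ⊗[ℝ] (∀ i, V i)) (r : ℝ)
    (a b : ExtDual V) : extMul μ a (r • b) = r • extMul μ a b := by
  refine Prod.ext (mul_left_comm _ _ _) ?_
  simp only [extMul, Prod.smul_fst, Prod.smul_snd, smul_add, dualMul_smul_right, smul_smul,
    smul_eq_mul, mul_comm]

theorem ExtDual.IsHomog.add {a : ℤ} {w w' : ExtDual V} (h : w.IsHomog a) (h' : w'.IsHomog a) :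
    (w + w').IsHomog a :=
  ⟨fun ha => by rw [Prod.fst_add, h.1 ha, h'.1 ha, add_zero],
    fun i hi => by rw [Prod.snd_add, Pi.add_apply, h.2 i hi, h'.2 i hi, add_zero]⟩

theorem ExtDual.IsHomog.smul {a : ℤ} {w : ExtDual V} (c : ℝ) (h : w.IsHomog a) :
    (c • w).IsHomog a :=
  ⟨fun ha => by rw [Prod.smul_fst, h.1 ha, smul_zero],
    fun i hi => by rw [Prod.smul_snd, Pi.smul_apply, h.2 i hi, smul_zero]⟩

theorem ExtDual.IsHomog.zero {a : ℤ} : (0 : ExtDual V).IsHomog a := ⟨fun _ => rfl, fun _ _ => rfl⟩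

/-- Graded commutativity relations, for a space graded in degrees `1, …, n` (index `i` has degree
`i + 1`). -/
inductive SymRel (W : Fin n → Type*) [∀ i, AddCommGroup (W i)] [∀ i, Module ℝ (W i)] :
    TensorAlgebra ℝ (∀ i, W i) → TensorAlgebra ℝ (∀ i, W i) → Prop
  | swap (i j : Fin n) (a : W i) (b : W j) : SymRel W
      (TensorAlgebra.ι ℝ (Pi.single i a) * TensorAlgebra.ι ℝ (Pi.single j b))
      ((-1 : ℝ) ^ ((i.val + 1) * (j.val + 1)) •
        (TensorAlgebra.ι ℝ (Pi.single j b) * TensorAlgebra.ι ℝ (Pi.single i a)))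

/-- The graded symmetric algebra `Sym 𝐖`. -/
def GSym (W : Fin n → Type*) [∀ i, AddCommGroup (W i)] [∀ i, Module ℝ (W i)] : Type _ :=
  RingQuot (SymRel W)

instance (W : Fin n → Type*) [∀ i, AddCommGroup (W i)] [∀ i, Module ℝ (W i)] : Ring (GSym W) :=
  inferInstanceAs (Ring (RingQuot (SymRel W)))

instance (W : Fin n → Type*) [∀ i, AddCommGroup (W i)] [∀ i, Module ℝ (W i)] :
    Algebra ℝ (GSym W) :=
  inferInstanceAs (Algebra ℝ (RingQuot (SymRel W)))

/-- The inclusion `𝐖 → Sym 𝐖`. -/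
def GSym.ι (W : Fin n → Type*) [∀ i, AddCommGroup (W i)] [∀ i, Module ℝ (W i)] :
    (∀ i, W i) →ₗ[ℝ] GSym W :=
  (RingQuot.mkAlgHom ℝ (SymRel W)).toLinearMap ∘ₗ TensorAlgebra.ι ℝ

/-- The elements of degree `l` of `Sym 𝐖`: the span of the products of homogeneous elements of `𝐖`
of total degree `l` (only `0` if `l < 0`). -/
def GSym.deg (W : Fin n → Type*) [∀ i, AddCommGroup (W i)] [∀ i, Module ℝ (W i)] (l : ℤ) :
    Submodule ℝ (GSym W) :=
  Submodule.span ℝ {s | ∃ L : List (Σ i, W i),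
    s = (L.map fun a => GSym.ι W (Pi.single a.1 a.2)).prod ∧
      (L.map fun a => (a.1.val : ℤ) + 1).sum = l}

end Fibre

/-! ### Sections over open subsets -/

section Sections

variable {d n : ℕ} {M : Type*} [TopologicalSpace M] [ChartedSpace (EuclideanSpace ℝ (Fin d)) M]

/-- Smooth real functions on an open subset. -/
abbrev Smooth (d : ℕ) {M : Type*} [TopologicalSpace M] [ChartedSpace (EuclideanSpace ℝ (Fin d)) M]
    (U : Opens M) : Type _ :=
  C^∞⟮𝓡 d, U; ℝ⟯

/-- Inclusion of open subsets, on points. -/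
def incl {U V : Opens M} (h : V ≤ U) (x : V) : U := ⟨x.1, h x.2⟩

theorem contMDiff_incl {U V : Opens M} (h : V ≤ U) :
    ContMDiff (𝓡 d) (𝓡 d) ∞ (incl h) :=
  contMDiff_inclusion h

variable (F : Fin n → Type*) [∀ i, NormedAddCommGroup (F i)] [∀ i, NormedSpace ℝ (F i)]
  (E : Fin n → M → Type*) [∀ i x, AddCommGroup (E i x)] [∀ i x, Module ℝ (E i x)]
  [∀ i x, TopologicalSpace (E i x)] [∀ i, TopologicalSpace (TotalSpace (F i) (E i))]
  [∀ i, FiberBundle (F i) (E i)]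

/-- `s` is a smooth section of the vector bundle `E i` over `U`. -/
def IsSmoothSection (d : ℕ) [ChartedSpace (EuclideanSpace ℝ (Fin d)) M] (i : Fin n) (U : Opens M)
    (s : ∀ x : U, E i x) : Prop :=
  ContMDiff (𝓡 d) ((𝓡 d).prod 𝓘(ℝ, F i)) ∞ (fun x : U => TotalSpace.mk' (F i) (x : M) (s x))

/-- `ξ` is a smooth section over `U` of the dual of `E i`: its pairing with every smooth section of
`E i` over an open subset of `U` is smooth. -/
def IsSmoothCosection (d : ℕ) [ChartedSpace (EuclideanSpace ℝ (Fin d)) M] (i : Fin n) (U : Opens M)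
    (ξ : ∀ x : U, Module.Dual ℝ (E i x)) : Prop :=
  ∀ (V : Opens M) (h : V ≤ U) (s : ∀ x : V, E i x), IsSmoothSection F E d i V s →
    ContMDiff (𝓡 d) 𝓘(ℝ, ℝ) ∞ (fun x : V => ξ (incl h x) (s x))


section

variable {F E}

theorem isSmoothSection_iff {i : Fin n} {U : Opens M} {s : ∀ x : U, E i x} :
    IsSmoothSection F E d i U s ↔ ∀ x₀ : U, ContMDiffAt (𝓡 d) 𝓘(ℝ, F i) ∞
      (fun x : U => (trivializationAt (F i) (E i) (x₀ : M) ⟨(x : M), s x⟩).2) x₀ := by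
  refine forall_congr' fun x₀ => ?_
  rw [contMDiffAt_totalSpace]
  exact and_iff_right contMDiff_subtype_val.contMDiffAt

theorem eventually_baseSet (i : Fin n) {U : Opens M} (x₀ : U) :
    ∀ᶠ x : U in nhds x₀, (x : M) ∈ (trivializationAt (F i) (E i) (x₀ : M)).baseSet :=
  continuous_subtype_val.continuousAt.eventually
    ((trivializationAt (F i) (E i) (x₀ : M)).open_baseSet.mem_nhds
      (mem_baseSet_trivializationAt (F i) (E i) (x₀ : M)))

variable (F E) [∀ i, VectorBundle ℝ (F i) (E i)]

theorem isSmoothSection_add {i : Fin n} {U : Opens M} {s t : ∀ x : U, E i x}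
    (hs : IsSmoothSection F E d i U s) (ht : IsSmoothSection F E d i U t) :
    IsSmoothSection F E d i U (s + t) := by
  rw [isSmoothSection_iff] at hs ht ⊢
  refine fun x₀ => ((hs x₀).add (ht x₀)).congr_of_eventuallyEq ?_
  filter_upwards [eventually_baseSet (F := F) (E := E) i x₀] with x hx
  exact ((trivializationAt (F i) (E i) (x₀ : M)).linear ℝ hx).map_add (s x) (t x)

theorem isSmoothSection_smul {i : Fin n} {U : Opens M} (f : Smooth d U) {s : ∀ x : U, E i x}
    (hs : IsSmoothSection F E d i U s) : IsSmoothSection F E d i U (fun x => f x • s x) := by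
  rw [isSmoothSection_iff] at hs ⊢
  refine fun x₀ => (f.contMDiff.contMDiffAt.smul (hs x₀)).congr_of_eventuallyEq ?_
  filter_upwards [eventually_baseSet (F := F) (E := E) i x₀] with x hx
  exact ((trivializationAt (F i) (E i) (x₀ : M)).linear ℝ hx).map_smul (f x) (s x)

theorem isSmoothSection_zero (i : Fin n) (U : Opens M) :
    IsSmoothSection F E d i U (0 : ∀ x : U, E i x) := by
  rw [isSmoothSection_iff]
  refine fun x₀ => (contMDiffAt_const (c := (0 : F i))).congr_of_eventuallyEq ?_
  filter_upwards [eventually_baseSet (F := F) (E := E) i x₀] with x hx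
  exact ((trivializationAt (F i) (E i) (x₀ : M)).linear ℝ hx).map_zero

end

/-- The fibre at `x` of the extended dual `E_ℝ^* = ℝ_M ⊕ ⨁_i E_{-i}^*`. -/
abbrev ExtFibre (x : M) : Type _ := ExtDual (fun i => E i x)

/-- The smooth sections of `E_ℝ^*` over `U`, as a subspace of all families. -/
def extSubmodule (d : ℕ) [ChartedSpace (EuclideanSpace ℝ (Fin d)) M] (U : Opens M) :
    Submodule ℝ (∀ x : U, ExtFibre E (x : M)) where
  carrier := {e | ContMDiff (𝓡 d) 𝓘(ℝ, ℝ) ∞ (fun x => (e x).1) ∧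
    ∀ i, IsSmoothCosection F E d i U (fun x => (e x).2 i)}
  add_mem' := fun ha hb => ⟨ha.1.add hb.1, fun i V h s hs => (ha.2 i V h s hs).add (hb.2 i V h s hs)⟩
  zero_mem' := ⟨contMDiff_const, fun _ _ _ _ _ => contMDiff_const⟩
  smul_mem' := fun _ _ ha => ⟨contMDiff_const.mul ha.1, fun i V h s hs =>
    contMDiff_const.mul (ha.2 i V h s hs)⟩

/-- The smooth sections of `E_ℝ^*` over `U`. -/
def ExtSections (d : ℕ) [ChartedSpace (EuclideanSpace ℝ (Fin d)) M] (U : Opens M) : Type _ :=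
  extSubmodule F E d U

instance (U : Opens M) : AddCommGroup (ExtSections F E d U) :=
  (extSubmodule F E d U).addCommGroup

instance (U : Opens M) : Module ℝ (ExtSections F E d U) :=
  (extSubmodule F E d U).module

instance (U : Opens M) : Module (Smooth d U) (ExtSections F E d U) where
  smul f e := ⟨fun x => f x • e.1 x, f.contMDiff.mul e.2.1, fun i V h s hs =>
    (f.contMDiff.comp (contMDiff_incl h)).mul (e.2.2 i V h s hs)⟩
  one_smul e := Subtype.ext (funext fun x => one_smul ℝ (e.1 x))
  mul_smul f g e := Subtype.ext (funext fun x => mul_smul (f x) (g x) (e.1 x))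
  smul_zero f := Subtype.ext (funext fun x => smul_zero (f x))
  smul_add f e e' := Subtype.ext (funext fun x => smul_add (f x) (e.1 x) (e'.1 x))
  add_smul f g e := Subtype.ext (funext fun x => add_smul (f x) (g x) (e.1 x))
  zero_smul e := Subtype.ext (funext fun x => zero_smul ℝ (e.1 x))

instance (U : Opens M) : SMulCommClass ℝ (Smooth d U) (ExtSections F E d U) where
  smul_comm c f e := Subtype.ext (funext fun x => smul_comm c (f x) (e.1 x))

/-- Restriction of smooth sections of `E_ℝ^*`. -/
def extRestrict (d : ℕ) [ChartedSpace (EuclideanSpace ℝ (Fin d)) M] {U V : Opens M} (h : V ≤ U) :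
    ExtSections F E d U →ₗ[ℝ] ExtSections F E d V where
  toFun e := ⟨fun x => e.1 (incl h x), e.2.1.comp (contMDiff_incl h),
    fun i W hW s hs => e.2.2 i W (hW.trans h) s hs⟩
  map_add' _ _ := rfl
  map_smul' _ _ := rfl

/-- A section of `E_ℝ^*` homogeneous of degree `a`. -/
def IsHomogSection {d : ℕ} [ChartedSpace (EuclideanSpace ℝ (Fin d)) M] {U : Opens M} (a : ℤ)
    (e : ExtSections F E d U) : Prop :=
  ∀ x, (e.1 x).IsHomog a

/-- An `n`-coalgebra bundle structure on `𝐄 = ⨁_{i=1}^n E_{-i} → M`, where `E_{-(i+1)}` is the vector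
bundle `E i`: a smooth, degree-preserving, coassociative, graded cocommutative bundle map
`μ : 𝐄 → 𝐄 ⊗ 𝐄` over the identity. Smoothness says that `(ξ ⊗ η) ∘ μ` is a smooth section of `𝐄^*` for
all smooth local sections `ξ`, `η` of `𝐄^*`. -/
structure CoalgebraBundle (d : ℕ) [ChartedSpace (EuclideanSpace ℝ (Fin d)) M] where
  /-- the comultiplication -/
  μ : ∀ x : M, (∀ i, E i x) →ₗ[ℝ] (∀ i, E i x) ⊗[ℝ] (∀ i, E i x)
  degree_preserving : ∀ (x : M) (p : Fin n) (v : E p x),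
    μ x (Pi.single p v) ∈ tensorDeg (fun i => E i x) (p.val + 1)
  coassoc : ∀ (x : M) (v : ∀ i, E i x),
    TensorProduct.assoc ℝ _ _ _ ((μ x).rTensor _ (μ x v)) = (μ x).lTensor _ (μ x v)
  cocomm : ∀ (x : M) (i j : Fin n) (v : ∀ i, E i x),
    comp₂ (fun i => E i x) j i (μ x v) = (-1 : ℝ) ^ ((i.val + 1) * (j.val + 1)) •
      TensorProduct.comm ℝ (E i x) (E j x) (comp₂ (fun i => E i x) i j (μ x v))
  smooth : ∀ (U : Opens M) (ξ η : ∀ (x : U) (i : Fin n), Module.Dual ℝ (E i x)),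
    (∀ i, IsSmoothCosection F E d i U (fun x => ξ x i)) →
    (∀ i, IsSmoothCosection F E d i U (fun x => η x i)) →
    ∀ p, IsSmoothCosection F E d p U (fun x => dualMul (μ x) (ξ x) (η x) p)

variable {F E}

/-- Admissibility: `im μ_{-q} = K^μ_{-q}` for `q = 2, …, n`. -/
def CoalgebraBundle.IsAdmissible (B : CoalgebraBundle F E d) : Prop :=
  ∀ (x : M) (p : Fin n), 2 ≤ p.val + 1 →
    Set.range (fun v : E p x => B.μ x (Pi.single p v)) =
      kSpace (B.μ x) ∩ tensorDeg (fun i => E i x) (p.val + 1)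

/-- The multiplication `m` on smooth sections of `E_ℝ^*`. -/
def CoalgebraBundle.mul (B : CoalgebraBundle F E d) {U : Opens M}
    (e e' : ExtSections F E d U) : ExtSections F E d U :=
  ⟨fun x => extMul (B.μ x) (e.1 x) (e'.1 x), e.2.1.mul e'.2.1, fun i V h s hs =>
    (((e.2.1.comp (contMDiff_incl h)).mul (e'.2.2 i V h s hs)).add
      ((e'.2.1.comp (contMDiff_incl h)).mul (e.2.2 i V h s hs))).add
        (B.smooth U (fun x => (e.1 x).2) (fun x => (e'.1 x).2) e.2.2 e'.2.2 i V h s hs)⟩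

/-! ### The sheaf of functions -/

variable (F E)

/-- The fibre at `x` of `Sym 𝐄^*`. -/
abbrev SymFibre (x : M) : Type _ := GSym (fun i => Module.Dual ℝ (E i x))

/-- The smooth functions and the smooth sections of `𝐄^*` over `V`, as sections of `Sym 𝐄^*`. -/
def symGenerators (d : ℕ) [ChartedSpace (EuclideanSpace ℝ (Fin d)) M] (V : Opens M) :
    Set (∀ x : V, SymFibre E (x : M)) :=
  {s | ∃ e : ExtSections F E d V,
    s = fun x => algebraMap ℝ _ (e.1 x).1 + GSym.ι _ (e.1 x).2}

/-- Restriction of families. -/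
def piRestrict {U V : Opens M} (h : V ≤ U) :
    (∀ x : U, SymFibre E (x : M)) →ₐ[ℝ] (∀ x : V, SymFibre E (x : M)) where
  toFun s x := s (incl h x)
  map_one' := rfl
  map_mul' _ _ := rfl
  map_zero' := rfl
  map_add' _ _ := rfl
  commutes' _ := rfl

theorem piRestrict_adjoin {d : ℕ} [ChartedSpace (EuclideanSpace ℝ (Fin d)) M] {U V : Opens M}
    (h : V ≤ U) {s : ∀ x : U, SymFibre E (x : M)}
    (hs : s ∈ Algebra.adjoin ℝ (symGenerators F E d U)) :
    piRestrict E h s ∈ Algebra.adjoin ℝ (symGenerators F E d V) := by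
  have h1 : (Algebra.adjoin ℝ (symGenerators F E d U)).map (piRestrict E h) ≤
      Algebra.adjoin ℝ (symGenerators F E d V) := by
    rw [AlgHom.map_adjoin]
    refine Algebra.adjoin_mono ?_
    rintro _ ⟨_, ⟨e, rfl⟩, rfl⟩
    exact ⟨extRestrict F E d h e, rfl⟩
  exact h1 ⟨s, hs, rfl⟩

/-- Sections over `U` of the sheaf of graded algebras `Γ_{Sym 𝐄^*}`: families of elements of the
fibres `Sym (𝐄_x^*)` which near each point are polynomial expressions in smooth functions and smooth
sections of `𝐄^*`. -/
def symSections (d : ℕ) [ChartedSpace (EuclideanSpace ℝ (Fin d)) M] (U : Opens M) :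
    Subalgebra ℝ (∀ x : U, SymFibre E (x : M)) where
  carrier := {s | ∀ x : U, ∃ (V : Opens M) (h : V ≤ U), (x : M) ∈ V ∧
    piRestrict E h s ∈ Algebra.adjoin ℝ (symGenerators F E d V)}
  mul_mem' := by
    intro s t hs ht x
    obtain ⟨V, h, hx, hV⟩ := hs x
    obtain ⟨W, h', hx', hW⟩ := ht x
    exact ⟨V ⊓ W, inf_le_left.trans h, ⟨hx, hx'⟩, mul_mem
      (piRestrict_adjoin F E (inf_le_left : V ⊓ W ≤ V) hV)
      (piRestrict_adjoin F E (inf_le_right : V ⊓ W ≤ W) hW)⟩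
  add_mem' := by
    intro s t hs ht x
    obtain ⟨V, h, hx, hV⟩ := hs x
    obtain ⟨W, h', hx', hW⟩ := ht x
    exact ⟨V ⊓ W, inf_le_left.trans h, ⟨hx, hx'⟩, add_mem
      (piRestrict_adjoin F E (inf_le_left : V ⊓ W ≤ V) hV)
      (piRestrict_adjoin F E (inf_le_right : V ⊓ W ≤ W) hW)⟩
  algebraMap_mem' r x := ⟨U, le_rfl, x.2, Subalgebra.algebraMap_mem _ r⟩

/-- Restriction in the sheaf `Γ_{Sym 𝐄^*}`. -/
def symRestrict (d : ℕ) [ChartedSpace (EuclideanSpace ℝ (Fin d)) M] {U V : Opens M} (h : V ≤ U) :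
    symSections F E d U →ₐ[ℝ] symSections F E d V :=
  ((piRestrict E h).comp (symSections F E d U).val).codRestrict (symSections F E d V) (by
    intro s x
    obtain ⟨W, hW, hx, hs⟩ := s.2 (incl h x)
    exact ⟨W ⊓ V, inf_le_right, ⟨hx, x.2⟩,
      piRestrict_adjoin F E (inf_le_left : W ⊓ V ≤ W) hs⟩)

variable {F E}

namespace CoalgebraBundle

variable (B : CoalgebraBundle F E d)

/-- The sections `ξ · η - μ^*(ξ, η)`, for `ξ`, `η` homogeneous sections of `𝐄^*` over `V` with
`|ξ| + |η| ≤ n`. -/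
def relators (V : Opens M) : Set (symSections F E d V) :=
  {s | ∃ (i j : Fin n) (ξ : ∀ x : V, Module.Dual ℝ (E i x)) (η : ∀ x : V, Module.Dual ℝ (E j x)),
    (i.val + 1) + (j.val + 1) ≤ n ∧ IsSmoothCosection F E d i V ξ ∧
    IsSmoothCosection F E d j V η ∧
    s.1 = fun x => GSym.ι _ (Pi.single i (ξ x)) * GSym.ι _ (Pi.single j (η x)) -
      GSym.ι _ (dualMul (B.μ x) (Pi.single i (ξ x)) (Pi.single j (η x)))}

theorem symRestrict_span {U V : Opens M} (h : V ≤ U) {s : symSections F E d U}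
    (hs : s ∈ TwoSidedIdeal.span (B.relators U)) :
    symRestrict F E d h s ∈ TwoSidedIdeal.span (B.relators V) := by
  have h1 : TwoSidedIdeal.span (B.relators U) ≤
      (TwoSidedIdeal.span (B.relators V)).comap (symRestrict F E d h) := by
    rw [TwoSidedIdeal.span_le]
    rintro t ⟨i, j, ξ, η, hij, hξ, hη, ht⟩
    refine (TwoSidedIdeal.mem_comap _).mpr (TwoSidedIdeal.subset_span
      ⟨i, j, fun x => ξ (incl h x), fun x => η (incl h x), hij, ?_, ?_, ?_⟩)
    · exact fun W hW s hs => hξ W (hW.trans h) s hs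
    · exact fun W hW s hs => hη W (hW.trans h) s hs
    · funext x
      exact congrFun ht (incl h x)
  exact (TwoSidedIdeal.mem_comap _).mp (h1 hs)

/-- The sheaf of ideals `𝓘_μ ⊆ Γ_{Sym 𝐄^*}` generated by the sections `ξ · η - μ^*(ξ, η)` with
`|ξ| + |η| ≤ n`: the sections which near each point lie in the ideal generated by these. -/
def idealSheaf (U : Opens M) : TwoSidedIdeal (symSections F E d U) :=
  TwoSidedIdeal.mk' {s | ∀ x : U, ∃ (V : Opens M) (h : V ≤ U), (x : M) ∈ V ∧
      symRestrict F E d h s ∈ TwoSidedIdeal.span (B.relators V)}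
    (fun x => ⟨U, le_rfl, x.2, by rw [map_zero]; exact TwoSidedIdeal.zero_mem _⟩)
    (by
      intro s t hs ht x
      obtain ⟨V, h, hx, hV⟩ := hs x
      obtain ⟨W, h', hx', hW⟩ := ht x
      exact ⟨V ⊓ W, inf_le_left.trans h, ⟨hx, hx'⟩, TwoSidedIdeal.add_mem _
        (B.symRestrict_span (inf_le_left : V ⊓ W ≤ V) hV)
        (B.symRestrict_span (inf_le_right : V ⊓ W ≤ W) hW)⟩)
    (by
      intro s hs x
      obtain ⟨V, h, hx, hV⟩ := hs x
      exact ⟨V, h, hx, by rw [map_neg]; exact TwoSidedIdeal.neg_mem _ hV⟩)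
    (by
      intro s t ht x
      obtain ⟨V, h, hx, hV⟩ := ht x
      exact ⟨V, h, hx, by rw [map_mul]; exact TwoSidedIdeal.mul_mem_left _ _ _ hV⟩)
    (by
      intro s t hs x
      obtain ⟨V, h, hx, hV⟩ := hs x
      exact ⟨V, h, hx, by rw [map_mul]; exact TwoSidedIdeal.mul_mem_right _ _ _ hV⟩)

/-- The algebra `C_𝓜(U) = (Γ_{Sym 𝐄^*} / 𝓘_μ)(U)` of functions over `U` on the `n`-manifold
`𝓜 = 𝓕(𝐄, μ)`. -/
def Fun (U : Opens M) : Type _ := (B.idealSheaf U).ringCon.Quotient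

instance (U : Opens M) : Ring (B.Fun U) :=
  inferInstanceAs (Ring (B.idealSheaf U).ringCon.Quotient)

instance (U : Opens M) : Algebra ℝ (B.Fun U) :=
  inferInstanceAs (Algebra ℝ (B.idealSheaf U).ringCon.Quotient)

/-- The quotient map `Γ_{Sym 𝐄^*}(U) → C_𝓜(U)`. -/
def mkFun (U : Opens M) : symSections F E d U →ₐ[ℝ] B.Fun U :=
  RingCon.mkₐ ℝ (B.idealSheaf U).ringCon

/-- The functions of degree `l`. -/
def funDeg (U : Opens M) (l : ℤ) : Set (B.Fun U) :=
  {f | ∃ s : symSections F E d U, (∀ x, s.1 x ∈ GSym.deg _ l) ∧ f = B.mkFun U s}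

/-- Restriction in the sheaf `C_𝓜`. -/
def funRestrict {U V : Opens M} (h : V ≤ U) : B.Fun U →+* B.Fun V :=
  RingCon.lift (B.idealSheaf U).ringCon ((B.mkFun V).comp (symRestrict F E d h)).toRingHom (by
    intro s t hst
    have h1 : s - t ∈ B.idealSheaf U := (TwoSidedIdeal.rel_iff _ s t).mp hst
    refine Quotient.sound ((TwoSidedIdeal.rel_iff _ _ _).mpr ?_)
    change symRestrict F E d h s - symRestrict F E d h t ∈ B.idealSheaf V
    rw [← map_sub]
    intro x
    obtain ⟨W, hW, hx, hs⟩ := h1 (incl h x)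
    exact ⟨W ⊓ V, inf_le_right, ⟨hx, x.2⟩,
      B.symRestrict_span (inf_le_left : W ⊓ V ≤ W) hs⟩)

/-- The canonical map `Γ_{𝐄_ℝ^*}(U) → C_𝓜(U)`. -/
def ofSection (U : Opens M) : ExtSections F E d U →ₗ[ℝ] B.Fun U where
  toFun e := B.mkFun U ⟨fun x => algebraMap ℝ _ (e.1 x).1 + GSym.ι _ (e.1 x).2, fun x =>
    ⟨U, le_rfl, x.2, Algebra.subset_adjoin ⟨e, rfl⟩⟩⟩
  map_add' e e' := by
    rw [← map_add]
    congr 1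
    apply Subtype.ext
    funext x
    change algebraMap ℝ (SymFibre E (x : M)) ((e.1 x).1 + (e'.1 x).1) +
      GSym.ι _ ((e.1 x).2 + (e'.1 x).2) = _
    rw [map_add, map_add, add_add_add_comm]
    rfl
  map_smul' c e := by
    rw [← map_smul]
    congr 1
    apply Subtype.ext
    funext x
    change algebraMap ℝ (SymFibre E (x : M)) (c • (e.1 x).1) + GSym.ι _ (c • (e.1 x).2) =
      c • (algebraMap ℝ (SymFibre E (x : M)) (e.1 x).1 + GSym.ι _ (e.1 x).2)
    rw [smul_add, (GSym.ι _).map_smul, smul_eq_mul, map_mul, Algebra.smul_def c (algebraMap ℝ _ _)]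

/-- Smooth functions on `U` as elements of `C_𝓜(U)`. -/
def ofSmooth (U : Opens M) : Smooth d U →+* B.Fun U :=
  (B.mkFun U).toRingHom.comp
    { toFun f := ⟨fun x => algebraMap ℝ _ (f x), fun x => ⟨U, le_rfl, x.2,
        Algebra.subset_adjoin ⟨⟨fun x => (f x, 0), f.contMDiff, fun _ _ _ _ _ => contMDiff_const⟩, by
          funext x
          change _ = algebraMap ℝ _ (f x) + GSym.ι _ 0
          rw [map_zero, add_zero]
          rfl⟩⟩⟩
      map_one' := Subtype.ext (funext fun _ => map_one _)
      map_mul' f g := Subtype.ext (funext fun x => map_mul _ (f x) (g x))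
      map_zero' := Subtype.ext (funext fun _ => map_zero _)
      map_add' f g := Subtype.ext (funext fun x => map_add _ (f x) (g x)) }

theorem ofSmooth_comm {U : Opens M} (f : Smooth d U) (g : B.Fun U) :
    B.ofSmooth U f * g = g * B.ofSmooth U f := by
  obtain ⟨s, rfl⟩ : ∃ s, B.mkFun U s = g := Quotient.exists_rep g
  change B.mkFun U _ * B.mkFun U s = B.mkFun U s * B.mkFun U _
  rw [← map_mul, ← map_mul]
  congr 1
  exact Subtype.ext (funext fun x => Algebra.commutes (f x) (s.1 x))

instance (U : Opens M) : Module (Smooth d U) (B.Fun U) := Module.compHom _ (B.ofSmooth U)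

theorem smooth_smul_def {U : Opens M} (f : Smooth d U) (g : B.Fun U) :
    f • g = B.ofSmooth U f * g := rfl

instance (U : Opens M) : SMulCommClass ℝ (Smooth d U) (B.Fun U) where
  smul_comm c f g := by rw [smooth_smul_def, smooth_smul_def, mul_smul_comm]

theorem zero_mem_funDeg (U : Opens M) (l : ℤ) : (0 : B.Fun U) ∈ B.funDeg U l :=
  ⟨0, fun _ => Submodule.zero_mem _, (map_zero _).symm⟩

theorem add_mem_funDeg {U : Opens M} {l : ℤ} {f g : B.Fun U} (hf : f ∈ B.funDeg U l)
    (hg : g ∈ B.funDeg U l) : f + g ∈ B.funDeg U l := by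
  obtain ⟨s, hs, rfl⟩ := hf
  obtain ⟨t, ht, rfl⟩ := hg
  exact ⟨s + t, fun x => Submodule.add_mem _ (hs x) (ht x), (map_add _ _ _).symm⟩

theorem smul_mem_funDeg {U : Opens M} {l : ℤ} (f : Smooth d U) {g : B.Fun U}
    (hg : g ∈ B.funDeg U l) : f • g ∈ B.funDeg U l := by
  obtain ⟨s, hs, rfl⟩ := hg
  refine ⟨_, fun x => ?_, (map_mul (B.mkFun U) _ s).symm⟩
  change algebraMap ℝ _ (f x) * s.1 x ∈ _
  rw [← Algebra.smul_def]
  exact Submodule.smul_mem _ _ (hs x)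

/-! ### Vector fields -/

/-- The vector fields of degree `k` on `𝓜|_U`: the `ℝ`-linear maps `X : C_𝓜(U) → C_𝓜(U)` with
`|X f| = |f| + k` and `X (f g) = X f * g + (-1)^{k |f|} f * X g` for homogeneous `f`. -/
def vectorFields (k : ℤ) (U : Opens M) : Submodule (Smooth d U) (B.Fun U →ₗ[ℝ] B.Fun U) where
  carrier := {X | ∀ (l : ℤ), ∀ f ∈ B.funDeg U l, X f ∈ B.funDeg U (l + k) ∧
    ∀ g, X (f * g) = X f * g + (k * l).negOnePow • (f * X g)}
  add_mem' := by
    intro X Y hX hY l f hf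
    refine ⟨B.add_mem_funDeg (hX l f hf).1 (hY l f hf).1, fun g => ?_⟩
    simp only [LinearMap.add_apply, (hX l f hf).2 g, (hY l f hf).2 g, add_mul, mul_add, smul_add]
    abel
  zero_mem' := fun l f _ => ⟨B.zero_mem_funDeg U _, fun g => by simp⟩
  smul_mem' := by
    intro φ X hX l f hf
    refine ⟨B.smul_mem_funDeg φ (hX l f hf).1, fun g => ?_⟩
    simp only [LinearMap.smul_apply, (hX l f hf).2 g, smul_add, smooth_smul_def]
    rw [mul_assoc, mul_smul_comm, ← mul_assoc _ f, B.ofSmooth_comm φ f, mul_assoc f]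

/-- The vector field `Y` on `𝓜|_V` is the restriction of the vector field `X` on `𝓜|_U`. -/
def IsRestrictionVF {U V : Opens M} (h : V ≤ U) (X : B.Fun U →ₗ[ℝ] B.Fun U)
    (Y : B.Fun V →ₗ[ℝ] B.Fun V) : Prop :=
  ∀ f, Y (B.funRestrict h f) = B.funRestrict h (X f)

end CoalgebraBundle

/-! ### Derivations of `𝐄_ℝ^*` -/

/-- The derivative of a smooth function along tangent vectors at `x`. -/
def dirDeriv {U : Opens M} (f : Smooth d U) (x : U) : TangentSpace (𝓡 d) x →ₗ[ℝ] ℝ :=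
  (mfderiv (𝓡 d) 𝓘(ℝ, ℝ) f x).toLinearMap

variable (F E)

/-- The derivations of degree `k` of `𝐄_ℝ^*|_U`: the operators `D` on `Γ_{𝐄_ℝ^*}(U)` of degree `k`
for which there is a smooth vector field `X` on `U`, the symbol, with `D (f e) = X(f) e + f D e`. -/
def derivations (d : ℕ) [ChartedSpace (EuclideanSpace ℝ (Fin d)) M] [IsManifold (𝓡 d) ∞ M] (k : ℤ)
    (U : Opens M) :
    Submodule (Smooth d U) (ExtSections F E d U →ₗ[ℝ] ExtSections F E d U) where
  carrier := {D |
    (∃ X : Cₛ^∞⟮𝓡 d; EuclideanSpace ℝ (Fin d), (TangentSpace (𝓡 d) : U → Type _)⟯,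
      ∀ (f : Smooth d U) (e : ExtSections F E d U) (x : U),
        (D (f • e)).1 x = dirDeriv f x (X x) • e.1 x + f x • (D e).1 x) ∧
    ∀ (a : ℤ) (e : ExtSections F E d U), IsHomogSection F E a e → IsHomogSection F E (a + k) (D e)}
  add_mem' := by
    rintro D D' ⟨⟨X, hX⟩, hD⟩ ⟨⟨X', hX'⟩, hD'⟩
    refine ⟨⟨X + X', fun f e x => ?_⟩, fun a e he x => (hD a e he x).add (hD' a e he x)⟩
    change (D (f • e)).1 x + (D' (f • e)).1 x =
      dirDeriv f x (X x + X' x) • e.1 x + f x • ((D e).1 x + (D' e).1 x)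
    rw [hX, hX', map_add, add_smul, smul_add]
    abel
  zero_mem' := by
    refine ⟨⟨0, fun f e x => ?_⟩, fun a e he x => ExtDual.IsHomog.zero⟩
    change (0 : ExtFibre E (x : M)) = dirDeriv f x 0 • e.1 x + f x • 0
    rw [map_zero, zero_smul, smul_zero, add_zero]
  smul_mem' := by
    rintro φ D ⟨⟨X, hX⟩, hD⟩
    refine ⟨⟨⟨fun x => φ x • X x, φ.contMDiff.smul_section X.contMDiff⟩, fun f e x => ?_⟩,
      fun a e he x => (hD a e he x).smul (φ x)⟩
    change φ x • (D (f • e)).1 x =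
      dirDeriv f x (φ x • X x) • e.1 x + f x • (φ x • (D e).1 x)
    rw [hX, map_smul, smul_assoc, smul_add, smul_comm (φ x) (f x)]

variable {F E}

/-- The derivation `D'` of `𝐄_ℝ^*|_V` is the restriction of the derivation `D` of `𝐄_ℝ^*|_U`. -/
def IsRestrictionDer {U V : Opens M} (h : V ≤ U)
    (D : ExtSections F E d U →ₗ[ℝ] ExtSections F E d U)
    (D' : ExtSections F E d V →ₗ[ℝ] ExtSections F E d V) : Prop :=
  ∀ e, D' (extRestrict F E d h e) = extRestrict F E d h (D e)

/-- A point of `M` as a point of the open set `⊤`. -/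
def topPt (x : M) : (⊤ : Opens M) := ⟨x, trivial⟩

/-- The value at `x` of a global section. -/
def valAt (e : ExtSections F E d ⊤) (x : M) : ExtFibre E x := e.1 (topPt x)

variable (F E)

/-- The fibre at `x` of the bundle `Der(𝐄_ℝ^*)_k`: the derivations `δ : Γ(𝐄_ℝ^*) → (𝐄_ℝ^*)_x` at `x`,
of degree `k`, for which there is a tangent vector `v` at `x`, the symbol, with
`δ (f e) = v(f) e(x) + f(x) δ e`. -/
def derFibre (d : ℕ) [ChartedSpace (EuclideanSpace ℝ (Fin d)) M] (k : ℤ) (x : M) :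
    Submodule ℝ (ExtSections F E d ⊤ →ₗ[ℝ] ExtFibre E x) where
  carrier := {δ |
    (∃ v : TangentSpace (𝓡 d) (topPt x), ∀ (f : Smooth d ⊤) (e : ExtSections F E d ⊤),
      δ (f • e) = dirDeriv f (topPt x) v • valAt e x + f (topPt x) • δ e) ∧
    ∀ (a : ℤ) (e : ExtSections F E d ⊤), IsHomogSection F E a e → (δ e).IsHomog (a + k)}
  add_mem' := by
    rintro D D' ⟨⟨X, hX⟩, hD⟩ ⟨⟨X', hX'⟩, hD'⟩
    refine ⟨⟨X + X', fun f e => ?_⟩, fun a e he => (hD a e he).add (hD' a e he)⟩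
    rw [LinearMap.add_apply, LinearMap.add_apply, hX, hX', map_add, add_smul, smul_add]
    abel
  zero_mem' := by
    refine ⟨⟨0, fun f e => ?_⟩, fun a e he => ExtDual.IsHomog.zero⟩
    rw [LinearMap.zero_apply, LinearMap.zero_apply, map_zero, zero_smul, smul_zero, add_zero]
  smul_mem' := by
    rintro c D ⟨⟨X, hX⟩, hD⟩
    refine ⟨⟨c • X, fun f e => ?_⟩, fun a e he => (hD a e he).smul c⟩
    rw [LinearMap.smul_apply, LinearMap.smul_apply, hX, map_smul, smul_assoc, smul_add,
      smul_comm c (f (topPt x))]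

variable {F E}

/-- The value at `x ∈ U` of a derivation of `𝐄_ℝ^*|_U`, as an element of the fibre at `x`. -/
def derAt {U : Opens M} (D : ExtSections F E d U →ₗ[ℝ] ExtSections F E d U) (x : U) :
    ExtSections F E d ⊤ →ₗ[ℝ] ExtFibre E (x : M) where
  toFun e := (D (extRestrict F E d le_top e)).1 x
  map_add' e e' := by rw [map_add, map_add]; rfl
  map_smul' c e := by rw [map_smul, map_smul]; rfl

namespace CoalgebraBundle

variable (B : CoalgebraBundle F E d)

/-- Compatibility of a degree `k` derivation with the multiplication `m`:
`D (m (e, e')) = m (D e, e') + (-1)^{k |e|} m (e, D e')` for homogeneous `e`, `e'` with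
`|e| + |e'| ≤ n`. -/
def IsCompatible (k : ℤ) {U : Opens M} (D : ExtSections F E d U →ₗ[ℝ] ExtSections F E d U) : Prop :=
  ∀ (a b : ℤ) (e e' : ExtSections F E d U), IsHomogSection F E a e → IsHomogSection F E b e' →
    a + b ≤ n → D (B.mul e e') = B.mul (D e) e' + (k * a).negOnePow • B.mul e (D e')

/-- The fibre at `x` of `Der(𝐄_ℝ^*, m)_k ⊆ Der(𝐄_ℝ^*)_k`: the derivations at `x` compatible with
`m`. -/
def compatFibre (k : ℤ) (x : M) : Submodule ℝ (ExtSections F E d ⊤ →ₗ[ℝ] ExtFibre E x) where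
  carrier := {δ | δ ∈ derFibre F E d k x ∧
    ∀ (a b : ℤ) (e e' : ExtSections F E d ⊤), IsHomogSection F E a e → IsHomogSection F E b e' →
      a + b ≤ n → δ (B.mul e e') = extMul (B.μ x) (δ e) (valAt e' x) +
        (k * a).negOnePow • extMul (B.μ x) (valAt e x) (δ e')}
  add_mem' := by
    rintro D D' ⟨h, hD⟩ ⟨h', hD'⟩
    refine ⟨add_mem h h', fun a b e e' he he' hab => ?_⟩
    simp only [LinearMap.add_apply, hD a b e e' he he' hab, hD' a b e e' he he' hab,
      extMul_add_left, extMul_add_right, smul_add]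
    abel
  zero_mem' := by
    refine ⟨zero_mem _, fun a b e e' _ _ _ => ?_⟩
    have h1 := extMul_smul_left (B.μ x) 0 0 (valAt e' x)
    have h2 := extMul_smul_right (B.μ x) 0 (valAt e x) 0
    rw [zero_smul, zero_smul] at h1 h2
    simp only [LinearMap.zero_apply]
    rw [h1, h2, smul_zero, add_zero]
  smul_mem' := by
    rintro c D ⟨h, hD⟩
    refine ⟨Submodule.smul_mem _ c h, fun a b e e' he he' hab => ?_⟩
    simp only [LinearMap.smul_apply, hD a b e e' he he' hab, extMul_smul_left, extMul_smul_right,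
      smul_add]
    rw [smul_comm c]

/-- The sections over `U` of `Der(𝐄_ℝ^*, m)_k`: the derivations of `𝐄_ℝ^*|_U` of degree `k` whose
value at each point lies in the fibre of `Der(𝐄_ℝ^*, m)_k`. -/
def compatSections [IsManifold (𝓡 d) ∞ M] (k : ℤ) (U : Opens M) :
    Submodule (Smooth d U) (ExtSections F E d U →ₗ[ℝ] ExtSections F E d U) where
  carrier := {D | D ∈ derivations F E d k U ∧ ∀ x : U, derAt D x ∈ B.compatFibre k x}
  add_mem' := fun h h' => ⟨add_mem h.1 h'.1, fun x => add_mem (h.2 x) (h'.2 x)⟩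
  zero_mem' := ⟨zero_mem _, fun x => zero_mem (B.compatFibre k x)⟩
  smul_mem' := fun f _ h =>
    ⟨Submodule.smul_mem _ f h.1, fun x => Submodule.smul_mem (B.compatFibre k x) (f x) (h.2 x)⟩

section Kernel

variable [∀ i, VectorBundle ℝ (F i) (E i)]

/-- The smooth sections over `U` of `ker (μ|_{E p}) ⊆ E p`, as a subspace of all families. -/
def kerSubmodule (p : Fin n) (U : Opens M) : Submodule ℝ (∀ x : U, E p x) where
  carrier := {s | IsSmoothSection F E d p U s ∧ ∀ x : U, B.μ x (Pi.single p (s x)) = 0}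
  add_mem' := fun h h' => ⟨isSmoothSection_add F E h.1 h'.1, fun x => by
    rw [Pi.add_apply, Pi.single_add, map_add, h.2 x, h'.2 x, add_zero]⟩
  zero_mem' := ⟨isSmoothSection_zero F E p U, fun x => by
    rw [Pi.zero_apply, Pi.single_zero, map_zero]⟩
  smul_mem' := fun c _ h => ⟨isSmoothSection_smul F E (algebraMap ℝ (Smooth d U) c) h.1, fun x => by
    rw [Pi.smul_apply, Pi.single_smul, map_smul, h.2 x, smul_zero]⟩

/-- The smooth sections over `U` of `ker (μ|_{E p}) ⊆ E p`. -/
def KerSections (p : Fin n) (U : Opens M) : Type _ := B.kerSubmodule p U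

instance (p : Fin n) (U : Opens M) : AddCommGroup (B.KerSections p U) :=
  (B.kerSubmodule p U).addCommGroup

instance (p : Fin n) (U : Opens M) : Module (Smooth d U) (B.KerSections p U) where
  smul f s := ⟨fun x => f x • s.1 x, isSmoothSection_smul F E f s.2.1, fun x => by
    rw [Pi.single_smul, map_smul, s.2.2 x, smul_zero]⟩
  one_smul e := Subtype.ext (funext fun x => one_smul ℝ (e.1 x))
  mul_smul f g e := Subtype.ext (funext fun x => mul_smul (f x) (g x) (e.1 x))
  smul_zero f := Subtype.ext (funext fun x => smul_zero (f x))
  smul_add f e e' := Subtype.ext (funext fun x => smul_add (f x) (e.1 x) (e'.1 x))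
  add_smul f g e := Subtype.ext (funext fun x => add_smul (f x) (g x) (e.1 x))
  zero_smul e := Subtype.ext (funext fun x => zero_smul ℝ (e.1 x))

/-- The fibre at `x` of `ker (μ|_{E p})`. -/
def kerFibre (p : Fin n) (x : M) : Submodule ℝ (E p x) :=
  LinearMap.ker (B.μ x ∘ₗ LinearMap.single ℝ (fun i => E i x) p)

end Kernel

end CoalgebraBundle

/-- The function `⟨e, s⟩` on `U`, as a section of `𝐄_ℝ^*` of degree `0`, for a section `e` of
`𝐄_ℝ^*` and a smooth section `s` of `E p`. -/
def pairing {U : Opens M} (p : Fin n) (e : ExtSections F E d U) (s : ∀ x : U, E p x)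
    (hs : IsSmoothSection F E d p U s) : ExtSections F E d U :=
  ⟨fun x => ((e.1 x).2 p (s x), 0), e.2.2 p U le_rfl s hs, fun _ _ _ _ _ => contMDiff_const⟩

end Sections

end NManifold

end

set_option linter.unusedSectionVars false

noncomputable section

namespace NManifold

open scoped Topology

/-! ### The dual algebra of one fibre: associativity, commutativity, grading -/

section FibreAlgebra

variable {n : ℕ} {V : Fin n → Type*} [∀ i, AddCommGroup (V i)] [∀ i, Module ℝ (V i)]

/-! Dualizing coassociativity and cocommutativity, μ makes each fibre ℝ ⊕ E_x^* a unital graded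
commutative algebra under `extMul`. The graded symmetric algebra of E_x^* acts on it by left
multiplication (`GSym.act`). Associativity makes every relator act as zero, and acting on the unit
returns the original element. Hence a section of E_ℝ^* can be read off from its class in C_𝓜, and
the canonical map is injective. Conversely, a polynomial in sections reduces in degrees ≤ n to a
single section modulo relators, one product at a time (`exists_proj_eq`). The local results glue
because the action on the unit gives a globally defined candidate.

A vector field of degree k ≤ 0 sends functions of degree ≤ n to functions of degree ≤ n, so it
restricts to an operator on sections of E_ℝ^*. The Leibniz rule for multiplication by functions
yields the symbol, because derivations of smooth functions are vector fields (Hadamard's lemma); the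
Leibniz rule for products of degree ≤ n is compatibility with m. The restriction is injective
because C_𝓜 is locally generated by sections, bump functions mediating between local and global
statements (`derivation_eq_zero`). For surjectivity, a compatible D is near each point a directional
derivative plus a linear map δ in a frame. The map δ extends to a graded derivation of Sym as the
corner of a 2 × 2 matrix representation (`GSym.derHom`), and together they give a derivation Δ of
Sym E^* extending D. It sends the relator of (e, e') to those of (D e, e') and (e, D e') up to sign,
whose degrees are still ≤ n because k ≤ 0. So Δ preserves the ideal sheaf and descends to a vector
field.

Admissibility gives local triviality of the coalgebra bundle (`CoalgebraBundle.exists_locFrame`),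
and with it the constant ranks. The point is that K^μ in degree −(q+1) only involves μ on the
summands of index < q (`map_mem_kSpace`). If a frame already matches μ with a model μ₀ there, then μ
on the next summand, read in the frame, and μ₀ are surjections onto the same space. A smooth family
of surjections becomes constant after a smooth change of frame (`exists_smooth_correction`), and
induction on q finishes the argument. In such a frame every fibre of Der(E_ℝ^*, m)_k is the product
of the space of symbols and one fixed space `modelDer` (`map_pointDer`), and ker μ_{-n} is one fixed
kernel.

For k = −n with n ≥ 1 the symbol vanishes and everything of degree < n is killed. What remains is a
functional on E_{-n}^* at each point, that is, the pairing with a section s of E_{-n}; compatibility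
on products of total degree n says exactly that μ(s) = 0. -/

theorem negOnePow_smul {N : Type*} [AddCommGroup N] [Module ℝ N] (a : ℤ) (x : N) :
    a.negOnePow • x = ((-1 : ℝ) ^ a) • x := by
  rw [← Int.cast_negOnePow ℝ, Units.smul_def, Int.cast_smul_eq_zsmul]

/-- The axioms of a graded cocommutative coalgebra (without counit). -/
structure IsGradedCoalgebra (μ : (∀ i, V i) →ₗ[ℝ] (∀ i, V i) ⊗[ℝ] (∀ i, V i)) : Prop where
  degree_preserving : ∀ (p : Fin n) (v : V p), μ (Pi.single p v) ∈ tensorDeg V (p.val + 1)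
  coassoc : ∀ v, TensorProduct.assoc ℝ _ _ _ (μ.rTensor _ (μ v)) = μ.lTensor _ (μ v)
  cocomm : ∀ (i j : Fin n) (v : ∀ i, V i),
    comp₂ V j i (μ v) = (-1 : ℝ) ^ ((i.val + 1) * (j.val + 1)) •
      TensorProduct.comm ℝ (V i) (V j) (comp₂ V i j (μ v))

theorem dualEval_apply (ξ : ∀ i, Module.Dual ℝ (V i)) (v : ∀ i, V i) :
    dualEval ξ v = ∑ i, ξ i (v i) := by
  simp [dualEval]

theorem dualEval_single_right (ξ : ∀ i, Module.Dual ℝ (V i)) (p : Fin n) (v : V p) :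
    dualEval ξ (Pi.single p v) = ξ p v := by
  rw [dualEval_apply, Finset.sum_eq_single p]
  · simp
  · intro b _ hb; simp [Pi.single_eq_of_ne hb]
  · simp

theorem dualEval_single_left (p : Fin n) (ξ : Module.Dual ℝ (V p)) :
    dualEval (Pi.single p ξ) = ξ ∘ₗ LinearMap.proj p := by
  ext v
  simp only [dualEval_apply, LinearMap.comp_apply, LinearMap.proj_apply]
  rw [Finset.sum_eq_single p]
  · simp
  · intro b _ hb; simp [Pi.single_eq_of_ne hb]
  · simp

/-- The functional `ξ ⊗ η` on `𝐕 ⊗ 𝐕`. -/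
def dualPair (ξ η : ∀ i, Module.Dual ℝ (V i)) : (∀ i, V i) ⊗[ℝ] (∀ i, V i) →ₗ[ℝ] ℝ :=
  LinearMap.mul' ℝ ℝ ∘ₗ TensorProduct.map (dualEval ξ) (dualEval η)

@[simp] theorem dualPair_tmul (ξ η : ∀ i, Module.Dual ℝ (V i)) (v w : ∀ i, V i) :
    dualPair ξ η (v ⊗ₜ w) = dualEval ξ v * dualEval η w := by
  simp [dualPair]

variable (μ : (∀ i, V i) →ₗ[ℝ] (∀ i, V i) ⊗[ℝ] (∀ i, V i))

theorem dualMul_apply (ξ η : ∀ i, Module.Dual ℝ (V i)) (p : Fin n) (v : V p) :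
    dualMul μ ξ η p v = dualPair ξ η (μ (Pi.single p v)) := rfl

theorem dualEval_dualMul (ξ η : ∀ i, Module.Dual ℝ (V i)) :
    dualEval (dualMul μ ξ η) = dualPair ξ η ∘ₗ μ := by
  refine LinearMap.pi_ext fun p v => ?_
  rw [dualEval_single_right]; rfl

theorem dualPair_eq_sum_comp₂ (ξ η : ∀ i, Module.Dual ℝ (V i)) (e : (∀ i, V i) ⊗[ℝ] (∀ i, V i)) :
    dualPair ξ η e = ∑ i, ∑ j, LinearMap.mul' ℝ ℝ (TensorProduct.map (ξ i) (η j) (comp₂ V i j e)) := by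
  induction e with
  | zero => simp
  | add x y hx hy => simp only [map_add, hx, hy, Finset.sum_add_distrib]
  | tmul v w =>
    simp [comp₂, dualEval_apply, Finset.sum_mul_sum]

variable {μ}

/-- Both sides are the functional ξ ⊗ η ⊗ ζ evaluated on an iterated comultiplication, bracketed to
the left and to the right; coassociativity identifies them. -/
theorem dualMul_assoc (hμ : IsGradedCoalgebra μ) (ξ η ζ : ∀ i, Module.Dual ℝ (V i)) :
    dualMul μ (dualMul μ ξ η) ζ = dualMul μ ξ (dualMul μ η ζ) := by
  have h1 : ∀ e, dualPair (dualMul μ ξ η) ζ e =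
      (LinearMap.mul' ℝ ℝ ∘ₗ TensorProduct.map (dualEval ξ) (dualPair η ζ))
        (TensorProduct.assoc ℝ _ _ _ (μ.rTensor _ e)) := by
    have h0 : ∀ (e) (w : ∀ i, V i), dualPair ξ η e * dualEval ζ w =
      (LinearMap.mul' ℝ ℝ ∘ₗ TensorProduct.map (dualEval ξ) (dualPair η ζ))
        (TensorProduct.assoc ℝ _ _ _ (e ⊗ₜ w)) := by
      intro e w
      induction e with
      | zero => simp
      | add x y hx hy => simp only [map_add, TensorProduct.add_tmul, add_mul, hx, hy]
      | tmul u v => simp [mul_assoc]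
    intro e
    induction e with
    | zero => simp
    | add x y hx hy => simp only [map_add, hx, hy]
    | tmul v w =>
      rw [dualPair_tmul, dualEval_dualMul, LinearMap.rTensor_tmul, ← h0]; rfl
  have h2 : ∀ e, dualPair ξ (dualMul μ η ζ) e =
      (LinearMap.mul' ℝ ℝ ∘ₗ TensorProduct.map (dualEval ξ) (dualPair η ζ)) (μ.lTensor _ e) := by
    intro e
    induction e with
    | zero => simp
    | add x y hx hy => simp only [map_add, hx, hy]
    | tmul v w => rw [dualPair_tmul, dualEval_dualMul]; simp
  funext p; ext v
  rw [dualMul_apply, dualMul_apply, h1, h2, hμ.coassoc]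

theorem extMul_assoc (hμ : IsGradedCoalgebra μ) (a b c : ExtDual V) :
    extMul μ (extMul μ a b) c = extMul μ a (extMul μ b c) := by
  refine Prod.ext (mul_assoc _ _ _) ?_
  simp only [extMul, dualMul_add_left, dualMul_add_right, dualMul_smul_left, dualMul_smul_right,
    smul_add, smul_smul, dualMul_assoc hμ]
  rw [mul_comm c.1 a.1, mul_comm c.1 b.1]
  abel

variable (μ) in
theorem one_extMul (a : ExtDual V) : extMul μ (1, 0) a = a := by
  have h := dualMul_smul_left μ 0 0 a.2
  rw [zero_smul, zero_smul] at h
  refine Prod.ext (one_mul _) ?_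
  simp [extMul, h]

variable (μ) in
theorem extMul_scalar (c : ℝ) (a : ExtDual V) : extMul μ (c, 0) a = c • a := by
  have : ((c, 0) : ExtDual V) = c • (1, 0) := by simp
  rw [this, extMul_smul_left, one_extMul]

variable (μ) in
theorem extMul_scalar_right (c : ℝ) (a : ExtDual V) : extMul μ a (c, 0) = c • a := by
  have h := dualMul_smul_right μ 0 a.2 0
  rw [zero_smul, zero_smul] at h
  refine Prod.ext (mul_comm _ _) ?_
  simp [extMul, h]

theorem extMul_homog (hμ : IsGradedCoalgebra μ) {a b : ℤ} {w w' : ExtDual V} (h : w.IsHomog a)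
    (h' : w'.IsHomog b) : (extMul μ w w').IsHomog (a + b) := by
  refine ⟨fun hab => ?_, fun p hp => ?_⟩
  · by_cases ha : a = 0
    · have : w'.1 = 0 := h'.1 (by omega)
      simp [extMul, this]
    · simp [extMul, h.1 ha]
  · have e1 : w.1 • w'.2 p = 0 := by
      by_cases ha : a = 0
      · rw [h'.2 p (by omega), smul_zero]
      · rw [h.1 ha, zero_smul]
    have e2 : w'.1 • w.2 p = 0 := by
      by_cases hb : b = 0
      · rw [h.2 p (by omega), smul_zero]
      · rw [h'.1 hb, zero_smul]
    have e3 : dualMul μ w.2 w'.2 p = 0 := by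
      ext v
      rw [dualMul_apply, dualPair_eq_sum_comp₂]
      refine Finset.sum_eq_zero fun i _ => Finset.sum_eq_zero fun j _ => ?_
      by_cases hi : (i.val : ℤ) + 1 = a
      · by_cases hj : (j.val : ℤ) + 1 = b
        · rw [hμ.degree_preserving p v i j (by omega)]; simp
        · rw [h'.2 j hj]; simp
      · rw [h.2 i hi]; simp
    simp only [extMul, Pi.add_apply, Pi.smul_apply, e1, e2, e3, add_zero]

/-- One product sees only the (i, j) component of μ(v), the other only the (j, i) component; graded
cocommutativity relates them with this sign. -/
theorem dualMul_single_comm (hμ : IsGradedCoalgebra μ) (i j : Fin n) (ξ : Module.Dual ℝ (V i))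
    (η : Module.Dual ℝ (V j)) : dualMul μ (Pi.single i ξ) (Pi.single j η) =
      (-1 : ℝ) ^ ((i.val + 1) * (j.val + 1)) • dualMul μ (Pi.single j η) (Pi.single i ξ) := by
  have key : ∀ (i j : Fin n) (ξ : Module.Dual ℝ (V i)) (η : Module.Dual ℝ (V j)) e,
      dualPair (Pi.single i ξ) (Pi.single j η) e =
        LinearMap.mul' ℝ ℝ (TensorProduct.map ξ η (comp₂ V i j e)) := by
    intro i j ξ η e
    induction e with
    | zero => simp
    | add x y hx hy => simp only [map_add, hx, hy]
    | tmul v w => simp [dualEval_single_left, comp₂]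
  have hc : ∀ e : V j ⊗[ℝ] V i, LinearMap.mul' ℝ ℝ (TensorProduct.map ξ η
      (TensorProduct.comm ℝ _ _ e)) = LinearMap.mul' ℝ ℝ (TensorProduct.map η ξ e) := by
    intro e
    induction e with
    | zero => simp
    | add x y hx hy => simp only [map_add, hx, hy]
    | tmul v w => simp [mul_comm]
  funext p; ext v
  rw [dualMul_apply, key, hμ.cocomm j i, Pi.smul_apply, LinearMap.smul_apply, dualMul_apply, key]
  rw [map_smul, map_smul, hc, mul_comm (j.val + 1)]

/-- The component of degree `a`. -/
def ExtDual.part (a : ℕ) : ExtDual V →ₗ[ℝ] ExtDual V where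
  toFun w := (if a = 0 then w.1 else 0, fun i => if i.val + 1 = a then w.2 i else 0)
  map_add' w w' := by
    refine Prod.ext ?_ (funext fun i => ?_)
    · by_cases h : a = 0 <;> simp [h]
    · by_cases h : i.val + 1 = a <;> simp [h]
  map_smul' c w := by
    refine Prod.ext ?_ (funext fun i => ?_)
    · by_cases h : a = 0 <;> simp [h]
    · by_cases h : i.val + 1 = a <;> simp [h]

theorem ExtDual.part_homog (a : ℕ) (w : ExtDual V) : (ExtDual.part a w).IsHomog a := by
  refine ⟨fun h => if_neg (by exact_mod_cast h), fun i hi => if_neg (by omega)⟩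

theorem ExtDual.sum_part (w : ExtDual V) : ∑ a ∈ Finset.range (n + 1), ExtDual.part a w = w := by
  refine Prod.ext ?_ (funext fun i => ?_)
  · rw [Prod.fst_sum, Finset.sum_eq_single 0]
    · simp [ExtDual.part]
    · intro b _ hb; simp [ExtDual.part, hb]
    · simp
  · rw [Prod.snd_sum, Finset.sum_apply, Finset.sum_eq_single (i.val + 1)]
    · simp [ExtDual.part]
    · intro b _ hb; simp [ExtDual.part, Ne.symm hb]
    · intro h; exact absurd (Finset.mem_range.mpr (by omega)) h

theorem ExtDual.IsHomog.eq_zero {a : ℤ} {w : ExtDual V} (h : w.IsHomog a) (ha : a < 0 ∨ n < a) :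
    w = 0 :=
  Prod.ext (h.1 (by omega)) (funext fun i => h.2 i (by omega))

theorem ExtDual.isHomog_single (i : Fin n) (ξ : Module.Dual ℝ (V i)) :
    ExtDual.IsHomog (V := V) (i.val + 1) (0, Pi.single i ξ) :=
  ⟨fun _ => rfl, fun j hj => by
    have : j ≠ i := by rintro rfl; exact hj rfl
    simp [Pi.single_eq_of_ne this]⟩

theorem ExtDual.isHomog_scalar (c : ℝ) : ExtDual.IsHomog (V := V) 0 (c, 0) :=
  ⟨fun h => absurd rfl h, fun _ _ => rfl⟩

end FibreAlgebra

/-! ### The graded symmetric algebra: universal property and degree decomposition -/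

section GSym

variable {n : ℕ} {W : Fin n → Type*} [∀ i, AddCommGroup (W i)] [∀ i, Module ℝ (W i)]

namespace GSym

theorem ι_swap (i j : Fin n) (a : W i) (b : W j) :
    GSym.ι W (Pi.single i a) * GSym.ι W (Pi.single j b) =
      (-1 : ℝ) ^ ((i.val + 1) * (j.val + 1)) •
        (GSym.ι W (Pi.single j b) * GSym.ι W (Pi.single i a)) := by
  have h := RingQuot.mkAlgHom_rel ℝ (SymRel.swap (W := W) i j a b)
  rw [map_mul, map_smul, map_mul] at h
  exact h

/-- The universal property of the graded symmetric algebra. -/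
def lift {C : Type*} [Semiring C] [Algebra ℝ C] (f : (∀ i, W i) →ₗ[ℝ] C)
    (hf : ∀ i j (a : W i) (b : W j), f (Pi.single i a) * f (Pi.single j b) =
      (-1 : ℝ) ^ ((i.val + 1) * (j.val + 1)) • (f (Pi.single j b) * f (Pi.single i a))) :
    GSym W →ₐ[ℝ] C :=
  RingQuot.liftAlgHom ℝ ⟨TensorAlgebra.lift ℝ f, by
    rintro _ _ ⟨i, j, a, b⟩
    simp only [map_mul, map_smul, TensorAlgebra.lift_ι_apply]
    exact hf i j a b⟩

@[simp] theorem lift_ι {C : Type*} [Semiring C] [Algebra ℝ C] (f : (∀ i, W i) →ₗ[ℝ] C) (hf) (w) :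
    lift f hf (GSym.ι W w) = f w := by
  refine (RingQuot.liftAlgHom_mkAlgHom_apply ℝ (TensorAlgebra.lift ℝ f) _ _).trans ?_
  exact TensorAlgebra.lift_ι_apply f w

theorem ι_eq_sum (w : ∀ i, W i) : GSym.ι W w = ∑ i, GSym.ι W (Pi.single i (w i)) := by
  rw [← map_sum]; congr 1; exact (Finset.univ_sum_single w).symm

theorem induction {P : GSym W → Prop} (h0 : ∀ c, P (algebraMap ℝ _ c))
    (h1 : ∀ w, P (GSym.ι W w)) (hm : ∀ s t, P s → P t → P (s * t))
    (hadd : ∀ s t, P s → P t → P (s + t)) (s : GSym W) : P s := by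
  obtain ⟨t, rfl⟩ := RingQuot.mkAlgHom_surjective ℝ (SymRel W) s
  refine TensorAlgebra.induction (C := fun t => P (RingQuot.mkAlgHom ℝ (SymRel W) t))
    (fun r => ?_) (fun w => ?_) (fun a b ha hb => ?_) (fun a b ha hb => ?_) t
  · rw [AlgHom.commutes]; exact h0 r
  · exact h1 w
  · rw [map_mul]; exact hm _ _ ha hb
  · rw [map_add]; exact ‹∀ s t, P s → P t → P (s + t)› _ _ ha hb

theorem algHom_ext {C : Type*} [Semiring C] [Algebra ℝ C] {f g : GSym W →ₐ[ℝ] C}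
    (h : ∀ w, f (GSym.ι W w) = g (GSym.ι W w)) : f = g := by
  ext s
  induction s using GSym.induction with
  | h0 c => rw [AlgHom.commutes, AlgHom.commutes]
  | h1 w => exact h w
  | hm s t hs ht => rw [map_mul, map_mul, hs, ht]
  | hadd s t hs ht => rw [map_add, map_add, hs, ht]

theorem one_mem_deg : (1 : GSym W) ∈ deg W 0 := Submodule.subset_span ⟨[], rfl, rfl⟩

theorem algebraMap_mem_deg (c : ℝ) : algebraMap ℝ (GSym W) c ∈ deg W 0 := by
  rw [Algebra.algebraMap_eq_smul_one]; exact Submodule.smul_mem _ _ one_mem_deg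

theorem ι_single_mem_deg (i : Fin n) (a : W i) : GSym.ι W (Pi.single i a) ∈ deg W (i.val + 1) :=
  Submodule.subset_span ⟨[⟨i, a⟩], by simp, by simp⟩

theorem mul_mem_deg {k l : ℤ} {s t : GSym W} (hs : s ∈ deg W k) (ht : t ∈ deg W l) :
    s * t ∈ deg W (k + l) := by
  have h : deg W k * deg W l ≤ deg W (k + l) := by
    rw [deg, deg, Submodule.span_mul_span, Submodule.span_le]
    rintro _ ⟨_, ⟨L, rfl, rfl⟩, _, ⟨L', rfl, rfl⟩, rfl⟩
    exact Submodule.subset_span ⟨L ++ L', by simp, by simp⟩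
  exact h (Submodule.mul_mem_mul hs ht)

theorem deg_induction {l : ℤ} {P : GSym W → Prop}
    (hL : ∀ L : List (Σ i, W i), (L.map fun a => (a.1.val : ℤ) + 1).sum = l →
      P (L.map fun a => GSym.ι W (Pi.single a.1 a.2)).prod)
    (h0 : P 0) (ha : ∀ s t, P s → P t → P (s + t)) (hs : ∀ (c : ℝ) s, P s → P (c • s))
    {s : GSym W} (h : s ∈ deg W l) : P s :=
  Submodule.span_induction (fun _ ⟨L, e, hl⟩ => e ▸ hL L hl) h0 (fun s t _ _ => ha s t)
    (fun c s _ => hs c s) h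

/-- Functoriality of the graded symmetric algebra. -/
def map {W' : Fin n → Type*} [∀ i, AddCommGroup (W' i)] [∀ i, Module ℝ (W' i)]
    (f : ∀ i, W i →ₗ[ℝ] W' i) : GSym W →ₐ[ℝ] GSym W' :=
  lift (GSym.ι W' ∘ₗ LinearMap.pi fun i => f i ∘ₗ LinearMap.proj i) (by
    have h : ∀ i (a : W i), (GSym.ι W' ∘ₗ LinearMap.pi fun i => f i ∘ₗ LinearMap.proj i)
        (Pi.single i a) = GSym.ι W' (Pi.single i (f i a)) := by
      intro i a
      refine congrArg (GSym.ι W') (funext fun j => ?_)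
      by_cases hj : j = i
      · subst hj; simp
      · simp [Pi.single_eq_of_ne hj]
    intro i j a b
    rw [h, h]
    exact ι_swap i j _ _)

@[simp] theorem map_ι {W' : Fin n → Type*} [∀ i, AddCommGroup (W' i)] [∀ i, Module ℝ (W' i)]
    (f : ∀ i, W i →ₗ[ℝ] W' i) (w : ∀ i, W i) :
    map f (GSym.ι W w) = GSym.ι W' (fun i => f i (w i)) := lift_ι _ _ w

theorem map_map {W' W'' : Fin n → Type*} [∀ i, AddCommGroup (W' i)] [∀ i, Module ℝ (W' i)]
    [∀ i, AddCommGroup (W'' i)] [∀ i, Module ℝ (W'' i)]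
    (f : ∀ i, W i →ₗ[ℝ] W' i) (g : ∀ i, W' i →ₗ[ℝ] W'' i) (s : GSym W) :
    map g (map f s) = map (fun i => g i ∘ₗ f i) s := by
  have : (map g).comp (map f) = map (fun i => g i ∘ₗ f i) :=
    algHom_ext fun w => by simp
  exact DFunLike.congr_fun this s

theorem map_id (s : GSym W) : map (fun i => (LinearMap.id : W i →ₗ[ℝ] W i)) s = s := by
  have : map (fun i => (LinearMap.id : W i →ₗ[ℝ] W i)) = AlgHom.id ℝ (GSym W) :=
    algHom_ext fun w => by simp
  exact DFunLike.congr_fun this s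

theorem map_mem_deg {W' : Fin n → Type*} [∀ i, AddCommGroup (W' i)] [∀ i, Module ℝ (W' i)]
    (f : ∀ i, W i →ₗ[ℝ] W' i) {l : ℤ} {s : GSym W} (hs : s ∈ deg W l) : map f s ∈ deg W' l := by
  refine deg_induction (P := fun s => map f s ∈ deg W' l) ?_ ?_ ?_ ?_ hs
  · rintro L hL
    refine Submodule.subset_span ⟨L.map fun a => ⟨a.1, f a.1 a.2⟩, ?_, ?_⟩
    · rw [map_list_prod, List.map_map, List.map_map]
      congr 1
      refine List.map_congr_left fun a _ => ?_
      simp only [Function.comp, map_ι]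
      congr 1
      funext j
      by_cases hj : j = a.1
      · subst hj; simp
      · simp [Pi.single_eq_of_ne hj]
    · rw [List.map_map]; exact hL
  · rw [map_zero]; exact zero_mem _
  · intro s t hs ht; rw [map_add]; exact add_mem hs ht
  · intro c s hs; rw [map_smul]; exact Submodule.smul_mem _ _ hs

/-- The sum decomposition of `w`, weighted by the degree variable. -/
def gradLin (W : Fin n → Type*) [∀ i, AddCommGroup (W i)] [∀ i, Module ℝ (W i)] :
    (∀ i, W i) →ₗ[ℝ] Polynomial (GSym W) :=
  ∑ i, ((Polynomial.monomial (i.val + 1)).restrictScalars ℝ :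
    GSym W →ₗ[ℝ] Polynomial (GSym W)) ∘ₗ GSym.ι W ∘ₗ LinearMap.single ℝ W i ∘ₗ LinearMap.proj i

theorem gradLin_single (i : Fin n) (a : W i) :
    gradLin W (Pi.single i a) = Polynomial.monomial (i.val + 1) (GSym.ι W (Pi.single i a)) := by
  rw [gradLin, LinearMap.sum_apply, Finset.sum_eq_single i]
  · simp
  · intro b _ hb; simp [Pi.single_eq_of_ne hb]
  · simp

/-- The grading of the graded symmetric algebra, as a coaction. -/
def gradHom (W : Fin n → Type*) [∀ i, AddCommGroup (W i)] [∀ i, Module ℝ (W i)] :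
    GSym W →ₐ[ℝ] Polynomial (GSym W) :=
  lift (gradLin W) (by
    intro i j a b
    rw [gradLin_single, gradLin_single, Polynomial.monomial_mul_monomial,
      Polynomial.monomial_mul_monomial, ι_swap, Polynomial.smul_monomial, add_comm (i.val + 1)])

/-- The projection of the graded symmetric algebra to its component of degree `l`. -/
def proj (l : ℤ) : GSym W →ₗ[ℝ] GSym W :=
  if 0 ≤ l then ((Polynomial.lcoeff (GSym W) l.toNat).restrictScalars ℝ) ∘ₗ (gradHom W).toLinearMap
  else 0

/-- Weighting each generator by X to the power of its degree gives an algebra map to polynomials,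
since graded commutation preserves total degree. Homogeneous components are then coefficients, which
is how the spans `deg` are seen to be independent. -/
theorem gradHom_prod (L : List (Σ i, W i)) :
    gradHom W (L.map fun a => GSym.ι W (Pi.single a.1 a.2)).prod =
      Polynomial.monomial (L.map fun a => a.1.val + 1).sum
        (L.map fun a => GSym.ι W (Pi.single a.1 a.2)).prod := by
  induction L with
  | nil => simp
  | cons a L ih =>
    simp only [List.map_cons, List.prod_cons, List.sum_cons, map_mul, ih]
    rw [gradHom, lift_ι, gradLin_single, Polynomial.monomial_mul_monomial]

theorem proj_prod (l : ℤ) (L : List (Σ i, W i)) :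
    proj l (L.map fun a => GSym.ι W (Pi.single a.1 a.2)).prod =
      if (L.map fun a => (a.1.val : ℤ) + 1).sum = l then
        (L.map fun a => GSym.ι W (Pi.single a.1 a.2)).prod else 0 := by
  have e : (L.map fun a => (a.1.val : ℤ) + 1).sum = ((L.map fun a => a.1.val + 1).sum : ℕ) := by
    rw [Nat.cast_list_sum, List.map_map]
    congr 1
  rw [proj]
  split_ifs with h0 h1 h1
  · simp only [LinearMap.comp_apply, AlgHom.toLinearMap_apply, LinearMap.restrictScalars_apply,
      Polynomial.lcoeff_apply, gradHom_prod]
    rw [Polynomial.coeff_monomial, if_pos (by omega)]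
  · simp only [LinearMap.comp_apply, AlgHom.toLinearMap_apply, LinearMap.restrictScalars_apply,
      Polynomial.lcoeff_apply, gradHom_prod]
    rw [Polynomial.coeff_monomial, if_neg (by omega)]
  -- A product of generators has degree at least 0, so a negative l cannot be its degree.
  · omega
  · rfl

theorem proj_of_mem_deg {l : ℤ} {s : GSym W} (hs : s ∈ deg W l) : proj l s = s := by
  refine deg_induction (P := fun s => proj l s = s) ?_ ?_ ?_ ?_ hs
  · intro L hL; rw [proj_prod, if_pos hL]
  · exact map_zero _
  · intro s t hs ht; rw [map_add, hs, ht]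
  · intro c s hs; rw [map_smul, hs]

theorem proj_of_mem_deg_ne {l l' : ℤ} (h : l ≠ l') {s : GSym W} (hs : s ∈ deg W l) :
    proj l' s = 0 := by
  refine deg_induction (P := fun s => proj l' s = 0) ?_ ?_ ?_ ?_ hs
  · intro L hL; rw [proj_prod, if_neg (by omega)]
  · exact map_zero _
  · intro s t hs ht; rw [map_add, hs, ht, add_zero]
  · intro c s hs; rw [map_smul, hs, smul_zero]

theorem mem_iSup_deg (s : GSym W) : s ∈ ⨆ l, deg W l := by
  have hle : ∀ l, deg W l ≤ ⨆ l, deg W l := le_iSup (deg W)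
  induction s using GSym.induction with
  | h0 c => exact hle 0 (algebraMap_mem_deg c)
  | h1 w => rw [ι_eq_sum]; exact sum_mem fun i _ => hle _ (ι_single_mem_deg i (w i))
  | hadd s t hs ht => exact add_mem hs ht
  | hm s t hs ht =>
    induction hs using Submodule.iSup_induction' with
    | zero => rw [zero_mul]; exact zero_mem _
    | add x y _ _ hx hy => rw [add_mul]; exact add_mem hx hy
    | mem k x hx =>
      induction ht using Submodule.iSup_induction' with
      | zero => rw [mul_zero]; exact zero_mem _
      | add y z _ _ hy hz => rw [mul_add]; exact add_mem hy hz
      | mem l y hy => exact hle _ (mul_mem_deg hx hy)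

theorem proj_mem_deg (l : ℤ) (s : GSym W) : proj l s ∈ deg W l := by
  induction mem_iSup_deg s using Submodule.iSup_induction' with
  | zero => rw [map_zero]; exact zero_mem _
  | add x y _ _ hx hy => rw [map_add]; exact add_mem hx hy
  | mem k x hx =>
    by_cases h : k = l
    · subst h; rw [proj_of_mem_deg hx]; exact hx
    · rw [proj_of_mem_deg_ne h hx]; exact zero_mem _

end GSym

end GSym

/-! ### Derivations of the symmetric algebra and its action on the extended dual -/

section ExtElements

variable {n : ℕ} {V : Fin n → Type*} [∀ i, AddCommGroup (V i)] [∀ i, Module ℝ (V i)]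

/-- The canonical map `ℝ ⊕ 𝐕^* → Sym 𝐕^*`. -/
def GSym.ofExt (V : Fin n → Type*) [∀ i, AddCommGroup (V i)] [∀ i, Module ℝ (V i)] :
    ExtDual V →ₗ[ℝ] GSym (fun i => Module.Dual ℝ (V i)) :=
  (Algebra.linearMap ℝ _).coprod (GSym.ι _)

theorem GSym.ofExt_apply (w : ExtDual V) :
    GSym.ofExt V w = algebraMap ℝ _ w.1 + GSym.ι _ w.2 := rfl

theorem GSym.ofExt_mem_deg {a : ℤ} {w : ExtDual V} (h : w.IsHomog a) :
    GSym.ofExt V w ∈ GSym.deg _ a := by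
  rw [ofExt_apply, ι_eq_sum]
  refine add_mem ?_ (sum_mem fun i _ => ?_)
  · by_cases ha : a = 0
    · subst ha; exact algebraMap_mem_deg _
    · rw [h.1 ha, map_zero]; exact zero_mem _
  · by_cases hi : (i.val : ℤ) + 1 = a
    · subst hi; exact ι_single_mem_deg i _
    · rw [h.2 i hi, Pi.single_zero, map_zero]; exact zero_mem _

theorem neg_one_zpow_mul_self (a : ℤ) : ((-1 : ℝ) ^ a) * (-1 : ℝ) ^ a = 1 := by
  rw [← mul_zpow]; norm_num

/-- An induction principle for homogeneous elements of the extended dual. -/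
theorem ExtDual.homog_cases {a : ℤ} {P : ExtDual V → Prop}
    (h0 : ∀ c : ℝ, a = 0 → P (c, 0)) (h1 : ∀ i (ξ : Module.Dual ℝ (V i)), (i.val : ℤ) + 1 = a →
      P (0, Pi.single i ξ)) (hz : P 0) {w : ExtDual V} (h : w.IsHomog a) : P w := by
  by_cases ha : a = 0
  · have : w = (w.1, 0) := Prod.ext rfl (funext fun i => h.2 i (by omega))
    rw [this]; exact h0 _ ha
  · by_cases hi : ∃ i : Fin n, (i.val : ℤ) + 1 = a
    · obtain ⟨i, hi⟩ := hi
      have : w = (0, Pi.single i (w.2 i)) := by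
        refine Prod.ext (h.1 ha) (funext fun j => ?_)
        by_cases hj : j = i
        · subst hj; simp
        · have : (j.val : ℤ) ≠ i.val := fun e => hj (Fin.ext (by exact_mod_cast e))
          rw [h.2 j (by omega)]
          simp [Pi.single_eq_of_ne hj]
      rw [this]; exact h1 i _ hi
    · push Not at hi
      have : w = 0 := Prod.ext (h.1 ha) (funext fun i => h.2 i (hi i))
      rw [this]; exact hz

theorem GSym.ofExt_comm {a b : ℤ} {w w' : ExtDual V} (h : w.IsHomog a) (h' : w'.IsHomog b) :
    GSym.ofExt V w * GSym.ofExt V w' = ((-1 : ℝ) ^ (a * b)) • (GSym.ofExt V w' * GSym.ofExt V w) := by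
  refine ExtDual.homog_cases (P := fun w => GSym.ofExt V w * GSym.ofExt V w' =
    ((-1 : ℝ) ^ (a * b)) • (GSym.ofExt V w' * GSym.ofExt V w)) ?_ ?_ (by simp) h
  · rintro c rfl
    simp [ofExt_apply, Algebra.commutes]
  · rintro i ξ rfl
    refine ExtDual.homog_cases (P := fun w' => GSym.ofExt V _ * GSym.ofExt V w' =
      ((-1 : ℝ) ^ (((i.val : ℤ) + 1) * b)) • (GSym.ofExt V w' * GSym.ofExt V _)) ?_ ?_ (by simp) h'
    · rintro c rfl
      simp [ofExt_apply, Algebra.commutes]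
    · rintro j η rfl
      simp only [ofExt_apply, map_zero, zero_add]
      rw [GSym.ι_swap, ← zpow_natCast]
      push_cast; rfl

/-- The signed parity operator `w ↦ (-1)^{k |w|} w`. -/
def ExtDual.parity (k : ℤ) : ExtDual V →ₗ[ℝ] ExtDual V :=
  LinearMap.prodMap LinearMap.id
    (LinearMap.pi fun i => ((-1 : ℝ) ^ (k * (i.val + 1))) • LinearMap.proj i)

theorem ExtDual.parity_homog (k : ℤ) {a : ℤ} {w : ExtDual V} (h : w.IsHomog a) :
    ExtDual.parity k w = ((-1 : ℝ) ^ (k * a)) • w := by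
  refine ExtDual.homog_cases (P := fun w => ExtDual.parity k w = ((-1 : ℝ) ^ (k * a)) • w)
    ?_ ?_ (by simp) h
  · rintro c rfl; simp [parity]
  · rintro i ξ rfl
    refine Prod.ext (by simp [parity]) (funext fun j => ?_)
    by_cases hj : j = i
    · subst hj; simp [parity]
    · simp [parity, Pi.single_eq_of_ne hj]

/-- The signed parity automorphism `s ↦ (-1)^{k |s|} s`. -/
def GSym.parity (V : Fin n → Type*) [∀ i, AddCommGroup (V i)] [∀ i, Module ℝ (V i)] (k : ℤ) :
    GSym (fun i => Module.Dual ℝ (V i)) →ₐ[ℝ] GSym (fun i => Module.Dual ℝ (V i)) :=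
  GSym.map fun i => ((-1 : ℝ) ^ (k * (i.val + 1))) • LinearMap.id

theorem GSym.parity_ofExt (k : ℤ) (w : ExtDual V) :
    GSym.parity V k (GSym.ofExt V w) = GSym.ofExt V (ExtDual.parity k w) := by
  simp only [ofExt_apply, map_add, AlgHom.commutes, parity, map_ι]
  rfl

theorem GSym.parity_of_mem_deg (k : ℤ) {l : ℤ} {s : GSym (fun i => Module.Dual ℝ (V i))}
    (hs : s ∈ GSym.deg _ l) : GSym.parity V k s = ((-1 : ℝ) ^ (k * l)) • s := by
  refine deg_induction (P := fun s => GSym.parity V k s = ((-1 : ℝ) ^ (k * l)) • s) ?_ ?_ ?_ ?_ hs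
  · rintro L rfl
    clear hs
    induction L with
    | nil => simp
    | cons a L ih =>
      have h1 : GSym.parity V k (GSym.ι _ (Pi.single a.1 a.2)) =
          ((-1 : ℝ) ^ (k * ((a.1.val : ℤ) + 1))) • GSym.ι _ (Pi.single a.1 a.2) := by
        have := GSym.parity_ofExt k ((0, Pi.single a.1 a.2) : ExtDual V)
        rw [ExtDual.parity_homog k (ExtDual.isHomog_single a.1 a.2), map_smul] at this
        simpa [ofExt_apply] using this
      rw [List.map_cons, List.prod_cons, map_mul, ih, h1, List.map_cons, List.sum_cons,
        mul_add k (_ + _), zpow_add₀ (by norm_num : (-1 : ℝ) ≠ 0) (k * (_ + _)), smul_mul_smul_comm]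
  · simp
  · intro s t hs ht; rw [map_add, hs, ht, smul_add]
  · intro c s hs; rw [map_smul, hs, smul_comm]

/-! Derivations of `Sym 𝐕^*` from linear maps of degree `k`. -/

/-- A linear endomorphism of degree `k` of the extended dual, killing the unit. -/
structure ExtDual.IsPreDer (k : ℤ) (δ : ExtDual V →ₗ[ℝ] ExtDual V) : Prop where
  deg : ∀ (a : ℤ) w, ExtDual.IsHomog a w → (δ w).IsHomog (a + k)
  one : δ (1, 0) = 0

/-- The matrix realization of a graded derivation. -/
def GSym.derHom (k : ℤ) (δ : ExtDual V →ₗ[ℝ] ExtDual V) (hδ : ExtDual.IsPreDer k δ) :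
    GSym (fun i => Module.Dual ℝ (V i)) →ₐ[ℝ]
      Matrix (Fin 2) (Fin 2) (GSym (fun i => Module.Dual ℝ (V i))) :=
  GSym.lift
    -- The corner entry of a product of upper triangular matrices with diagonals (parity s, s) and
    -- (parity t, t) is parity s · Δt + Δs · t. Multiplicativity is therefore the graded Leibniz
    -- rule, and a derivation is obtained from the universal property for algebra maps.
    { toFun := fun w => !![GSym.parity V k (GSym.ι _ w), GSym.ofExt V (δ (0, w)); 0, GSym.ι _ w]
      map_add' := fun w w' => by
        have : ((0, w + w') : ExtDual V) = (0, w) + (0, w') := by simp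
        rw [this]
        simp only [map_add]
        ext a b; fin_cases a <;> fin_cases b <;> simp
      map_smul' := fun c w => by
        have : ((0, c • w) : ExtDual V) = c • (0, w) := by simp
        rw [this]
        simp only [map_smul]
        ext a b; fin_cases a <;> fin_cases b <;> simp } (by
    intro i j ξ η
    have hi := ExtDual.isHomog_single (V := V) i ξ
    have hj := ExtDual.isHomog_single (V := V) j η
    have e : ∀ (i : Fin n) (ξ : Module.Dual ℝ (V i)),
        GSym.ι (fun i => Module.Dual ℝ (V i)) (Pi.single i ξ) =
          GSym.ofExt V (0, Pi.single i ξ) := fun i ξ => by simp [ofExt_apply]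
    have hs : (-1 : ℝ) ^ ((i.val + 1) * (j.val + 1)) =
        (-1 : ℝ) ^ (((i.val : ℤ) + 1) * (j.val + 1)) := by
      rw [← zpow_natCast]; push_cast; rfl
    simp only [LinearMap.coe_mk, AddHom.coe_mk, e, hs, Matrix.mul_fin_two, parity_ofExt,
      ExtDual.parity_homog k hi, ExtDual.parity_homog k hj, map_smul]
    -- With a, b the degrees of ξ and η, commuting ξ past δη costs (-1)^(a(b+k)) and δξ past η costs
    -- (-1)^((a+k)b); the parity factors (-1)^(ka) and (-1)^(kb) absorb the excess and leave
    -- (-1)^(ab).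
    have c1 := ofExt_comm hi hj
    have c2 := ofExt_comm hi (hδ.deg _ _ hj)
    have c3 := ofExt_comm (hδ.deg _ _ hi) hj
    ext a b
    fin_cases a <;> fin_cases b
    · simp only [Fin.zero_eta, Matrix.of_apply, Matrix.cons_val', Matrix.cons_val_zero,
        Matrix.smul_apply, mul_zero, add_zero, smul_mul_smul_comm]
      rw [c1, smul_smul, smul_smul]
      congr 1; ring
    · simp only [Fin.zero_eta, Fin.mk_one, Matrix.of_apply, Matrix.cons_val', Matrix.cons_val_zero,
        Matrix.cons_val_one, Matrix.smul_apply, smul_mul_assoc]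
      rw [c2, c3, smul_add, smul_smul, smul_smul, add_comm]
      congr 1
      · rw [add_mul, zpow_add₀ (by norm_num)]
      · congr 1
        rw [mul_add _ _ k, zpow_add₀ (by norm_num : (-1 : ℝ) ≠ 0), mul_comm k ((i.val : ℤ) + 1),
          mul_left_comm, neg_one_zpow_mul_self, mul_one]
    · simp
    · simp only [Fin.mk_one, Matrix.of_apply, Matrix.cons_val', 
        Matrix.cons_val_one, Matrix.smul_apply, zero_mul, zero_add]
      exact c1)

section

variable {k : ℤ} {δ : ExtDual V →ₗ[ℝ] ExtDual V} (hδ : ExtDual.IsPreDer k δ)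

/-- The graded derivation of `Sym 𝐕^*` extending `δ`. -/
def GSym.der : GSym (fun i => Module.Dual ℝ (V i)) →ₗ[ℝ] GSym (fun i => Module.Dual ℝ (V i)) where
  toFun s := GSym.derHom k δ hδ s 0 1
  map_add' s t := by rw [map_add]; rfl
  map_smul' c s := by rw [map_smul]; rfl

/-- Products of upper triangular matrices multiply the diagonal entries and keep the zero, so the
three entries other than the corner are determined by their values on generators. -/
theorem GSym.derHom_eq (s) : GSym.derHom k δ hδ s = !![GSym.parity V k s, GSym.der hδ s; 0, s] := by
  have h : ∀ s, GSym.derHom k δ hδ s 0 0 = GSym.parity V k s ∧ GSym.derHom k δ hδ s 1 0 = 0 ∧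
      GSym.derHom k δ hδ s 1 1 = s := by
    intro s
    induction s using GSym.induction with
    | h0 c => simp [AlgHom.commutes, Matrix.algebraMap_matrix_apply]
    | h1 w => simp [derHom]
    | hm s t hs ht =>
      obtain ⟨h1, h2, h3⟩ := hs
      obtain ⟨h1', h2', h3'⟩ := ht
      simp only [map_mul, Matrix.mul_apply, Fin.sum_univ_two, h1, h2, h3, h1', h2', h3']
      simp
    | hadd s t hs ht =>
      obtain ⟨h1, h2, h3⟩ := hs
      obtain ⟨h1', h2', h3'⟩ := ht
      simp [map_add, h1, h2, h3, h1', h2', h3']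
  obtain ⟨h1, h2, h3⟩ := h s
  ext a b
  fin_cases a <;> fin_cases b
  · exact h1
  · rfl
  · exact h2
  · exact h3

theorem GSym.der_mul (s t) :
    GSym.der hδ (s * t) = GSym.der hδ s * t + GSym.parity V k s * GSym.der hδ t := by
  change GSym.derHom k δ hδ (s * t) 0 1 = _
  rw [map_mul, derHom_eq, derHom_eq, Matrix.mul_fin_two]
  simp [add_comm]

theorem GSym.der_algebraMap (c : ℝ) : GSym.der hδ (algebraMap ℝ _ c) = 0 := by
  change GSym.derHom k δ hδ _ 0 1 = _
  rw [AlgHom.commutes, Matrix.algebraMap_matrix_apply]; simp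

/-- The derivation vanishes on scalars, so it can extend δ only because δ kills the unit. -/
theorem GSym.der_ofExt (w : ExtDual V) : GSym.der hδ (GSym.ofExt V w) = GSym.ofExt V (δ w) := by
  have h : w = w.1 • ((1, 0) : ExtDual V) + (0, w.2) := by
    refine Prod.ext ?_ ?_ <;> simp
  have h2 : δ w = δ (0, w.2) := by
    conv_lhs => rw [h]
    rw [map_add, map_smul, hδ.one, smul_zero, zero_add]
  rw [ofExt_apply, map_add, der_algebraMap, zero_add, h2]
  change GSym.derHom k δ hδ _ 0 1 = _
  rw [derHom, lift_ι]; simp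

theorem GSym.der_mem_deg {l : ℤ} {s} (hs : s ∈ GSym.deg (fun i => Module.Dual ℝ (V i)) l) :
    GSym.der hδ s ∈ GSym.deg _ (l + k) := by
  refine deg_induction (P := fun s => GSym.der hδ s ∈ GSym.deg _ (l + k)) ?_ ?_ ?_ ?_ hs
  · rintro L rfl
    clear hs
    induction L with
    | nil =>
      simp only [List.map_nil, List.prod_nil]
      rw [← map_one (algebraMap ℝ (GSym _)), der_algebraMap]
      exact zero_mem _
    | cons a L ih =>
      have e : GSym.ι (fun i => Module.Dual ℝ (V i)) (Pi.single a.1 a.2) =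
          GSym.ofExt V (0, Pi.single a.1 a.2) := by simp [ofExt_apply]
      have ha := ExtDual.isHomog_single (V := V) a.1 a.2
      have hL : (L.map fun a => GSym.ι (fun i => Module.Dual ℝ (V i)) (Pi.single a.1 a.2)).prod ∈
          GSym.deg _ (L.map fun a => (a.1.val : ℤ) + 1).sum := Submodule.subset_span ⟨L, rfl, rfl⟩
      simp only [List.map_cons, List.prod_cons, List.sum_cons]
      rw [der_mul, e, der_ofExt, parity_ofExt, ExtDual.parity_homog k ha, map_smul]
      refine add_mem ?_ ?_
      · have := mul_mem_deg (ofExt_mem_deg (hδ.deg _ _ ha)) hL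
        rwa [add_right_comm] at this
      · rw [smul_mul_assoc]
        refine Submodule.smul_mem _ _ ?_
        rw [add_assoc]
        exact mul_mem_deg (ofExt_mem_deg ha) ih
  · rw [map_zero]; exact zero_mem _
  · intro s t hs ht; rw [map_add]; exact add_mem hs ht
  · intro c s hs; rw [map_smul]; exact Submodule.smul_mem _ _ hs

end

/-! The action of `Sym 𝐕^*` on the extended dual algebra. -/

section Action

variable {μ : (∀ i, V i) →ₗ[ℝ] (∀ i, V i) ⊗[ℝ] (∀ i, V i)}

/-- Left multiplication. -/
def extMulLeft (μ : (∀ i, V i) →ₗ[ℝ] (∀ i, V i) ⊗[ℝ] (∀ i, V i)) :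
    ExtDual V →ₗ[ℝ] Module.End ℝ (ExtDual V) :=
  LinearMap.mk₂ ℝ (extMul μ) (extMul_add_left μ) (extMul_smul_left μ) (extMul_add_right μ)
    (fun c a b => extMul_smul_right μ c a b)

@[simp] theorem extMulLeft_apply (a b : ExtDual V) : extMulLeft μ a b = extMul μ a b := rfl

theorem extMulLeft_mul (hμ : IsGradedCoalgebra μ) (a b : ExtDual V) :
    extMulLeft μ a * extMulLeft μ b = extMulLeft μ (extMul μ a b) :=
  LinearMap.ext fun c => (extMul_assoc hμ a b c).symm

theorem extMul_single (i j : Fin n) (ξ : Module.Dual ℝ (V i)) (η : Module.Dual ℝ (V j)) :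
    extMul μ (0, Pi.single i ξ) (0, Pi.single j η) =
      (0, dualMul μ (Pi.single i ξ) (Pi.single j η)) := by
  simp [extMul]

/-- Left multiplication by elements of positive degree. -/
def posMulLeft (μ : (∀ i, V i) →ₗ[ℝ] (∀ i, V i) ⊗[ℝ] (∀ i, V i)) :
    (∀ i, Module.Dual ℝ (V i)) →ₗ[ℝ] Module.End ℝ (ExtDual V) :=
  extMulLeft μ ∘ₗ LinearMap.inr ℝ ℝ (∀ i, Module.Dual ℝ (V i))

theorem posMulLeft_apply (ξ : ∀ i, Module.Dual ℝ (V i)) :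
    posMulLeft μ ξ = extMulLeft μ (0, ξ) := rfl

theorem posMulLeft_swap (hμ : IsGradedCoalgebra μ) (i j : Fin n) (ξ : Module.Dual ℝ (V i))
    (η : Module.Dual ℝ (V j)) : posMulLeft μ (Pi.single i ξ) * posMulLeft μ (Pi.single j η) =
      (-1 : ℝ) ^ ((i.val + 1) * (j.val + 1)) •
        (posMulLeft μ (Pi.single j η) * posMulLeft μ (Pi.single i ξ)) := by
  rw [posMulLeft_apply, posMulLeft_apply, extMulLeft_mul hμ, extMulLeft_mul hμ, extMul_single,
    extMul_single, dualMul_single_comm hμ, ← map_smul]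
  simp

/-- The action of `Sym 𝐕^*` on `ℝ ⊕ 𝐕^*` by left multiplication. -/
def GSym.act (hμ : IsGradedCoalgebra μ) :
    GSym (fun i => Module.Dual ℝ (V i)) →ₐ[ℝ] Module.End ℝ (ExtDual V) :=
  GSym.lift (posMulLeft μ) (posMulLeft_swap hμ)

theorem GSym.act_ofExt (hμ : IsGradedCoalgebra μ) (w : ExtDual V) :
    GSym.act hμ (GSym.ofExt V w) = extMulLeft μ w := by
  rw [ofExt_apply, map_add, AlgHom.commutes, act, lift_ι]
  refine LinearMap.ext fun x => ?_
  change w.1 • x + extMul μ (0, w.2) x = extMul μ w x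
  rw [← extMul_scalar, ← extMul_add_left]
  simp

/-- The unit is neutral for `extMul`, so evaluation at it inverts `ofExt`. Together with
`act_relator` this gives a retraction that survives the passage to the quotient; injectivity of the
canonical map rests on it. -/
theorem GSym.act_ofExt_one (hμ : IsGradedCoalgebra μ) (w : ExtDual V) :
    GSym.act hμ (GSym.ofExt V w) (1, 0) = w := by
  rw [act_ofExt, extMulLeft_apply, extMul_scalar_right, one_smul]

/-- This is associativity of `extMul`; no bound on the degrees of ξ and η is needed. -/
theorem GSym.act_relator (hμ : IsGradedCoalgebra μ) (i j : Fin n) (ξ : Module.Dual ℝ (V i))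
    (η : Module.Dual ℝ (V j)) :
    GSym.act hμ (GSym.ι _ (Pi.single i ξ) * GSym.ι _ (Pi.single j η) -
      GSym.ι _ (dualMul μ (Pi.single i ξ) (Pi.single j η))) = 0 := by
  rw [map_sub, map_mul, act, lift_ι, lift_ι, lift_ι]
  simp only [posMulLeft_apply, extMulLeft_mul hμ, extMul_single, sub_self]

theorem GSym.act_homog (hμ : IsGradedCoalgebra μ) {l a : ℤ}
    {s : GSym (fun i => Module.Dual ℝ (V i))} (hs : s ∈ GSym.deg _ l) {w : ExtDual V}
    (hw : w.IsHomog a) : (GSym.act hμ s w).IsHomog (l + a) := by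
  refine deg_induction (P := fun s => (GSym.act hμ s w).IsHomog (l + a)) ?_ ?_ ?_ ?_ hs
  · rintro L rfl
    clear hs
    induction L with
    | nil => simpa using hw
    | cons b L ih =>
      have e : GSym.ι (fun i => Module.Dual ℝ (V i)) (Pi.single b.1 b.2) =
          GSym.ofExt V (0, Pi.single b.1 b.2) := by simp [ofExt_apply]
      simp only [List.map_cons, List.prod_cons, List.sum_cons, map_mul, Module.End.mul_apply, e,
        act_ofExt, extMulLeft_apply, add_assoc]
      rw [← add_assoc]
      exact extMul_homog hμ (ExtDual.isHomog_single (V := V) b.1 b.2) ih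
  · rw [map_zero]; exact ExtDual.IsHomog.zero
  · intro s t hs ht; rw [map_add]; exact hs.add ht
  · intro c s hs; rw [map_smul]; exact hs.smul c

end Action

/-! Transport along an isomorphism of coalgebras. -/

section Transport

variable {V' : Fin n → Type*} [∀ i, AddCommGroup (V' i)] [∀ i, Module ℝ (V' i)]
  (θ : ∀ i, V i →ₗ[ℝ] V' i)

/-- The total map of a graded linear map. -/
def totalMap : (∀ i, V i) →ₗ[ℝ] (∀ i, V' i) := LinearMap.pi fun i => θ i ∘ₗ LinearMap.proj i

@[simp] theorem totalMap_apply (v : ∀ i, V i) (i : Fin n) : totalMap θ v i = θ i (v i) := rfl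

theorem totalMap_single (i : Fin n) (v : V i) :
    totalMap θ (Pi.single i v) = Pi.single i (θ i v) := by
  funext j
  by_cases hj : j = i
  · subst hj; simp
  · simp [Pi.single_eq_of_ne hj]

/-- The pullback of elements of the extended dual. -/
def ExtDual.pullback : ExtDual V' →ₗ[ℝ] ExtDual V :=
  LinearMap.prodMap LinearMap.id (LinearMap.pi fun i => (θ i).dualMap ∘ₗ LinearMap.proj i)

@[simp] theorem ExtDual.pullback_fst (w : ExtDual V') : (ExtDual.pullback θ w).1 = w.1 := rfl

@[simp] theorem ExtDual.pullback_snd (w : ExtDual V') (i) :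
    (ExtDual.pullback θ w).2 i = w.2 i ∘ₗ θ i := rfl

theorem ExtDual.pullback_homog {a : ℤ} {w : ExtDual V'} (h : w.IsHomog a) :
    (ExtDual.pullback θ w).IsHomog a :=
  ⟨fun ha => h.1 ha, fun i hi => by rw [pullback_snd, h.2 i hi, LinearMap.zero_comp]⟩

theorem dualEval_comp_totalMap (ξ : ∀ i, Module.Dual ℝ (V' i)) :
    dualEval ξ ∘ₗ totalMap θ = dualEval (fun i => ξ i ∘ₗ θ i) := by
  refine LinearMap.ext fun v => ?_
  simp [dualEval_apply]

theorem dualPair_map (ξ η : ∀ i, Module.Dual ℝ (V' i)) (e : (∀ i, V i) ⊗[ℝ] (∀ i, V i)) :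
    dualPair ξ η (TensorProduct.map (totalMap θ) (totalMap θ) e) =
      dualPair (fun i => ξ i ∘ₗ θ i) (fun i => η i ∘ₗ θ i) e := by
  induction e with
  | zero => simp
  | add x y hx hy => simp only [map_add, hx, hy]
  | tmul v w =>
    simp only [TensorProduct.map_tmul, dualPair_tmul, ← dualEval_comp_totalMap,
      LinearMap.comp_apply]

theorem ExtDual.pullback_extMul {μ : (∀ i, V i) →ₗ[ℝ] (∀ i, V i) ⊗[ℝ] (∀ i, V i)}
    {μ' : (∀ i, V' i) →ₗ[ℝ] (∀ i, V' i) ⊗[ℝ] (∀ i, V' i)}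
    (h : ∀ v, TensorProduct.map (totalMap θ) (totalMap θ) (μ v) = μ' (totalMap θ v))
    (w w' : ExtDual V') : ExtDual.pullback θ (extMul μ' w w') =
      extMul μ (ExtDual.pullback θ w) (ExtDual.pullback θ w') := by
  refine Prod.ext rfl (funext fun p => ?_)
  ext v
  simp only [pullback_snd, extMul, LinearMap.comp_apply, Pi.add_apply, LinearMap.add_apply,
    Pi.smul_apply, LinearMap.smul_apply, pullback_fst, dualMul_apply, ← totalMap_single, ← h,
    dualPair_map]
  rfl

theorem GSym.map_ofExt (w : ExtDual V') :
    GSym.map (fun i => (θ i).dualMap) (GSym.ofExt V' w) = GSym.ofExt V (ExtDual.pullback θ w) := by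
  simp only [ofExt_apply, map_add, AlgHom.commutes, map_ι]
  rfl

theorem GSym.map_parity (k : ℤ) (s : GSym fun i => Module.Dual ℝ (V' i)) :
    GSym.map (fun i => (θ i).dualMap) (GSym.parity V' k s) =
      GSym.parity V k (GSym.map (fun i => (θ i).dualMap) s) := by
  rw [parity, parity, map_map, map_map]
  congr 2

end Transport

end ExtElements

/-! ### Naturality of the spaces K^μ -/

section KSpaceNaturality

variable {n : ℕ} {V V' : Fin n → Type*} [∀ i, AddCommGroup (V i)] [∀ i, Module ℝ (V i)]
  [∀ i, AddCommGroup (V' i)] [∀ i, Module ℝ (V' i)] (θ : ∀ i, V i →ₗ[ℝ] V' i)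

theorem eq_sum_comp₂ (e : (∀ i, V i) ⊗[ℝ] (∀ i, V i)) :
    e = ∑ i, ∑ j, TensorProduct.map (LinearMap.single ℝ V i) (LinearMap.single ℝ V j)
      (comp₂ V i j e) := by
  induction e with
  | zero => simp
  | add x y hx hy =>
    conv_lhs => rw [hx, hy]
    simp only [map_add, Finset.sum_add_distrib]
  | tmul v w =>
    simp only [comp₂, TensorProduct.map_tmul, LinearMap.proj_apply, LinearMap.coe_single,
      ← TensorProduct.tmul_sum, ← TensorProduct.sum_tmul, Finset.univ_sum_single]

/-- All degrees are at least one, so a component of index (i, j) with (i+1) + (j+1) = m ≤ q+1 has i,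
j < q. This shift is what allows degree q+1 of the tensor square to be controlled by the indices
below q. -/
theorem map_eq_of_mem_tensorDeg {X Y : Type*} [AddCommGroup X] [Module ℝ X] [AddCommGroup Y]
    [Module ℝ Y] {q m : ℕ} (hm : m ≤ q + 1) {f f' : (∀ i, V i) →ₗ[ℝ] X} {g g' : (∀ i, V i) →ₗ[ℝ] Y}
    (hf : ∀ i : Fin n, i.val < q → ∀ a : V i, f (Pi.single i a) = f' (Pi.single i a))
    (hg : ∀ i : Fin n, i.val < q → ∀ a : V i, g (Pi.single i a) = g' (Pi.single i a))
    {e : (∀ i, V i) ⊗[ℝ] (∀ i, V i)} (he : e ∈ tensorDeg V m) :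
    TensorProduct.map f g e = TensorProduct.map f' g' e := by
  rw [eq_sum_comp₂ e]
  simp only [map_sum]
  refine Finset.sum_congr rfl fun i _ => Finset.sum_congr rfl fun j _ => ?_
  by_cases hij : (i.val + 1) + (j.val + 1) = m
  · generalize comp₂ V i j e = c
    induction c with
    | zero => simp
    | add x y hx hy => simp only [map_add, hx, hy]
    | tmul v w =>
      simp only [TensorProduct.map_tmul, LinearMap.coe_single]
      rw [hf i (by omega), hg j (by omega)]
  · rw [he i j hij]; simp

theorem map_totalMap_mem_tensorDeg {m : ℕ} {e : (∀ i, V i) ⊗[ℝ] (∀ i, V i)}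
    (he : e ∈ tensorDeg V m) :
    TensorProduct.map (totalMap θ) (totalMap θ) e ∈ tensorDeg V' m := by
  intro i j hij
  have : comp₂ V' i j (TensorProduct.map (totalMap θ) (totalMap θ) e) =
      TensorProduct.map (θ i) (θ j) (comp₂ V i j e) := by
    rw [comp₂, comp₂, ← LinearMap.comp_apply, ← LinearMap.comp_apply, ← TensorProduct.map_comp,
      ← TensorProduct.map_comp]
    rfl
  rw [this, he i j hij, map_zero]

section

variable {X Y : Type*} [AddCommGroup X] [Module ℝ X] [AddCommGroup Y] [Module ℝ Y] (f : X →ₗ[ℝ] Y)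

/-- Functoriality of tensor powers. -/
def tpowMap (r : ℕ) : (⨂[ℝ]^r X) →ₗ[ℝ] (⨂[ℝ]^r Y) := PiTensorProduct.map fun _ => f

theorem tpowMap_tprod {r : ℕ} (x : Fin r → X) :
    tpowMap f r (PiTensorProduct.tprod ℝ x) = PiTensorProduct.tprod ℝ (fun a => f (x a)) :=
  PiTensorProduct.map_tprod _ _

theorem tpowMap_cast {r s : ℕ} (h : r = s) (x : ⨂[ℝ]^r X) :
    tpowMap f s (TensorPower.cast ℝ X h x) = TensorPower.cast ℝ Y h (tpowMap f r x) := by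
  subst h
  simp [TensorPower.cast_refl]

theorem mulEquiv_tprod {r s : ℕ} (a : Fin r → X) (b : Fin s → X) :
    TensorPower.mulEquiv (PiTensorProduct.tprod ℝ a ⊗ₜ[ℝ] PiTensorProduct.tprod ℝ b) =
      PiTensorProduct.tprod ℝ (Fin.append a b) := TensorPower.tprod_mul_tprod ℝ a b

theorem reindex_const_tprod {r : ℕ} (τ : Equiv.Perm (Fin r)) (a : Fin r → X) :
    PiTensorProduct.reindex ℝ (fun _ => X) τ (PiTensorProduct.tprod ℝ a) =
      PiTensorProduct.tprod ℝ (fun i => a (τ.symm i)) := PiTensorProduct.reindex_tprod τ a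

theorem tpowMap_mulEquiv {r s : ℕ} (e : (⨂[ℝ]^r X) ⊗[ℝ] (⨂[ℝ]^s X)) :
    tpowMap f (r + s) (TensorPower.mulEquiv e) =
      TensorPower.mulEquiv (TensorProduct.map (tpowMap f r) (tpowMap f s) e) := by
  induction e with
  | zero => simp
  | add x y hx hy => simp only [map_add, hx, hy]
  | tmul x y =>
    induction x using PiTensorProduct.induction_on with
    | smul_tprod c a =>
      induction y using PiTensorProduct.induction_on with
      | smul_tprod c' b =>
        simp only [TensorProduct.tmul_smul, ← TensorProduct.smul_tmul', map_smul,
          TensorProduct.map_tmul, tpowMap_tprod, mulEquiv_tprod]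
        congr 3
        funext i
        refine Fin.addCases (fun j => ?_) (fun j => ?_) i <;> simp
      | add u v hu hv => simp only [map_add, TensorProduct.tmul_add, hu, hv]
    | add u v hu hv => simp only [map_add, TensorProduct.add_tmul, hu, hv]

end

theorem tensorOne_apply (v : ∀ i, V i) :
    tensorOne V v = PiTensorProduct.tprod ℝ (fun _ => v) :=
  PiTensorProduct.subsingletonEquiv_symm_apply' _ _

theorem tpowMap_tensorOne (v : ∀ i, V i) :
    tpowMap (totalMap θ) 1 (tensorOne V v) = tensorOne V' (totalMap θ v) := by
  rw [tensorOne_apply, tensorOne_apply, tpowMap_tprod]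

theorem tpowMap_braiding {r : ℕ} (τ : Equiv.Perm (Fin r)) (x : ⨂[ℝ]^r (∀ i, V i)) :
    tpowMap (totalMap θ) r (braiding V τ x) = braiding V' τ (tpowMap (totalMap θ) r x) := by
  induction x using PiTensorProduct.induction_on with
  | smul_tprod c a =>
    simp only [map_smul, tpowMap_tprod, braiding, LinearMap.sum_apply, LinearMap.smul_apply, map_sum,
      LinearMap.comp_apply, LinearEquiv.coe_coe, PiTensorProduct.map_tprod]
    refine congrArg (c • ·) (Finset.sum_congr rfl fun δ _ => congrArg (koszulSign δ τ • ·) ?_)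
    rw [reindex_const_tprod, reindex_const_tprod, tpowMap_tprod]
    congr 1
    funext i
    simp [totalMap_single]
  | add u v hu hv => simp only [map_add, hu, hv]

variable {μ : (∀ i, V i) →ₗ[ℝ] (∀ i, V i) ⊗[ℝ] (∀ i, V i)}
  {μ' : (∀ i, V' i) →ₗ[ℝ] (∀ i, V' i) ⊗[ℝ] (∀ i, V' i)}

/-- Comultiplication strictly lowers the index in both factors, so the recursion for μ^k stays below
q and uses the intertwining only there. -/
theorem tpowMap_iterComul (hμ : ∀ (p : Fin n) (v : V p), μ (Pi.single p v) ∈ tensorDeg V (p.val + 1))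
    {q : ℕ} (h : ∀ p : Fin n, p.val < q → ∀ v : V p,
      TensorProduct.map (totalMap θ) (totalMap θ) (μ (Pi.single p v)) = μ' (Pi.single p (θ p v)))
    (k : ℕ) (p : Fin n) (hp : p.val < q) (v : V p) :
    tpowMap (totalMap θ) (k + 1) (iterComul μ k (Pi.single p v)) =
      iterComul μ' k (Pi.single p (θ p v)) := by
  induction k generalizing p with
  | zero => rw [iterComul, iterComul, tpowMap_tensorOne, totalMap_single]
  | succ k ih =>
    simp only [iterComul, LinearMap.comp_apply, LinearEquiv.coe_coe]
    rw [tpowMap_cast, tpowMap_mulEquiv, ← h p hp]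
    congr 2
    rw [← LinearMap.comp_apply, ← LinearMap.comp_apply (TensorProduct.map _ _), 
      ← TensorProduct.map_comp, ← TensorProduct.map_comp]
    refine map_eq_of_mem_tensorDeg (q := q) (by omega) ?_ ?_ (hμ p v)
    · intro i _ a
      simp only [LinearMap.comp_apply, tpowMap_tensorOne]
    · intro i hi a
      simp only [LinearMap.comp_apply, totalMap_single]
      exact ih i hi a

/-- In degree q+1 the conditions defining K^μ evaluate iterated comultiplications only on factors of
index < q. No relation between μ and μ' at index q itself is required, which is what makes the
induction on q possible. -/
theorem map_mem_kSpace (hμ : ∀ (p : Fin n) (v : V p), μ (Pi.single p v) ∈ tensorDeg V (p.val + 1))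
    {q : ℕ} (h : ∀ p : Fin n, p.val < q → ∀ v : V p,
      TensorProduct.map (totalMap θ) (totalMap θ) (μ (Pi.single p v)) = μ' (Pi.single p (θ p v)))
    {e : (∀ i, V i) ⊗[ℝ] (∀ i, V i)} (he : e ∈ kSpace μ ∩ tensorDeg V (q + 1)) :
    TensorProduct.map (totalMap θ) (totalMap θ) e ∈ kSpace μ' ∩ tensorDeg V' (q + 1) := by
  refine ⟨?_, map_totalMap_mem_tensorDeg θ he.2⟩
  have key : ∀ k l, iterComulTensor μ' k l (TensorProduct.map (totalMap θ) (totalMap θ) e) =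
      tpowMap (totalMap θ) _ (iterComulTensor μ k l e) := by
    intro k l
    simp only [iterComulTensor, LinearMap.comp_apply, LinearEquiv.coe_coe]
    rw [tpowMap_mulEquiv]
    congr 1
    rw [← LinearMap.comp_apply, ← LinearMap.comp_apply (TensorProduct.map _ _), 
      ← TensorProduct.map_comp, ← TensorProduct.map_comp]
    refine map_eq_of_mem_tensorDeg (q := q) le_rfl ?_ ?_ he.2
    · intro i hi a
      simp only [LinearMap.comp_apply, totalMap_single]
      exact (tpowMap_iterComul θ hμ h k i hi a).symm
    · intro i hi a
      simp only [LinearMap.comp_apply, totalMap_single]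
      exact (tpowMap_iterComul θ hμ h l i hi a).symm
  intro r k l k' l' hr hr' τ τ'
  rw [key, key, ← tpowMap_cast, ← tpowMap_cast, ← tpowMap_braiding, ← tpowMap_braiding,
    he.1 r k l k' l' hr hr' τ τ']

end KSpaceNaturality

/-! ### Hadamard's lemma with a smooth remainder -/

section Hadamard

variable {H : Type*} [NormedAddCommGroup H] [InnerProductSpace ℝ H] [FiniteDimensional ℝ H]

/-- Hadamard's lemma. -/
theorem exists_hadamard {f : H → ℝ} (hf : ContDiff ℝ ∞ f) (x₀ : H) :
    ∃ G : H → (H →L[ℝ] ℝ), ContDiff ℝ ∞ G ∧ ∀ y, f y = f x₀ + G y (y - x₀) := by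
  -- The remainder ∫₀¹ Df(x₀ + t(y − x₀)) dt is written as the convolution at 0 of the indicator of
  -- [0, 1] with g y, so that smoothness in y follows from smooth dependence of convolutions on
  -- parameters. The cutoff χ provides compact support and is 1 on [−2, 2], in particular at the
  -- points s = −t that occur.
  let χ : ContDiffBump (0 : ℝ) := ⟨2, 3, by norm_num, by norm_num⟩
  let g : H → ℝ → (H →L[ℝ] ℝ) := fun p s => χ s • fderiv ℝ f (x₀ - s • (p - x₀))
  let ind : ℝ → ℝ := Set.indicator (Set.Icc 0 1) 1
  have hfd : ContDiff ℝ ∞ (fderiv ℝ f) := hf.fderiv_right (by simp)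
  have hg : ContDiff ℝ ∞ (Function.uncurry g) := by
    refine ContDiff.smul (χ.contDiff.comp contDiff_snd) (hfd.comp ?_)
    fun_prop
  have hloc : MeasureTheory.LocallyIntegrable ind MeasureTheory.volume := by
    refine (MeasureTheory.IntegrableOn.integrable_indicator ?_
      measurableSet_Icc).locallyIntegrable
    exact (continuous_const.integrableOn_Icc (μ := MeasureTheory.volume) (a := (0 : ℝ)) (b := 1))
  refine ⟨fun y => MeasureTheory.convolution ind (g y) (ContinuousLinearMap.lsmul ℝ ℝ)
    MeasureTheory.volume 0, ?_, fun y => ?_⟩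
  · rw [← contDiffOn_univ]
    refine MeasureTheory.contDiffOn_convolution_right_with_param_comp (n := ⊤) (P := H) (G := ℝ)
      (ContinuousLinearMap.lsmul ℝ ℝ) (v := fun _ => (0 : ℝ)) contDiffOn_const isOpen_univ
      (k := tsupport χ) χ.hasCompactSupport ?_ hloc (hg.contDiffOn)
    intro p s _ hs
    have : χ s = 0 := image_eq_zero_of_notMem_tsupport hs
    simp [g, this]
  · have h1 : MeasureTheory.convolution ind (g y) (ContinuousLinearMap.lsmul ℝ ℝ)
        MeasureTheory.volume 0 = ∫ t in (0 : ℝ)..1, fderiv ℝ f (x₀ + t • (y - x₀)) := by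
      rw [MeasureTheory.convolution, intervalIntegral.integral_of_le zero_le_one,
        ← MeasureTheory.integral_Icc_eq_integral_Ioc,
        ← MeasureTheory.integral_indicator measurableSet_Icc]
      congr 1
      funext t
      by_cases ht : t ∈ Set.Icc (0 : ℝ) 1
      · have hχ : χ (0 - t) = 1 := by
          refine χ.one_of_mem_closedBall ?_
          change dist (0 - t) 0 ≤ 2
          rw [dist_zero_right, Real.norm_eq_abs, zero_sub, abs_neg, abs_of_nonneg ht.1]
          linarith [ht.2]
        rw [zero_sub] at hχ
        simp [ind, g, ht, hχ]
      · simp [ind, ht]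
    have hcont : Continuous fun t : ℝ => fderiv ℝ f (x₀ + t • (y - x₀)) :=
      hfd.continuous.comp (by fun_prop)
    have h2 : ∫ t in (0 : ℝ)..1, fderiv ℝ f (x₀ + t • (y - x₀)) (y - x₀) =
        f (x₀ + (1 : ℝ) • (y - x₀)) - f (x₀ + (0 : ℝ) • (y - x₀)) := by
      refine intervalIntegral.integral_eq_sub_of_hasDerivAt
        (f := fun t : ℝ => f (x₀ + t • (y - x₀))) (fun t _ => ?_)
        ((hcont.clm_apply continuous_const).intervalIntegrable _ _)
      have h3 : HasDerivAt (fun t : ℝ => x₀ + t • (y - x₀)) ((1 : ℝ) • (y - x₀)) t :=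
        ((hasDerivAt_id t).smul_const _).const_add _
      have h4 := ((hf.differentiable (by simp)) (x₀ + t • (y - x₀))).hasFDerivAt.comp_hasDerivAt t h3
      simpa [Function.comp_def] using h4
    change f y = f x₀ + (MeasureTheory.convolution ind (g y) (ContinuousLinearMap.lsmul ℝ ℝ)
        MeasureTheory.volume 0) (y - x₀)
    rw [h1]
    have h5 : (∫ t in (0 : ℝ)..1, fderiv ℝ f (x₀ + t • (y - x₀))) (y - x₀) =
        ∫ t in (0 : ℝ)..1, fderiv ℝ f (x₀ + t • (y - x₀)) (y - x₀) :=
      ContinuousLinearMap.intervalIntegral_apply (hcont.intervalIntegrable _ _) _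
    rw [h5, h2]
    simp

end Hadamard

/-! ### Directional derivatives of functions, extension by zero, bump functions -/

section Functions

variable {d : ℕ} {M : Type*} [TopologicalSpace M] [ChartedSpace (EuclideanSpace ℝ (Fin d)) M]

/-- The derivative of a function along a vector at `x`, in the preferred chart at `x`. -/
def vderiv (d : ℕ) [ChartedSpace (EuclideanSpace ℝ (Fin d)) M] (x : M)
    (v : EuclideanSpace ℝ (Fin d)) (f : M → ℝ) : ℝ :=
  fderiv ℝ (f ∘ (extChartAt (𝓡 d) x).symm) (extChartAt (𝓡 d) x x) v

/-- Smoothness at a point. -/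
abbrev SmoothAt (d : ℕ) [ChartedSpace (EuclideanSpace ℝ (Fin d)) M] (f : M → ℝ) (x : M) : Prop :=
  ContMDiffAt (𝓡 d) 𝓘(ℝ, ℝ) ∞ f x

theorem SmoothAt.contDiffAt {f : M → ℝ} {x : M} (hf : SmoothAt d f x) :
    ContDiffAt ℝ ∞ (f ∘ (extChartAt (𝓡 d) x).symm) (extChartAt (𝓡 d) x x) := by
  have h := (contMDiffAt_iff.mp hf).2
  rwa [ModelWithCorners.range_eq_univ, contDiffWithinAt_univ] at h

theorem SmoothAt.differentiableAt {f : M → ℝ} {x : M} (hf : SmoothAt d f x) :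
    DifferentiableAt ℝ (f ∘ (extChartAt (𝓡 d) x).symm) (extChartAt (𝓡 d) x x) :=
  hf.contDiffAt.differentiableAt (by simp)

theorem vderiv_congr {f g : M → ℝ} {x : M} (h : f =ᶠ[𝓝 x] g) (v) : vderiv d x v f = vderiv d x v g := by
  have h1 : Filter.Tendsto (extChartAt (𝓡 d) x).symm (𝓝 (extChartAt (𝓡 d) x x)) (𝓝 x) := by
    have := continuousAt_extChartAt_symm (I := 𝓡 d) x
    rwa [ContinuousAt, extChartAt_to_inv] at this
  rw [vderiv, vderiv, Filter.EventuallyEq.fderiv_eq (h.comp_tendsto h1)]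

@[simp] theorem vderiv_const (x : M) (v) (c : ℝ) : vderiv d x v (fun _ => c) = 0 := by
  have : ((fun _ => c) ∘ (extChartAt (𝓡 d) x).symm) = fun _ => c := rfl
  rw [vderiv, this]; simp

theorem vderiv_add {f g : M → ℝ} {x : M} (hf : SmoothAt d f x) (hg : SmoothAt d g x) (v) :
    vderiv d x v (fun y => f y + g y) = vderiv d x v f + vderiv d x v g := by
  have := fderiv_add hf.differentiableAt hg.differentiableAt
  exact DFunLike.congr_fun this v

theorem vderiv_mul {f g : M → ℝ} {x : M} (hf : SmoothAt d f x) (hg : SmoothAt d g x) (v) :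
    vderiv d x v (fun y => f y * g y) = vderiv d x v f * g x + f x * vderiv d x v g := by
  have := fderiv_mul hf.differentiableAt hg.differentiableAt
  refine (DFunLike.congr_fun this v).trans ?_
  simp [vderiv]
  ring

theorem vderiv_const_mul {g : M → ℝ} {x : M} (c : ℝ) (hg : SmoothAt d g x) (v) :
    vderiv d x v (fun y => c * g y) = c * vderiv d x v g := by
  rw [vderiv_mul contMDiffAt_const hg, vderiv_const, zero_mul, zero_add]

theorem SmoothAt.sum {ι : Type*} (s : Finset ι) {f : ι → M → ℝ} {x : M}
    (hf : ∀ i ∈ s, SmoothAt d (f i) x) : SmoothAt d (fun y => ∑ i ∈ s, f i y) x := by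
  classical
  induction s using Finset.induction_on with
  | empty => simpa using contMDiffAt_const
  | insert a s ha ih =>
    simp only [Finset.sum_insert ha]
    exact (hf a (by simp)).add (ih fun i hi => hf i (by simp [hi]))

theorem vderiv_sum {ι : Type*} (s : Finset ι) {f : ι → M → ℝ} {x : M}
    (hf : ∀ i ∈ s, SmoothAt d (f i) x) (v) :
    vderiv d x v (fun y => ∑ i ∈ s, f i y) = ∑ i ∈ s, vderiv d x v (f i) := by
  classical
  induction s using Finset.induction_on with
  | empty => simp
  | insert a s ha ih =>
    simp only [Finset.sum_insert ha]
    rw [vderiv_add (hf a (by simp)) (SmoothAt.sum s fun i hi => hf i (by simp [hi])),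
      ih fun i hi => hf i (by simp [hi])]

@[simp] theorem vderiv_vec_zero (x : M) (f : M → ℝ) : vderiv d x 0 f = 0 := map_zero _

theorem vderiv_vec_add (x : M) (v w) (f : M → ℝ) :
    vderiv d x (v + w) f = vderiv d x v f + vderiv d x w f := map_add _ _ _

theorem vderiv_vec_smul (x : M) (c : ℝ) (v) (f : M → ℝ) :
    vderiv d x (c • v) f = c * vderiv d x v f := map_smul _ _ _

/-- Extension by zero of a function on an open subset. -/
def ext0 {G : Type*} [Zero G] {U : Opens M} (f : U → G) : M → G :=
  Function.extend Subtype.val f 0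

@[simp] theorem ext0_coe {G : Type*} [Zero G] {U : Opens M} (f : U → G) (x : U) :
    ext0 f (x : M) = f x := Subtype.val_injective.extend_apply _ _ _

theorem ext0_mk {G : Type*} [Zero G] {U : Opens M} (f : U → G) {x : M} (h : x ∈ U) :
    ext0 f x = f ⟨x, h⟩ := ext0_coe f ⟨x, h⟩

theorem smoothAt_ext0_iff {U : Opens M} {f : U → ℝ} {x : U} :
    SmoothAt d (ext0 f) (x : M) ↔ ContMDiffAt (𝓡 d) 𝓘(ℝ, ℝ) ∞ f x := by
  rw [SmoothAt, ← contMDiffAt_subtype_iff]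
  simp only [ext0_coe]

theorem contMDiff_iff_ext0 {U : Opens M} {f : U → ℝ} :
    ContMDiff (𝓡 d) 𝓘(ℝ, ℝ) ∞ f ↔ ∀ x : U, SmoothAt d (ext0 f) (x : M) :=
  forall_congr' fun _ => smoothAt_ext0_iff.symm

theorem Opens.eventually_mem {U : Opens M} {x : M} (h : x ∈ U) : ∀ᶠ y in 𝓝 x, y ∈ U :=
  U.isOpen.mem_nhds h

theorem ext0_incl_eventuallyEq {G : Type*} [Zero G] {U V : Opens M} (h : V ≤ U) (f : U → G) {x : M}
    (hx : x ∈ V) : ext0 (fun y : V => f (incl h y)) =ᶠ[𝓝 x] ext0 f := by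
  filter_upwards [Opens.eventually_mem hx] with y hy
  rw [ext0_mk _ hy, ext0_mk _ (h hy)]; rfl

theorem Smooth.smoothAt {U : Opens M} (f : Smooth d U) (x : U) : SmoothAt d (ext0 f) (x : M) :=
  contMDiff_iff_ext0.mp f.contMDiff x

/-- The chart of an open subset at x is the restriction of the chart of M, so both sides
differentiate the same germ. Pointwise computations can then take place on M, with one model of
tangent vectors for all open sets. -/
theorem dirDeriv_eq_vderiv {U : Opens M} (f : Smooth d U) (x : U) (v : EuclideanSpace ℝ (Fin d)) :
    dirDeriv f x v = vderiv d (x : M) v (ext0 f) := by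
  have hmd : MDifferentiableAt (𝓡 d) 𝓘(ℝ, ℝ) f x := f.contMDiff.contMDiffAt.mdifferentiableAt (by simp)
  have h1 : dirDeriv f x v = fderivWithin ℝ (writtenInExtChartAt (𝓡 d) 𝓘(ℝ, ℝ) x f)
      (Set.range (𝓡 d)) (extChartAt (𝓡 d) x x) v := by
    exact DFunLike.congr_fun hmd.mfderiv v
  rw [h1, ModelWithCorners.range_eq_univ, fderivWithin_univ, vderiv]
  have h2 : extChartAt (𝓡 d) x x = extChartAt (𝓡 d) (x : M) (x : M) := by
    simp [extChartAt, Opens.chartAt_eq]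
  rw [h2]
  congr 1
  refine Filter.EventuallyEq.fderiv_eq ?_
  have h3 := TopologicalSpace.Opens.chartAt_subtype_val_symm_eventuallyEq U (H := EuclideanSpace ℝ (Fin d))
    (x := x)
  have h4 : chartAt (EuclideanSpace ℝ (Fin d)) (x : M) (x : M) =
    extChartAt (𝓡 d) (x : M) (x : M) := by simp [extChartAt]
  rw [h4] at h3
  filter_upwards [h3] with y hy
  simp only [writtenInExtChartAt, Function.comp, extChartAt, mfld_simps] at hy ⊢
  rw [hy, ext0_coe]
  rfl

/-- Restriction of smooth functions. -/
def Smooth.res {U V : Opens M} (h : V ≤ U) (f : Smooth d U) : Smooth d V :=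
  ⟨fun x => f (incl h x), f.contMDiff.comp (contMDiff_incl h)⟩

/-- Restriction of a global smooth function. -/
def Smooth.ofGlobal (U : Opens M) (ρ : M → ℝ) (hρ : ContMDiff (𝓡 d) 𝓘(ℝ, ℝ) ∞ ρ) : Smooth d U :=
  ⟨fun x => ρ x, hρ.comp contMDiff_subtype_val⟩

@[simp] theorem Smooth.ofGlobal_apply (U : Opens M) (ρ : M → ℝ) (hρ) (x : U) :
    Smooth.ofGlobal (d := d) U ρ hρ x = ρ x := rfl

theorem exists_bump [T2Space M] [IsManifold (𝓡 d) ∞ M] {V : Opens M} {x : M} (hx : x ∈ V) :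
    ∃ ρ : M → ℝ, ContMDiff (𝓡 d) 𝓘(ℝ, ℝ) ∞ ρ ∧ (∀ᶠ y in 𝓝 x, ρ y = 1) ∧
      tsupport ρ ⊆ (V : Set M) := by
  obtain ⟨f, -, hf⟩ := (SmoothBumpFunction.nhds_basis_tsupport (I := 𝓡 d) x).mem_iff.mp
    (V.isOpen.mem_nhds hx)
  exact ⟨f, f.contMDiff, f.eventuallyEq_one, hf⟩

end Functions

/-! ### Derivations of smooth functions are vector fields -/

section PointDerivations

variable {d : ℕ} {M : Type*} [TopologicalSpace M] [ChartedSpace (EuclideanSpace ℝ (Fin d)) M]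

theorem smoothAt_mul_of_tsupport {ρ g : M → ℝ} (hρ : ContMDiff (𝓡 d) 𝓘(ℝ, ℝ) ∞ ρ)
    (hg : ∀ x ∈ tsupport ρ, SmoothAt d g x) : ContMDiff (𝓡 d) 𝓘(ℝ, ℝ) ∞ (fun y => ρ y * g y) := by
  intro x
  by_cases hx : x ∈ tsupport ρ
  · exact (hρ x).mul (hg x hx)
  · refine (contMDiffAt_const (c := (0 : ℝ))).congr_of_eventuallyEq ?_
    filter_upwards [(isClosed_tsupport ρ).isOpen_compl.mem_nhds hx] with y hy
    rw [image_eq_zero_of_notMem_tsupport hy, zero_mul]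

theorem SmoothAt.of_chart [IsManifold (𝓡 d) ∞ M] {x₀ x : M}
    (hx : x ∈ (chartAt (EuclideanSpace ℝ (Fin d)) x₀).source)
    {G : EuclideanSpace ℝ (Fin d) → ℝ} (hG : ContDiff ℝ ∞ G) :
    SmoothAt d (fun y => G (extChartAt (𝓡 d) x₀ y)) x :=
  hG.contMDiff.contMDiffAt.comp x (contMDiffAt_extChartAt' hx)

variable [T2Space M] [IsManifold (𝓡 d) ∞ M]

/-- A smooth function with support in the open set `V`, equal to `1` near `x`. -/
structure IsBump (d : ℕ) [ChartedSpace (EuclideanSpace ℝ (Fin d)) M] (x : M) (V : Opens M)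
    (ρ : M → ℝ) : Prop where
  smooth : ContMDiff (𝓡 d) 𝓘(ℝ, ℝ) ∞ ρ
  one : ∀ᶠ y in 𝓝 x, ρ y = 1
  supp : tsupport ρ ⊆ (V : Set M)

theorem exists_isBump {V : Opens M} {x : M} (hx : x ∈ V) : ∃ ρ, IsBump d x V ρ :=
  let ⟨ρ, h1, h2, h3⟩ := exists_bump (d := d) hx
  ⟨ρ, h1, h2, h3⟩

theorem IsBump.apply_self {x : M} {V : Opens M} {ρ : M → ℝ} (h : IsBump d x V ρ) : ρ x = 1 :=
  h.one.self_of_nhds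

theorem IsBump.eq_zero {x : M} {V : Opens M} {ρ : M → ℝ} (h : IsBump d x V ρ) {y : M}
    (hy : y ∉ V) : ρ y = 0 :=
  image_eq_zero_of_notMem_tsupport fun h' => hy (h.supp h')

/-- Multiplying by a bump function in the chart produces a function that is smooth on the whole
Euclidean space, as Hadamard's lemma requires. -/
theorem exists_contDiff_localization {U : Opens M} (f : Smooth d U) (x : U) :
    ∃ F : EuclideanSpace ℝ (Fin d) → ℝ, ContDiff ℝ ∞ F ∧
      F =ᶠ[𝓝 (extChartAt (𝓡 d) (x : M) x)] ext0 f ∘ (extChartAt (𝓡 d) (x : M)).symm := by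
  have hT : IsOpen ((extChartAt (𝓡 d) (x : M)).target ∩
      (extChartAt (𝓡 d) (x : M)).symm ⁻¹' (U : Set M)) :=
    (continuousOn_extChartAt_symm (x : M)).isOpen_inter_preimage
      (isOpen_extChartAt_target (x : M)) U.isOpen
  have hxT : extChartAt (𝓡 d) (x : M) x ∈ ((extChartAt (𝓡 d) (x : M)).target ∩
      (extChartAt (𝓡 d) (x : M)).symm ⁻¹' (U : Set M)) :=
    ⟨mem_extChartAt_target (x : M), by
      rw [Set.mem_preimage, extChartAt_to_inv]; exact x.2⟩
  obtain ⟨χ, h1, h2, h3⟩ := exists_bump (d := d) (M := EuclideanSpace ℝ (Fin d)) (V := ⟨_, hT⟩) hxT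
  refine ⟨fun y => χ y * (ext0 f ∘ (extChartAt (𝓡 d) (x : M)).symm) y, ?_, ?_⟩
  · rw [← contMDiff_iff_contDiff]
    refine smoothAt_mul_of_tsupport h1 fun y hy => ?_
    obtain ⟨hy1, hy2⟩ := h3 hy
    have e1 : ContMDiffAt 𝓘(ℝ, EuclideanSpace ℝ (Fin d)) (𝓡 d) ∞
        (extChartAt (𝓡 d) (x : M)).symm y :=
      (contMDiffOn_extChartAt_symm (x : M)).contMDiffAt
        ((isOpen_extChartAt_target (x : M)).mem_nhds hy1)
    exact ContMDiffAt.comp y (f.smoothAt ⟨_, hy2⟩) e1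
  · filter_upwards [h2] with y hy
    rw [hy, one_mul]

/-- The algebraic tangent vectors are the geometric ones. -/
theorem exists_vderiv_eq {U : Opens M} (x : U) (δ : Smooth d U →ₗ[ℝ] ℝ)
    (hδ : ∀ f g, δ (f * g) = δ f * g x + f x * δ g) :
    ∃ v : EuclideanSpace ℝ (Fin d), ∀ f, δ f = vderiv d (x : M) v (ext0 f) := by
  classical
  set φ := extChartAt (𝓡 d) (x : M) with hφ
  obtain ⟨ρ, hρ⟩ := exists_isBump (d := d)
    (V := U ⊓ ⟨_, (chartAt (EuclideanSpace ℝ (Fin d)) (x : M)).open_source⟩)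
    (x := (x : M)) ⟨x.2, mem_chart_source _ _⟩
  have hsupp : ∀ y ∈ tsupport ρ, y ∈ (chartAt (EuclideanSpace ℝ (Fin d)) (x : M)).source :=
    fun y hy => (hρ.supp hy).2
  have h1 : δ 1 = 0 := by
    have := hδ 1 1
    simp at this
    exact this
  -- The functional δ only sees germs: for σ equal to 1 at x and supported where f = g, the product
  -- σ(f − g) is zero, while the Leibniz rule evaluates δ on it to δ(f − g).
  have hloc : ∀ f g : Smooth d U, (∀ᶠ y in 𝓝 (x : M), ext0 f y = ext0 g y) → δ f = δ g := by
    intro f g hfg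
    obtain ⟨O, hO, hOo, hxO⟩ := eventually_nhds_iff.mp hfg
    obtain ⟨σ, hσ⟩ := exists_isBump (d := d) (V := ⟨O, hOo⟩) hxO
    have h0 : Smooth.ofGlobal U σ hσ.smooth * (f - g) = 0 := by
      ext y
      change σ y * (f y - g y) = 0
      by_cases hy : (y : M) ∈ O
      · have := hO y hy
        rw [ext0_coe, ext0_coe] at this
        rw [this, sub_self, mul_zero]
      · rw [hσ.eq_zero hy, zero_mul]
    have h2 := hδ (Smooth.ofGlobal U σ hσ.smooth) (f - g)
    have h3 : (f - g) x = 0 := by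
      have := hfg.self_of_nhds
      rw [ext0_coe, ext0_coe] at this
      change f x - g x = 0
      rw [this, sub_self]
    rw [h0, map_zero, h3, mul_zero, zero_add, Smooth.ofGlobal_apply, hσ.apply_self, one_mul,
      map_sub] at h2
    linarith
  -- These are cut-off chart coordinates centred at x. Hadamard's lemma writes f near x as f(x) + Σ
  -- cᵢ gᵢ with cᵢ(x) = 0 and gᵢ(x) = ∂ᵢf(x), so δ f = Σ δ(cᵢ) ∂ᵢf(x) and the vector must have the
  -- components δ(cᵢ).
  let c : Fin d → Smooth d U := fun i => Smooth.ofGlobal U (fun y => ρ y * (φ y i - φ x i))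
    (smoothAt_mul_of_tsupport hρ.smooth fun y hy => SmoothAt.of_chart (hsupp y hy)
      (G := fun z => z i - φ x i) (by fun_prop))
  refine ⟨WithLp.toLp 2 fun i => δ (c i), fun f => ?_⟩
  obtain ⟨F, hF, hFf⟩ := exists_contDiff_localization f x
  obtain ⟨G, hG, hFG⟩ := exists_hadamard hF (φ x)
  let g : Fin d → Smooth d U := fun i => Smooth.ofGlobal U
    (fun y => ρ y * (G (φ y) (EuclideanSpace.single i 1)))
    (smoothAt_mul_of_tsupport hρ.smooth fun y hy => SmoothAt.of_chart (hsupp y hy)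
      (G := fun z => G z (EuclideanSpace.single i 1)) (hG.clm_apply contDiff_const))
  have hvec : ∀ z : EuclideanSpace ℝ (Fin d), z = ∑ i, z i • EuclideanSpace.single i (1 : ℝ) := by
    intro z
    ext j
    simp [Pi.single_apply]
  have hf : δ f = δ (algebraMap ℝ _ (f x) + ∑ i, c i * g i) := by
    refine hloc _ _ ?_
    have hsrc : ∀ᶠ y in 𝓝 (x : M), y ∈ φ.source := extChartAt_source_mem_nhds (x : M)
    have hF' : ∀ᶠ y in 𝓝 (x : M), F (φ y) = ext0 f (φ.symm (φ y)) :=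
      (continuousAt_extChartAt (x : M)).eventually hFf
    filter_upwards [hρ.one, hsrc, hF', Opens.eventually_mem x.2] with y hy1 hy2 hy3 hyU
    rw [φ.left_inv hy2] at hy3
    rw [← hy3, ext0_mk _ hyU, hFG, hFf.self_of_nhds]
    have e1 : (algebraMap ℝ (Smooth d U) (f x) + ∑ i, c i * g i) ⟨y, hyU⟩ =
        f x + ∑ i, c i ⟨y, hyU⟩ * g i ⟨y, hyU⟩ := by
      rw [ContMDiffMap.coe_add, Pi.add_apply]
      congr 1
      have := map_sum (ContMDiffMap.evalRingHom (I := 𝓡 d) (I' := 𝓘(ℝ, ℝ)) (n := ∞) (R := ℝ)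
        (⟨y, hyU⟩ : U)) (fun i => c i * g i) Finset.univ
      exact this
    rw [e1]
    congr 1
    · rw [Function.comp_apply, φ.left_inv (mem_extChartAt_source (x : M)), ext0_coe]
    · conv_lhs => rw [hvec (φ y - φ x)]
      rw [map_sum]
      refine Finset.sum_congr rfl fun i _ => ?_
      simp [c, g, hy1]
  have hcx : ∀ i, c i x = 0 := fun i => by simp [c]
  have hgx : ∀ i, g i x = fderiv ℝ F (φ x) (EuclideanSpace.single i 1) := by
    intro i
    have hd : HasFDerivAt F (G (φ x)) (φ x) := by
      have h1 := ((hG.differentiable (by simp)) (φ x)).hasFDerivAt.clm_apply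
        ((hasFDerivAt_id (φ x)).sub_const (φ x))
      have h2 := h1.const_add (F (φ x))
      have h3 : (fun y => F (φ x) + G y (id y - φ x)) = F := by
        funext y; exact (hFG y).symm
      rw [h3] at h2
      refine h2.congr_fderiv ?_
      ext z
      simp
    rw [hd.fderiv]
    simp [g, hρ.apply_self]
  rw [hf, map_add, Algebra.algebraMap_eq_smul_one, map_smul, h1, smul_zero, zero_add, map_sum,
    vderiv, ← hFf.fderiv_eq]
  conv_rhs => rw [hvec (WithLp.toLp 2 fun i => δ (c i)), map_sum]
  refine Finset.sum_congr rfl fun i _ => ?_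
  rw [hδ, hcx, zero_mul, add_zero, hgx, map_smul, smul_eq_mul]

/-- Derivations of the algebra of smooth functions are smooth vector fields. -/
theorem exists_vectorField {U : Opens M} (D : Smooth d U →ₗ[ℝ] Smooth d U)
    (hD : ∀ f g, D (f * g) = D f * g + f * D g) :
    ∃ X : Cₛ^∞⟮𝓡 d; EuclideanSpace ℝ (Fin d), (TangentSpace (𝓡 d) : U → Type _)⟯,
      ∀ (f : Smooth d U) (x : U), D f x = dirDeriv f x (X x) := by
  have h1 : ∀ x : U, ∃ v : EuclideanSpace ℝ (Fin d), ∀ f, D f x = vderiv d (x : M) v (ext0 f) := by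
    intro x
    refine exists_vderiv_eq x ⟨⟨fun f => D f x, fun f g => ?_⟩, fun c f => ?_⟩ fun f g => ?_
    · rw [map_add]; rfl
    · exact congrArg (fun g : Smooth d U => g x) (map_smul D c f)
    · change D (f * g) x = _
      rw [hD]; rfl
  choose X hX using h1
  refine ⟨⟨fun x => X x, fun x₀ => ?_⟩, fun f x => (hX x f).trans (dirDeriv_eq_vderiv f x (X x)).symm⟩
  refine (Bundle.contMDiffAt_section (E := (TangentSpace (𝓡 d) : U → Type _))
    (F := EuclideanSpace ℝ (Fin d)) (s := X) x₀).mpr ?_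
  obtain ⟨ρ, hρ⟩ := exists_isBump (d := d)
    (V := U ⊓ ⟨_, (chartAt (EuclideanSpace ℝ (Fin d)) (x₀ : M)).open_source⟩)
    (x := (x₀ : M)) ⟨x₀.2, mem_chart_source _ _⟩
  -- In the trivialization at x₀ the components of X near x₀ are D applied to the cut-off
  -- coordinates of one fixed chart, and these are smooth functions.
  let c : Fin d → Smooth d U := fun i => Smooth.ofGlobal U
    (fun y => ρ y * (extChartAt (𝓡 d) (x₀ : M) y i))
    (smoothAt_mul_of_tsupport hρ.smooth fun y hy => SmoothAt.of_chart (hρ.supp hy).2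
      (G := fun z => z i) (by fun_prop))
  have key : ∀ᶠ x : U in 𝓝 x₀,
      (trivializationAt (EuclideanSpace ℝ (Fin d)) (TangentSpace (𝓡 d)) x₀ ⟨x, X x⟩).2 =
        (WithLp.toLp 2 fun i => D (c i) x : EuclideanSpace ℝ (Fin d)) := by
    have hs : ∀ᶠ x : U in 𝓝 x₀, x ∈ (chartAt (EuclideanSpace ℝ (Fin d)) x₀).source :=
      (chartAt (EuclideanSpace ℝ (Fin d)) x₀).open_source.mem_nhds (mem_chart_source _ _)
    -- The differential at x sees a neighbourhood of x, so ρ = 1 is needed near every x close to x₀.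
    have hone : ∀ᶠ x : U in 𝓝 x₀, ∀ᶠ y : U in 𝓝 x, ρ y = 1 :=
      eventually_eventually_nhds.mpr (continuous_subtype_val.continuousAt.eventually hρ.one)
    filter_upwards [hs, hone] with x hx hx1
    have e1 : (trivializationAt (EuclideanSpace ℝ (Fin d)) (TangentSpace (𝓡 d)) x₀ ⟨x, X x⟩).2 =
        mfderiv (𝓡 d) 𝓘(ℝ, EuclideanSpace ℝ (Fin d)) (extChartAt (𝓡 d) x₀) x (X x) := by
      have hb : x ∈ (trivializationAt (EuclideanSpace ℝ (Fin d))
          (TangentSpace (𝓡 d) : U → Type _) x₀).baseSet := by simpa using hx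
      exact (congrFun (Trivialization.coe_linearMapAt_of_mem (R := ℝ) _ hb) (X x)).symm.trans
        (DFunLike.congr_fun (TangentBundle.continuousLinearMapAt_trivializationAt (I := 𝓡 d) hx)
          (X x))
    rw [e1]
    ext i
    have e2 : HasMFDerivAt (𝓡 d) 𝓘(ℝ, ℝ) (fun y => (extChartAt (𝓡 d) x₀ y) i) x
        ((EuclideanSpace.proj i : EuclideanSpace ℝ (Fin d) →L[ℝ] ℝ).comp
          (mfderiv (𝓡 d) 𝓘(ℝ, EuclideanSpace ℝ (Fin d)) (extChartAt (𝓡 d) x₀) x)) :=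
      ((EuclideanSpace.proj i : EuclideanSpace ℝ (Fin d) →L[ℝ] ℝ).hasMFDerivAt).comp x
        (mdifferentiableAt_extChartAt hx).hasMFDerivAt
    have e3 : (c i : U → ℝ) =ᶠ[𝓝 x] fun y => (extChartAt (𝓡 d) x₀ y) i := by
      filter_upwards [hx1] with y hy
      change ρ y * _ = _
      rw [hy, one_mul]
      rfl
    have e4 := (e2.congr_of_eventuallyEq e3).mfderiv
    have e5 : D (c i) x = dirDeriv (c i) x (X x) := by rw [hX, dirDeriv_eq_vderiv]
    change _ = D (c i) x
    rw [e5]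
    exact (DFunLike.congr_fun e4 (X x)).symm
  refine ContMDiffAt.congr_of_eventuallyEq ?_ key
  have h2 : ContMDiffAt (𝓡 d) 𝓘(ℝ, Fin d → ℝ) ∞ (fun x : U => fun i => D (c i) x) x₀ :=
    contMDiffAt_pi_space.mpr fun i => (D (c i)).contMDiff.contMDiffAt
  exact ((PiLp.continuousLinearEquiv 2 ℝ (fun _ : Fin d => ℝ)).symm.contDiff.contMDiff).contMDiffAt.comp
    x₀ h2

theorem exists_vectorField_frame (W : Opens M) {x₀ : M} (hx₀ : x₀ ∈ W) :
    ∃ V : Opens M, V ≤ W ∧ x₀ ∈ V ∧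
      ∃ X : Fin d → Cₛ^∞⟮𝓡 d; EuclideanSpace ℝ (Fin d), (TangentSpace (𝓡 d) : V → Type _)⟯,
        ∀ x : V, ∃ b : Module.Basis (Fin d) ℝ (EuclideanSpace ℝ (Fin d)), ∀ i, X i x = b i := by
  let V : Opens M := W ⊓ ⟨_, (chartAt (EuclideanSpace ℝ (Fin d)) x₀).open_source⟩
  have hV : x₀ ∈ V := ⟨hx₀, mem_chart_source _ _⟩
  let e := trivializationAt (EuclideanSpace ℝ (Fin d)) (TangentSpace (𝓡 d)) (⟨x₀, hV⟩ : V)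
  have he : ∀ x : V, x ∈ e.baseSet := by
    intro x
    have h := x.2.2
    simp only [e, TangentBundle.trivializationAt_baseSet, Opens.chartAt_eq,
      OpenPartialHomeomorph.subtypeRestr_source]
    exact h
  let b := (EuclideanSpace.basisFun (Fin d) ℝ).toBasis
  refine ⟨V, inf_le_left, hV, fun i => ⟨e.localFrame b i, fun x =>
    contMDiffAt_localFrame_of_mem ∞ e b i (he x)⟩, fun x => ⟨e.basisAt b (he x), fun i => ?_⟩⟩
  exact e.localFrame_apply_of_mem_baseSet b (he x)

end PointDerivations

/-! ### Comparing two surjections onto the same space -/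

section LinearAlgebra

variable {P K : Type*} [AddCommGroup P] [Module ℝ P] [AddCommGroup K] [Module ℝ K]

/-- The splitting of a surjection given by a right inverse. -/
def splitEquiv (N : P →ₗ[ℝ] K) (s : K →ₗ[ℝ] P) (h : N ∘ₗ s = LinearMap.id) :
    P ≃ₗ[ℝ] LinearMap.ker N × K where
  toFun p := (⟨p - s (N p), by
    have := LinearMap.congr_fun h (N p)
    simp only [LinearMap.comp_apply, LinearMap.id_apply] at this
    rw [LinearMap.mem_ker, map_sub, this, sub_self]⟩, N p)
  map_add' p q := Prod.ext (Subtype.ext (by simp; abel)) (by simp)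
  map_smul' c p := Prod.ext (Subtype.ext (by simp [smul_sub])) (by simp)
  invFun x := x.1 + s x.2
  left_inv p := by simp
  right_inv x := by
    have h1 := LinearMap.congr_fun h x.2
    simp only [LinearMap.comp_apply, LinearMap.id_apply] at h1
    refine Prod.ext (Subtype.ext ?_) ?_ <;> simp [h1]

/-- Both kernels have dimension dim P − dim K. Splitting P as kernel × K for each map and matching
the kernels gives the automorphism. -/
theorem exists_equiv_comp_eq [FiniteDimensional ℝ P] {N N₀ : P →ₗ[ℝ] K}
    (hN : Function.Surjective N) (hN₀ : Function.Surjective N₀) :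
    ∃ g : P ≃ₗ[ℝ] P, N ∘ₗ g.toLinearMap = N₀ := by
  obtain ⟨s, hs⟩ := N.exists_rightInverse_of_surjective (LinearMap.range_eq_top.mpr hN)
  obtain ⟨s₀, hs₀⟩ := N₀.exists_rightInverse_of_surjective (LinearMap.range_eq_top.mpr hN₀)
  have hk : Module.finrank ℝ (LinearMap.ker N₀) = Module.finrank ℝ (LinearMap.ker N) := by
    have h1 := N.finrank_range_add_finrank_ker
    have h2 := N₀.finrank_range_add_finrank_ker
    rw [LinearMap.range_eq_top.mpr hN] at h1
    rw [LinearMap.range_eq_top.mpr hN₀] at h2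
    omega
  let κ := LinearEquiv.ofFinrankEq _ _ hk
  refine ⟨(splitEquiv N₀ s₀ hs₀).trans ((κ.prodCongr (LinearEquiv.refl ℝ K)).trans
    (splitEquiv N s hs).symm), LinearMap.ext fun p => ?_⟩
  have h : ∀ x, N ((splitEquiv N s hs).symm x) = x.2 := fun x => by
    conv_rhs => rw [← (splitEquiv N s hs).apply_symm_apply x]
    rfl
  simp only [LinearMap.comp_apply, LinearEquiv.coe_coe, LinearEquiv.trans_apply, h]
  rfl

end LinearAlgebra

/-! ### Straightening a smooth family of surjections -/

section SmoothLinear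

variable {d : ℕ} {M : Type*} [TopologicalSpace M] [ChartedSpace (EuclideanSpace ℝ (Fin d)) M]

theorem contMDiffAt_clm_of_entries {a b : ℕ} {x : M} {N : M → (Fin a → ℝ) →L[ℝ] (Fin b → ℝ)}
    (h : ∀ i j, SmoothAt d (fun y => N y (Pi.single i 1) j) x) :
    ContMDiffAt (𝓡 d) 𝓘(ℝ, (Fin a → ℝ) →L[ℝ] (Fin b → ℝ)) ∞ N x := by
  let L : (Fin a → Fin b → ℝ) →ₗ[ℝ] ((Fin a → ℝ) →L[ℝ] (Fin b → ℝ)) :=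
    LinearMap.toContinuousLinearMap.toLinearMap ∘ₗ
      ((Pi.basisFun ℝ (Fin a)).constr ℝ).toLinearMap
  have hN : N = fun y => LinearMap.toContinuousLinearMap L (fun i => N y (Pi.single i 1)) := by
    funext y
    ext1 v
    change N y v = ((Pi.basisFun ℝ (Fin a)).constr ℝ) _ v
    have : ((N y : (Fin a → ℝ) →ₗ[ℝ] (Fin b → ℝ))) =
        ((Pi.basisFun ℝ (Fin a)).constr ℝ) (fun i => N y (Pi.single i 1)) := by
      refine (Pi.basisFun ℝ (Fin a)).ext fun i => ?_
      rw [Module.Basis.constr_basis]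
      simp
    exact LinearMap.congr_fun this v
  rw [hN]
  refine (LinearMap.toContinuousLinearMap L).contDiff.contMDiff.contMDiffAt.comp x ?_
  exact contMDiffAt_pi_space.mpr fun i => contMDiffAt_pi_space.mpr fun j => h i j

/-- A smooth family of surjections with a given initial value can be trivialized near a point:
the coordinate version. -/
theorem exists_smooth_correction_coord {a b : ℕ} {V : Opens M} {x₀ : M} (hx₀ : x₀ ∈ V)
    {N : M → (Fin a → ℝ) →L[ℝ] (Fin b → ℝ)} {N₀ : (Fin a → ℝ) →L[ℝ] (Fin b → ℝ)}
    (hN : ∀ x ∈ V, ContMDiffAt (𝓡 d) 𝓘(ℝ, (Fin a → ℝ) →L[ℝ] (Fin b → ℝ)) ∞ N x)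
    (hs : Function.Surjective (N x₀)) (hs₀ : Function.Surjective N₀) :
    ∃ W : Opens M, W ≤ V ∧ x₀ ∈ W ∧ ∃ g g' : M → (Fin a → ℝ) →L[ℝ] (Fin a → ℝ),
      (∀ x ∈ W, ContMDiffAt (𝓡 d) 𝓘(ℝ, (Fin a → ℝ) →L[ℝ] (Fin a → ℝ)) ∞ g x) ∧
      (∀ x ∈ W, ContMDiffAt (𝓡 d) 𝓘(ℝ, (Fin a → ℝ) →L[ℝ] (Fin a → ℝ)) ∞ g' x) ∧
      ∀ x ∈ W, (g x).comp (g' x) = ContinuousLinearMap.id ℝ _ ∧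
        (g' x).comp (g x) = ContinuousLinearMap.id ℝ _ ∧ (N x).comp (g x) = N₀ := by
  obtain ⟨e, he⟩ := exists_equiv_comp_eq (N := (N x₀).toLinearMap) (N₀ := N₀.toLinearMap) hs hs₀
  obtain ⟨s, hs'⟩ := (N x₀).toLinearMap.exists_rightInverse_of_surjective
    (LinearMap.range_eq_top.mpr hs)
  let g₀ : (Fin a → ℝ) →L[ℝ] (Fin a → ℝ) := LinearMap.toContinuousLinearMap e.toLinearMap
  let S : (Fin b → ℝ) →L[ℝ] (Fin a → ℝ) := LinearMap.toContinuousLinearMap s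
  have hNS : (N x₀).comp S = 1 := by
    ext1 v; exact LinearMap.congr_fun hs' v
  have hNg : (N x₀).comp g₀ = N₀ := by
    ext1 v; exact LinearMap.congr_fun he v
  let A : M → (Fin b → ℝ) →L[ℝ] (Fin b → ℝ) := fun x => (N x).comp S
  have hA : ∀ x ∈ V, ContMDiffAt (𝓡 d) 𝓘(ℝ, (Fin b → ℝ) →L[ℝ] (Fin b → ℝ)) ∞ A x :=
    fun x hx => (hN x hx).clm_comp contMDiffAt_const
  -- Since S is a right inverse of N x₀, the map A x = (N x) S is the identity at x₀ and invertible
  -- nearby, and subtracting S A(x)⁻¹ (N x g₀ − N₀) from g₀ corrects N x g₀ to exactly N₀. The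
  -- correction is zero at x₀, so g stays invertible near x₀.
  let g : M → (Fin a → ℝ) →L[ℝ] (Fin a → ℝ) := fun x =>
    g₀ - S.comp ((Ring.inverse (A x)).comp ((N x).comp g₀ - N₀))
  have hinv : ∀ {m : ℕ} (T : M → (Fin m → ℝ) →L[ℝ] (Fin m → ℝ)) (x : M), IsUnit (T x) →
      ContMDiffAt (𝓡 d) 𝓘(ℝ, (Fin m → ℝ) →L[ℝ] (Fin m → ℝ)) ∞ T x →
      ContMDiffAt (𝓡 d) 𝓘(ℝ, (Fin m → ℝ) →L[ℝ] (Fin m → ℝ)) ∞ (fun x => Ring.inverse (T x)) x := by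
    intro m T x hu hT
    obtain ⟨u, hu⟩ := hu
    have h1 := contDiffAt_ringInverse ℝ u (n := ∞)
    rw [hu] at h1
    exact h1.contMDiffAt.comp x hT
  have hg : ∀ x ∈ V, IsUnit (A x) →
      ContMDiffAt (𝓡 d) 𝓘(ℝ, (Fin a → ℝ) →L[ℝ] (Fin a → ℝ)) ∞ g x := by
    intro x hx hu
    exact contMDiffAt_const.sub (contMDiffAt_const.clm_comp ((hinv A x hu (hA x hx)).clm_comp
      (((hN x hx).clm_comp contMDiffAt_const).sub contMDiffAt_const)))
  have hAx₀ : IsUnit (A x₀) := by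
    change IsUnit ((N x₀).comp S)
    rw [hNS]; exact isUnit_one
  have hgx₀ : g x₀ = g₀ := by
    change g₀ - S.comp ((Ring.inverse (A x₀)).comp ((N x₀).comp g₀ - N₀)) = g₀
    rw [hNg, sub_self]; simp
  have hgu : IsUnit (g x₀) := by
    rw [hgx₀]
    refine ⟨⟨g₀, LinearMap.toContinuousLinearMap e.symm.toLinearMap, ?_, ?_⟩, rfl⟩
    · ext1 v; exact e.apply_symm_apply v
    · ext1 v; exact e.symm_apply_apply v
  have hopen : ∀ {m : ℕ} (T : M → (Fin m → ℝ) →L[ℝ] (Fin m → ℝ)), IsUnit (T x₀) →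
      ContinuousAt T x₀ → ∀ᶠ x in 𝓝 x₀, IsUnit (T x) := fun T hu hT =>
    hT.eventually (Units.isOpen.mem_nhds hu)
  have hev : ∀ᶠ x in 𝓝 x₀, x ∈ V ∧ IsUnit (A x) ∧ IsUnit (g x) :=
    (Opens.eventually_mem hx₀).and ((hopen A hAx₀ (hA x₀ hx₀).continuousAt).and
      (hopen g hgu (hg x₀ hx₀ hAx₀).continuousAt))
  obtain ⟨O, hO, hOo, hxO⟩ := eventually_nhds_iff.mp hev
  refine ⟨⟨O, hOo⟩, fun x hx => (hO x hx).1, hxO, g, fun x => Ring.inverse (g x),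
    fun x hx => hg x (hO x hx).1 (hO x hx).2.1,
    fun x hx => hinv g x (hO x hx).2.2 (hg x (hO x hx).1 (hO x hx).2.1), fun x hx => ⟨?_, ?_, ?_⟩⟩
  · exact Ring.mul_inverse_cancel _ (hO x hx).2.2
  · exact Ring.inverse_mul_cancel _ (hO x hx).2.2
  · have h1 : (A x).comp (Ring.inverse (A x)) = 1 := Ring.mul_inverse_cancel _ (hO x hx).2.1
    ext1 v
    have h2 := DFunLike.congr_fun h1 ((N x) (g₀ v) - N₀ v)
    change N x (g₀ v - S (Ring.inverse (A x) (N x (g₀ v) - N₀ v))) = N₀ v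
    change N x (S (Ring.inverse (A x) (N x (g₀ v) - N₀ v))) = N x (g₀ v) - N₀ v at h2
    rw [map_sub, h2]
    abel

/-- A smooth family of surjections can be trivialized near a point. -/
theorem exists_smooth_correction {P K : Type*} [AddCommGroup P] [Module ℝ P] [AddCommGroup K]
    [Module ℝ K] [FiniteDimensional ℝ P] {V : Opens M} {x₀ : M}
    (hx₀ : x₀ ∈ V) {N : V → P →ₗ[ℝ] K} {N₀ : P →ₗ[ℝ] K}
    (hN : ∀ (f : P) (ψ : Module.Dual ℝ K), ContMDiff (𝓡 d) 𝓘(ℝ, ℝ) ∞ fun x : V => ψ (N x f))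
    (hs : ∀ x, Function.Surjective (N x)) (hs₀ : Function.Surjective N₀) :
    ∃ (W : Opens M) (h : W ≤ V), x₀ ∈ W ∧ ∃ g : W → P ≃ₗ[ℝ] P,
      (∀ (f : P) (φ : Module.Dual ℝ P), ContMDiff (𝓡 d) 𝓘(ℝ, ℝ) ∞ fun x : W => φ (g x f)) ∧
      (∀ (f : P) (φ : Module.Dual ℝ P), ContMDiff (𝓡 d) 𝓘(ℝ, ℝ) ∞ fun x : W => φ ((g x).symm f)) ∧
      ∀ (x : W) f, N (incl h x) (g x f) = N₀ f := by
  have : FiniteDimensional ℝ K := Module.Finite.of_surjective N₀ hs₀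
  let bP := Module.finBasis ℝ P
  let bK := Module.finBasis ℝ K
  let eP := bP.equivFun
  let eK := bK.equivFun
  have co : ∀ T : P →ₗ[ℝ] K, Function.Surjective T → Function.Surjective
      (LinearMap.toContinuousLinearMap (eK.toLinearMap ∘ₗ T ∘ₗ eP.symm.toLinearMap)) := by
    intro T hT
    exact eK.surjective.comp (hT.comp eP.symm.surjective)
  let N' : M → (Fin (Module.finrank ℝ P) → ℝ) →L[ℝ] (Fin (Module.finrank ℝ K) → ℝ) :=
    ext0 fun x => LinearMap.toContinuousLinearMap (eK.toLinearMap ∘ₗ N x ∘ₗ eP.symm.toLinearMap)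
  obtain ⟨W, hWV, hxW, g, g', hg, hg', h⟩ := exists_smooth_correction_coord (d := d) (N := N')
    (N₀ := LinearMap.toContinuousLinearMap (eK.toLinearMap ∘ₗ N₀ ∘ₗ eP.symm.toLinearMap)) hx₀
    (fun x hx => contMDiffAt_clm_of_entries fun i j => by
      have h1 := contMDiff_iff_ext0.mp (hN (eP.symm (Pi.single i 1)) (bK.coord j)) ⟨x, hx⟩
      refine ContMDiffAt.congr_of_eventuallyEq h1 ?_
      filter_upwards [Opens.eventually_mem hx] with y hy
      simp only [N']
      rw [ext0_mk _ hy, ext0_mk _ hy]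
      simp [eK, Module.Basis.equivFun_apply])
    (by simp only [N']; rw [ext0_mk _ hx₀]; exact co _ (hs _)) (co _ hs₀)
  let G : W → P ≃ₗ[ℝ] P := fun x => eP.trans ((⟨(g x).toLinearMap, g' x,
      fun v => DFunLike.congr_fun (h x x.2).2.1 v, fun v => DFunLike.congr_fun (h x x.2).1 v⟩ :
      (Fin (Module.finrank ℝ P) → ℝ) ≃ₗ[ℝ] (Fin (Module.finrank ℝ P) → ℝ)).trans eP.symm)
  have sm : ∀ (T : M → (Fin (Module.finrank ℝ P) → ℝ) →L[ℝ] (Fin (Module.finrank ℝ P) → ℝ)),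
      (∀ x ∈ W, ContMDiffAt (𝓡 d) 𝓘(ℝ, (Fin (Module.finrank ℝ P) → ℝ) →L[ℝ]
        (Fin (Module.finrank ℝ P) → ℝ)) ∞ T x) → ∀ (f : P) (φ : Module.Dual ℝ P),
      ContMDiff (𝓡 d) 𝓘(ℝ, ℝ) ∞ fun x : W => φ (eP.symm (T x (eP f))) := by
    intro T hT f φ x
    refine contMDiffAt_subtype_iff (f := fun y => φ (eP.symm (T y (eP f)))).mpr ?_
    have h1 : ContMDiffAt (𝓡 d) 𝓘(ℝ, Fin (Module.finrank ℝ P) → ℝ) ∞ (fun y => T y (eP f)) (x : M) :=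
      (hT x x.2).clm_apply contMDiffAt_const
    exact (LinearMap.toContinuousLinearMap (φ ∘ₗ eP.symm.toLinearMap)).contDiff.contMDiff.contMDiffAt.comp
      (x : M) h1
  refine ⟨W, hWV, hxW, G, sm g hg, sm g' hg', fun x f => ?_⟩
  have h1 := DFunLike.congr_fun (h x x.2).2.2 (eP f)
  simp only [N'] at h1
  rw [ext0_mk _ (hWV x.2)] at h1
  have h2 : eK (N (incl hWV x) (eP.symm (g x (eP f)))) = eK (N₀ (eP.symm (eP f))) := h1
  rw [LinearEquiv.symm_apply_apply] at h2
  exact eK.injective h2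

end SmoothLinear

/-- Smoothness of μ is given only after pairing with ξ ⊗ η. In finite dimension these functionals
span the dual of the tensor square, which transfers smoothness to every functional. -/
theorem exists_sum_dualPair {n : ℕ} {V : Fin n → Type*} [∀ i, AddCommGroup (V i)]
    [∀ i, Module ℝ (V i)] [∀ i, FiniteDimensional ℝ (V i)]
    (ψ : Module.Dual ℝ ((∀ i, V i) ⊗[ℝ] (∀ i, V i))) :
    ∃ (m : ℕ) (ξ : Fin m → ∀ i, Module.Dual ℝ (V i)) (c : Fin m → Fin m → ℝ),
      ∀ t, ψ t = ∑ a, ∑ b, c a b * dualPair (ξ a) (ξ b) t := by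
  let b := Module.finBasis ℝ (∀ i, V i)
  refine ⟨_, fun a i => b.coord a ∘ₗ LinearMap.single ℝ V i, fun a c => ψ (b a ⊗ₜ b c), fun t => ?_⟩
  have hev : ∀ a, dualEval (fun i => b.coord a ∘ₗ LinearMap.single ℝ V i) = b.coord a := fun a => by
    refine LinearMap.ext fun v => ?_
    rw [dualEval_apply]
    conv_rhs => rw [← Finset.univ_sum_single v, map_sum]
    rfl
  have h := LinearMap.congr_fun (f := ψ) (g := ∑ a, ∑ c, ψ (b a ⊗ₜ b c) • dualPair
    (fun i => b.coord a ∘ₗ LinearMap.single ℝ V i) (fun i => b.coord c ∘ₗ LinearMap.single ℝ V i))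
    (by
      refine (b.tensorProduct b).ext fun ⟨a', c'⟩ => ?_
      simp [dualPair_tmul, hev, Finsupp.single_apply, Finset.sum_ite_eq, Module.Basis.tensorProduct_apply]) t
  simpa [LinearMap.sum_apply] using h

theorem basis_map_eq_sum {ι P G : Type*} [Fintype ι] [AddCommGroup P] [Module ℝ P] [AddCommGroup G]
    [Module ℝ G] (b : Module.Basis ι ℝ P) (L : P →ₗ[ℝ] G) (v : P) :
    L v = ∑ a, b.coord a v • L (b a) := by
  conv_lhs => rw [← b.sum_repr v, map_sum]
  simp

/-! ### Smooth frames and local triviality of admissible coalgebra bundles -/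

section Frames

variable {d n : ℕ} {M : Type*} [TopologicalSpace M] [ChartedSpace (EuclideanSpace ℝ (Fin d)) M]
  (F : Fin n → Type*) [∀ i, NormedAddCommGroup (F i)] [∀ i, NormedSpace ℝ (F i)]
  (E : Fin n → M → Type*) [∀ i x, AddCommGroup (E i x)] [∀ i x, Module ℝ (E i x)]
  [∀ i x, TopologicalSpace (E i x)] [∀ i, TopologicalSpace (TotalSpace (F i) (E i))]
  [∀ i, FiberBundle (F i) (E i)]

/-- A smooth trivialization of the graded vector bundle `E` over `V` with typical fibre `V₀`. -/
structure LocFrame (d : ℕ) [ChartedSpace (EuclideanSpace ℝ (Fin d)) M] (V₀ : Fin n → Type*)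
    [∀ i, AddCommGroup (V₀ i)] [∀ i, Module ℝ (V₀ i)] (V : Opens M) where
  /-- the trivialization on fibres -/
  toEquiv : ∀ (x : V) (i : Fin n), V₀ i ≃ₗ[ℝ] E i (x : M)
  smooth : ∀ i (f : V₀ i), IsSmoothSection F E d i V (fun x => toEquiv x i f)
  smooth_symm : ∀ i (φ : Module.Dual ℝ (V₀ i)),
    IsSmoothCosection F E d i V (fun x => φ ∘ₗ (toEquiv x i).symm.toLinearMap)

variable {F E} {V₀ : Fin n → Type*} [∀ i, AddCommGroup (V₀ i)] [∀ i, Module ℝ (V₀ i)]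

theorem IsSmoothSection.restrict {i : Fin n} {U V : Opens M} (h : V ≤ U) {s : ∀ x : U, E i (x : M)}
    (hs : IsSmoothSection F E d i U s) : IsSmoothSection F E d i V (fun x => s (incl h x)) :=
  ContMDiff.comp hs (contMDiff_incl h)

theorem IsSmoothCosection.restrict {i : Fin n} {U V : Opens M} (h : V ≤ U)
    {ξ : ∀ x : U, Module.Dual ℝ (E i (x : M))} (hξ : IsSmoothCosection F E d i U ξ) :
    IsSmoothCosection F E d i V (fun x => ξ (incl h x)) :=
  fun W hW s hs => hξ W (hW.trans h) s hs

namespace LocFrame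

variable {V : Opens M} (Θ : LocFrame F E d V₀ V)

/-- Restriction of a local trivialization. -/
def restrict {W : Opens M} (h : W ≤ V) : LocFrame F E d V₀ W where
  toEquiv x := Θ.toEquiv (incl h x)
  smooth i f := (Θ.smooth i f).restrict h
  smooth_symm i φ := (Θ.smooth_symm i φ).restrict h

variable [∀ i, FiniteDimensional ℝ (V₀ i)]

/-- A section expands in the frame with smooth coefficients, so testing a cosection on frame
sections is enough. -/
theorem isSmoothCosection {i : Fin n} {ξ : ∀ x : V, Module.Dual ℝ (E i (x : M))}
    (hξ : ∀ f, ContMDiff (𝓡 d) 𝓘(ℝ, ℝ) ∞ fun x : V => ξ x (Θ.toEquiv x i f)) :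
    IsSmoothCosection F E d i V ξ := by
  intro W h s hs
  let b := Module.finBasis ℝ (V₀ i)
  have h1 : (fun x : W => ξ (incl h x) (s x)) = fun x => ∑ a,
      b.coord a ((Θ.toEquiv (incl h x) i).symm (s x)) *
        ξ (incl h x) (Θ.toEquiv (incl h x) i (b a)) := by
    funext x
    have h2 := basis_map_eq_sum b (ξ (incl h x) ∘ₗ (Θ.toEquiv (incl h x) i).toLinearMap)
      ((Θ.toEquiv (incl h x) i).symm (s x))
    exact (congrArg (ξ (incl h x)) ((Θ.toEquiv (incl h x) i).apply_symm_apply (s x))).symm.trans h2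
  rw [h1]
  refine contMDiff_finsetSum fun a _ => ?_
  exact (Θ.smooth_symm i (b.coord a) W h s hs).mul ((hξ (b a)).comp (contMDiff_incl h))

variable [∀ i, VectorBundle ℝ (F i) (E i)]

theorem isSmoothSection_sum {ι : Type*} (t : Finset ι) {i : Fin n} {U : Opens M}
    {s : ι → ∀ x : U, E i (x : M)} (hs : ∀ a ∈ t, IsSmoothSection F E d i U (s a)) :
    IsSmoothSection F E d i U (fun x => ∑ a ∈ t, s a x) := by
  classical
  induction t using Finset.induction_on with
  | empty =>
    simp only [Finset.sum_empty]
    exact isSmoothSection_zero F E i U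
  | insert a t ha ih =>
    simp only [Finset.sum_insert ha]
    exact isSmoothSection_add F E (hs a (Finset.mem_insert_self _ _))
      (ih fun b hb => hs b (Finset.mem_insert_of_mem hb))

theorem isSmoothSection {i : Fin n} {s : ∀ x : V, E i (x : M)}
    (hs : ∀ φ : Module.Dual ℝ (V₀ i), ContMDiff (𝓡 d) 𝓘(ℝ, ℝ) ∞
      fun x : V => φ ((Θ.toEquiv x i).symm (s x))) :
    IsSmoothSection F E d i V s := by
  let b := Module.finBasis ℝ (V₀ i)
  have h1 : s = fun x => ∑ a, b.coord a ((Θ.toEquiv x i).symm (s x)) • Θ.toEquiv x i (b a) := by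
    funext x
    have h2 := basis_map_eq_sum b (Θ.toEquiv x i).toLinearMap ((Θ.toEquiv x i).symm (s x))
    simp only [LinearEquiv.coe_coe, LinearEquiv.apply_symm_apply] at h2
    exact h2
  rw [h1]
  exact isSmoothSection_sum _ fun a _ => isSmoothSection_smul F E (d := d)
    ⟨_, hs (b.coord a)⟩ (Θ.smooth i (b a))

/-- Change of a local trivialization on one summand. -/
def update (p : Fin n) (g : V → V₀ p ≃ₗ[ℝ] V₀ p)
    (hg : ∀ (f : V₀ p) (φ : Module.Dual ℝ (V₀ p)), ContMDiff (𝓡 d) 𝓘(ℝ, ℝ) ∞ fun x : V => φ (g x f))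
    (hg' : ∀ (f : V₀ p) (φ : Module.Dual ℝ (V₀ p)),
      ContMDiff (𝓡 d) 𝓘(ℝ, ℝ) ∞ fun x : V => φ ((g x).symm f)) :
    LocFrame F E d V₀ V where
  toEquiv x := Function.update (Θ.toEquiv x) p ((g x).trans (Θ.toEquiv x p))
  smooth i f := by
    by_cases hi : i = p
    · subst hi
      simp only [Function.update_self]
      refine Θ.isSmoothSection fun φ => ?_
      simp only [LinearEquiv.trans_apply, LinearEquiv.symm_apply_apply]
      exact hg f φ
    · simp only [Function.update_of_ne hi]
      exact Θ.smooth i f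
  smooth_symm i φ := by
    by_cases hi : i = p
    · subst hi
      simp only [Function.update_self]
      refine Θ.isSmoothCosection fun f => ?_
      simp only [LinearEquiv.trans_symm, LinearMap.comp_apply, LinearEquiv.coe_coe,
        LinearEquiv.trans_apply, LinearEquiv.symm_apply_apply]
      exact hg' f φ
    · simp only [Function.update_of_ne hi]
      exact Θ.smooth_symm i φ

end LocFrame

variable [∀ i, VectorBundle ℝ (F i) (E i)] [∀ i, FiniteDimensional ℝ (F i)]
  [IsManifold (𝓡 d) ∞ M]  [∀ i, ContMDiffVectorBundle ∞ (F i) (E i) (𝓡 d)]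

variable (F E) in
theorem finrank_fibre (i : Fin n) (x : M) : Module.finrank ℝ (E i x) = Module.finrank ℝ (F i) :=
  ((trivializationAt (F i) (E i) x).linearEquivAt ℝ x
    (mem_baseSet_trivializationAt (F i) (E i) x)).finrank_eq

variable (F E) in
theorem finiteDimensional_fibre (i : Fin n) (x : M) :
    Module.finrank ℝ (E i x) = Module.finrank ℝ (F i) ∧ FiniteDimensional ℝ (E i x) :=
  ⟨finrank_fibre F E i x, Module.Finite.equiv ((trivializationAt (F i) (E i) x).linearEquivAt ℝ x
    (mem_baseSet_trivializationAt (F i) (E i) x)).symm⟩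

variable (d F E) in
theorem exists_locFrame [∀ i, FiniteDimensional ℝ (V₀ i)]
    (h : ∀ i, Module.finrank ℝ (V₀ i) = Module.finrank ℝ (F i)) (x₀ : M) :
    ∃ V : Opens M, x₀ ∈ V ∧ Nonempty (LocFrame F E d V₀ V) := by
  let e := fun i => trivializationAt (F i) (E i) x₀
  let V : Opens M := ⟨⋂ i, (e i).baseSet, isOpen_iInter_of_finite fun i => (e i).open_baseSet⟩
  have hV : ∀ (x : V) i, (x : M) ∈ (e i).baseSet := fun x i => Set.mem_iInter.mp x.2 i
  let κ : ∀ i, V₀ i ≃ₗ[ℝ] F i := fun i => LinearEquiv.ofFinrankEq _ _ (h i)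
  refine ⟨V, Set.mem_iInter.mpr fun i => mem_baseSet_trivializationAt (F i) (E i) x₀,
    ⟨⟨fun x i => (κ i).trans ((e i).linearEquivAt ℝ x (hV x i)).symm, fun i f x => ?_, 
      fun i φ W hW s hs x => ?_⟩⟩⟩
  · refine ((e i).contMDiffAt_iff ((e i).mem_source.mpr (hV x i))).mpr
      ⟨contMDiff_subtype_val.contMDiffAt, ?_⟩
    refine (contMDiffAt_const (c := κ i f)).congr_of_eventuallyEq (Filter.Eventually.of_forall fun y => ?_)
    exact ((e i).linearEquivAt ℝ y (hV y i)).apply_symm_apply (κ i f)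
  · have h1 := (((e i).contMDiffAt_iff ((e i).mem_source.mpr (hV (incl hW x) i))).mp (hs x)).2
    have h2 : ContMDiffAt (𝓡 d) 𝓘(ℝ, ℝ) ∞ _ x :=
      (LinearMap.toContinuousLinearMap (φ ∘ₗ (κ i).symm.toLinearMap)).contDiff.contMDiff.contMDiffAt.comp x h1
    exact h2

/-- The trivialization `Θ` intertwines the comultiplications on the summands of index `< q`. -/
def LocFrame.IntertwinesBelow {V : Opens M} (Θ : LocFrame F E d V₀ V) (B : CoalgebraBundle F E d)
    (μ₀ : (∀ i, V₀ i) →ₗ[ℝ] (∀ i, V₀ i) ⊗[ℝ] (∀ i, V₀ i)) (q : ℕ) : Prop :=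
  ∀ (x : V) (p : Fin n), p.val < q → ∀ v : V₀ p,
    TensorProduct.map (totalMap fun i => (Θ.toEquiv x i).toLinearMap)
      (totalMap fun i => (Θ.toEquiv x i).toLinearMap) (μ₀ (Pi.single p v)) =
    B.μ x (Pi.single p (Θ.toEquiv x p v))

theorem map_totalMap_symm {W W' : Fin n → Type*} [∀ i, AddCommGroup (W i)] [∀ i, Module ℝ (W i)]
    [∀ i, AddCommGroup (W' i)] [∀ i, Module ℝ (W' i)] (θ : ∀ i, W i ≃ₗ[ℝ] W' i) (t) :
    TensorProduct.map (totalMap fun i => (θ i).symm.toLinearMap)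
      (totalMap fun i => (θ i).symm.toLinearMap)
      (TensorProduct.map (totalMap fun i => (θ i).toLinearMap)
        (totalMap fun i => (θ i).toLinearMap) t) = t := by
  have : (totalMap fun i => (θ i).symm.toLinearMap) ∘ₗ (totalMap fun i => (θ i).toLinearMap) =
      LinearMap.id := LinearMap.ext fun v => funext fun i => by simp
  rw [← LinearMap.comp_apply, ← TensorProduct.map_comp, this, TensorProduct.map_id,
    LinearMap.id_apply]

/-- Both factors of a tensor have degree at least one. This covers the summand of degree −1, about
which admissibility says nothing: μ vanishes on it. -/
theorem tensorDeg_one_eq_zero {W : Fin n → Type*} [∀ i, AddCommGroup (W i)] [∀ i, Module ℝ (W i)]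
    {e : (∀ i, W i) ⊗[ℝ] (∀ i, W i)} (he : e ∈ tensorDeg W 1) : e = 0 := by
  rw [eq_sum_comp₂ e]
  refine Finset.sum_eq_zero fun i _ => Finset.sum_eq_zero fun j _ => ?_
  rw [he i j (by omega), map_zero]

/-- Induction on q. Below q the frame matches μ with μ₀, so admissibility and `map_mem_kSpace`,
applied in both directions, show that μ on the next summand, read in the frame, has the same image K
as μ₀. It is thus a smooth family of surjections onto K, and `exists_smooth_correction` supplies a
change of frame on this one summand that turns it into the constant map μ₀. -/
theorem CoalgebraBundle.exists_locFrame_intertwinesBelow [∀ i, FiniteDimensional ℝ (V₀ i)]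
    (B : CoalgebraBundle F E d) (hB : B.IsAdmissible)
    {μ₀ : (∀ i, V₀ i) →ₗ[ℝ] (∀ i, V₀ i) ⊗[ℝ] (∀ i, V₀ i)}
    (hμ₀ : ∀ (p : Fin n) (v : V₀ p), μ₀ (Pi.single p v) ∈ tensorDeg V₀ (p.val + 1))
    (hadm : ∀ p : Fin n, 2 ≤ p.val + 1 → Set.range (fun v : V₀ p => μ₀ (Pi.single p v)) =
      kSpace μ₀ ∩ tensorDeg V₀ (p.val + 1))
    (h : ∀ i, Module.finrank ℝ (V₀ i) = Module.finrank ℝ (F i)) (x₀ : M) (q : ℕ) (hq : q ≤ n) :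
    ∃ V : Opens M, x₀ ∈ V ∧ ∃ Θ : LocFrame F E d V₀ V, Θ.IntertwinesBelow B μ₀ q := by
  induction q with
  | zero =>
    obtain ⟨V, hx, ⟨Θ⟩⟩ := exists_locFrame (d := d) F E h x₀
    exact ⟨V, hx, Θ, fun x p hp => absurd hp (Nat.not_lt_zero _)⟩
  | succ q ih =>
    obtain ⟨V, hxV, Θ, hΘ⟩ := ih (Nat.le_of_succ_le hq)
    let p : Fin n := ⟨q, hq⟩
    let T := fun x => totalMap fun i => (Θ.toEquiv x i).toLinearMap
    let S := fun x => totalMap fun i => (Θ.toEquiv x i).symm.toLinearMap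
    have hST : ∀ x t, TensorProduct.map (S x) (S x) (TensorProduct.map (T x) (T x) t) = t :=
      fun x => map_totalMap_symm (Θ.toEquiv x)
    have hTS : ∀ x t, TensorProduct.map (T x) (T x) (TensorProduct.map (S x) (S x) t) = t :=
      fun x => map_totalMap_symm fun i => (Θ.toEquiv x i).symm
    let N₀ : V₀ p →ₗ[ℝ] (∀ i, V₀ i) ⊗[ℝ] (∀ i, V₀ i) := μ₀ ∘ₗ LinearMap.single ℝ V₀ p
    let N : V → V₀ p →ₗ[ℝ] (∀ i, V₀ i) ⊗[ℝ] (∀ i, V₀ i) := fun x =>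
      TensorProduct.map (S x) (S x) ∘ₗ B.μ x ∘ₗ LinearMap.single ℝ (fun i => E i (x : M)) p ∘ₗ
        (Θ.toEquiv x p).toLinearMap
    have hS : ∀ (x : V) (p : Fin n), p.val < q → ∀ v, TensorProduct.map (S x) (S x)
        (B.μ x (Pi.single p v)) = μ₀ (Pi.single p ((Θ.toEquiv x p).symm v)) := by
      intro x p hp v
      have h1 := hΘ x p hp ((Θ.toEquiv x p).symm v)
      rw [LinearEquiv.apply_symm_apply] at h1
      rw [← h1]
      exact hST x _
    have hNmem : ∀ x f, ∃ f₀, N₀ f₀ = N x f := by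
      intro x f
      have h1 : N x f ∈ tensorDeg V₀ (q + 1) :=
        map_totalMap_mem_tensorDeg _ (B.degree_preserving x p _)
      rcases Nat.eq_zero_or_pos q with h0 | h0
      · refine ⟨0, ?_⟩
        have h2 : N x f = 0 := tensorDeg_one_eq_zero (by rw [h0] at h1; exact h1)
        rw [h2, map_zero]
      · have h2 : N x f ∈ kSpace μ₀ ∩ tensorDeg V₀ (p.val + 1) := by
          refine map_mem_kSpace (μ := B.μ x) (q := q) (fun i => (Θ.toEquiv x i).symm.toLinearMap)
            (B.degree_preserving x) (hS x) ?_
          have := hB x p (by change 2 ≤ q + 1; omega)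
          rw [show q + 1 = p.val + 1 from rfl, ← this]
          exact ⟨_, rfl⟩
        rw [← hadm p (by change 2 ≤ q + 1; omega)] at h2
        exact h2
    have hN₀mem : ∀ x f₀, ∃ f, N x f = N₀ f₀ := by
      intro x f₀
      rcases Nat.eq_zero_or_pos q with h0 | h0
      · refine ⟨0, ?_⟩
        have h2 : N₀ f₀ = 0 := tensorDeg_one_eq_zero (by
          have := hμ₀ p f₀
          rw [show p.val = 0 from h0] at this
          exact this)
        rw [h2, map_zero]
      · have h2 : TensorProduct.map (T x) (T x) (N₀ f₀) ∈
            kSpace (B.μ x) ∩ tensorDeg (fun i => E i (x : M)) (p.val + 1) := by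
          refine map_mem_kSpace (μ := μ₀) (q := q) (fun i => (Θ.toEquiv x i).toLinearMap)
            hμ₀ (hΘ x) ?_
          have := hadm p (by change 2 ≤ q + 1; omega)
          rw [show q + 1 = p.val + 1 from rfl, ← this]
          exact ⟨_, rfl⟩
        rw [← hB x p (by change 2 ≤ q + 1; omega)] at h2
        obtain ⟨v, hv⟩ := h2
        refine ⟨(Θ.toEquiv x p).symm v, ?_⟩
        rw [← hST x (N₀ f₀), ← hv]
        simp [N]
    let K := LinearMap.range N₀
    let N' : V → V₀ p →ₗ[ℝ] K := fun x => (N x).codRestrict K fun f => hNmem x f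
    -- A functional on K extends to the whole tensor square, where it is a combination of products
    -- of functionals. The frame turns these into smooth cosections, to which the smoothness of μ
    -- applies.
    have hsm : ∀ (f : V₀ p) (ψ : Module.Dual ℝ K),
        ContMDiff (𝓡 d) 𝓘(ℝ, ℝ) ∞ fun x : V => ψ (N' x f) := by
      intro f ψ
      obtain ⟨ψ', hψ'⟩ : ∃ ψ' : Module.Dual ℝ ((∀ i, V₀ i) ⊗[ℝ] (∀ i, V₀ i)), ψ' ∘ₗ K.subtype = ψ :=
        LinearMap.exists_extend ψ
      obtain ⟨m, ξ, c, hc⟩ := exists_sum_dualPair ψ'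
      have h1 : (fun x : V => ψ (N' x f)) = fun x : V =>
          ∑ a, ∑ b, c a b * dualMul (B.μ x)
            (fun i => ξ a i ∘ₗ (Θ.toEquiv x i).symm.toLinearMap)
            (fun i => ξ b i ∘ₗ (Θ.toEquiv x i).symm.toLinearMap) p (Θ.toEquiv x p f) := by
        funext x
        rw [← hψ']
        refine (hc (N x f)).trans ?_
        refine Finset.sum_congr rfl fun a _ => Finset.sum_congr rfl fun b _ => ?_
        congr 1
        exact dualPair_map _ _ _ _
      rw [h1]
      refine contMDiff_finsetSum fun a _ => contMDiff_finsetSum fun b _ => ?_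
      refine contMDiff_const.mul ?_
      exact B.smooth V _ _ (fun i => Θ.smooth_symm i (ξ a i)) (fun i => Θ.smooth_symm i (ξ b i)) p
        V le_rfl _ (Θ.smooth p f)
    have hsur : ∀ x, Function.Surjective (N' x) := by
      rintro x ⟨_, f₀, rfl⟩
      obtain ⟨f, hf⟩ := hN₀mem x f₀
      exact ⟨f, Subtype.ext hf⟩
    obtain ⟨W, hW, hxW, g, hg, hg', hgN⟩ := exists_smooth_correction (d := d) (P := V₀ p) (K := K) hxV
      (N₀ := N₀.rangeRestrict) hsm hsur N₀.surjective_rangeRestrict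
    refine ⟨W, hxW, (Θ.restrict hW).update p g hg hg', fun x p' hp' v => ?_⟩
    have hne : ∀ i : Fin n, i.val < q →
        ((Θ.restrict hW).update p g hg hg').toEquiv x i = Θ.toEquiv (incl hW x) i := fun i hi =>
      Function.update_of_ne (fun h => by rw [h] at hi; exact lt_irrefl _ hi) _ _
    -- On indices ≤ q the map μ₀ only produces factors of index < q, where the frame is unchanged,
    -- so the update at p does not affect the left side of the intertwining relation.
    have hT : TensorProduct.map
        (totalMap fun i => (((Θ.restrict hW).update p g hg hg').toEquiv x i).toLinearMap)
        (totalMap fun i => (((Θ.restrict hW).update p g hg hg').toEquiv x i).toLinearMap)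
        (μ₀ (Pi.single p' v)) = TensorProduct.map (T (incl hW x)) (T (incl hW x))
          (μ₀ (Pi.single p' v)) := by
      have h1 : ∀ i : Fin n, i.val < q → ∀ a : V₀ i,
          totalMap (fun i => (((Θ.restrict hW).update p g hg hg').toEquiv x i).toLinearMap)
            (Pi.single i a) = T (incl hW x) (Pi.single i a) := by
        intro i hi a
        refine (totalMap_single _ i a).trans (Eq.trans ?_
          (totalMap_single (fun i => (Θ.toEquiv (incl hW x) i).toLinearMap) i a).symm)
        exact congrArg (fun e : V₀ i ≃ₗ[ℝ] E i (x : M) => (Pi.single i (e a) : ∀ i, E i (x : M)))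
          (hne i hi)
      exact map_eq_of_mem_tensorDeg (m := p'.val + 1) (q := q) (by omega) h1 h1 (hμ₀ p' v)
    rw [hT]
    rcases Nat.lt_succ_iff_lt_or_eq.mp hp' with h1 | h1
    · rw [hne p' h1]
      exact hΘ (incl hW x) p' h1 v
    · have h2 : p' = p := Fin.ext h1
      subst h2
      have h3 : N (incl hW x) (g x v) = N₀ v := congrArg Subtype.val (hgN x v)
      have h4 : ((Θ.restrict hW).update p g hg hg').toEquiv x p =
          (g x).trans (Θ.toEquiv (incl hW x) p) := Function.update_self _ _ _
      rw [h4]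
      change TensorProduct.map (T (incl hW x)) (T (incl hW x)) (N₀ v) = _
      rw [← h3]
      exact hTS _ _

theorem CoalgebraBundle.isGradedCoalgebra (B : CoalgebraBundle F E d) (x : M) :
    IsGradedCoalgebra (B.μ x) :=
  ⟨B.degree_preserving x, B.coassoc x, B.cocomm x⟩

/-- The trivialization `Θ` intertwines the comultiplications. -/
def LocFrame.Intertwines {V : Opens M} (Θ : LocFrame F E d V₀ V) (B : CoalgebraBundle F E d)
    (μ₀ : (∀ i, V₀ i) →ₗ[ℝ] (∀ i, V₀ i) ⊗[ℝ] (∀ i, V₀ i)) : Prop :=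
  ∀ (x : V) (v : ∀ i, V₀ i),
    TensorProduct.map (totalMap fun i => (Θ.toEquiv x i).toLinearMap)
      (totalMap fun i => (Θ.toEquiv x i).toLinearMap) (μ₀ v) =
    B.μ x (totalMap (fun i => (Θ.toEquiv x i).toLinearMap) v)

/-- Admissible coalgebra bundles are locally trivial. -/
theorem CoalgebraBundle.exists_locFrame (B : CoalgebraBundle F E d) (hB : B.IsAdmissible)
    (x₁ x₀ : M) : ∃ V : Opens M, x₀ ∈ V ∧ ∃ Θ : LocFrame F E d (fun i => E i x₁) V,
      Θ.Intertwines B (B.μ x₁) := by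
  have := fun i => (finiteDimensional_fibre F E i x₁).2
  obtain ⟨V, hx, Θ, hΘ⟩ := B.exists_locFrame_intertwinesBelow hB (B.degree_preserving x₁) (hB x₁)
    (fun i => finrank_fibre F E i x₁) x₀ n le_rfl
  refine ⟨V, hx, Θ, fun x v => ?_⟩
  rw [← Finset.univ_sum_single v]
  simp only [map_sum]
  refine Finset.sum_congr rfl fun p _ => ?_
  rw [hΘ x p p.2, totalMap_single]
  rfl

end Frames

/-! ### Directional derivatives of vector-valued functions -/

section VectorValued

variable {d : ℕ} {M : Type*} [TopologicalSpace M] [ChartedSpace (EuclideanSpace ℝ (Fin d)) M]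
  {G : Type*} [AddCommGroup G] [Module ℝ G] {G' : Type*} [AddCommGroup G'] [Module ℝ G']

/-- A function with values in a vector space which near `x` takes values in a finite-dimensional
subspace and is smooth. -/
def FinSmoothAt (d : ℕ) [ChartedSpace (EuclideanSpace ℝ (Fin d)) M] (u : M → G) (x : M) : Prop :=
  ∃ (m : ℕ) (c : Fin m → M → ℝ) (g : Fin m → G), (∀ a, SmoothAt d (c a) x) ∧
    u =ᶠ[𝓝 x] fun y => ∑ a, c a y • g a

theorem vderiv_dual_sum {x : M} {u : M → G} {m : ℕ} {c : Fin m → M → ℝ} {g : Fin m → G}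
    (hc : ∀ a, SmoothAt d (c a) x) (h : u =ᶠ[𝓝 x] fun y => ∑ a, c a y • g a)
    (φ : Module.Dual ℝ G) (v) :
    vderiv d x v (fun y => φ (u y)) = φ (∑ a, vderiv d x v (c a) • g a) := by
  have h2 : (fun y => φ (u y)) =ᶠ[𝓝 x] fun y => ∑ a, φ (g a) * c a y := by
    filter_upwards [h] with y hy
    rw [hy, map_sum]
    simp [mul_comm]
  have h3 := vderiv_sum (d := d) (x := x) Finset.univ (f := fun a y => φ (g a) * c a y)
    (fun a _ => contMDiffAt_const.mul (hc a)) v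
  rw [vderiv_congr h2, h3, map_sum]
  refine Finset.sum_congr rfl fun a _ => ?_
  rw [vderiv_const_mul _ (hc a), map_smul, smul_eq_mul, mul_comm]

open Classical in
/-- The directional derivative of a vector-valued function. -/
def gderiv (d : ℕ) [ChartedSpace (EuclideanSpace ℝ (Fin d)) M] (x : M)
    (v : EuclideanSpace ℝ (Fin d)) (u : M → G) : G :=
  -- Linear functionals separate points and therefore determine the derivative. No topology on G is
  -- used, and G may be infinite-dimensional, like the fibres of Sym. Without local smoothness the
  -- value is 0.
  if h : FinSmoothAt d u x ∧ ∃ g : G, ∀ φ : Module.Dual ℝ G, φ g = vderiv d x v (fun y => φ (u y))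
  then h.2.choose else 0

variable {x : M} {u w : M → G}

theorem eq_of_forall_dual {g g' : G} (h : ∀ φ : Module.Dual ℝ G, φ g = φ g') : g = g' := by
  rw [← sub_eq_zero]
  refine (Module.forall_dual_apply_eq_zero_iff ℝ _).mp fun φ => ?_
  rw [map_sub, h, sub_self]

theorem FinSmoothAt.smoothAt (hu : FinSmoothAt d u x) (φ : Module.Dual ℝ G) :
    SmoothAt d (fun y => φ (u y)) x := by
  obtain ⟨m, c, g, hc, h⟩ := hu
  have h1 : SmoothAt d (fun y => ∑ a, c a y * φ (g a)) x :=
    SmoothAt.sum _ fun a _ => (hc a).mul contMDiffAt_const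
  refine ContMDiffAt.congr_of_eventuallyEq h1 ?_
  filter_upwards [h] with y hy
  rw [hy, map_sum]
  simp

theorem dual_gderiv (hu : FinSmoothAt d u x) (φ : Module.Dual ℝ G) (v) :
    φ (gderiv d x v u) = vderiv d x v (fun y => φ (u y)) := by
  have h : FinSmoothAt d u x ∧
      ∃ g : G, ∀ φ : Module.Dual ℝ G, φ g = vderiv d x v (fun y => φ (u y)) := by
    refine ⟨hu, ?_⟩
    obtain ⟨m, c, g, hc, h⟩ := hu
    exact ⟨_, fun φ => (vderiv_dual_sum hc h φ v).symm⟩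
  rw [gderiv, dif_pos h]
  exact h.2.choose_spec φ

theorem gderiv_eq {m : ℕ} {c : Fin m → M → ℝ} {g : Fin m → G} (hc : ∀ a, SmoothAt d (c a) x)
    (h : u =ᶠ[𝓝 x] fun y => ∑ a, c a y • g a) (v) :
    gderiv d x v u = ∑ a, vderiv d x v (c a) • g a :=
  eq_of_forall_dual fun φ => by
    rw [dual_gderiv ⟨m, c, g, hc, h⟩, vderiv_dual_sum hc h]

theorem FinSmoothAt.congr (hu : FinSmoothAt d u x) (h : w =ᶠ[𝓝 x] u) : FinSmoothAt d w x := by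
  obtain ⟨m, c, g, hc, h'⟩ := hu
  exact ⟨m, c, g, hc, h.trans h'⟩

theorem gderiv_congr (h : u =ᶠ[𝓝 x] w) (v) : gderiv d x v u = gderiv d x v w := by
  by_cases hu : FinSmoothAt d u x
  · have hw : FinSmoothAt d w x := hu.congr h.symm
    refine eq_of_forall_dual fun φ => ?_
    rw [dual_gderiv hu, dual_gderiv hw]
    exact vderiv_congr (h.fun_comp φ) v
  · have hw : ¬ FinSmoothAt d w x := fun hw => hu (hw.congr h)
    rw [gderiv, gderiv, dif_neg fun h => hu h.1, dif_neg fun h => hw h.1]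

theorem FinSmoothAt.of_fintype {ι : Type*} [Fintype ι] {c : ι → M → ℝ} {g : ι → G}
    (hc : ∀ a, SmoothAt d (c a) x) (h : u =ᶠ[𝓝 x] fun y => ∑ a, c a y • g a) :
    FinSmoothAt d u x := by
  let e := Fintype.equivFin ι
  refine ⟨_, fun a => c (e.symm a), fun a => g (e.symm a), fun a => hc _, h.trans ?_⟩
  refine Filter.Eventually.of_forall fun y => ?_
  exact (Equiv.sum_comp e.symm (fun a => c a y • g a)).symm

theorem FinSmoothAt.const (g : G) : FinSmoothAt d (fun _ => g) x :=
  ⟨1, fun _ _ => 1, fun _ => g, fun _ => contMDiffAt_const, Filter.Eventually.of_forall fun y => by simp⟩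

theorem FinSmoothAt.add (hu : FinSmoothAt d u x) (hw : FinSmoothAt d w x) :
    FinSmoothAt d (fun y => u y + w y) x := by
  obtain ⟨m, c, g, hc, h⟩ := hu
  obtain ⟨m', c', g', hc', h'⟩ := hw
  refine FinSmoothAt.of_fintype (ι := Fin m ⊕ Fin m') (c := Sum.elim c c') (g := Sum.elim g g') ?_ ?_
  · rintro (a | a)
    exacts [hc a, hc' a]
  · filter_upwards [h, h'] with y hy hy'
    rw [hy, hy', Fintype.sum_sum_type]
    rfl

theorem FinSmoothAt.map (hu : FinSmoothAt d u x) (L : G →ₗ[ℝ] G') :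
    FinSmoothAt d (fun y => L (u y)) x := by
  obtain ⟨m, c, g, hc, h⟩ := hu
  refine ⟨m, c, fun a => L (g a), hc, ?_⟩
  filter_upwards [h] with y hy
  rw [hy, map_sum]
  simp

theorem FinSmoothAt.smul (hu : FinSmoothAt d u x) {f : M → ℝ} (hf : SmoothAt d f x) :
    FinSmoothAt d (fun y => f y • u y) x := by
  obtain ⟨m, c, g, hc, h⟩ := hu
  refine ⟨m, fun a y => f y * c a y, g, fun a => hf.mul (hc a), ?_⟩
  filter_upwards [h] with y hy
  rw [hy, Finset.smul_sum]
  simp [mul_smul]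

theorem FinSmoothAt.mul {C : Type*} [Ring C] [Algebra ℝ C] {u w : M → C} (hu : FinSmoothAt d u x)
    (hw : FinSmoothAt d w x) : FinSmoothAt d (fun y => u y * w y) x := by
  obtain ⟨m, c, g, hc, h⟩ := hu
  obtain ⟨m', c', g', hc', h'⟩ := hw
  refine FinSmoothAt.of_fintype (ι := Fin m × Fin m') (c := fun a y => c a.1 y * c' a.2 y)
    (g := fun a => g a.1 * g' a.2) (fun a => (hc a.1).mul (hc' a.2)) ?_
  filter_upwards [h, h'] with y hy hy'
  rw [hy, hy', Finset.sum_mul_sum, Fintype.sum_prod_type]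
  simp only [smul_mul_smul_comm]

@[simp] theorem gderiv_const (v) (g : G) : gderiv d x v (fun _ => g) = 0 :=
  eq_of_forall_dual fun φ => by
    rw [dual_gderiv (.const g), vderiv_const, map_zero]

theorem gderiv_add (hu : FinSmoothAt d u x) (hw : FinSmoothAt d w x) (v) :
    gderiv d x v (fun y => u y + w y) = gderiv d x v u + gderiv d x v w :=
  eq_of_forall_dual fun φ => by
    rw [dual_gderiv (hu.add hw), map_add, dual_gderiv hu, dual_gderiv hw,
      ← vderiv_add (hu.smoothAt φ) (hw.smoothAt φ)]
    simp only [map_add]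

theorem gderiv_map (hu : FinSmoothAt d u x) (L : G →ₗ[ℝ] G') (v) :
    gderiv d x v (fun y => L (u y)) = L (gderiv d x v u) :=
  eq_of_forall_dual fun φ => by
    rw [dual_gderiv (hu.map L)]
    exact (dual_gderiv hu (φ ∘ₗ L) v).symm

theorem gderiv_smul (hu : FinSmoothAt d u x) {f : M → ℝ} (hf : SmoothAt d f x) (v) :
    gderiv d x v (fun y => f y • u y) = vderiv d x v f • u x + f x • gderiv d x v u :=
  eq_of_forall_dual fun φ => by
    rw [dual_gderiv (hu.smul hf), map_add, map_smul, map_smul, dual_gderiv hu]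
    simp only [map_smul, smul_eq_mul]
    exact vderiv_mul hf (hu.smoothAt φ) v

/-- Only u is expanded, as a finite sum of smooth coefficients times constants. Each summand is then
a function times a fixed linear map applied to w, which reduces the rule to the scalar one. -/
theorem gderiv_mul {C : Type*} [Ring C] [Algebra ℝ C] {u w : M → C} (hu : FinSmoothAt d u x)
    (hw : FinSmoothAt d w x) (v) :
    gderiv d x v (fun y => u y * w y) = gderiv d x v u * w x + u x * gderiv d x v w := by
  refine eq_of_forall_dual fun φ => ?_
  obtain ⟨m, c, g, hc, h⟩ := hu
  rw [gderiv_eq hc h]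
  have h1 : (fun y => u y * w y) =ᶠ[𝓝 x] fun y => ∑ a, c a y • (g a * w y) := by
    filter_upwards [h] with y hy
    rw [hy, Finset.sum_mul]
    simp only [smul_mul_assoc]
  have h2 : ∀ a, FinSmoothAt d (fun y => g a * w y) x := fun a => hw.map (LinearMap.mulLeft ℝ (g a))
  have h3 : ∀ a, gderiv d x v (fun y => g a * w y) = g a * gderiv d x v w := fun a =>
    gderiv_map hw (LinearMap.mulLeft ℝ (g a)) v
  have h4 : ∀ a, SmoothAt d (fun y => c a y * φ (g a * w y)) x := fun a =>
    (hc a).mul ((h2 a).smoothAt φ)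
  rw [dual_gderiv (FinSmoothAt.mul ⟨m, c, g, hc, h⟩ hw)]
  have h5 : (fun y => φ (u y * w y)) =ᶠ[𝓝 x] fun y => ∑ a, c a y * φ (g a * w y) := by
    filter_upwards [h1] with y hy
    rw [hy, map_sum]
    simp
  rw [vderiv_congr h5, vderiv_sum _ fun a _ => h4 a, h.self_of_nhds, Finset.sum_mul, Finset.sum_mul,
    ← Finset.sum_add_distrib, map_sum]
  refine Finset.sum_congr rfl fun a _ => ?_
  rw [vderiv_mul (hc a) ((h2 a).smoothAt φ), ← dual_gderiv (h2 a), h3, map_add, smul_mul_assoc,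
    smul_mul_assoc, map_smul, map_smul, smul_eq_mul, smul_eq_mul]

@[simp] theorem gderiv_vec_zero (u : M → G) : gderiv d x 0 u = 0 := by
  by_cases hu : FinSmoothAt d u x
  · exact eq_of_forall_dual fun φ => by rw [dual_gderiv hu, vderiv_vec_zero, map_zero]
  · rw [gderiv, dif_neg fun h => hu h.1]

theorem gderiv_vec_add (hu : FinSmoothAt d u x) (v v') :
    gderiv d x (v + v') u = gderiv d x v u + gderiv d x v' u :=
  eq_of_forall_dual fun φ => by
    rw [map_add, dual_gderiv hu, dual_gderiv hu, dual_gderiv hu, vderiv_vec_add]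

theorem gderiv_vec_smul (hu : FinSmoothAt d u x) (c : ℝ) (v) :
    gderiv d x (c • v) u = c • gderiv d x v u :=
  eq_of_forall_dual fun φ => by
    rw [map_smul, dual_gderiv hu, dual_gderiv hu, vderiv_vec_smul, smul_eq_mul]

theorem contMDiff_dirDeriv [IsManifold (𝓡 d) ∞ M] {U : Opens M} (f : Smooth d U)
    (X : Cₛ^∞⟮𝓡 d; EuclideanSpace ℝ (Fin d), (TangentSpace (𝓡 d) : U → Type _)⟯) :
    ContMDiff (𝓡 d) 𝓘(ℝ, ℝ) ∞ fun x => dirDeriv f x (X x) := by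
  have h1 := (f.contMDiff.contMDiff_tangentMap (m := ∞) (by simp)).comp X.contMDiff
  exact contMDiff_snd_tangentBundle_modelSpace ℝ 𝓘(ℝ, ℝ) |>.comp h1

end VectorValued

theorem FinSmoothAt.sum {d : ℕ} {M : Type*} [TopologicalSpace M]
    [ChartedSpace (EuclideanSpace ℝ (Fin d)) M] {G : Type*} [AddCommGroup G] [Module ℝ G] {x : M}
    {ι : Type*} (t : Finset ι) {u : ι → M → G} (hu : ∀ a ∈ t, FinSmoothAt d (u a) x) :
    FinSmoothAt d (fun y => ∑ a ∈ t, u a y) x := by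
  classical
  induction t using Finset.induction_on with
  | empty => simpa using FinSmoothAt.const (0 : G)
  | insert a t ha ih =>
    simp only [Finset.sum_insert ha]
    exact (hu a (Finset.mem_insert_self _ _)).add (ih fun b hb => hu b (Finset.mem_insert_of_mem hb))

/-! ### Extended duals under isomorphisms and in bases -/

section FibreEquiv

variable {n : ℕ} {V V' : Fin n → Type*} [∀ i, AddCommGroup (V i)] [∀ i, Module ℝ (V i)]
  [∀ i, AddCommGroup (V' i)] [∀ i, Module ℝ (V' i)]

/-- The isomorphism of extended duals induced by a graded isomorphism. -/
def ExtDual.pullbackEquiv (θ : ∀ i, V i ≃ₗ[ℝ] V' i) : ExtDual V' ≃ₗ[ℝ] ExtDual V where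
  __ := ExtDual.pullback fun i => (θ i).toLinearMap
  invFun := ExtDual.pullback fun i => (θ i).symm.toLinearMap
  left_inv w := Prod.ext rfl (funext fun i => LinearMap.ext fun v => by simp)
  right_inv w := Prod.ext rfl (funext fun i => LinearMap.ext fun v => by simp)

theorem ExtDual.pullbackEquiv_homog (θ : ∀ i, V i ≃ₗ[ℝ] V' i) {a : ℤ} {w : ExtDual V'} :
    (ExtDual.pullbackEquiv θ w).IsHomog a ↔ w.IsHomog a :=
  ⟨fun h => by
    rw [← (ExtDual.pullbackEquiv θ).symm_apply_apply w]
    exact ExtDual.pullback_homog _ h, ExtDual.pullback_homog _⟩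

theorem ExtDual.pullbackEquiv_symm_homog (θ : ∀ i, V i ≃ₗ[ℝ] V' i) {a : ℤ} {w : ExtDual V} :
    ((ExtDual.pullbackEquiv θ).symm w).IsHomog a ↔ w.IsHomog a := by
  rw [← ExtDual.pullbackEquiv_homog θ, LinearEquiv.apply_symm_apply]

theorem ExtDual.eq_sum_basis [∀ i, FiniteDimensional ℝ (V i)] (w : ExtDual V) :
    w = w.1 • ((1, 0) : ExtDual V) + ∑ i, ∑ a, w.2 i (Module.finBasis ℝ (V i) a) •
      ((0, Pi.single i ((Module.finBasis ℝ (V i)).coord a)) : ExtDual V) := by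
  refine Prod.ext ?_ (funext fun j => (Module.finBasis ℝ (V j)).ext fun c => ?_)
  · simp [Prod.fst_sum]
  · simp only [Prod.snd_add, Prod.smul_snd, smul_zero, zero_add, Prod.snd_sum, Finset.sum_apply,
      Pi.smul_apply, LinearMap.sum_apply, LinearMap.smul_apply, smul_eq_mul]
    rw [Finset.sum_eq_single j]
    · simp [Finsupp.single_apply]
    · intro i _ hi
      refine Finset.sum_eq_zero fun a _ => ?_
      rw [Pi.single_eq_of_ne hi.symm]
      simp
    · simp

end FibreEquiv

/-! ### Cutting off sections, coordinates in a frame, the local form of a derivation -/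

section Cutoff

variable {d n : ℕ} {M : Type*} [TopologicalSpace M] [ChartedSpace (EuclideanSpace ℝ (Fin d)) M]
  [T2Space M] [IsManifold (𝓡 d) ∞ M]
  {F : Fin n → Type*} [∀ i, NormedAddCommGroup (F i)] [∀ i, NormedSpace ℝ (F i)]
  {E : Fin n → M → Type*} [∀ i x, AddCommGroup (E i x)] [∀ i x, Module ℝ (E i x)]
  [∀ i x, TopologicalSpace (E i x)] [∀ i, TopologicalSpace (TotalSpace (F i) (E i))]
  [∀ i, FiberBundle (F i) (E i)]

/-- Off the support of ρ the function is locally zero; near a point of the support it is a product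
of smooth functions. -/
theorem contMDiff_of_cutoff {W V : Opens M} {x : M} {ρ : M → ℝ} (hρ : IsBump d x V ρ) {f : W → ℝ}
    {g : M → ℝ} (hg : ∀ y ∈ W, y ∈ V → SmoothAt d g y)
    (h : ∀ (y : W), (y : M) ∈ V → f y = ρ y * g y) (h' : ∀ y : W, (y : M) ∉ V → f y = 0) :
    ContMDiff (𝓡 d) 𝓘(ℝ, ℝ) ∞ f := by
  rw [contMDiff_iff_ext0]
  intro y
  by_cases hy : (y : M) ∈ tsupport ρ
  · have hyV : (y : M) ∈ V := hρ.supp hy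
    refine ContMDiffAt.congr_of_eventuallyEq (f := fun z => ρ z * g z)
      ((hρ.smooth y).mul (hg y y.2 hyV)) ?_
    filter_upwards [Opens.eventually_mem hyV, Opens.eventually_mem y.2] with z hz hzW
    rw [ext0_mk _ hzW, h _ hz]
  · refine (contMDiffAt_const (c := (0 : ℝ))).congr_of_eventuallyEq ?_
    filter_upwards [(isClosed_tsupport ρ).isOpen_compl.mem_nhds hy, Opens.eventually_mem y.2]
      with z hz hzW
    rw [ext0_mk _ hzW]
    by_cases hzV : z ∈ V
    · rw [h ⟨z, hzW⟩ hzV, image_eq_zero_of_notMem_tsupport hz, zero_mul]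
    · exact h' ⟨z, hzW⟩ hzV

open Classical in
/-- The family `ρ e` over `U`, for a family `e` over `V` and a function `ρ` vanishing outside `V`. -/
def cutFun (ρ : M → ℝ) {V : Opens M} (e : ∀ y : V, ExtFibre E (y : M)) (U : Opens M) (y : U) :
    ExtFibre E (y : M) :=
  if h : (y : M) ∈ V then ρ y • e ⟨y, h⟩ else 0

theorem cutFun_of_mem (ρ : M → ℝ) {V : Opens M} (e : ∀ y : V, ExtFibre E (y : M)) {U : Opens M}
    {y : U} (h : (y : M) ∈ V) : cutFun ρ e U y = ρ y • e ⟨y, h⟩ := dif_pos h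

theorem cutFun_of_notMem (ρ : M → ℝ) {V : Opens M} (e : ∀ y : V, ExtFibre E (y : M)) {U : Opens M}
    {y : U} (h : (y : M) ∉ V) : cutFun ρ e U y = 0 := dif_neg h

/-- The section `ρ e` over `U`, for a section `e` over `V` and a bump function `ρ` with support
in `V`. -/
def cut {V : Opens M} {x : M} {ρ : M → ℝ} (hρ : IsBump d x V ρ) (U : Opens M) :
    ExtSections F E d V →ₗ[ℝ] ExtSections F E d U where
  toFun e := ⟨cutFun ρ e.1 U, by
    refine contMDiff_of_cutoff hρ (g := ext0 fun z => (e.1 z).1) ?_ ?_ ?_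
    · exact fun y _ hy => contMDiff_iff_ext0.mp e.2.1 ⟨y, hy⟩
    · intro y hy
      rw [cutFun_of_mem ρ _ hy, ext0_mk _ hy]; rfl
    · intro y hy
      rw [cutFun_of_notMem ρ _ hy]; rfl, by
    intro i W hW s hs
    refine contMDiff_of_cutoff hρ (V := V)
      (g := ext0 fun z : (W ⊓ V : Opens M) => (e.1 ⟨z, z.2.2⟩).2 i (s ⟨z, z.2.1⟩)) ?_ ?_ ?_
    · exact fun y hyW hy => contMDiff_iff_ext0.mp (e.2.2 i (W ⊓ V) inf_le_right _
        (IsSmoothSection.restrict inf_le_left hs)) ⟨y, hyW, hy⟩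
    · intro y hy
      have h1 := cutFun_of_mem ρ e.1 (U := U) (y := incl hW y) hy
      beta_reduce
      rw [h1, ext0_mk _ (show (y : M) ∈ W ⊓ V from ⟨y.2, hy⟩)]; rfl
    · intro y hy
      have h1 := cutFun_of_notMem ρ e.1 (U := U) (y := incl hW y) hy
      beta_reduce
      rw [h1]; rfl⟩
  map_add' e e' := Subtype.ext (funext fun y => by
    change cutFun (E := E) ρ (e + e').1 U y = cutFun ρ e.1 U y + cutFun ρ e'.1 U y
    by_cases h : (y : M) ∈ V
    · rw [cutFun_of_mem ρ _ h, cutFun_of_mem ρ _ h, cutFun_of_mem ρ _ h]; exact smul_add _ _ _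
    · rw [cutFun_of_notMem ρ _ h, cutFun_of_notMem ρ _ h, cutFun_of_notMem ρ _ h, add_zero])
  map_smul' c e := Subtype.ext (funext fun y => by
    change cutFun (E := E) ρ (c • e).1 U y = c • cutFun ρ e.1 U y
    by_cases h : (y : M) ∈ V
    · rw [cutFun_of_mem ρ _ h, cutFun_of_mem ρ _ h]; exact smul_comm (ρ y) c (e.1 ⟨y, h⟩)
    · rw [cutFun_of_notMem ρ _ h, cutFun_of_notMem ρ _ h, smul_zero])

section

variable {V : Opens M} {x : M} {ρ : M → ℝ} (hρ : IsBump d x V ρ) {U : Opens M}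
  (e : ExtSections F E d V)

theorem cut_apply {y : U} (h : (y : M) ∈ V) : (cut hρ U e).1 y = ρ y • e.1 ⟨y, h⟩ :=
  cutFun_of_mem ρ _ h

theorem cut_apply_of_notMem {y : U} (h : (y : M) ∉ V) : (cut hρ U e).1 y = 0 :=
  cutFun_of_notMem ρ _ h

theorem cut_homog {a : ℤ} (he : IsHomogSection F E a e) : IsHomogSection F E a (cut hρ U e) := by
  intro y
  by_cases h : (y : M) ∈ V
  · rw [cut_apply hρ e h]; exact (he _).smul _
  · rw [cut_apply_of_notMem hρ e h]; exact ExtDual.IsHomog.zero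

theorem IsBump.exists_opens {V' : Opens M} {x : M} {ρ : M → ℝ} (hρ : IsBump d x V' ρ) {V : Opens M}
    (hV : x ∈ V) : ∃ W : Opens M, x ∈ W ∧ W ≤ V ∧ ∀ y ∈ W, ρ y = 1 := by
  obtain ⟨O, hO, hOo, hxO⟩ := eventually_nhds_iff.mp (hρ.one.and (Opens.eventually_mem hV))
  exact ⟨⟨O, hOo⟩, hxO, fun y hy => (hO y hy).2, fun y hy => (hO y hy).1⟩

end

variable {V₀ : Fin n → Type*} [∀ i, AddCommGroup (V₀ i)] [∀ i, Module ℝ (V₀ i)]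
  {W : Opens M} (Θ : LocFrame F E d V₀ W)

namespace LocFrame

/-- The identification of the fibre of `E_ℝ^*` at `x` with the typical fibre. -/
def fib (x : W) : ExtFibre E (x : M) ≃ₗ[ℝ] ExtDual V₀ := ExtDual.pullbackEquiv (Θ.toEquiv x)

/-- The section of `E_ℝ^*` with constant coordinates. -/
def constSec : ExtDual V₀ →ₗ[ℝ] ExtSections F E d W where
  toFun a := ⟨fun x => (Θ.fib x).symm a, contMDiff_const, fun i => Θ.smooth_symm i (a.2 i)⟩
  map_add' _ _ := Subtype.ext (funext fun _ => map_add _ _ _)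
  map_smul' c a := Subtype.ext (funext fun x => map_smul (Θ.fib x).symm c a)

theorem constSec_apply (a : ExtDual V₀) (x : W) : (Θ.constSec a).1 x = (Θ.fib x).symm a := rfl

open Classical in
/-- The coordinates of a section of `E_ℝ^*`. -/
def hat {U : Opens M} (e : ExtSections F E d U) (y : M) : ExtDual V₀ :=
  if h : y ∈ W ∧ y ∈ U then Θ.fib ⟨y, h.1⟩ (e.1 ⟨y, h.2⟩) else 0

theorem hat_apply {U : Opens M} (e : ExtSections F E d U) {y : M} (hW : y ∈ W) (hU : y ∈ U) :
    Θ.hat e y = Θ.fib ⟨y, hW⟩ (e.1 ⟨y, hU⟩) := dif_pos ⟨hW, hU⟩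

theorem fib_symm_hat {U : Opens M} (e : ExtSections F E d U) {y : M} (hW : y ∈ W) (hU : y ∈ U) :
    (Θ.fib ⟨y, hW⟩).symm (Θ.hat e y) = e.1 ⟨y, hU⟩ := by
  rw [Θ.hat_apply e hW hU, LinearEquiv.symm_apply_apply]

theorem hat_add {U : Opens M} (e e' : ExtSections F E d U) (y : M) :
    Θ.hat (e + e') y = Θ.hat e y + Θ.hat e' y := by
  by_cases h : y ∈ W ∧ y ∈ U
  · rw [Θ.hat_apply _ h.1 h.2, Θ.hat_apply _ h.1 h.2, Θ.hat_apply _ h.1 h.2, ← map_add]; rfl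
  · rw [hat, hat, hat, dif_neg h, dif_neg h, dif_neg h, add_zero]

theorem hat_smul {U : Opens M} (f : Smooth d U) (e : ExtSections F E d U) (y : M) :
    Θ.hat (f • e) y = ext0 f y • Θ.hat e y := by
  by_cases h : y ∈ W ∧ y ∈ U
  · rw [Θ.hat_apply _ h.1 h.2, Θ.hat_apply _ h.1 h.2, ext0_mk _ h.2, ← map_smul]; rfl
  · rw [hat, hat, dif_neg h, dif_neg h, smul_zero]

theorem hat_const_smul {U : Opens M} (c : ℝ) (e : ExtSections F E d U) (y : M) :
    Θ.hat (c • e) y = c • Θ.hat e y := by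
  by_cases h : y ∈ W ∧ y ∈ U
  · rw [Θ.hat_apply _ h.1 h.2, Θ.hat_apply _ h.1 h.2, ← map_smul]; rfl
  · rw [hat, hat, dif_neg h, dif_neg h, smul_zero]

theorem hat_homog {U : Opens M} {a : ℤ} {e : ExtSections F E d U} (he : IsHomogSection F E a e)
    (y : M) : (Θ.hat e y).IsHomog a := by
  rw [hat]
  split_ifs with h
  · exact (ExtDual.pullbackEquiv_homog _).mpr (he _)
  · exact ExtDual.IsHomog.zero

theorem hat_constSec (a : ExtDual V₀) {y : M} (hy : y ∈ W) : Θ.hat (Θ.constSec a) y = a := by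
  rw [Θ.hat_apply _ hy hy, constSec_apply, LinearEquiv.apply_symm_apply]

theorem hat_cut {x : M} {ρ : M → ℝ} {V : Opens M} (hρ : IsBump d x V ρ) {U : Opens M}
    (e : ExtSections F E d V) {y : M} (hW : y ∈ W) (hU : y ∈ U) :
    Θ.hat (cut hρ U e) y = ρ y • Θ.hat e y := by
  rw [Θ.hat_apply _ hW hU]
  by_cases h : y ∈ V
  · rw [cut_apply (U := U) hρ e (y := ⟨y, hU⟩) h, map_smul, Θ.hat_apply _ hW h]
  · rw [cut_apply_of_notMem (U := U) hρ e (y := ⟨y, hU⟩) h, map_zero, hρ.eq_zero h, zero_smul]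

theorem hat_restrict {U V : Opens M} (h : V ≤ U) (e : ExtSections F E d U) {y : M} (hV : y ∈ V) :
    Θ.hat (extRestrict F E d h e) y = Θ.hat e y := by
  by_cases hW : y ∈ W
  · rw [Θ.hat_apply _ hW hV, Θ.hat_apply _ hW (h hV)]; rfl
  · rw [hat, hat, dif_neg fun h => hW h.1, dif_neg fun h => hW h.1]

theorem finSmoothAt_hat [∀ i, FiniteDimensional ℝ (V₀ i)] {U : Opens M} (e : ExtSections F E d U)
    {x : M} (hW : x ∈ W) (hU : x ∈ U) : FinSmoothAt d (Θ.hat e) x := by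
  have h1 : Θ.hat e = fun y => (Θ.hat e y).1 • ((1, 0) : ExtDual V₀) + ∑ i, ∑ a,
      (Θ.hat e y).2 i (Module.finBasis ℝ (V₀ i) a) •
      ((0, Pi.single i ((Module.finBasis ℝ (V₀ i)).coord a)) : ExtDual V₀) :=
    funext fun y => ExtDual.eq_sum_basis _
  rw [h1]
  refine FinSmoothAt.add (.smul (.const _) ?_)
    (FinSmoothAt.sum _ fun i _ => FinSmoothAt.sum _ fun a _ => .smul (.const _) ?_)
  · refine ContMDiffAt.congr_of_eventuallyEq (contMDiff_iff_ext0.mp e.2.1 ⟨x, hU⟩) ?_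
    filter_upwards [Opens.eventually_mem hW, Opens.eventually_mem hU] with y hyW hyU
    rw [Θ.hat_apply e hyW hyU, ext0_mk _ hyU]
    rfl
  · refine ContMDiffAt.congr_of_eventuallyEq (contMDiff_iff_ext0.mp (e.2.2 i (U ⊓ W) inf_le_left _
      (IsSmoothSection.restrict inf_le_right (Θ.smooth i (Module.finBasis ℝ (V₀ i) a))))
        ⟨x, hU, hW⟩) ?_
    filter_upwards [Opens.eventually_mem hW, Opens.eventually_mem hU] with y hyW hyU
    rw [Θ.hat_apply e hyW hyU, ext0_mk _ (show y ∈ U ⊓ W from ⟨hyU, hyW⟩)]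
    rfl

end LocFrame

variable [∀ i, FiniteDimensional ℝ (V₀ i)]

/-- The form in a local trivialization of a derivation at a point. -/
theorem LocFrame.exists_form {U : Opens M} {x : M} (hU : x ∈ U)
    (hW : x ∈ W) (L : ExtSections F E d U →ₗ[ℝ] ExtFibre E x) (v : EuclideanSpace ℝ (Fin d))
    (hL : ∀ (f : Smooth d U) e, L (f • e) = vderiv d x v (ext0 f) • e.1 ⟨x, hU⟩ +
      f ⟨x, hU⟩ • L e) :
    ∃ δ : ExtDual V₀ →ₗ[ℝ] ExtDual V₀,
      (∀ e, L e = (Θ.fib ⟨x, hW⟩).symm (gderiv d x v (Θ.hat e) + δ (Θ.hat e x))) ∧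
      ∀ k : ℤ, (∀ a e, IsHomogSection F E a e → (L e).IsHomog (a + k)) →
        ∀ a w, ExtDual.IsHomog a w → (δ w).IsHomog (a + k) := by
  obtain ⟨ρ, hρ⟩ := exists_isBump (d := d) hW
  obtain ⟨ρ', hρ'⟩ := exists_isBump (d := d) (V := W ⊓ U) ⟨hW, hU⟩
  -- On sections with constant coordinates the derivative term vanishes, so δ has to be L on these,
  -- cut off by ρ to be defined over U.
  let δ : ExtDual V₀ →ₗ[ℝ] ExtDual V₀ :=
    (Θ.fib ⟨x, hW⟩).toLinearMap ∘ₗ L ∘ₗ cut hρ U ∘ₗ Θ.constSec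
  refine ⟨δ, fun e => ?_, fun k hk a w hw => ?_⟩
  · let b := Module.finBasis ℝ (ExtDual V₀)
    let c := fun j y => b.coord j (Θ.hat e y)
    have hc : ∀ j, ∀ y ∈ W ⊓ U, SmoothAt d (c j) y := fun j y hy =>
      (Θ.finSmoothAt_hat e hy.1 hy.2).smoothAt (b.coord j)
    let f : Fin _ → Smooth d U := fun j => Smooth.ofGlobal U (fun y => ρ' y * c j y)
      (smoothAt_mul_of_tsupport hρ'.smooth fun y hy => hc j y (hρ'.supp hy))
    -- The expansion of e in frame sections is available only over W. After multiplication by g = ρ'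
    -- ρ, which is 1 near x, it becomes an identity over all of U: ρ' extends the coefficients and ρ
    -- the frame sections.
    let g : Smooth d U := Smooth.ofGlobal U (fun y => ρ' y * ρ y) (hρ'.smooth.mul hρ.smooth)
    have h1 : g • e = ∑ j, f j • cut hρ U (Θ.constSec (b j)) := by
      refine Subtype.ext (funext fun y => ?_)
      have h2 : (∑ j, f j • cut hρ U (Θ.constSec (b j)) : ExtSections F E d U).1 y =
          ∑ j, (ρ' y * c j y) • (cut hρ U (Θ.constSec (b j))).1 y := by
        have : ∀ s : Finset (Fin (Module.finrank ℝ (ExtDual V₀))),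
            (∑ j ∈ s, f j • cut hρ U (Θ.constSec (b j)) : ExtSections F E d U).1 y =
            ∑ j ∈ s, (ρ' y * c j y) • (cut hρ U (Θ.constSec (b j))).1 y := by
          intro s
          classical
          induction s using Finset.induction_on with
          | empty => rfl
          | insert j s hj ih => rw [Finset.sum_insert hj, Finset.sum_insert hj, ← ih]; rfl
        exact this Finset.univ
      rw [h2]
      change (ρ' y * ρ y) • e.1 y = _
      by_cases hy : (y : M) ∈ W
      · have h3 : e.1 y = ∑ j, c j y • (Θ.fib ⟨y, hy⟩).symm (b j) := by
          refine (Θ.fib_symm_hat e hy y.2).symm.trans ?_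
          exact basis_map_eq_sum b (Θ.fib ⟨y, hy⟩).symm.toLinearMap _
        rw [h3, Finset.smul_sum]
        refine Finset.sum_congr rfl fun j _ => ?_
        rw [cut_apply hρ _ hy, constSec_apply, smul_smul, smul_smul]
        congr 1
        ring
      · have h3 : ρ' y = 0 := hρ'.eq_zero fun h => hy h.1
        simp [h3]
    have hg : ext0 g =ᶠ[𝓝 x] fun _ => 1 := by
      filter_upwards [hρ.one, hρ'.one, Opens.eventually_mem hU] with y h1 h2 h3
      rw [ext0_mk _ h3]
      change ρ' y * ρ y = 1
      rw [h1, h2, one_mul]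
    have hf : ∀ j, ext0 (f j) =ᶠ[𝓝 x] c j := by
      intro j
      filter_upwards [hρ'.one, Opens.eventually_mem hU] with y h2 h3
      rw [ext0_mk _ h3]
      change ρ' y * c j y = c j y
      rw [h2, one_mul]
    have h4 : L e = L (g • e) := by
      rw [hL, vderiv_congr hg, vderiv_const, zero_smul, zero_add, ← ext0_mk g hU, hg.self_of_nhds,
        one_smul]
    rw [h4, h1, map_sum, map_add, gderiv_eq (c := c) (g := b) (fun j => hc j x ⟨hW, hU⟩)
      (Filter.Eventually.of_forall fun y => (b.sum_repr (Θ.hat e y)).symm), basis_map_eq_sum b δ,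
      map_sum, map_sum, ← Finset.sum_add_distrib]
    refine Finset.sum_congr rfl fun j _ => ?_
    rw [hL, vderiv_congr (hf j), cut_apply (U := U) hρ _ (y := ⟨x, hU⟩) hW, ← ext0_mk (f j) hU,
      (hf j).self_of_nhds, map_smul, map_smul, constSec_apply]
    change vderiv d x v (c j) • ρ x • (Θ.fib ⟨x, hW⟩).symm (b j) + _ = _ + c j x •
      (Θ.fib ⟨x, hW⟩).symm (Θ.fib ⟨x, hW⟩ (L (cut hρ U (Θ.constSec (b j)))))
    rw [hρ.apply_self, one_smul, LinearEquiv.symm_apply_apply]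
  · refine (ExtDual.pullbackEquiv_homog _).mpr (hk a _ (cut_homog hρ _ fun y => ?_))
    exact (ExtDual.pullbackEquiv_symm_homog _).mpr hw

end Cutoff

/-! ### Bilinear Leibniz rule, degrees, and vectors with zero derivative -/

section VectorValued

variable {d : ℕ} {M : Type*} [TopologicalSpace M] [ChartedSpace (EuclideanSpace ℝ (Fin d)) M]
  {x : M}

theorem gderiv_sum {ι G : Type*} [AddCommGroup G] [Module ℝ G] (t : Finset ι) {u : ι → M → G}
    (hu : ∀ a ∈ t, FinSmoothAt d (u a) x) (v) :
    gderiv d x v (fun y => ∑ a ∈ t, u a y) = ∑ a ∈ t, gderiv d x v (u a) := by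
  classical
  induction t using Finset.induction_on with
  | empty => simp
  | insert a t ha ih =>
    have hu' : ∀ b ∈ t, FinSmoothAt d (u b) x := fun b hb => hu b (Finset.mem_insert_of_mem hb)
    simp only [Finset.sum_insert ha]
    rw [gderiv_add (hu a (Finset.mem_insert_self _ _)) (FinSmoothAt.sum t hu'), ih hu']

theorem gderiv_bilin {G₁ G₂ G₃ : Type*} [AddCommGroup G₁] [Module ℝ G₁] [AddCommGroup G₂]
    [Module ℝ G₂] [AddCommGroup G₃] [Module ℝ G₃] {u : M → G₁} {w : M → G₂}
    (hu : FinSmoothAt d u x) (hw : FinSmoothAt d w x) (β : G₁ →ₗ[ℝ] G₂ →ₗ[ℝ] G₃) (v) :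
    gderiv d x v (fun y => β (u y) (w y)) =
      β (gderiv d x v u) (w x) + β (u x) (gderiv d x v w) := by
  obtain ⟨m, c, g, hc, h⟩ := hu
  have h1 : (fun y => β (u y) (w y)) =ᶠ[𝓝 x] fun y => ∑ a, c a y • β (g a) (w y) := by
    filter_upwards [h] with y hy
    rw [hy, map_sum, LinearMap.sum_apply]
    simp only [map_smul, LinearMap.smul_apply]
  rw [gderiv_congr h1, gderiv_sum _ fun a _ => (hw.map (β (g a))).smul (hc a), gderiv_eq hc h,
    h.self_of_nhds, map_sum, map_sum, LinearMap.sum_apply, LinearMap.sum_apply,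
    ← Finset.sum_add_distrib]
  refine Finset.sum_congr rfl fun a _ => ?_
  rw [gderiv_smul (hw.map (β (g a))) (hc a), gderiv_map hw (β (g a))]
  simp only [map_smul, LinearMap.smul_apply]

theorem gderiv_homog {n : ℕ} {V : Fin n → Type*} [∀ i, AddCommGroup (V i)] [∀ i, Module ℝ (V i)]
    {u : M → ExtDual V} (hu : FinSmoothAt d u x) {a : ℤ} (h : ∀ y, (u y).IsHomog a) (v) :
    (gderiv d x v u).IsHomog a := by
  refine ⟨fun ha => ?_, fun i hi => ?_⟩
  · have h1 := gderiv_map hu (LinearMap.fst ℝ ℝ (∀ i, Module.Dual ℝ (V i))) v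
    refine h1.symm.trans ?_
    have : (fun y => LinearMap.fst ℝ ℝ (∀ i, Module.Dual ℝ (V i)) (u y)) = fun _ => 0 :=
      funext fun y => (h y).1 ha
    rw [this, gderiv_const]
  · have h1 := gderiv_map hu
      (LinearMap.proj i ∘ₗ LinearMap.snd ℝ ℝ (∀ i, Module.Dual ℝ (V i))) v
    refine h1.symm.trans ?_
    have : (fun y => (LinearMap.proj i ∘ₗ LinearMap.snd ℝ ℝ (∀ i, Module.Dual ℝ (V i))) (u y)) =
      fun _ => 0 := funext fun y => (h y).2 i hi
    rw [this, gderiv_const]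

/-- Testing on cut-off chart coordinates returns the components of v. -/
theorem eq_zero_of_vderiv_eq_zero [T2Space M] [IsManifold (𝓡 d) ∞ M]
    {v : EuclideanSpace ℝ (Fin d)} {U : Opens M} (hU : x ∈ U)
    (h : ∀ f : Smooth d U, vderiv d x v (ext0 f) = 0) : v = 0 := by
  obtain ⟨ρ, hρ⟩ := exists_isBump (d := d)
    (V := ⟨_, (chartAt (EuclideanSpace ℝ (Fin d)) x).open_source⟩) (mem_chart_source _ x)
  ext i
  let g : M → ℝ := fun y => (extChartAt (𝓡 d) x y) i
  have hg : ∀ y ∈ (chartAt (EuclideanSpace ℝ (Fin d)) x).source, SmoothAt d g y := fun y hy =>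
    SmoothAt.of_chart hy (EuclideanSpace.proj (𝕜 := ℝ) i).contDiff
  have h1 := h (Smooth.ofGlobal U (fun y => ρ y * g y)
    (smoothAt_mul_of_tsupport hρ.smooth fun y hy => hg y (hρ.supp hy)))
  have h2 : ext0 (Smooth.ofGlobal (d := d) U (fun y => ρ y * g y)
      (smoothAt_mul_of_tsupport hρ.smooth fun y hy => hg y (hρ.supp hy))) =ᶠ[𝓝 x] g := by
    filter_upwards [hρ.one, Opens.eventually_mem hU] with y hy hyU
    rw [ext0_mk _ hyU, Smooth.ofGlobal_apply]
    change ρ y * g y = g y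
    rw [hy, one_mul]
  rw [vderiv_congr h2] at h1
  have h3 : g ∘ (extChartAt (𝓡 d) x).symm =ᶠ[𝓝 (extChartAt (𝓡 d) x x)]
      (EuclideanSpace.proj (𝕜 := ℝ) i : EuclideanSpace ℝ (Fin d) →L[ℝ] ℝ) := by
    filter_upwards [extChartAt_target_mem_nhds (I := 𝓡 d) x] with y hy
    simp only [Function.comp_apply, g]
    rw [(extChartAt (𝓡 d) x).right_inv hy]
    rfl
  rw [vderiv, h3.fderiv_eq, ContinuousLinearMap.fderiv] at h1
  exact h1

end VectorValued

/-! ### The model for the fibres of Der(E_ℝ^*, m)_k -/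

section Model

variable {n : ℕ} {V : Fin n → Type*} [∀ i, AddCommGroup (V i)] [∀ i, Module ℝ (V i)]

/-- The graded derivations of degree `k` of the extended algebra, in the degrees `≤ n`. -/
def modelDer (μ : (∀ i, V i) →ₗ[ℝ] (∀ i, V i) ⊗[ℝ] (∀ i, V i)) (k : ℤ) :
    Submodule ℝ (ExtDual V →ₗ[ℝ] ExtDual V) where
  carrier := {δ | (∀ (a : ℤ) w, ExtDual.IsHomog a w → (δ w).IsHomog (a + k)) ∧
    ∀ (a b : ℤ) w w', ExtDual.IsHomog a w → ExtDual.IsHomog b w' → a + b ≤ n →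
      δ (extMul μ w w') = extMul μ (δ w) w' + (k * a).negOnePow • extMul μ w (δ w')}
  add_mem' := by
    rintro δ δ' ⟨h, h'⟩ ⟨g, g'⟩
    refine ⟨fun a w hw => (h a w hw).add (g a w hw), fun a b w w' hw hw' hab => ?_⟩
    simp only [LinearMap.add_apply, h' a b w w' hw hw' hab, g' a b w w' hw hw' hab,
      extMul_add_left, extMul_add_right, smul_add]
    abel
  zero_mem' := ⟨fun a w _ => ExtDual.IsHomog.zero, fun a b w w' _ _ _ => by
    have h1 := extMul_smul_left μ 0 0 w'
    have h2 := extMul_smul_right μ 0 w 0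
    rw [zero_smul, zero_smul] at h1 h2
    simp only [LinearMap.zero_apply, h1, h2, smul_zero, add_zero]⟩
  smul_mem' := by
    rintro c δ ⟨h, h'⟩
    refine ⟨fun a w hw => (h a w hw).smul c, fun a b w w' hw hw' hab => ?_⟩
    simp only [LinearMap.smul_apply, h' a b w w' hw hw' hab, extMul_smul_left, extMul_smul_right,
      smul_add]
    rw [smul_comm c]

/-- The symbols of derivations of degree `k` at a point. -/
def symbolSpace (d : ℕ) (k : ℤ) : Submodule ℝ (EuclideanSpace ℝ (Fin d)) where
  carrier := {v | k ≠ 0 → v = 0}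
  add_mem' h h' hk := by rw [h hk, h' hk, add_zero]
  zero_mem' _ := rfl
  smul_mem' c v h hk := by rw [h hk, smul_zero]

end Model

/-! ### Derivations at a point, read in a frame -/

section Frames

variable {d n : ℕ} {M : Type*} [TopologicalSpace M] [ChartedSpace (EuclideanSpace ℝ (Fin d)) M]
  [T2Space M] [IsManifold (𝓡 d) ∞ M]
  {F : Fin n → Type*} [∀ i, NormedAddCommGroup (F i)] [∀ i, NormedSpace ℝ (F i)]
  {E : Fin n → M → Type*} [∀ i x, AddCommGroup (E i x)] [∀ i x, Module ℝ (E i x)]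
  [∀ i x, TopologicalSpace (E i x)] [∀ i, TopologicalSpace (TotalSpace (F i) (E i))]
  [∀ i, FiberBundle (F i) (E i)]
  {V₀ : Fin n → Type*} [∀ i, AddCommGroup (V₀ i)] [∀ i, Module ℝ (V₀ i)]
  [∀ i, FiniteDimensional ℝ (V₀ i)]
  {W : Opens M} (Θ : LocFrame F E d V₀ W)

/-- The section `1` of `E_ℝ^*`. -/
def oneSec (F : Fin n → Type*) [∀ i, NormedAddCommGroup (F i)] [∀ i, NormedSpace ℝ (F i)]
    (E : Fin n → M → Type*) [∀ i x, AddCommGroup (E i x)] [∀ i x, Module ℝ (E i x)]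
    [∀ i x, TopologicalSpace (E i x)] [∀ i, TopologicalSpace (TotalSpace (F i) (E i))]
    [∀ i, FiberBundle (F i) (E i)] (d : ℕ) [ChartedSpace (EuclideanSpace ℝ (Fin d)) M]
    (U : Opens M) : ExtSections F E d U :=
  ⟨fun _ => (1, 0), contMDiff_const, fun _ _ _ _ _ => contMDiff_const⟩

theorem oneSec_apply {U : Opens M} (x : U) : (oneSec F E d U).1 x = (1, 0) := rfl

theorem oneSec_homog {U : Opens M} : IsHomogSection F E 0 (oneSec F E d U) :=
  fun _ => ExtDual.isHomog_scalar 1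

namespace LocFrame

/-- The derivation at `x` with symbol `v` and coordinate matrix `δ`. -/
def pointDer (x : W) {U : Opens M} (hU : (x : M) ∈ U) :
    (EuclideanSpace ℝ (Fin d) × (ExtDual V₀ →ₗ[ℝ] ExtDual V₀)) →ₗ[ℝ]
      (ExtSections F E d U →ₗ[ℝ] ExtFibre E (x : M)) :=
  LinearMap.mk₂ ℝ
    (fun P e => (Θ.fib x).symm (gderiv d (x : M) P.1 (Θ.hat e) + P.2 (Θ.hat e x)))
    (fun P Q e => by
      rw [Prod.fst_add, Prod.snd_add, gderiv_vec_add (Θ.finSmoothAt_hat e x.2 hU), ← map_add,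
        LinearMap.add_apply]
      congr 1; abel)
    (fun c P e => by
      rw [Prod.smul_fst, Prod.smul_snd, gderiv_vec_smul (Θ.finSmoothAt_hat e x.2 hU), ← map_smul,
        LinearMap.smul_apply, smul_add])
    (fun P e e' => by
      have h : Θ.hat (e + e') = fun y => Θ.hat e y + Θ.hat e' y := funext (Θ.hat_add e e')
      rw [h, gderiv_add (Θ.finSmoothAt_hat e x.2 hU) (Θ.finSmoothAt_hat e' x.2 hU), ← map_add,
        map_add P.2]
      congr 1; abel)
    (fun c P e => by
      have h : Θ.hat (c • e) = fun y => (c • LinearMap.id : ExtDual V₀ →ₗ[ℝ] ExtDual V₀)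
        (Θ.hat e y) := funext (Θ.hat_const_smul c e)
      rw [h, gderiv_map (Θ.finSmoothAt_hat e x.2 hU)]
      change (Θ.fib x).symm (c • gderiv d (x : M) P.1 (Θ.hat e) + P.2 (c • Θ.hat e x)) = _
      rw [map_smul P.2, ← smul_add, map_smul])

theorem pointDer_apply (x : W) {U : Opens M} (hU : (x : M) ∈ U) (P) (e : ExtSections F E d U) :
    Θ.pointDer x hU P e = (Θ.fib x).symm (gderiv d (x : M) P.1 (Θ.hat e) + P.2 (Θ.hat e x)) := rfl

theorem pointDer_smul (x : W) {U : Opens M} (hU : (x : M) ∈ U) (P) (f : Smooth d U)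
    (e : ExtSections F E d U) : Θ.pointDer x hU P (f • e) =
      vderiv d (x : M) P.1 (ext0 f) • e.1 ⟨x, hU⟩ + f ⟨x, hU⟩ • Θ.pointDer x hU P e := by
  have h : Θ.hat (f • e) = fun y => ext0 f y • Θ.hat e y := funext (Θ.hat_smul f e)
  rw [pointDer_apply, pointDer_apply, h,
    gderiv_smul (Θ.finSmoothAt_hat e x.2 hU) (f.smoothAt ⟨x, hU⟩), ← Θ.fib_symm_hat e x.2 hU,
    ← map_smul, ← map_smul, ← map_add, map_smul P.2, smul_add]
  simp only [ext0_mk f hU]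
  congr 1; abel

theorem pointDer_homog (x : W) {U : Opens M} (hU : (x : M) ∈ U) {k : ℤ}
    {P : EuclideanSpace ℝ (Fin d) × (ExtDual V₀ →ₗ[ℝ] ExtDual V₀)} (hv : P.1 ∈ symbolSpace d k)
    (hδ : ∀ (a : ℤ) w, ExtDual.IsHomog a w → (P.2 w).IsHomog (a + k)) {a : ℤ}
    {e : ExtSections F E d U} (he : IsHomogSection F E a e) :
    (Θ.pointDer x hU P e).IsHomog (a + k) := by
  refine (ExtDual.pullbackEquiv_symm_homog _).mpr (.add ?_ (hδ a _ (Θ.hat_homog he _)))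
  by_cases hk : k = 0
  · subst hk
    rw [add_zero]
    exact gderiv_homog (Θ.finSmoothAt_hat e x.2 hU) (Θ.hat_homog he) _
  · rw [hv hk, gderiv_vec_zero]
    exact ExtDual.IsHomog.zero

/-- The derivative of a locally constant function is zero, so sections of this kind isolate the
matrix part. -/
theorem pointDer_of_eventuallyEq (x : W) {U : Opens M} (hU : (x : M) ∈ U) (P)
    {e : ExtSections F E d U} {w : ExtDual V₀} (h : Θ.hat e =ᶠ[𝓝 (x : M)] fun _ => w) :
    Θ.pointDer x hU P e = (Θ.fib x).symm (P.2 w) := by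
  rw [pointDer_apply, gderiv_congr h, gderiv_const, zero_add, h.self_of_nhds]

theorem hat_oneSec {U : Opens M} {y : M} (hW : y ∈ W) (hU : y ∈ U) :
    Θ.hat (oneSec F E d U) y = (1, 0) := by
  rw [Θ.hat_apply _ hW hU]
  exact Prod.ext rfl (funext fun i => LinearMap.zero_comp _)

theorem hat_cut_constSec {x : M} {ρ : M → ℝ} (hρ : IsBump d x W ρ) (hx : x ∈ W) {U : Opens M}
    (hU : x ∈ U) (w : ExtDual V₀) :
    Θ.hat (cut hρ U (Θ.constSec w)) =ᶠ[𝓝 x] fun _ => w := by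
  filter_upwards [hρ.one, Opens.eventually_mem hx, Opens.eventually_mem hU] with y h1 hW hU
  rw [Θ.hat_cut hρ _ hW hU, h1, one_smul, Θ.hat_constSec w hW]

/-- Sections with coordinates constant near x determine the matrix; then the multiples f · 1
determine the symbol. -/
theorem pointDer_injective (x : W) {U : Opens M} (hU : (x : M) ∈ U) :
    Function.Injective (Θ.pointDer x hU) := by
  intro P Q hPQ
  obtain ⟨ρ, hρ⟩ := exists_isBump (d := d) x.2
  have h2 : P.2 = Q.2 := LinearMap.ext fun w => by
    have h3 := LinearMap.congr_fun hPQ (cut hρ U (Θ.constSec w))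
    rw [Θ.pointDer_of_eventuallyEq x hU P (Θ.hat_cut_constSec hρ x.2 hU w),
      Θ.pointDer_of_eventuallyEq x hU Q (Θ.hat_cut_constSec hρ x.2 hU w)] at h3
    exact (Θ.fib x).symm.injective h3
  refine Prod.ext (sub_eq_zero.mp (eq_zero_of_vderiv_eq_zero hU fun f => ?_)) h2
  have h3 := LinearMap.congr_fun hPQ (f • oneSec F E d U)
  have h4 := LinearMap.congr_fun hPQ (oneSec F E d U)
  rw [pointDer_smul, pointDer_smul, h4] at h3
  have h5 := congrArg Prod.fst (add_right_cancel h3)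
  have h6 : vderiv d (x : M) P.1 (ext0 f) = vderiv d (x : M) Q.1 (ext0 f) := by
    simpa [oneSec_apply] using h5
  have h7 : vderiv d (x : M) (P.1 - Q.1) (ext0 f) =
      vderiv d (x : M) P.1 (ext0 f) - vderiv d (x : M) Q.1 (ext0 f) := map_sub _ _ _
  rw [h7, h6, sub_self]

variable (B : CoalgebraBundle F E d) {μ₀ : (∀ i, V₀ i) →ₗ[ℝ] (∀ i, V₀ i) ⊗[ℝ] (∀ i, V₀ i)}

variable {Θ B} in
theorem Intertwines.fib_extMul (hΘ : Θ.Intertwines B μ₀) (x : W) (w w' : ExtFibre E (x : M)) :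
    Θ.fib x (extMul (B.μ x) w w') = extMul μ₀ (Θ.fib x w) (Θ.fib x w') :=
  ExtDual.pullback_extMul _ (hΘ x) w w'

variable {Θ B} in
theorem Intertwines.fib_symm_extMul (hΘ : Θ.Intertwines B μ₀) (x : W) (w w' : ExtDual V₀) :
    (Θ.fib x).symm (extMul μ₀ w w') = extMul (B.μ x) ((Θ.fib x).symm w) ((Θ.fib x).symm w') := by
  rw [LinearEquiv.symm_apply_eq, hΘ.fib_extMul, LinearEquiv.apply_symm_apply,
    LinearEquiv.apply_symm_apply]

variable {Θ B} in
theorem Intertwines.hat_mul (hΘ : Θ.Intertwines B μ₀) {U : Opens M} (e e' : ExtSections F E d U)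
    {y : M} (hW : y ∈ W) (hU : y ∈ U) :
    Θ.hat (B.mul e e') y = extMul μ₀ (Θ.hat e y) (Θ.hat e' y) := by
  rw [Θ.hat_apply _ hW hU, Θ.hat_apply _ hW hU, Θ.hat_apply _ hW hU, ← hΘ.fib_extMul]
  rfl

variable {Θ B} in
-- In an intertwining frame the multiplication has constant coefficients, so the directional
-- derivative satisfies a Leibniz rule for m by itself. Compatibility becomes a condition on the
-- matrix alone, independent of the point and of the symbol.
theorem Intertwines.map_pointDer (hΘ : Θ.Intertwines B μ₀) (k : ℤ) (x : W) :
    ((symbolSpace d k).prod (modelDer μ₀ k)).map (Θ.pointDer x (U := ⊤) (Opens.mem_top _)) =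
      B.compatFibre k (x : M) := by
  refine le_antisymm ?_ ?_
  · rintro _ ⟨P, ⟨hv, hδ, hm⟩, rfl⟩
    refine ⟨⟨⟨P.1, fun f e => ?_⟩, fun a e he => Θ.pointDer_homog x (Opens.mem_top _) hv hδ he⟩,
      fun a b e e' he he' hab => ?_⟩
    · rw [pointDer_smul, dirDeriv_eq_vderiv]; rfl
    · have h1 : Θ.hat (B.mul e e') =ᶠ[𝓝 (x : M)] fun y => extMulLeft μ₀ (Θ.hat e y) (Θ.hat e' y) := by
        filter_upwards [Opens.eventually_mem x.2] with y hy
        exact hΘ.hat_mul e e' hy (Opens.mem_top _)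
      -- The directional derivative obeys the unsigned Leibniz rule. The sign (-1)^(ka) can differ
      -- from 1 only for k ≠ 0, and then the symbol, and with it this term, vanishes.
      have hs : (k * a).negOnePow • extMul μ₀ (Θ.hat e x) (gderiv d (x : M) P.1 (Θ.hat e')) =
          extMul μ₀ (Θ.hat e x) (gderiv d (x : M) P.1 (Θ.hat e')) := by
        by_cases hk : k = 0
        · rw [hk, zero_mul, Int.negOnePow_zero, one_smul]
        · rw [hv hk, gderiv_vec_zero, ← extMulLeft_apply, map_zero, smul_zero]
      have hx : ∀ e : ExtSections F E d ⊤, valAt e (x : M) = (Θ.fib x).symm (Θ.hat e x) :=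
        fun e => (Θ.fib_symm_hat e x.2 (Opens.mem_top _)).symm
      rw [pointDer_apply, gderiv_congr h1, h1.self_of_nhds,
        gderiv_bilin (Θ.finSmoothAt_hat e x.2 (Opens.mem_top _)) (Θ.finSmoothAt_hat e' x.2 (Opens.mem_top _)),
        extMulLeft_apply, extMulLeft_apply]
      beta_reduce
      rw [extMulLeft_apply, hm a b _ _ (Θ.hat_homog he x) (Θ.hat_homog he' x) hab, ← hs, hx, hx, pointDer_apply,
        pointDer_apply, ← hΘ.fib_symm_extMul, ← hΘ.fib_symm_extMul, extMul_add_left,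
        extMul_add_right, negOnePow_smul, negOnePow_smul, negOnePow_smul, ← map_smul, ← map_add,
        smul_add]
      congr 1; abel
  · rintro L ⟨⟨⟨v, hv⟩, hL⟩, hm⟩
    obtain ⟨ρ, hρ⟩ := exists_isBump (d := d) x.2
    have h1 : ∃ v ∈ symbolSpace d k, ∀ (f : Smooth d ⊤) (e : ExtSections F E d ⊤), L (f • e) =
        vderiv d (x : M) v (ext0 f) • e.1 ⟨(x : M), (Opens.mem_top _)⟩ + f ⟨(x : M), (Opens.mem_top _)⟩ • L e := by
      by_cases hk : k = 0
      · refine ⟨v, fun h => absurd hk h, fun f e => ?_⟩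
        refine (hv f e).trans ?_
        have h := dirDeriv_eq_vderiv f (topPt (x : M)) v
        exact congrArg (fun c : ℝ => c • valAt e (x : M) + f (topPt (x : M)) • L e) h
      -- For k ≠ 0 neither L(1) nor L(f · 1) has a component of degree 0, so the Leibniz rule forces
      -- v(f) = 0 for all f, and v may be replaced by 0.
      · refine ⟨0, fun _ => rfl, fun f e => ?_⟩
        have h2 := (hL 0 _ (oneSec_homog (F := F) (E := E) (d := d))).1 (by simpa using hk)
        have h3 : IsHomogSection F E 0 (f • oneSec F E d ⊤) := fun y =>
          (ExtDual.isHomog_scalar 1).smul (f y)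
        have h4 := (hL 0 _ h3).1 (by simpa using hk)
        rw [hv, Prod.fst_add, Prod.smul_fst, Prod.smul_fst, h2, smul_zero, add_zero] at h4
        have h5 : dirDeriv f (topPt (x : M)) v = 0 := by
          simpa [valAt, oneSec_apply] using h4
        rw [hv, h5, vderiv_vec_zero]; rfl
    obtain ⟨v, hvk, hv⟩ := h1
    obtain ⟨δ, hδ, hδk⟩ := Θ.exists_form (U := ⊤) (Opens.mem_top _) x.2 L v hv
    have hLδ : L = Θ.pointDer x (Opens.mem_top _) (v, δ) := LinearMap.ext fun e => hδ e
    refine ⟨(v, δ), ⟨hvk, hδk k hL, fun a b w w' hw hw' hab => ?_⟩, hLδ.symm⟩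
    have hc : ∀ {a : ℤ} {w : ExtDual V₀}, w.IsHomog a →
        IsHomogSection F E a (cut hρ ⊤ (Θ.constSec w)) := fun hw =>
      cut_homog hρ _ fun y => (ExtDual.pullbackEquiv_symm_homog _).mpr hw
    have h1 := hm a b _ _ (hc hw) (hc hw') hab
    have h2 := Θ.hat_cut_constSec hρ x.2 (U := ⊤) (Opens.mem_top _) w
    have h3 := Θ.hat_cut_constSec hρ x.2 (U := ⊤) (Opens.mem_top _) w'
    have h4 : Θ.hat (B.mul (cut hρ ⊤ (Θ.constSec w)) (cut hρ ⊤ (Θ.constSec w'))) =ᶠ[𝓝 (x : M)]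
        fun _ => extMul μ₀ w w' := by
      filter_upwards [h2, h3, Opens.eventually_mem x.2] with y h2 h3 hy
      rw [hΘ.hat_mul _ _ hy (Opens.mem_top _), h2, h3]
    have hx : ∀ w, valAt (cut hρ ⊤ (Θ.constSec w)) (x : M) = (Θ.fib x).symm w := fun w => by
      refine (Θ.fib_symm_hat _ x.2 (U := ⊤) (Opens.mem_top _)).symm.trans ?_
      rw [(Θ.hat_cut_constSec hρ x.2 (U := ⊤) (Opens.mem_top _) w).self_of_nhds]
    rw [hLδ, Θ.pointDer_of_eventuallyEq x (Opens.mem_top _) _ h4, Θ.pointDer_of_eventuallyEq x (Opens.mem_top _) _ h2,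
      Θ.pointDer_of_eventuallyEq x (Opens.mem_top _) _ h3, hx, hx, ← hΘ.fib_symm_extMul,
      ← hΘ.fib_symm_extMul, negOnePow_smul, ← map_smul, ← map_add] at h1
    rw [negOnePow_smul]
    exact (Θ.fib x).symm.injective h1

end LocFrame

end Frames

/-! ### Smooth frames of Der(E_ℝ^*, m)_k and constancy of the rank -/

section FrameTheorem

variable {d n : ℕ} {M : Type*} [TopologicalSpace M] [ChartedSpace (EuclideanSpace ℝ (Fin d)) M]
  [T2Space M] [IsManifold (𝓡 d) ∞ M]

theorem exists_basis_family {G : Type*} [AddCommMonoid G] [Module ℝ G] [Module.Finite ℝ G]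
    (S : Submodule ℝ G) : ∃ (m : ℕ) (c : Fin m → G), LinearIndependent ℝ c ∧
      Submodule.span ℝ (Set.range c) = S := by
  let : AddCommGroup G := Module.addCommMonoidToAddCommGroup ℝ
  let c := Module.finBasis ℝ S
  refine ⟨_, fun j => (c j).1, (LinearMap.linearIndependent_iff_of_injOn S.subtype
    Subtype.val_injective.injOn).mpr c.linearIndependent, ?_⟩
  have h4 : (Set.range fun j => (c j).1) = S.subtype '' Set.range c := by
    rw [← Set.range_comp]; rfl
  rw [h4, Submodule.span_image, c.span_eq, Submodule.map_subtype_top]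

/-- The value of a vector field at a point. -/
def vecAt {U : Opens M}
    (X : Cₛ^∞⟮𝓡 d; EuclideanSpace ℝ (Fin d), (TangentSpace (𝓡 d) : U → Type _)⟯) (x : U) :
    EuclideanSpace ℝ (Fin d) := X x

theorem dirDeriv_vecAt {U : Opens M} (f : Smooth d U)
    (X : Cₛ^∞⟮𝓡 d; EuclideanSpace ℝ (Fin d), (TangentSpace (𝓡 d) : U → Type _)⟯) (x : U) :
    dirDeriv f x (X x) = vderiv d (x : M) (vecAt X x) (ext0 f) := dirDeriv_eq_vderiv f x _

/-- Symbols are arbitrary for k = 0 and zero otherwise, so the rank is d or 0; in the first case a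
local frame of the tangent bundle serves. -/
theorem exists_symbol_frame (d : ℕ) {M : Type*} [TopologicalSpace M]
    [ChartedSpace (EuclideanSpace ℝ (Fin d)) M] [T2Space M] [IsManifold (𝓡 d) ∞ M] (k : ℤ) :
    ∃ r : ℕ, ∀ (W : Opens M) (x₀ : M), x₀ ∈ W → ∃ V : Opens M, V ≤ W ∧ x₀ ∈ V ∧
      ∃ X : Fin r → Cₛ^∞⟮𝓡 d; EuclideanSpace ℝ (Fin d), (TangentSpace (𝓡 d) : V → Type _)⟯,
        ∀ x : V, ∃ b : Fin r → EuclideanSpace ℝ (Fin d), (∀ i, vecAt (X i) x = b i) ∧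
          LinearIndependent ℝ b ∧ Submodule.span ℝ (Set.range b) = symbolSpace d k := by
  by_cases hk : k = 0
  · refine ⟨d, fun W x₀ hx₀ => ?_⟩
    obtain ⟨V, hV, hx, X, hX⟩ := exists_vectorField_frame (d := d) W hx₀
    refine ⟨V, hV, hx, X, fun x => ?_⟩
    obtain ⟨b, hb⟩ := hX x
    refine ⟨b, hb, b.linearIndependent, b.span_eq.trans (Eq.symm ?_)⟩
    exact eq_top_iff.mpr fun v _ h => absurd hk h
  · refine ⟨0, fun W x₀ hx₀ => ⟨W, le_rfl, hx₀, Fin.elim0, fun x => ⟨Fin.elim0, fun i => i.elim0,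
      linearIndependent_empty_type, ?_⟩⟩⟩
    rw [Set.range_eq_empty, Submodule.span_empty]
    exact (eq_bot_iff.mpr fun v hv => (Submodule.mem_bot ℝ).mpr (hv hk)).symm

variable {F : Fin n → Type*} [∀ i, NormedAddCommGroup (F i)] [∀ i, NormedSpace ℝ (F i)]
  {E : Fin n → M → Type*} [∀ i x, AddCommGroup (E i x)] [∀ i x, Module ℝ (E i x)]
  [∀ i x, TopologicalSpace (E i x)] [∀ i, TopologicalSpace (TotalSpace (F i) (E i))]
  [∀ i, FiberBundle (F i) (E i)] [∀ i, VectorBundle ℝ (F i) (E i)]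
  [∀ i, FiniteDimensional ℝ (F i)] [∀ i, ContMDiffVectorBundle ∞ (F i) (E i) (𝓡 d)]
  {V₀ : Fin n → Type*} [∀ i, AddCommGroup (V₀ i)] [∀ i, Module ℝ (V₀ i)]
  [∀ i, FiniteDimensional ℝ (V₀ i)]
  {W : Opens M} (Θ : LocFrame F E d V₀ W)

namespace LocFrame

theorem pointDer_restrict (x : W) {U U' : Opens M} (h : U' ≤ U) (hU : (x : M) ∈ U') (P)
    (e : ExtSections F E d U) :
    Θ.pointDer x hU P (extRestrict F E d h e) = Θ.pointDer x (h hU) P e := by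
  have h1 : Θ.hat (extRestrict F E d h e) =ᶠ[𝓝 (x : M)] Θ.hat e := by
    filter_upwards [Opens.eventually_mem hU] with y hy
    exact Θ.hat_restrict h e hy
  rw [pointDer_apply, pointDer_apply, gderiv_congr h1, h1.self_of_nhds]

/-- The section of `E_ℝ^*` with given smooth coordinates. -/
def ofCoords (w : W → ExtDual V₀) (hw : ∀ φ : Module.Dual ℝ (ExtDual V₀),
    ContMDiff (𝓡 d) 𝓘(ℝ, ℝ) ∞ fun x => φ (w x)) : ExtSections F E d W :=
  ⟨fun x => (Θ.fib x).symm (w x), hw (LinearMap.fst ℝ ℝ _), fun i => Θ.isSmoothCosection fun f => by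
    have h := hw (Module.Dual.eval ℝ (V₀ i) f ∘ₗ LinearMap.proj i ∘ₗ LinearMap.snd ℝ ℝ _)
    refine h.congr fun x => ?_
    change (w x).2 i ((Θ.toEquiv x i).symm (Θ.toEquiv x i f)) = (w x).2 i f
    rw [LinearEquiv.symm_apply_apply]⟩

/-- The coordinates of a section of `E_ℝ^*` with respect to a functional are smooth. -/
def coord {U : Opens M} (h : U ≤ W) (e : ExtSections F E d U) (φ : Module.Dual ℝ (ExtDual V₀)) :
    Smooth d U :=
  ⟨fun x => φ (Θ.hat e x), contMDiff_iff_ext0.mpr fun x => by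
    refine ContMDiffAt.congr_of_eventuallyEq ((Θ.finSmoothAt_hat e (h x.2) x.2).smoothAt φ) ?_
    filter_upwards [Opens.eventually_mem x.2] with y hy
    exact ext0_mk (fun x : U => φ (Θ.hat e x)) hy⟩

theorem ext0_coord {U : Opens M} (h : U ≤ W) (e : ExtSections F E d U)
    (φ : Module.Dual ℝ (ExtDual V₀)) {y : M} (hy : y ∈ U) :
    ext0 (Θ.coord h e φ) y = φ (Θ.hat e y) :=
  ext0_mk _ hy

/-- In each coordinate this is the derivative of a smooth function along a smooth vector field, plus
a smooth function. -/
theorem contMDiff_gderiv_hat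
    (X : Cₛ^∞⟮𝓡 d; EuclideanSpace ℝ (Fin d), (TangentSpace (𝓡 d) : W → Type _)⟯)
    (e : ExtSections F E d W) (δ : ExtDual V₀ →ₗ[ℝ] ExtDual V₀)
    (φ : Module.Dual ℝ (ExtDual V₀)) : ContMDiff (𝓡 d) 𝓘(ℝ, ℝ) ∞ fun x : W =>
      φ (gderiv d (x : M) (vecAt X x) (Θ.hat e) + δ (Θ.hat e x)) := by
  refine ((contMDiff_dirDeriv (Θ.coord le_rfl e φ) X).add
    (Θ.coord le_rfl e (φ ∘ₗ δ)).contMDiff).congr fun x => ?_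
  rw [map_add, dual_gderiv (Θ.finSmoothAt_hat e x.2 x.2)]
  congr 1
  refine Eq.trans ?_ (dirDeriv_vecAt (Θ.coord le_rfl e φ) X x).symm
  refine vderiv_congr ?_ _
  filter_upwards [Opens.eventually_mem x.2] with y hy
  exact (Θ.ext0_coord le_rfl e φ hy).symm

/-- The derivation with symbol `X` and constant coordinate matrix `δ`. -/
def fieldDer (X : Cₛ^∞⟮𝓡 d; EuclideanSpace ℝ (Fin d), (TangentSpace (𝓡 d) : W → Type _)⟯)
    (δ : ExtDual V₀ →ₗ[ℝ] ExtDual V₀) : ExtSections F E d W →ₗ[ℝ] ExtSections F E d W where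
  toFun e := Θ.ofCoords (fun x => gderiv d (x : M) (vecAt X x) (Θ.hat e) + δ (Θ.hat e x))
    (Θ.contMDiff_gderiv_hat X e δ)
  map_add' e e' := Subtype.ext (funext fun x => (Θ.pointDer x x.2 (vecAt X x, δ)).map_add e e')
  map_smul' c e := Subtype.ext (funext fun x => (Θ.pointDer x x.2 (vecAt X x, δ)).map_smul c e)

theorem fieldDer_mem
    {X : Cₛ^∞⟮𝓡 d; EuclideanSpace ℝ (Fin d), (TangentSpace (𝓡 d) : W → Type _)⟯}
    {δ : ExtDual V₀ →ₗ[ℝ] ExtDual V₀} {k : ℤ} (hX : ∀ x, vecAt X x ∈ symbolSpace d k)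
    (hδ : ∀ (a : ℤ) w, ExtDual.IsHomog a w → (δ w).IsHomog (a + k)) :
    Θ.fieldDer X δ ∈ derivations F E d k W := by
  refine ⟨⟨X, fun f e x => ?_⟩, fun a e he x =>
    Θ.pointDer_homog (P := (vecAt X x, δ)) x x.2 (hX x) hδ he⟩
  refine (Θ.pointDer_smul x x.2 (vecAt X x, δ) f e).trans ?_
  exact congrArg (fun c : ℝ => c • e.1 x + f x • Θ.pointDer x x.2 (vecAt X x, δ) e)
    (dirDeriv_vecAt f X x).symm

theorem derAt_fieldDer
    (X : Cₛ^∞⟮𝓡 d; EuclideanSpace ℝ (Fin d), (TangentSpace (𝓡 d) : W → Type _)⟯)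
    (δ : ExtDual V₀ →ₗ[ℝ] ExtDual V₀) (x : W) :
    derAt (Θ.fieldDer X δ) x = Θ.pointDer x (Opens.mem_top _) (vecAt X x, δ) :=
  LinearMap.ext fun e => Θ.pointDer_restrict x le_top x.2 (vecAt X x, δ) e

end LocFrame

/-- By `map_pointDer` all fibres are injective images of one product: symbols times `modelDer` of a
fixed reference fibre. A frame of symbols with zero matrix, together with a basis of `modelDer` with
zero symbol, is therefore a frame whose length does not depend on the point. -/
theorem CoalgebraBundle.exists_frame (B : CoalgebraBundle F E d) (hB : B.IsAdmissible) (k : ℤ) :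
    ∃ r : ℕ, ∀ x₀ : M, ∃ V : Opens M, x₀ ∈ V ∧
      ∃ D : Fin r → (ExtSections F E d V →ₗ[ℝ] ExtSections F E d V),
        (∀ a, D a ∈ derivations F E d k V) ∧
        ∀ x : V, LinearIndependent ℝ (fun a => derAt (D a) x) ∧
          Submodule.span ℝ (Set.range fun a => derAt (D a) x) = B.compatFibre k (x : M) := by
  -- An empty base has no reference fibre; any rank serves.
  rcases isEmpty_or_nonempty M with hM | ⟨⟨x₁⟩⟩
  · exact ⟨0, fun x => hM.elim x⟩
  have := fun i => (finiteDimensional_fibre F E i x₁).2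
  obtain ⟨r, hr⟩ := exists_symbol_frame d (M := M) k
  obtain ⟨m, c, hc, hc2⟩ := exists_basis_family (modelDer (B.μ x₁) k)
  refine ⟨r + m, fun x₀ => ?_⟩
  obtain ⟨W, hW, Θ', hΘ'⟩ := B.exists_locFrame hB x₁ x₀
  obtain ⟨V, hV, hx, X, hX⟩ := hr W x₀ hW
  let Θ := Θ'.restrict hV
  have hΘ : Θ.Intertwines B (B.μ x₁) := fun x => hΘ' (incl hV x)
  let s : Fin r ⊕ Fin m → (ExtSections F E d V →ₗ[ℝ] ExtSections F E d V) :=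
    Sum.elim (fun i => Θ.fieldDer (X i) 0) fun j => Θ.fieldDer 0 (c j)
  have hs : ∀ t, s t ∈ derivations F E d k V := by
    rintro (i | j)
    · refine Θ.fieldDer_mem (δ := 0) (fun x => ?_) fun a w _ => ExtDual.IsHomog.zero
      obtain ⟨b, hb, -, hb'⟩ := hX x
      rw [hb i, ← hb']
      exact Submodule.subset_span ⟨i, rfl⟩
    · exact Θ.fieldDer_mem (X := 0) (fun x _ => rfl)
        (hc2.le (Submodule.subset_span ⟨j, rfl⟩) : c j ∈ modelDer (B.μ x₁) k).1
  refine ⟨V, hx, fun a => s (finSumFinEquiv.symm a), fun a => hs _, fun x => ?_⟩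
  · obtain ⟨b, hb, hb1, hb2⟩ := hX x
    let p : Fin r ⊕ Fin m → EuclideanSpace ℝ (Fin d) ×
        (ExtDual (fun i => E i x₁) →ₗ[ℝ] ExtDual (fun i => E i x₁)) :=
      Sum.elim (LinearMap.inl ℝ _ _ ∘ b) (LinearMap.inr ℝ _ _ ∘ c)
    have h1 : ∀ t, derAt (s t) x = Θ.pointDer x (Opens.mem_top _) (p t) := by
      rintro (i | j)
      · refine (Θ.derAt_fieldDer _ _ x).trans ?_
        rw [hb i]; rfl
      · exact Θ.derAt_fieldDer _ _ x
    have hp : LinearIndependent ℝ p := linearIndependent_inl_union_inr' hb1 hc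
    have hp2 : Submodule.span ℝ (Set.range p) = (symbolSpace d k).prod (modelDer (B.μ x₁) k) := by
      have h2 : Set.range p = LinearMap.inl ℝ _ _ '' Set.range b ∪
          LinearMap.inr ℝ _ _ '' Set.range c := by
        rw [Set.Sum.elim_range, Set.range_comp, Set.range_comp]
      rw [h2, LinearMap.span_inl_union_inr, hb2, hc2]
    have h2 : (fun a => derAt (s (finSumFinEquiv.symm a)) x) =
        (Θ.pointDer x (U := ⊤) (Opens.mem_top _) ∘ p) ∘ finSumFinEquiv.symm := funext fun a => h1 _
    rw [h2]
    refine ⟨LinearIndependent.comp ((LinearMap.linearIndependent_iff_of_injOn _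
      (Θ.pointDer_injective x (Opens.mem_top _)).injOn).mpr hp) _
        finSumFinEquiv.symm.injective, ?_⟩
    rw [Set.range_comp (Θ.pointDer x (U := ⊤) (Opens.mem_top _) ∘ p),
      finSumFinEquiv.symm.range_eq_univ, Set.image_univ, Set.range_comp, Submodule.span_image, hp2,
      hΘ.map_pointDer]

end FrameTheorem

/-! ### Locality and restriction of derivations -/

section Derivations

variable {d n : ℕ} {M : Type*} [TopologicalSpace M] [ChartedSpace (EuclideanSpace ℝ (Fin d)) M]
  [T2Space M] [IsManifold (𝓡 d) ∞ M]
  {F : Fin n → Type*} [∀ i, NormedAddCommGroup (F i)] [∀ i, NormedSpace ℝ (F i)]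
  {E : Fin n → M → Type*} [∀ i x, AddCommGroup (E i x)] [∀ i x, Module ℝ (E i x)]
  [∀ i x, TopologicalSpace (E i x)] [∀ i, TopologicalSpace (TotalSpace (F i) (E i))]
  [∀ i, FiberBundle (F i) (E i)]

/-- The Leibniz rule at a point, with symbol `v`. -/
def IsDerivationAt {U : Opens M} {x : M} (hU : x ∈ U) (v : EuclideanSpace ℝ (Fin d))
    (L : ExtSections F E d U →ₗ[ℝ] ExtFibre E x) : Prop :=
  ∀ (f : Smooth d U) e, L (f • e) = vderiv d x v (ext0 f) • e.1 ⟨x, hU⟩ + f ⟨x, hU⟩ • L e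

/-- Multiplication by a bump function f at x makes the two sections equal. In the Leibniz rule the
symbol terms agree because e(x) = e'(x), and f(x) = 1 leaves L e = L e'. -/
theorem IsDerivationAt.eq_of_eq_near {U : Opens M} {x : M} {hU : x ∈ U}
    {v : EuclideanSpace ℝ (Fin d)} {L : ExtSections F E d U →ₗ[ℝ] ExtFibre E x}
    (hL : IsDerivationAt hU v L) {W : Opens M} (hW : x ∈ W) {e e' : ExtSections F E d U}
    (h : ∀ y : U, (y : M) ∈ W → e.1 y = e'.1 y) : L e = L e' := by
  obtain ⟨ρ, hρ⟩ := exists_isBump (d := d) hW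
  let f : Smooth d U := Smooth.ofGlobal U ρ hρ.smooth
  have h1 : f • e = f • e' := Subtype.ext (funext fun y => by
    change ρ y • e.1 y = ρ y • e'.1 y
    by_cases hy : (y : M) ∈ W
    · rw [h y hy]
    · rw [hρ.eq_zero hy, zero_smul, zero_smul])
  have h2 := hL f e
  have h3 := hL f e'
  rw [h1, h3, h ⟨x, hU⟩ hW, add_right_inj] at h2
  have h4 : f ⟨x, hU⟩ = 1 := hρ.apply_self
  rw [h4, one_smul, one_smul] at h2
  exact h2.symm

/-- Evaluation of sections at a point. -/
def evalSec {U : Opens M} (x : U) : ExtSections F E d U →ₗ[ℝ] ExtFibre E (x : M) where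
  toFun e := e.1 x
  map_add' _ _ := rfl
  map_smul' _ _ := rfl

theorem ExtSections.ext_eval {U : Opens M} {e e' : ExtSections F E d U}
    (h : ∀ x, e.1 x = e'.1 x) : e = e' := Subtype.ext (funext h)

theorem isDerivationAt_of_mem {k : ℤ} {U : Opens M}
    {D : ExtSections F E d U →ₗ[ℝ] ExtSections F E d U} (hD : D ∈ derivations F E d k U) (x : U) :
    ∃ v, IsDerivationAt x.2 v (evalSec x ∘ₗ D) := by
  obtain ⟨⟨X, hX⟩, -⟩ := hD
  exact ⟨vecAt X x, fun f e => (hX f e x).trans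
    (congrArg (fun c : ℝ => c • e.1 x + f x • (D e).1 x) (dirDeriv_vecAt f X x))⟩

/-- The pointwise symbols act on f through the degree 0 component of D(f · 1) − f D(1). This is a
derivation of the smooth functions, hence a smooth vector field, so smoothness of the symbol need
not be assumed. -/
theorem mem_derivations_of {k : ℤ} {U : Opens M}
    {D : ExtSections F E d U →ₗ[ℝ] ExtSections F E d U}
    (h : ∀ x : U, ∃ v, IsDerivationAt x.2 v (evalSec x ∘ₗ D))
    (hk : ∀ (a : ℤ) (e : ExtSections F E d U), IsHomogSection F E a e →
      IsHomogSection F E (a + k) (D e)) : D ∈ derivations F E d k U := by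
  choose v hv using h
  have hv' : ∀ (f : Smooth d U) (e : ExtSections F E d U) (x : U), (D (f • e)).1 x =
      vderiv d (x : M) (v x) (ext0 f) • e.1 x + f x • (D e).1 x := fun f e x => hv x f e
  have h1 : ∀ (f : Smooth d U) (x : U), ((D (f • oneSec F E d U)).1 x).1 -
      f x * ((D (oneSec F E d U)).1 x).1 = vderiv d (x : M) (v x) (ext0 f) := fun f x => by
    rw [hv' f _ x]
    change vderiv d (x : M) (v x) (ext0 f) * 1 + f x * _ - _ = _
    ring
  let Δ : Smooth d U →ₗ[ℝ] Smooth d U :=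
    { toFun := fun f => ⟨fun x => ((D (f • oneSec F E d U)).1 x).1 -
        f x * ((D (oneSec F E d U)).1 x).1, (D (f • oneSec F E d U)).2.1.sub
          (f.contMDiff.mul (D (oneSec F E d U)).2.1)⟩
      map_add' := fun f g => by
        ext x
        change ((D ((f + g) • oneSec F E d U)).1 x).1 - (f x + g x) * _ =
          (((D (f • oneSec F E d U)).1 x).1 - f x * _) + (((D (g • oneSec F E d U)).1 x).1 - g x * _)
        rw [add_smul, map_add]
        change (((D (f • oneSec F E d U)).1 x).1 + ((D (g • oneSec F E d U)).1 x).1) -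
          (f x + g x) * _ = _
        ring
      map_smul' := fun c f => by
        ext x
        change ((D ((c • f) • oneSec F E d U)).1 x).1 - (c * f x) * _ =
          c * (((D (f • oneSec F E d U)).1 x).1 - f x * _)
        have h2 : (c • f) • oneSec F E d U = c • (f • oneSec F E d U) :=
          ExtSections.ext_eval fun x => smul_assoc c (f x) _
        rw [h2, map_smul]
        change c * ((D (f • oneSec F E d U)).1 x).1 - (c * f x) * _ = _
        ring }
  have hΔ : ∀ f x, Δ f x = vderiv d (x : M) (v x) (ext0 f) := h1
  obtain ⟨X, hX⟩ := exists_vectorField Δ fun f g => by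
    ext x
    change Δ (f * g) x = Δ f x * g x + f x * Δ g x
    rw [hΔ, hΔ, hΔ]
    have h2 : ext0 (f * g : Smooth d U) =ᶠ[𝓝 (x : M)] fun y => ext0 f y * ext0 g y := by
      filter_upwards [Opens.eventually_mem x.2] with y hy
      rw [ext0_mk _ hy, ext0_mk _ hy, ext0_mk _ hy]
      rfl
    rw [vderiv_congr h2, vderiv_mul (f.smoothAt x) (g.smoothAt x), ext0_coe, ext0_coe]
  refine ⟨⟨X, fun f e x => (hv' f e x).trans ?_⟩, hk⟩
  exact congrArg (fun c : ℝ => c • e.1 x + f x • (D e).1 x) ((hΔ f x).symm.trans (hX f x))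

theorem mem_extSubmodule_of_local {U : Opens M} {s : ∀ x : U, ExtFibre E (x : M)}
    (h : ∀ x : U, ∃ (W : Opens M) (hW : W ≤ U), (x : M) ∈ W ∧ ∃ e : ExtSections F E d W,
      ∀ y : W, s (incl hW y) = e.1 y) : s ∈ extSubmodule F E d U := by
  refine ⟨contMDiff_iff_ext0.mpr fun x => ?_, fun i V hV t ht => contMDiff_iff_ext0.mpr fun x => ?_⟩
  · obtain ⟨W, hW, hx, e, he⟩ := h x
    refine ContMDiffAt.congr_of_eventuallyEq (contMDiff_iff_ext0.mp e.2.1 ⟨x, hx⟩) ?_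
    filter_upwards [Opens.eventually_mem hx] with y hy
    rw [ext0_mk _ (hW hy), ext0_mk _ hy, ← he ⟨y, hy⟩]
    rfl
  · obtain ⟨W, hW, hx, e, he⟩ := h (incl hV x)
    refine ContMDiffAt.congr_of_eventuallyEq (contMDiff_iff_ext0.mp (e.2.2 i (W ⊓ V) inf_le_left _
      (ht.restrict inf_le_right)) ⟨x, hx, x.2⟩) ?_
    filter_upwards [Opens.eventually_mem hx, Opens.eventually_mem x.2] with y hy hyV
    rw [ext0_mk _ hyV, ext0_mk _ (show y ∈ W ⊓ V from ⟨hy, hyV⟩)]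
    change (s (incl hW ⟨y, hy⟩)).2 i (t ⟨y, hyV⟩) = _
    rw [he ⟨y, hy⟩]
    rfl

theorem restrict_cut_eq {U V : Opens M} {x : M} {ρ : M → ℝ} (hρ : IsBump d x V ρ) (h : V ≤ U)
    (e : ExtSections F E d V) {y : V} (hy : ρ y = 1) :
    (extRestrict F E d h (cut hρ U e)).1 y = e.1 y := by
  change (cut hρ U e).1 (incl h y) = e.1 y
  rw [cut_apply (U := U) hρ e (y := incl h y) y.2]
  change ρ y • e.1 y = e.1 y
  rw [hy, one_smul]

theorem extRestrict_homog {U V : Opens M} (h : V ≤ U) {a : ℤ} {e : ExtSections F E d U}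
    (he : IsHomogSection F E a e) : IsHomogSection F E a (extRestrict F E d h e) :=
  fun x => he (incl h x)

/-- The bump function used to extend sections over `V` near the point `y`. -/
theorem exists_isBump_near {V : Opens M} (y : V) : ∃ ρ, IsBump d (y : M) V ρ :=
  exists_isBump (d := d) y.2

section Restriction

variable {U V : Opens M} (h : V ≤ U) {k : ℤ} {D : ExtSections F E d U →ₗ[ℝ] ExtSections F E d U}
  (hD : D ∈ derivations F E d k U)

/-- By locality D(ρ e) at z depends on ρ only through its being 1 near z. Different bump functions
may therefore be chosen at different points in `resDer`. -/
theorem derivation_cut_eq (h : V ≤ U) (hD : D ∈ derivations F E d k U) {y z : V} {ρ ρ' : M → ℝ} (hρ : IsBump d (y : M) V ρ)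
    (hρ' : IsBump d (z : M) V ρ') (hy : ∀ᶠ x in 𝓝 (z : M), ρ x = 1) (e : ExtSections F E d V) :
    (D (cut hρ U e)).1 (incl h z) = (D (cut hρ' U e)).1 (incl h z) := by
  obtain ⟨v, hv⟩ := isDerivationAt_of_mem hD (incl h z)
  obtain ⟨O, hO, hOo, hxO⟩ := eventually_nhds_iff.mp (hy.and hρ'.one)
  refine hv.eq_of_eq_near (W := ⟨O, hOo⟩) hxO fun x hx => ?_
  by_cases hxV : (x : M) ∈ V
  · rw [cut_apply hρ e hxV, cut_apply hρ' e hxV, (hO x hx).1, (hO x hx).2]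
  · rw [cut_apply_of_notMem hρ e hxV, cut_apply_of_notMem hρ' e hxV]

/-- The restriction of a derivation to an open subset. -/
def resDer : ExtSections F E d V →ₗ[ℝ] ExtSections F E d V where
  toFun e := ⟨fun y => (D (cut (exists_isBump_near (d := d) y).choose_spec U e)).1 (incl h y),
    mem_extSubmodule_of_local fun y => by
      have hρ := (exists_isBump_near (d := d) y).choose_spec
      obtain ⟨W, hyW, hWV, hW⟩ := hρ.exists_opens y.2
      -- The bump function chosen at y is 1 on W, so it computes the restriction at every point of
      -- W; there the result is the restriction of a single section over U.
      refine ⟨W, hWV, hyW, extRestrict F E d (hWV.trans h) (D (cut hρ U e)), fun z => ?_⟩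
      refine (derivation_cut_eq h hD hρ (exists_isBump_near (d := d) (incl hWV z)).choose_spec ?_
        e).symm
      filter_upwards [Opens.eventually_mem z.2] with x hx
      exact hW x hx⟩
  map_add' e e' := ExtSections.ext_eval fun y => by
    change (D (cut _ U (e + e'))).1 (incl h y) = _
    rw [map_add, map_add]
    rfl
  map_smul' c e := ExtSections.ext_eval fun y => by
    change (D (cut _ U (c • e))).1 (incl h y) = _
    rw [map_smul, map_smul]
    rfl

theorem resDer_apply {e : ExtSections F E d V} {y : V} {ρ : M → ℝ} (hρ : IsBump d (y : M) V ρ) :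
    (resDer h hD e).1 y = (D (cut hρ U e)).1 (incl h y) :=
  derivation_cut_eq h hD (exists_isBump_near (d := d) y).choose_spec hρ
    (exists_isBump_near (d := d) y).choose_spec.one e

theorem isRestrictionDer_resDer : IsRestrictionDer h D (resDer h hD) := by
  intro e
  refine ExtSections.ext_eval fun y => ?_
  obtain ⟨ρ, hρ⟩ := exists_isBump_near (d := d) y
  rw [resDer_apply h hD hρ]
  obtain ⟨v, hv⟩ := isDerivationAt_of_mem hD (incl h y)
  obtain ⟨W, hyW, hWV, hW⟩ := hρ.exists_opens y.2
  refine hv.eq_of_eq_near hyW fun x hx => ?_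
  rw [cut_apply hρ _ (hWV hx), hW _ hx, one_smul]
  rfl

theorem resDer_mem : resDer h hD ∈ derivations F E d k V := by
  refine mem_derivations_of (fun y => ?_) fun a e he y => ?_
  · obtain ⟨v, hv⟩ := isDerivationAt_of_mem hD (incl h y)
    obtain ⟨ρ, hρ⟩ := exists_isBump_near (d := d) y
    refine ⟨v, fun f e => ?_⟩
    obtain ⟨ρ', hρ'⟩ := exists_isBump_near (d := d) y
    -- The function f is defined on V only; g has the same germ at y and is defined on U.
    let g : Smooth d U := ⟨fun z => ρ' z * ext0 f z, contMDiff_of_cutoff hρ' (g := ext0 f)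
      (fun z _ hz => f.smoothAt ⟨z, hz⟩) (fun z hz => rfl) fun z hz => by
        rw [hρ'.eq_zero hz, zero_mul]⟩
    have h1 := hv g (cut hρ U e)
    have h2 : ext0 g =ᶠ[𝓝 (y : M)] ext0 f := by
      filter_upwards [hρ'.one, Opens.eventually_mem y.2] with z hz hzV
      rw [ext0_mk g (h hzV)]
      change ρ' z * ext0 f z = _
      rw [hz, one_mul]
    have h3 : g (incl h y) = f y := by
      rw [← ext0_coe g (incl h y), ← ext0_coe f y]
      exact h2.self_of_nhds
    have h4 : (cut hρ U e).1 (incl h y) = e.1 y := by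
      rw [cut_apply (U := U) hρ e (y := incl h y) y.2]
      change ρ y • e.1 y = e.1 y
      rw [hρ.apply_self, one_smul]
    change (resDer h hD (f • e)).1 y = vderiv d (y : M) v (ext0 f) • e.1 y +
      f y • (resDer h hD e).1 y
    rw [resDer_apply h hD hρ, resDer_apply h hD hρ, ← h4, ← h3, ← vderiv_congr h2]
    refine Eq.trans ?_ h1
    obtain ⟨W, hyW, hWV, hW⟩ := hρ'.exists_opens y.2
    refine hv.eq_of_eq_near hyW fun x hx => ?_
    change _ = (ρ' x * ext0 f x) • (cut hρ U e).1 x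
    rw [hW _ hx, one_mul, cut_apply hρ _ (hWV hx), cut_apply hρ _ (hWV hx), ext0_mk _ (hWV hx),
      smul_comm]
    rfl
  · obtain ⟨ρ, hρ⟩ := exists_isBump_near (d := d) y
    rw [resDer_apply h hD hρ]
    exact hD.2 a _ (cut_homog hρ e he) _

end Restriction

/-- Near each point a section over V coincides with the restriction of its cutoff, which is defined
over U; locality does the rest. -/
theorem IsRestrictionDer.eq {U V : Opens M} {h : V ≤ U} {k : ℤ}
    {D : ExtSections F E d U →ₗ[ℝ] ExtSections F E d U}
    {D' D'' : ExtSections F E d V →ₗ[ℝ] ExtSections F E d V} (h' : IsRestrictionDer h D D')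
    (h'' : IsRestrictionDer h D D'') (hD' : D' ∈ derivations F E d k V)
    (hD'' : D'' ∈ derivations F E d k V) : D' = D'' := by
  refine LinearMap.ext fun e => ExtSections.ext_eval fun y => ?_
  obtain ⟨ρ, hρ⟩ := exists_isBump_near (d := d) y
  obtain ⟨W, hyW, hWV, hW⟩ := hρ.exists_opens y.2
  have h1 : ∀ x : V, (x : M) ∈ W → e.1 x = (extRestrict F E d h (cut hρ U e)).1 x :=
    fun x hx => (restrict_cut_eq hρ h e (hW x hx)).symm
  obtain ⟨v', hv'⟩ := isDerivationAt_of_mem hD' y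
  obtain ⟨v'', hv''⟩ := isDerivationAt_of_mem hD'' y
  refine (hv'.eq_of_eq_near hyW h1).trans (Eq.trans ?_ (hv''.eq_of_eq_near hyW h1).symm)
  change (D' _).1 y = (D'' _).1 y
  rw [h', h'']

variable (B : CoalgebraBundle F E d)

namespace CoalgebraBundle

/-- The fibre condition tests global sections, while compatibility tests sections over U. Cutting
off in one direction and restricting in the other passes between them, by locality. -/
theorem mem_compatSections_iff {k : ℤ} {U : Opens M}
    {D : ExtSections F E d U →ₗ[ℝ] ExtSections F E d U} (hD : D ∈ derivations F E d k U) :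
    D ∈ B.compatSections k U ↔ B.IsCompatible k D := by
  constructor
  · rintro ⟨-, h⟩ a b e e' he he' hab
    refine ExtSections.ext_eval fun x => ?_
    obtain ⟨ρ, hρ⟩ := exists_isBump (d := d) x.2
    obtain ⟨W, hyW, hWV, hW⟩ := hρ.exists_opens x.2
    obtain ⟨v, hv⟩ := isDerivationAt_of_mem hD x
    have h1 := (h x).2 a b _ _ (cut_homog hρ (U := ⊤) e he) (cut_homog hρ (U := ⊤) e' he') hab
    have hc : ∀ (e : ExtSections F E d U), ∀ y : U, (y : M) ∈ W →
        (extRestrict F E d le_top (cut hρ ⊤ e)).1 y = e.1 y :=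
      fun e y hy => restrict_cut_eq hρ le_top e (hW y hy)
    have h2 : ∀ e, derAt D x (cut hρ ⊤ e) = (D e).1 x := fun e =>
      hv.eq_of_eq_near hyW (hc e)
    have h3 : derAt D x (B.mul (cut hρ ⊤ e) (cut hρ ⊤ e')) = (D (B.mul e e')).1 x :=
      hv.eq_of_eq_near hyW fun y hy => by
        change extMul (B.μ y) ((extRestrict F E d le_top (cut hρ ⊤ e)).1 y)
          ((extRestrict F E d le_top (cut hρ ⊤ e')).1 y) = extMul (B.μ y) (e.1 y) (e'.1 y)
        rw [hc e y hy, hc e' y hy]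
    have h4 : ∀ e, valAt (cut hρ ⊤ e) (x : M) = e.1 x := fun e => hc e x hyW
    rw [h3, h2, h2, h4, h4] at h1
    exact h1
  · refine fun h => ⟨hD, fun x => ⟨⟨?_, fun a e he => hD.2 a _ (extRestrict_homog le_top he) x⟩,
      fun a b e e' he he' hab => ?_⟩⟩
    · obtain ⟨v, hv⟩ := isDerivationAt_of_mem hD x
      refine ⟨v, fun f e => (hv (f.res le_top) (extRestrict F E d le_top e)).trans ?_⟩
      have h1 : vderiv d (x : M) v (ext0 (f.res (le_top : U ≤ ⊤))) =
          dirDeriv f (topPt (x : M)) v := by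
        refine Eq.trans ?_ (dirDeriv_eq_vderiv f (topPt (x : M)) v).symm
        exact vderiv_congr (ext0_incl_eventuallyEq le_top f x.2) v
      rw [h1]
      rfl
    · have h1 := h a b _ _ (extRestrict_homog (le_top : U ≤ ⊤) he)
        (extRestrict_homog (le_top : U ≤ ⊤) he') hab
      exact congrArg (evalSec x) h1

theorem resDer_mem_compatSections {U V : Opens M} (h : V ≤ U) {k : ℤ}
    {D : ExtSections F E d U →ₗ[ℝ] ExtSections F E d U} (hD : D ∈ B.compatSections k U) :
    resDer h hD.1 ∈ B.compatSections k V := by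
  refine (B.mem_compatSections_iff (resDer_mem h hD.1)).mpr fun a b e e' he he' hab => ?_
  have hc := (B.mem_compatSections_iff hD.1).mp hD
  refine ExtSections.ext_eval fun y => ?_
  obtain ⟨ρ, hρ⟩ := exists_isBump_near (d := d) y
  have h1 := congrArg (evalSec (incl h y))
    (hc a b _ _ (cut_homog hρ (U := U) e he) (cut_homog hρ (U := U) e' he') hab)
  have h4 : ∀ e : ExtSections F E d V, (cut hρ U e).1 (incl h y) = e.1 y := fun e => by
    rw [cut_apply (U := U) hρ e (y := incl h y) y.2]
    change ρ y • e.1 y = e.1 y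
    rw [hρ.apply_self, one_smul]
  obtain ⟨v, hv⟩ := isDerivationAt_of_mem hD.1 (incl h y)
  obtain ⟨W, hyW, hWV, hW⟩ := hρ.exists_opens y.2
  have h5 : (D (cut hρ U (B.mul e e'))).1 (incl h y) =
      (D (B.mul (cut hρ U e) (cut hρ U e'))).1 (incl h y) :=
    hv.eq_of_eq_near hyW fun x hx => by
      change _ = extMul (B.μ x) ((cut hρ U e).1 x) ((cut hρ U e').1 x)
      rw [cut_apply hρ _ (hWV hx), cut_apply hρ _ (hWV hx), cut_apply hρ _ (hWV hx), hW _ hx,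
        one_smul, one_smul, one_smul]
      rfl
  change (resDer h hD.1 (B.mul e e')).1 y = extMul (B.μ y) ((resDer h hD.1 e).1 y) (e'.1 y) +
    (k * a).negOnePow • extMul (B.μ y) (e.1 y) ((resDer h hD.1 e').1 y)
  rw [resDer_apply h hD.1 hρ, resDer_apply h hD.1 hρ, resDer_apply h hD.1 hρ, h5, ← h4 e, ← h4 e']
  exact h1

end CoalgebraBundle

end Derivations

/-! ### Functions of degree at most n are sections of E_ℝ^* -/

theorem GSym.proj_mul {n : ℕ} {W : Fin n → Type*} [∀ i, AddCommGroup (W i)] [∀ i, Module ℝ (W i)]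
    {a b : ℤ} {s : GSym W} (hs : s ∈ deg W b) (t : GSym W) :
    proj a (s * t) = s * proj (a - b) t := by
  induction mem_iSup_deg t using Submodule.iSup_induction' with
  | mem l t ht =>
    by_cases h : l = a - b
    · subst h
      rw [proj_of_mem_deg ht]
      refine proj_of_mem_deg ?_
      have := mul_mem_deg hs ht
      rwa [add_sub_cancel] at this
    · rw [proj_of_mem_deg_ne h ht, mul_zero, proj_of_mem_deg_ne _ (mul_mem_deg hs ht)]
      omega
  | zero => simp
  | add t t' _ _ ht ht' => rw [mul_add, map_add, map_add, mul_add, ht, ht']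

theorem ExtDual.IsHomog.eq_scalar {n : ℕ} {V : Fin n → Type*} [∀ i, AddCommGroup (V i)]
    [∀ i, Module ℝ (V i)] {w : ExtDual V} (h : w.IsHomog 0) : w = (w.1, 0) :=
  Prod.ext rfl (funext fun i => h.2 i (by omega))

theorem ExtDual.IsHomog.eq_single {n : ℕ} {V : Fin n → Type*} [∀ i, AddCommGroup (V i)]
    [∀ i, Module ℝ (V i)] {w : ExtDual V} {i : Fin n} (h : w.IsHomog (i.val + 1)) :
    w = (0, Pi.single i (w.2 i)) := by
  refine Prod.ext (h.1 (by omega)) (funext fun j => ?_)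
  by_cases hj : j = i
  · subst hj; simp
  · rw [h.2 j fun h => hj (Fin.ext (by omega))]
    simp [Pi.single_eq_of_ne hj]

section Functions

variable {d n : ℕ} {M : Type*} [TopologicalSpace M] [ChartedSpace (EuclideanSpace ℝ (Fin d)) M]
  [T2Space M] [IsManifold (𝓡 d) ∞ M]
  {F : Fin n → Type*} [∀ i, NormedAddCommGroup (F i)] [∀ i, NormedSpace ℝ (F i)]
  {E : Fin n → M → Type*} [∀ i x, AddCommGroup (E i x)] [∀ i x, Module ℝ (E i x)]
  [∀ i x, TopologicalSpace (E i x)] [∀ i, TopologicalSpace (TotalSpace (F i) (E i))]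
  [∀ i, FiberBundle (F i) (E i)] [∀ i, VectorBundle ℝ (F i) (E i)]
  [∀ i, FiniteDimensional ℝ (F i)] [∀ i, ContMDiffVectorBundle ∞ (F i) (E i) (𝓡 d)]

/-- The component of degree `a` of a section of `E_ℝ^*`. -/
def partSec (a : ℕ) {U : Opens M} (e : ExtSections F E d U) : ExtSections F E d U :=
  ⟨fun x => ExtDual.part a (e.1 x), by
    by_cases h : a = 0
    · refine e.2.1.congr fun x => ?_
      change (if a = 0 then (e.1 x).1 else 0) = _
      rw [if_pos h]
    · refine (contMDiff_const (c := (0 : ℝ))).congr fun x => ?_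
      change (if a = 0 then (e.1 x).1 else 0) = _
      rw [if_neg h], fun i => by
    by_cases h : i.val + 1 = a
    · have h1 : (fun x => (ExtDual.part a (e.1 x)).2 i) = fun x => (e.1 x).2 i := funext fun x => by
        change (if i.val + 1 = a then (e.1 x).2 i else 0) = _
        rw [if_pos h]
      rw [h1]
      exact e.2.2 i
    · have h1 : (fun x => (ExtDual.part a (e.1 x)).2 i) = fun x => 0 := funext fun x => by
        change (if i.val + 1 = a then (e.1 x).2 i else 0) = _
        rw [if_neg h]
      rw [h1]
      exact fun _ _ _ _ => contMDiff_const⟩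

theorem partSec_homog (a : ℕ) {U : Opens M} (e : ExtSections F E d U) :
    IsHomogSection F E a (partSec a e) := fun _ => ExtDual.part_homog a _

theorem evalSec_sum {ι : Type*} (s : Finset ι) {U : Opens M} (e : ι → ExtSections F E d U) (x : U) :
    (∑ i ∈ s, e i).1 x = ∑ i ∈ s, (e i).1 x := map_sum (evalSec x) e s

theorem sum_partSec {U : Opens M} (e : ExtSections F E d U) :
    ∑ a ∈ Finset.range (n + 1), partSec a e = e :=
  ExtSections.ext_eval fun x => (evalSec_sum _ _ x).trans (ExtDual.sum_part _)

/-- A section of `E_ℝ^*` as a section of `Sym E^*`. -/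
def symSec {U : Opens M} : ExtSections F E d U →ₗ[ℝ] symSections F E d U where
  toFun e := ⟨fun x => GSym.ofExt _ (e.1 x), fun x =>
    ⟨U, le_rfl, x.2, Algebra.subset_adjoin ⟨e, rfl⟩⟩⟩
  map_add' _ _ := Subtype.ext (funext fun _ => map_add _ _ _)
  map_smul' c _ := Subtype.ext (funext fun _ => map_smul _ c _)

theorem symSec_apply {U : Opens M} (e : ExtSections F E d U) (x : U) :
    (symSec e).1 x = GSym.ofExt _ (e.1 x) := rfl

theorem symSec_oneSec {U : Opens M} : symSec (oneSec F E d U) = 1 :=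
  Subtype.ext (funext fun x => by
    rw [symSec_apply, oneSec_apply, GSym.ofExt_apply, map_one, map_zero, add_zero]; rfl)

theorem symSec_mem_adjoin {U : Opens M} (e : ExtSections F E d U) :
    (symSec e).1 ∈ Algebra.adjoin ℝ (symGenerators F E d U) := Algebra.subset_adjoin ⟨e, rfl⟩

/-- Polynomials are sums of iterated products of homogeneous sections, because every section is the
sum of its homogeneous parts; stability under left multiplication by homogeneous sections is
therefore enough. -/
theorem sym_induction {U : Opens M} {P : symSections F E d U → Prop} (h1 : P 1)
    (hadd : ∀ s t, P s → P t → P (s + t))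
    (hmul : ∀ (b : ℤ) e t, IsHomogSection F E b e → P t → P (symSec e * t))
    {t : symSections F E d U} (ht : t.1 ∈ Algebra.adjoin ℝ (symGenerators F E d U)) : P t := by
  have h0 : P 0 := by
    have := hmul 0 0 1 (fun x => ExtDual.IsHomog.zero) h1
    rwa [map_zero, zero_mul] at this
  have hsum : ∀ (A : Finset ℕ) (g : ℕ → symSections F E d U), (∀ a, P (g a)) →
      P (∑ a ∈ A, g a) := by
    intro A g hg
    classical
    induction A using Finset.induction_on with
    | empty => simpa using h0
    | insert a A ha ih => rw [Finset.sum_insert ha]; exact hadd _ _ (hg a) ih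
  -- The predicate P need not be multiplicative. The induction runs over those s whose left
  -- multiplication preserves P, and is applied to 1 at the end.
  have key : ∀ s, s ∈ Algebra.adjoin ℝ (symGenerators F E d U) →
      ∃ h : s ∈ symSections F E d U, ∀ t, P t → P (⟨s, h⟩ * t) := by
    intro s hs
    induction hs using Algebra.adjoin_induction with
    | mem s hs =>
      obtain ⟨e, rfl⟩ := hs
      refine ⟨(symSec e).2, fun t ht => ?_⟩
      change P (symSec e * t)
      rw [← sum_partSec e, map_sum, Finset.sum_mul]
      exact hsum _ _ fun a => hmul a _ t (partSec_homog a e) ht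
    | algebraMap c =>
      refine ⟨Subalgebra.algebraMap_mem _ c, fun t ht => ?_⟩
      have h2 := hmul 0 (c • oneSec F E d U) t (fun x => (oneSec_homog x).smul c) ht
      rw [map_smul, symSec_oneSec] at h2
      convert h2 using 2
      exact Subtype.ext (Algebra.algebraMap_eq_smul_one c)
    | add s s' _ _ h h' =>
      obtain ⟨hs, h⟩ := h
      obtain ⟨hs', h'⟩ := h'
      refine ⟨add_mem hs hs', fun t ht => ?_⟩
      have h2 := hadd _ _ (h t ht) (h' t ht)
      rwa [← add_mul] at h2
    | mul s s' _ _ h h' =>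
      obtain ⟨hs, h⟩ := h
      obtain ⟨hs', h'⟩ := h'
      refine ⟨mul_mem hs hs', fun t ht => ?_⟩
      have h2 := h _ (h' t ht)
      rwa [← mul_assoc] at h2
  obtain ⟨h, ht⟩ := key t.1 ht
  have := ht 1 h1
  rwa [mul_one] at this

variable (B : CoalgebraBundle F E d)

namespace CoalgebraBundle

theorem mkFun_eq_iff {U : Opens M} {s t : symSections F E d U} :
    B.mkFun U s = B.mkFun U t ↔ s - t ∈ B.idealSheaf U :=
  (RingCon.eq (B.idealSheaf U).ringCon).trans (TwoSidedIdeal.rel_iff _ s t)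

theorem mkFun_eq_zero_iff {U : Opens M} {s : symSections F E d U} :
    B.mkFun U s = 0 ↔ s ∈ B.idealSheaf U := by
  rw [← map_zero (B.mkFun U), mkFun_eq_iff, sub_zero]

theorem mkFun_surjective (U : Opens M) : Function.Surjective (B.mkFun U) :=
  fun g => Quotient.exists_rep g

theorem ofSection_eq {U : Opens M} (e : ExtSections F E d U) :
    B.ofSection U e = B.mkFun U (symSec e) := rfl

theorem mem_idealSheaf_iff {U : Opens M} {s : symSections F E d U} :
    s ∈ B.idealSheaf U ↔ ∀ x : U, ∃ (V : Opens M) (h : V ≤ U), (x : M) ∈ V ∧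
      symRestrict F E d h s ∈ TwoSidedIdeal.span (B.relators V) :=
  TwoSidedIdeal.mem_mk' ..

theorem span_le_idealSheaf {U : Opens M} {s : symSections F E d U}
    (hs : s ∈ TwoSidedIdeal.span (B.relators U)) : s ∈ B.idealSheaf U :=
  B.mem_idealSheaf_iff.mpr fun x => ⟨U, le_rfl, x.2, hs⟩

/-- Evaluation of sections of `Sym E^*` at a point. -/
def symEval {U : Opens M} (x : U) : symSections F E d U →ₐ[ℝ] SymFibre E (x : M) where
  toFun s := s.1 x
  map_one' := rfl
  map_mul' _ _ := rfl
  map_zero' := rfl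
  map_add' _ _ := rfl
  commutes' _ := rfl

theorem act_span {U : Opens M} {s : symSections F E d U}
    (hs : s ∈ TwoSidedIdeal.span (B.relators U)) (x : U) :
    GSym.act (B.isGradedCoalgebra x) (s.1 x) = 0 := by
  have h1 : TwoSidedIdeal.span (B.relators U) ≤
      TwoSidedIdeal.ker ((GSym.act (B.isGradedCoalgebra (x : M))).comp (symEval x)) := by
    rw [TwoSidedIdeal.span_le]
    rintro t ⟨i, j, ξ, η, -, -, -, ht⟩
    refine (TwoSidedIdeal.mem_ker _).mpr ?_
    change GSym.act _ (t.1 x) = 0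
    rw [ht]
    exact GSym.act_relator _ i j _ _
  exact (TwoSidedIdeal.mem_ker _).mp (h1 hs)

theorem act_idealSheaf {U : Opens M} {s : symSections F E d U} (hs : s ∈ B.idealSheaf U) (x : U) :
    GSym.act (B.isGradedCoalgebra x) (s.1 x) = 0 := by
  obtain ⟨V, h, hx, hV⟩ := B.mem_idealSheaf_iff.mp hs x
  exact B.act_span hV ⟨x, hx⟩

/-- Elements of the ideal act as zero on each fibre, whereas a section acting on the unit returns
its own value. -/
theorem ofSection_injective (U : Opens M) : Function.Injective (B.ofSection U) := by
  refine (injective_iff_map_eq_zero (B.ofSection U)).mpr fun e he => ExtSections.ext_eval fun x => ?_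
  have h1 : GSym.act (B.isGradedCoalgebra (x : M)) (GSym.ofExt _ (e.1 x)) = 0 :=
    B.act_idealSheaf (s := symSec e) (B.mkFun_eq_zero_iff.mp he) x
  rw [← GSym.act_ofExt_one (B.isGradedCoalgebra (x : M)) (e.1 x), h1]
  rfl

theorem ofSection_mem_funDeg {U : Opens M} {a : ℤ} {e : ExtSections F E d U}
    (he : IsHomogSection F E a e) : B.ofSection U e ∈ B.funDeg U a :=
  ⟨symSec e, fun x => GSym.ofExt_mem_deg (he x), rfl⟩

theorem homogSection_eq_zero {U : Opens M} {a : ℤ} {e : ExtSections F E d U}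
    (he : IsHomogSection F E a e) (ha : a < 0 ∨ n < a) : e = 0 :=
  ExtSections.ext_eval fun x => (he x).eq_zero ha

/-- Relators only treat two factors of positive degree. If one factor has degree 0, the difference
is zero because m is then scalar multiplication, and homogeneous sections of degree outside 0, …, n
vanish. -/
theorem symSec_mul_sub_mem {U : Opens M} {a b : ℤ} {e e' : ExtSections F E d U}
    (he : IsHomogSection F E a e) (he' : IsHomogSection F E b e') (hab : a + b ≤ n) :
    symSec e * symSec e' - symSec (B.mul e e') ∈ TwoSidedIdeal.span (B.relators U) := by
  by_cases h0 : a < 0 ∨ n < a ∨ b < 0 ∨ n < b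
  · have h1 : e = 0 ∨ e' = 0 := by
      rcases h0 with h | h | h | h
      exacts [.inl (homogSection_eq_zero he (.inl h)), .inl (homogSection_eq_zero he (.inr h)),
        .inr (homogSection_eq_zero he' (.inl h)), .inr (homogSection_eq_zero he' (.inr h))]
    have h2 : symSec e * symSec e' - symSec (B.mul e e') = 0 := by
      refine Subtype.ext (funext fun x => ?_)
      change GSym.ofExt _ (e.1 x) * GSym.ofExt _ (e'.1 x) -
        GSym.ofExt _ (extMul (B.μ x) (e.1 x) (e'.1 x)) = 0
      rcases h1 with rfl | rfl
      · change GSym.ofExt _ 0 * GSym.ofExt _ (e'.1 x) -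
          GSym.ofExt _ (extMul (B.μ x) 0 (e'.1 x)) = 0
        rw [map_zero, zero_mul, ← extMulLeft_apply, map_zero, LinearMap.zero_apply, map_zero,
          sub_zero]
      · change GSym.ofExt _ (e.1 x) * GSym.ofExt _ 0 -
          GSym.ofExt _ (extMul (B.μ x) (e.1 x) 0) = 0
        rw [map_zero, mul_zero, ← extMulLeft_apply, map_zero, map_zero, sub_zero]
    rw [h2]
    exact TwoSidedIdeal.zero_mem _
  push Not at h0
  obtain ⟨ha0, han, hb0, hbn⟩ := h0
  have hz : ∀ e : ExtSections F E d U, IsHomogSection F E 0 e → ∀ x, e.1 x = ((e.1 x).1, 0) :=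
    fun e he x => (he x).eq_scalar
  have hp : ∀ (i : Fin n) (e : ExtSections F E d U), IsHomogSection F E (i.val + 1 : ℤ) e →
      ∀ x, e.1 x = (0, Pi.single i ((e.1 x).2 i)) :=
    fun i e he x => (he x).eq_single
  by_cases ha : a = 0
  · have h2 : symSec e * symSec e' - symSec (B.mul e e') = 0 := by
      refine Subtype.ext (funext fun x => ?_)
      change GSym.ofExt _ (e.1 x) * GSym.ofExt _ (e'.1 x) -
        GSym.ofExt _ (extMul (B.μ x) (e.1 x) (e'.1 x)) = 0
      subst ha
      rw [hz e he x, extMul_scalar, map_smul, GSym.ofExt_apply ((e.1 x).1, 0), map_zero, add_zero,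
        Algebra.smul_def, sub_self]
    rw [h2]
    exact TwoSidedIdeal.zero_mem _
  by_cases hb : b = 0
  · have h2 : symSec e * symSec e' - symSec (B.mul e e') = 0 := by
      refine Subtype.ext (funext fun x => ?_)
      change GSym.ofExt _ (e.1 x) * GSym.ofExt _ (e'.1 x) -
        GSym.ofExt _ (extMul (B.μ x) (e.1 x) (e'.1 x)) = 0
      subst hb
      rw [hz e' he' x, extMul_scalar_right, map_smul, GSym.ofExt_apply ((e'.1 x).1, 0), map_zero,
        add_zero, Algebra.smul_def, ← Algebra.commutes, sub_self]
    rw [h2]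
    exact TwoSidedIdeal.zero_mem _
  obtain ⟨i, rfl⟩ : ∃ i : Fin n, a = i.val + 1 :=
    ⟨⟨(a - 1).toNat, by omega⟩, by simp only; omega⟩
  obtain ⟨j, rfl⟩ : ∃ j : Fin n, b = j.val + 1 :=
    ⟨⟨(b - 1).toNat, by omega⟩, by simp only; omega⟩
  refine TwoSidedIdeal.subset_span ⟨i, j, fun x => (e.1 x).2 i, fun x => (e'.1 x).2 j, by omega,
    e.2.2 i, e'.2.2 j, funext fun x => ?_⟩
  change GSym.ofExt _ (e.1 x) * GSym.ofExt _ (e'.1 x) -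
    GSym.ofExt _ (extMul (B.μ x) (e.1 x) (e'.1 x)) = _
  conv_lhs => rw [hp i e he x, hp j e' he' x, extMul_single, GSym.ofExt_apply, GSym.ofExt_apply,
    GSym.ofExt_apply]
  simp only [map_zero, zero_add]

theorem ofSection_mul {U : Opens M} {a b : ℤ} {e e' : ExtSections F E d U}
    (he : IsHomogSection F E a e) (he' : IsHomogSection F E b e') (hab : a + b ≤ n) :
    B.ofSection U (B.mul e e') = B.ofSection U e * B.ofSection U e' := by
  rw [ofSection_eq, ofSection_eq, ofSection_eq, ← map_mul]
  exact (B.mkFun_eq_iff.mpr (B.span_le_idealSheaf (B.symSec_mul_sub_mem he he' hab))).symm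

theorem mul_homog {U : Opens M} {a b : ℤ} {e e' : ExtSections F E d U}
    (he : IsHomogSection F E a e) (he' : IsHomogSection F E b e') :
    IsHomogSection F E (a + b) (B.mul e e') :=
  fun x => extMul_homog (B.isGradedCoalgebra (x : M)) (he x) (he' x)

/-- Reduction of a product e t with e of degree b: by induction the part of t of degree a − b is a
section e' modulo relators, and one more relator replaces e e' by m(e, e'), because b + (a − b) = a
≤ n. -/
theorem exists_proj_eq {V : Opens M} {t : symSections F E d V}
    (ht : t.1 ∈ Algebra.adjoin ℝ (symGenerators F E d V)) {a : ℤ} (ha : a ≤ n) :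
    ∃ e : ExtSections F E d V, IsHomogSection F E a e ∧
      ∃ r ∈ TwoSidedIdeal.span (B.relators V), ∀ y, GSym.proj a (t.1 y) =
        (symSec e).1 y + r.1 y := by
  revert a
  refine sym_induction (P := fun t => ∀ {a : ℤ}, a ≤ n → ∃ e : ExtSections F E d V,
    IsHomogSection F E a e ∧ ∃ r ∈ TwoSidedIdeal.span (B.relators V),
      ∀ y, GSym.proj a (t.1 y) = (symSec e).1 y + r.1 y) ?_ ?_ ?_ ht
  · intro a ha
    by_cases h : a = 0
    · subst h
      refine ⟨oneSec F E d V, oneSec_homog, 0, TwoSidedIdeal.zero_mem _, fun y => ?_⟩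
      rw [symSec_oneSec]
      exact (GSym.proj_of_mem_deg GSym.one_mem_deg).trans (add_zero _).symm
    · refine ⟨0, fun _ => ExtDual.IsHomog.zero, 0, TwoSidedIdeal.zero_mem _, fun y => ?_⟩
      rw [map_zero]
      exact (GSym.proj_of_mem_deg_ne (Ne.symm h) GSym.one_mem_deg).trans (add_zero _).symm
  · intro s t hs ht a ha
    obtain ⟨e, he, r, hr, h⟩ := hs ha
    obtain ⟨e', he', r', hr', h'⟩ := ht ha
    refine ⟨e + e', fun x => (he x).add (he' x), r + r', TwoSidedIdeal.add_mem _ hr hr',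
      fun y => ?_⟩
    rw [map_add]
    change GSym.proj a (s.1 y + t.1 y) = ((symSec e).1 y + (symSec e').1 y) + (r.1 y + r'.1 y)
    rw [map_add, h, h']
    abel
  · intro b e t he ht a ha
    -- The induction hypothesis needs a − b ≤ n, which holds for b ≥ 0; a section of negative degree
    -- is zero.
    by_cases hb : b < 0
    · refine ⟨0, fun _ => ExtDual.IsHomog.zero, 0, TwoSidedIdeal.zero_mem _, fun y => ?_⟩
      rw [homogSection_eq_zero he (.inl hb), map_zero, zero_mul]
      exact (map_zero (GSym.proj a)).trans (add_zero _).symm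
    obtain ⟨e', he', r, hr, h⟩ := ht (a := a - b) (by omega)
    refine ⟨B.mul e e', ?_, symSec e * symSec e' - symSec (B.mul e e') + symSec e * r,
      TwoSidedIdeal.add_mem _ (B.symSec_mul_sub_mem he he' (by omega))
        (TwoSidedIdeal.mul_mem_left _ _ _ hr), fun y => ?_⟩
    · have := B.mul_homog he he'
      rwa [add_sub_cancel] at this
    · have h1 : GSym.proj a ((symSec e).1 y * t.1 y) = (symSec e).1 y * GSym.proj (a - b) (t.1 y) :=
        GSym.proj_mul (GSym.ofExt_mem_deg (he y)) _
      refine h1.trans ?_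
      rw [h, mul_add]
      change _ = (symSec (B.mul e e')).1 y + ((symSec e).1 y * (symSec e').1 y -
        (symSec (B.mul e e')).1 y + (symSec e).1 y * r.1 y)
      abel

/-- Representatives near each point come from `exists_proj_eq`. They glue because the action of s on
the unit is defined over all of U and returns each local representative. -/
theorem exists_ofSection_eq {U : Opens M} {a : ℤ} (ha : a ≤ n)
    {f : B.Fun U} (hf : f ∈ B.funDeg U a) :
    ∃ e : ExtSections F E d U, IsHomogSection F E a e ∧ B.ofSection U e = f := by
  obtain ⟨s, hs, rfl⟩ := hf
  have key : ∀ x : U, ∃ (V : Opens M) (h : V ≤ U), (x : M) ∈ V ∧ ∃ e : ExtSections F E d V,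
      IsHomogSection F E a e ∧ ∃ r ∈ TwoSidedIdeal.span (B.relators V),
        ∀ y : V, s.1 (incl h y) = (symSec e).1 y + r.1 y := by
    intro x
    obtain ⟨V, h, hx, hV⟩ := s.2 x
    obtain ⟨e, he, r, hr, h1⟩ := B.exists_proj_eq (t := symRestrict F E d h s) hV ha
    exact ⟨V, h, hx, e, he, r, hr, fun y => (GSym.proj_of_mem_deg (hs _)).symm.trans (h1 y)⟩
  let w : ∀ x : U, ExtFibre E (x : M) := fun x =>
    GSym.act (B.isGradedCoalgebra (x : M)) (s.1 x) (1, 0)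
  have hw : ∀ {V : Opens M} (h : V ≤ U) (e : ExtSections F E d V),
      ∀ r ∈ TwoSidedIdeal.span (B.relators V), (∀ y : V, s.1 (incl h y) =
        (symSec e).1 y + r.1 y) → ∀ y : V, w (incl h y) = e.1 y := by
    intro V h e r hr h1 y
    change GSym.act (B.isGradedCoalgebra (y : M)) (s.1 (incl h y)) (1, 0) = _
    rw [h1, map_add, B.act_span hr y, add_zero]
    exact GSym.act_ofExt_one _ _
  let e : ExtSections F E d U := ⟨w, mem_extSubmodule_of_local fun x => by
    obtain ⟨V, h, hx, e, -, r, hr, h1⟩ := key x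
    exact ⟨V, h, hx, e, hw h e r hr h1⟩⟩
  refine ⟨e, fun x => ?_, B.mkFun_eq_iff.mpr (B.mem_idealSheaf_iff.mpr fun x => ?_)⟩
  · have := GSym.act_homog (B.isGradedCoalgebra (x : M)) (hs x)
      (ExtDual.isHomog_scalar (V := fun i => E i (x : M)) 1)
    rwa [add_zero] at this
  · obtain ⟨V, h, hx, e', he', r, hr, h1⟩ := key x
    refine ⟨V, h, hx, ?_⟩
    have h2 : symRestrict F E d h (symSec e - s) = -r := by
      refine Subtype.ext (funext fun y => ?_)
      change GSym.ofExt _ (w (incl h y)) - s.1 (incl h y) = -r.1 y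
      rw [hw h e' r hr h1 y, h1 y]
      change GSym.ofExt _ (e'.1 y) - (GSym.ofExt _ (e'.1 y) + r.1 y) = -r.1 y
      rw [sub_add_cancel_left]
    exact h2 ▸ TwoSidedIdeal.neg_mem _ hr

theorem ofSection_image (U : Opens M) {a : ℤ} (ha : a ≤ n) :
    B.ofSection U '' {e | IsHomogSection F E a e} = B.funDeg U a := by
  refine Set.Subset.antisymm ?_ fun f hf => ?_
  · rintro _ ⟨e, he, rfl⟩
    exact B.ofSection_mem_funDeg he
  · obtain ⟨e, he, h⟩ := B.exists_ofSection_eq ha hf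
    exact ⟨e, he, h⟩

end CoalgebraBundle

end Functions

/-! ### From vector fields to derivations of E_ℝ^*, and injectivity -/

section VectorFields

variable {d n : ℕ} {M : Type*} [TopologicalSpace M] [ChartedSpace (EuclideanSpace ℝ (Fin d)) M]
  [T2Space M] [IsManifold (𝓡 d) ∞ M]
  {F : Fin n → Type*} [∀ i, NormedAddCommGroup (F i)] [∀ i, NormedSpace ℝ (F i)]
  {E : Fin n → M → Type*} [∀ i x, AddCommGroup (E i x)] [∀ i x, Module ℝ (E i x)]
  [∀ i x, TopologicalSpace (E i x)] [∀ i, TopologicalSpace (TotalSpace (F i) (E i))]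
  [∀ i, FiberBundle (F i) (E i)] [∀ i, VectorBundle ℝ (F i) (E i)]
  [∀ i, FiniteDimensional ℝ (F i)] [∀ i, ContMDiffVectorBundle ∞ (F i) (E i) (𝓡 d)]

/-- Sections of `Sym E^*` are locally restrictions of polynomial expressions in sections over a
larger open set. -/
theorem exists_adjoin_eq_near {U V : Opens M} (h : V ≤ U) (s : symSections F E d V) (x : V) :
    ∃ t : symSections F E d U, t.1 ∈ Algebra.adjoin ℝ (symGenerators F E d U) ∧
      ∃ W : Opens M, W ≤ V ∧ (x : M) ∈ W ∧ ∀ y : V, (y : M) ∈ W → t.1 (incl h y) = s.1 y := by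
  obtain ⟨V', h', hx, hV⟩ := s.2 x
  obtain ⟨ρ, hρ⟩ := exists_isBump (d := d) hx
  obtain ⟨W, hxW, hWV, hW⟩ := hρ.exists_opens hx
  have key : ∀ {s' : symSections F E d V'}, s'.1 ∈ Algebra.adjoin ℝ (symGenerators F E d V') →
      ∃ t : symSections F E d U, t.1 ∈ Algebra.adjoin ℝ (symGenerators F E d U) ∧
        ∀ y : V', (y : M) ∈ W → t.1 (incl (h'.trans h) y) = s'.1 y := by
    intro s' hs'
    refine sym_induction (P := fun s' => ∃ t : symSections F E d U,
      t.1 ∈ Algebra.adjoin ℝ (symGenerators F E d U) ∧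
        ∀ y : V', (y : M) ∈ W → t.1 (incl (h'.trans h) y) = s'.1 y) ?_ ?_ ?_ hs'
    · exact ⟨1, one_mem _, fun y _ => rfl⟩
    · rintro s s' ⟨t, ht, h1⟩ ⟨t', ht', h1'⟩
      exact ⟨t + t', add_mem ht ht', fun y hy => congrArg₂ (· + ·) (h1 y hy) (h1' y hy)⟩
    · rintro b e s - ⟨t, ht, h1⟩
      refine ⟨symSec (cut hρ U e) * t, mul_mem (symSec_mem_adjoin _) ht, fun y hy =>
        congrArg₂ (· * ·) ?_ (h1 y hy)⟩
      refine congrArg (GSym.ofExt _) ?_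
      exact restrict_cut_eq hρ (h'.trans h) e (hW y hy)
  obtain ⟨t, ht, h1⟩ := key (s' := symRestrict F E d h' s) hV
  exact ⟨t, ht, W, hWV.trans h', hxW, fun y hy => h1 ⟨y, hWV hy⟩ hy⟩

variable (B : CoalgebraBundle F E d)

namespace CoalgebraBundle

/-- A smooth function as a section of `Sym E^*`. -/
def smoothSec {U : Opens M} (f : Smooth d U) : symSections F E d U := symSec (f • oneSec F E d U)

theorem smoothSec_apply {U : Opens M} (f : Smooth d U) (x : U) :
    (smoothSec (F := F) (E := E) f).1 x = algebraMap ℝ _ (f x) := by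
  change GSym.ofExt _ (f x • ((1, 0) : ExtFibre E (x : M))) = _
  rw [map_smul, GSym.ofExt_apply, map_one, map_zero, add_zero, Algebra.algebraMap_eq_smul_one]

theorem ofSmooth_eq {U : Opens M} (f : Smooth d U) :
    B.ofSmooth U f = B.ofSection U (f • oneSec F E d U) :=
  congrArg (B.mkFun U) (Subtype.ext (funext fun x => (smoothSec_apply f x).symm))

theorem ofSmooth_mem_funDeg {U : Opens M} (f : Smooth d U) : B.ofSmooth U f ∈ B.funDeg U 0 := by
  rw [ofSmooth_eq]
  exact B.ofSection_mem_funDeg fun x => (oneSec_homog x).smul (f x)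

theorem ofSection_oneSec {U : Opens M} : B.ofSection U (oneSec F E d U) = 1 := by
  rw [ofSection_eq, symSec_oneSec, map_one]

theorem ofSection_smul {U : Opens M} (f : Smooth d U) (e : ExtSections F E d U) :
    B.ofSection U (f • e) = f • B.ofSection U e := by
  rw [smooth_smul_def, ofSmooth_eq, ofSection_eq, ofSection_eq, ofSection_eq, ← map_mul]
  refine congrArg (B.mkFun U) (Subtype.ext (funext fun x => ?_))
  change GSym.ofExt _ (f x • e.1 x) = (smoothSec (F := F) (E := E) f).1 x * GSym.ofExt _ (e.1 x)
  rw [smoothSec_apply, map_smul, Algebra.smul_def]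

theorem funRestrict_ofSection {U V : Opens M} (h : V ≤ U) (e : ExtSections F E d U) :
    B.funRestrict h (B.ofSection U e) = B.ofSection V (extRestrict F E d h e) := rfl

theorem funRestrict_ofSmooth {U V : Opens M} (h : V ≤ U) (f : Smooth d U) :
    B.funRestrict h (B.ofSmooth U f) = B.ofSmooth V (f.res h) := rfl

theorem funRestrict_mem_funDeg {U V : Opens M} (h : V ≤ U) {l : ℤ} {f : B.Fun U}
    (hf : f ∈ B.funDeg U l) : B.funRestrict h f ∈ B.funDeg V l := by
  obtain ⟨s, hs, rfl⟩ := hf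
  exact ⟨symRestrict F E d h s, fun x => hs (incl h x), rfl⟩

/-- A graded derivation along a restriction map which vanishes on the sections of `E_ℝ^*` is zero. -/
theorem derivation_eq_zero {U V : Opens M} (h : V ≤ U) {k : ℤ} (Z : B.Fun U →+ B.Fun V)
    (hZ : ∀ (l : ℤ), ∀ f ∈ B.funDeg U l, ∀ g, Z (f * g) =
      Z f * B.funRestrict h g + (k * l).negOnePow • (B.funRestrict h f * Z g))
    (h0 : ∀ e, Z (B.ofSection U e) = 0) (f : B.Fun U) : Z f = 0 := by
  obtain ⟨s, rfl⟩ := B.mkFun_surjective U f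
  obtain ⟨t, ht⟩ := B.mkFun_surjective V (Z (B.mkFun U s))
  rw [← ht, mkFun_eq_zero_iff, mem_idealSheaf_iff]
  intro x
  -- The polynomial s' has the germ of s at x, and the Leibniz rule gives Z(s') = 0. For a bump
  -- function φ supported where s = s', applying Z to φ (s − s') = 0 gives φ Z(s) = 0. So the
  -- representative t of Z(s) lies in the ideal near x, where φ = 1.
  obtain ⟨s', hs', W, hWU, hxW, hW⟩ := exists_adjoin_eq_near le_rfl s (incl h x)
  have h1 : Z (B.mkFun U s') = 0 := by
    refine sym_induction (P := fun s' => Z (B.mkFun U s') = 0) ?_ ?_ ?_ hs'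
    · rw [map_one, ← ofSection_oneSec, h0]
    · intro s t hs ht
      rw [map_add, map_add, hs, ht, add_zero]
    · intro b e t he ht
      rw [map_mul, ← ofSection_eq, hZ b _ (B.ofSection_mem_funDeg he), h0, ht, zero_mul, mul_zero,
        smul_zero, add_zero]
  obtain ⟨ρ, hρ⟩ := exists_isBump (d := d) hxW
  let φ : Smooth d U := Smooth.ofGlobal U ρ hρ.smooth
  have h2 : B.ofSmooth U φ * B.mkFun U (s - s') = 0 := by
    rw [ofSmooth_eq, ofSection_eq, ← map_mul, ← map_zero (B.mkFun U)]
    refine congrArg (B.mkFun U) (Subtype.ext (funext fun y => ?_))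
    change (smoothSec (F := F) (E := E) φ).1 y * (s.1 y - s'.1 y) = 0
    rw [smoothSec_apply]
    by_cases hy : (y : M) ∈ W
    · rw [← hW y hy]
      exact (congrArg _ (sub_self _)).trans (mul_zero _)
    · have h3 : φ y = 0 := hρ.eq_zero hy
      rw [h3, map_zero, zero_mul]
  have h3 := hZ 0 _ (B.ofSmooth_mem_funDeg φ) (B.mkFun U (s - s'))
  rw [h2, map_zero, ofSmooth_eq, h0, zero_mul, zero_add, mul_zero, Int.negOnePow_zero, one_smul,
    map_sub, map_sub, h1, sub_zero, ← ht, ← ofSmooth_eq, funRestrict_ofSmooth, ofSmooth_eq,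
    ofSection_eq, ← map_mul] at h3
  obtain ⟨V', hV', hxV', h4⟩ := B.mem_idealSheaf_iff.mp (B.mkFun_eq_zero_iff.mp h3.symm) x
  obtain ⟨W', hxW', hW'V, hW'⟩ := hρ.exists_opens hxV'
  refine ⟨W', hW'V.trans hV', hxW', ?_⟩
  have h5 := B.symRestrict_span hW'V h4
  convert h5 using 1
  refine Subtype.ext (funext fun y => ?_)
  change t.1 _ = (smoothSec (F := F) (E := E) (φ.res h)).1 (incl (hW'V.trans hV') y) * t.1 _
  rw [smoothSec_apply]
  have h6 : (φ.res h) (incl (hW'V.trans hV') y) = 1 := hW' y y.2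
  rw [h6, map_one, one_mul]

section ToDerivation

variable {k : ℤ} {U : Opens M}

/-- As k ≤ 0, the homogeneous part of e of degree a ≤ n goes to degree a + k ≤ n, where functions
are sections. -/
theorem exists_ofSection_eq_vectorField (hk : k ≤ 0) {X : B.Fun U →ₗ[ℝ] B.Fun U}
    (hX : X ∈ B.vectorFields k U) (e : ExtSections F E d U) :
    ∃ e' : ExtSections F E d U, B.ofSection U e' = X (B.ofSection U e) := by
  have h1 : ∀ a ∈ Finset.range (n + 1), ∃ e' : ExtSections F E d U,
      B.ofSection U e' = X (B.ofSection U (partSec a e)) := by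
    intro a ha
    have ha' := Finset.mem_range.mp ha
    obtain ⟨e', -, h⟩ := B.exists_ofSection_eq (a := a + k) (by omega)
      (hX a _ (B.ofSection_mem_funDeg (partSec_homog a e))).1
    exact ⟨e', h⟩
  choose! g hg using h1
  refine ⟨∑ a ∈ Finset.range (n + 1), g a, ?_⟩
  conv_rhs => rw [← sum_partSec e, map_sum, map_sum]
  rw [map_sum]
  exact Finset.sum_congr rfl hg

/-- The action of a vector field on the sections of `E_ℝ^*`. -/
def vfDer (hk : k ≤ 0) {X : B.Fun U →ₗ[ℝ] B.Fun U} (hX : X ∈ B.vectorFields k U) :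
    ExtSections F E d U →ₗ[ℝ] ExtSections F E d U where
  toFun e := (B.exists_ofSection_eq_vectorField hk hX e).choose
  map_add' e e' := B.ofSection_injective U (by
    refine (B.exists_ofSection_eq_vectorField hk hX (e + e')).choose_spec.trans ?_
    rw [map_add (B.ofSection U), map_add X,
      map_add (B.ofSection U) (B.exists_ofSection_eq_vectorField hk hX e).choose,
      (B.exists_ofSection_eq_vectorField hk hX e).choose_spec,
      (B.exists_ofSection_eq_vectorField hk hX e').choose_spec])
  map_smul' c e := B.ofSection_injective U (by
    refine (B.exists_ofSection_eq_vectorField hk hX (c • e)).choose_spec.trans ?_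
    rw [map_smul (B.ofSection U), map_smul X, RingHom.id_apply,
      map_smul (B.ofSection U) c (B.exists_ofSection_eq_vectorField hk hX e).choose,
      (B.exists_ofSection_eq_vectorField hk hX e).choose_spec])

theorem ofSection_vfDer (hk : k ≤ 0) {X : B.Fun U →ₗ[ℝ] B.Fun U} (hX : X ∈ B.vectorFields k U)
    (e : ExtSections F E d U) : B.ofSection U (B.vfDer hk hX e) = X (B.ofSection U e) :=
  (B.exists_ofSection_eq_vectorField hk hX e).choose_spec

theorem vfDer_homog (hk : k ≤ 0) {X : B.Fun U →ₗ[ℝ] B.Fun U} (hX : X ∈ B.vectorFields k U)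
    {a : ℤ} {e : ExtSections F E d U} (he : IsHomogSection F E a e) :
    IsHomogSection F E (a + k) (B.vfDer hk hX e) := by
  by_cases ha : a ≤ n
  · obtain ⟨e', he', h⟩ := B.exists_ofSection_eq (a := a + k) (by omega)
      (hX a _ (B.ofSection_mem_funDeg he)).1
    have h1 : B.vfDer hk hX e = e' := B.ofSection_injective U
      ((B.ofSection_vfDer hk hX e).trans h.symm)
    rw [h1]
    exact he'
  · rw [homogSection_eq_zero he (.inr (by omega)), map_zero]
    exact fun _ => ExtDual.IsHomog.zero

/-- The section D(f · 1) has degree k ≤ 0, hence is a function c f times 1. The Leibniz rule makes c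
a derivation of the smooth functions, and its vector field is the symbol. -/
theorem vfDer_mem_derivations (hk : k ≤ 0) {X : B.Fun U →ₗ[ℝ] B.Fun U}
    (hX : X ∈ B.vectorFields k U) : B.vfDer hk hX ∈ derivations F E d k U := by
  let D := B.vfDer hk hX
  let c : Smooth d U → Smooth d U := fun f => ⟨fun x => ((D (f • oneSec F E d U)).1 x).1,
    (D (f • oneSec F E d U)).2.1⟩
  have hc : ∀ f, D (f • oneSec F E d U) = c f • oneSec F E d U := fun f =>
    ExtSections.ext_eval fun x => by
      have h1 := B.vfDer_homog hk hX (a := 0) (e := f • oneSec F E d U)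
        (fun x => (oneSec_homog x).smul (f x)) x
      rw [zero_add] at h1
      change (D (f • oneSec F E d U)).1 x = ((D (f • oneSec F E d U)).1 x).1 • (1, 0)
      refine Prod.ext (mul_one _).symm (funext fun i => ?_)
      exact (h1.2 i (by omega)).trans (smul_zero ((D (f • oneSec F E d U)).1 x).1).symm
  have hD : ∀ (f : Smooth d U) e, D (f • e) = c f • e + f • D e := fun f e =>
    B.ofSection_injective U (by
      have h1 := (hX 0 _ (B.ofSmooth_mem_funDeg f)).2 (B.ofSection U e)
      rw [mul_zero, Int.negOnePow_zero, one_smul, ofSmooth_eq, ← B.ofSection_vfDer hk hX,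
        ← B.ofSection_vfDer hk hX] at h1
      change _ = B.ofSection U (D (f • oneSec F E d U)) * _ + _ * B.ofSection U (D e) at h1
      rw [hc, ← ofSmooth_eq, ← ofSmooth_eq, ← smooth_smul_def, ← smooth_smul_def,
        ← smooth_smul_def, ← ofSection_smul, ← B.ofSection_vfDer hk hX, ← ofSection_smul,
        ← ofSection_smul, ← map_add] at h1
      exact h1)
  have hc1 : ∀ f x, c f x = ((D (f • oneSec F E d U)).1 x).1 := fun f x => rfl
  let Δ : Smooth d U →ₗ[ℝ] Smooth d U :=
    { toFun := c
      map_add' := fun f g => by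
        ext x
        change c (f + g) x = c f x + c g x
        rw [hc1, add_smul, map_add]
        rfl
      map_smul' := fun r f => by
        ext x
        change c (r • f) x = r * c f x
        have h2 : (r • f) • oneSec F E d U = r • (f • oneSec F E d U) :=
          ExtSections.ext_eval fun x => smul_assoc r (f x) _
        rw [hc1, h2, map_smul]
        rfl }
  obtain ⟨Y, hY⟩ := exists_vectorField Δ fun f g => by
    ext x
    change c (f * g) x = c f x * g x + f x * c g x
    rw [hc1, mul_smul, hD, hc]
    change c f x * (g x * 1) + f x * (c g x * 1) = _
    ring
  refine ⟨⟨Y, fun f e x => ?_⟩, fun a e he => B.vfDer_homog hk hX he⟩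
  refine (congrArg (evalSec x) (hD f e)).trans ?_
  exact congrArg (fun r : ℝ => r • e.1 x + f x • (D e).1 x) (hY f x)

theorem ofSection_negOnePow (m : ℤ) (e : ExtSections F E d U) :
    B.ofSection U (m.negOnePow • e) = m.negOnePow • B.ofSection U e := by
  rw [negOnePow_smul, negOnePow_smul, map_smul]

theorem vfDer_mem (hk : k ≤ 0) {X : B.Fun U →ₗ[ℝ] B.Fun U} (hX : X ∈ B.vectorFields k U) :
    B.vfDer hk hX ∈ B.compatSections k U := by
  refine (B.mem_compatSections_iff (B.vfDer_mem_derivations hk hX)).mpr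
    fun a b e e' he he' hab => B.ofSection_injective U ?_
  rw [ofSection_vfDer, B.ofSection_mul he he' hab, (hX a _ (B.ofSection_mem_funDeg he)).2, map_add,
    ofSection_negOnePow, B.ofSection_mul (B.vfDer_homog hk hX he) he' (by omega),
    B.ofSection_mul he (B.vfDer_homog hk hX he') (by omega), ofSection_vfDer, ofSection_vfDer]

/-- The action of vector fields on the sections of `E_ℝ^*`, as a linear map. -/
def vfToDer (hk : k ≤ 0) (U : Opens M) :
    B.vectorFields k U →ₗ[Smooth d U] B.compatSections k U where
  toFun X := ⟨B.vfDer hk X.2, B.vfDer_mem hk X.2⟩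
  map_add' X Y := Subtype.ext (LinearMap.ext fun e => B.ofSection_injective U (by
    refine (B.ofSection_vfDer hk (X + Y).2 e).trans ?_
    change X.1 (B.ofSection U e) + Y.1 (B.ofSection U e) =
      B.ofSection U (B.vfDer hk X.2 e + B.vfDer hk Y.2 e)
    rw [map_add, ofSection_vfDer, ofSection_vfDer]))
  map_smul' f X := Subtype.ext (LinearMap.ext fun e => B.ofSection_injective U (by
    refine (B.ofSection_vfDer hk (f • X).2 e).trans ?_
    change f • X.1 (B.ofSection U e) = B.ofSection U (f • B.vfDer hk X.2 e)
    rw [ofSection_smul, ofSection_vfDer]))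

theorem ofSection_vfToDer (hk : k ≤ 0) (X : B.vectorFields k U) (e : ExtSections F E d U) :
    B.ofSection U ((B.vfToDer hk U X).1 e) = X.1 (B.ofSection U e) := B.ofSection_vfDer hk X.2 e

/-- The defect Y ∘ res − res ∘ X is a graded derivation along the restriction map, so it vanishes as
soon as it vanishes on sections of E_ℝ^*. -/
theorem isRestrictionVF_iff (hk : k ≤ 0) {V : Opens M} (h : V ≤ U) (X : B.vectorFields k U)
    (Y : B.vectorFields k V) : B.IsRestrictionVF h X.1 Y.1 ↔
      IsRestrictionDer h (B.vfToDer hk U X).1 (B.vfToDer hk V Y).1 := by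
  constructor
  · refine fun hXY e => B.ofSection_injective V ?_
    rw [ofSection_vfToDer, ← funRestrict_ofSection, ← funRestrict_ofSection, ofSection_vfToDer, hXY]
  · intro hXY
    let Z : B.Fun U →+ B.Fun V := Y.1.toAddMonoidHom.comp (B.funRestrict h).toAddMonoidHom -
      (B.funRestrict h).toAddMonoidHom.comp X.1.toAddMonoidHom
    have hZ : ∀ f, Z f = Y.1 (B.funRestrict h f) - B.funRestrict h (X.1 f) := fun f => rfl
    refine fun f => sub_eq_zero.mp (B.derivation_eq_zero h (k := k) Z (fun l f hf g => ?_)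
      (fun e => ?_) f)
    · rw [hZ, hZ, hZ, map_mul, (Y.2 l _ (B.funRestrict_mem_funDeg h hf)).2, (X.2 l f hf).2, map_add,
        map_mul, Units.smul_def, Units.smul_def, Units.smul_def, map_zsmul, map_mul, sub_mul,
        mul_sub, smul_sub]
      abel
    · rw [hZ, funRestrict_ofSection, ← ofSection_vfToDer B hk, ← ofSection_vfToDer B hk,
        funRestrict_ofSection, hXY, sub_self]

/-- Two vector fields with the same derivation are related by restriction along the identity
inclusion, hence equal. -/
theorem vfToDer_injective (hk : k ≤ 0) (U : Opens M) : Function.Injective (B.vfToDer hk U) := by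
  intro X Y h
  refine Subtype.ext (LinearMap.ext fun f => ?_)
  have h1 := (B.isRestrictionVF_iff hk le_rfl X Y).mpr (by rw [h]; exact fun e => rfl) f
  have h2 : ∀ f : B.Fun U, B.funRestrict le_rfl f = f := fun f => by
    obtain ⟨s, rfl⟩ := B.mkFun_surjective U f
    rfl
  rw [h2, h2] at h1
  exact h1.symm

end ToDerivation

end CoalgebraBundle

end VectorFields

/-! ### Derivations of Sym E^* at a point -/

section SymDerivation

variable {d n : ℕ} {M : Type*} [TopologicalSpace M] [ChartedSpace (EuclideanSpace ℝ (Fin d)) M]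
  [T2Space M] [IsManifold (𝓡 d) ∞ M]
  {F : Fin n → Type*} [∀ i, NormedAddCommGroup (F i)] [∀ i, NormedSpace ℝ (F i)]
  {E : Fin n → M → Type*} [∀ i x, AddCommGroup (E i x)] [∀ i x, Module ℝ (E i x)]
  [∀ i x, TopologicalSpace (E i x)] [∀ i, TopologicalSpace (TotalSpace (F i) (E i))]
  [∀ i, FiberBundle (F i) (E i)] [∀ i, VectorBundle ℝ (F i) (E i)]
  [∀ i, FiniteDimensional ℝ (F i)] [∀ i, ContMDiffVectorBundle ∞ (F i) (E i) (𝓡 d)]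
  {V₀ : Fin n → Type*} [∀ i, AddCommGroup (V₀ i)] [∀ i, Module ℝ (V₀ i)]
  [∀ i, FiniteDimensional ℝ (V₀ i)]
  {W : Opens M} (Θ : LocFrame F E d V₀ W)

namespace LocFrame

/-- The identification of the fibre of `Sym E^*` at `x` with the typical fibre. -/
def symFib (x : W) : SymFibre E (x : M) ≃ₐ[ℝ] GSym (fun i => Module.Dual ℝ (V₀ i)) :=
  AlgEquiv.ofAlgHom (GSym.map fun i => (Θ.toEquiv x i).toLinearMap.dualMap)
    (GSym.map fun i => (Θ.toEquiv x i).symm.toLinearMap.dualMap)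
    (AlgHom.ext fun s => by
      rw [AlgHom.comp_apply, GSym.map_map, AlgHom.id_apply]
      refine Eq.trans ?_ (GSym.map_id s)
      congr 1
      congr 1
      funext i
      exact LinearMap.ext fun φ => LinearMap.ext fun v =>
        congrArg φ ((Θ.toEquiv x i).symm_apply_apply v))
    (AlgHom.ext fun s => by
      rw [AlgHom.comp_apply, GSym.map_map, AlgHom.id_apply]
      refine Eq.trans ?_ (GSym.map_id s)
      congr 1
      congr 1
      funext i
      exact LinearMap.ext fun φ => LinearMap.ext fun v =>
        congrArg φ ((Θ.toEquiv x i).apply_symm_apply v))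

theorem symFib_ofExt (x : W) (w : ExtFibre E (x : M)) :
    Θ.symFib x (GSym.ofExt _ w) = GSym.ofExt _ (Θ.fib x w) :=
  GSym.map_ofExt _ w

theorem symFib_symm_ofExt (x : W) (w : ExtDual V₀) :
    (Θ.symFib x).symm (GSym.ofExt _ w) = GSym.ofExt _ ((Θ.fib x).symm w) := by
  rw [AlgEquiv.symm_apply_eq, symFib_ofExt, LinearEquiv.apply_symm_apply]

theorem symFib_parity (x : W) (k : ℤ) (s : SymFibre E (x : M)) :
    Θ.symFib x (GSym.parity _ k s) = GSym.parity _ k (Θ.symFib x s) :=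
  GSym.map_parity _ k s

theorem symFib_symm_parity (x : W) (k : ℤ) (s) :
    (Θ.symFib x).symm (GSym.parity _ k s) = GSym.parity _ k ((Θ.symFib x).symm s) := by
  rw [AlgEquiv.symm_apply_eq, symFib_parity, AlgEquiv.apply_symm_apply]

theorem symFib_mem_deg (x : W) {l : ℤ} {s : SymFibre E (x : M)} (hs : s ∈ GSym.deg _ l) :
    Θ.symFib x s ∈ GSym.deg _ l := GSym.map_mem_deg _ hs

theorem symFib_symm_mem_deg (x : W) {l : ℤ} {s} (hs : s ∈ GSym.deg _ l) :
    (Θ.symFib x).symm s ∈ GSym.deg _ l := GSym.map_mem_deg _ hs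

open Classical in
/-- The coordinates of a section of `Sym E^*`. -/
def symHat {U : Opens M} (s : symSections F E d U) (y : M) :
    GSym (fun i => Module.Dual ℝ (V₀ i)) :=
  if h : y ∈ W ∧ y ∈ U then Θ.symFib ⟨y, h.1⟩ (s.1 ⟨y, h.2⟩) else 0

theorem symHat_apply {U : Opens M} (s : symSections F E d U) {y : M} (hW : y ∈ W) (hU : y ∈ U) :
    Θ.symHat s y = Θ.symFib ⟨y, hW⟩ (s.1 ⟨y, hU⟩) := dif_pos ⟨hW, hU⟩

theorem symHat_of_not {U : Opens M} (s : symSections F E d U) {y : M} (h : ¬ (y ∈ W ∧ y ∈ U)) :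
    Θ.symHat s y = 0 := dif_neg h

theorem symHat_add {U : Opens M} (s t : symSections F E d U) :
    Θ.symHat (s + t) = fun y => Θ.symHat s y + Θ.symHat t y := by
  funext y
  by_cases h : y ∈ W ∧ y ∈ U
  · rw [Θ.symHat_apply _ h.1 h.2, Θ.symHat_apply _ h.1 h.2, Θ.symHat_apply _ h.1 h.2, ← map_add]; rfl
  · rw [Θ.symHat_of_not _ h, Θ.symHat_of_not _ h, Θ.symHat_of_not _ h, add_zero]

theorem symHat_mul {U : Opens M} (s t : symSections F E d U) :
    Θ.symHat (s * t) = fun y => Θ.symHat s y * Θ.symHat t y := by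
  funext y
  by_cases h : y ∈ W ∧ y ∈ U
  · rw [Θ.symHat_apply _ h.1 h.2, Θ.symHat_apply _ h.1 h.2, Θ.symHat_apply _ h.1 h.2, ← map_mul]; rfl
  · rw [Θ.symHat_of_not _ h, Θ.symHat_of_not _ h, Θ.symHat_of_not _ h, mul_zero]

theorem symHat_smul {U : Opens M} (c : ℝ) (s : symSections F E d U) :
    Θ.symHat (c • s) = fun y => (c • LinearMap.id :
      GSym (fun i => Module.Dual ℝ (V₀ i)) →ₗ[ℝ] _) (Θ.symHat s y) := by
  funext y
  change Θ.symHat (c • s) y = c • Θ.symHat s y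
  by_cases h : y ∈ W ∧ y ∈ U
  · rw [Θ.symHat_apply _ h.1 h.2, Θ.symHat_apply _ h.1 h.2, ← map_smul]; rfl
  · rw [Θ.symHat_of_not _ h, Θ.symHat_of_not _ h, smul_zero]

theorem symHat_symSec {U : Opens M} (e : ExtSections F E d U) {y : M} (hW : y ∈ W) (hU : y ∈ U) :
    Θ.symHat (symSec e) y = GSym.ofExt _ (Θ.hat e y) := by
  rw [Θ.symHat_apply _ hW hU, Θ.hat_apply _ hW hU]
  exact Θ.symFib_ofExt _ _

theorem symHat_congr {U V : Opens M} {s : symSections F E d U} {t : symSections F E d V} {x : M}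
    {O : Opens M} (hO : x ∈ O) (hU : x ∈ U) (hV : x ∈ V)
    (h : ∀ y (hU : y ∈ U) (hV : y ∈ V), y ∈ O → s.1 ⟨y, hU⟩ = t.1 ⟨y, hV⟩) :
    Θ.symHat s =ᶠ[𝓝 x] Θ.symHat t := by
  filter_upwards [Opens.eventually_mem hO, Opens.eventually_mem hU, Opens.eventually_mem hV]
    with y hyO hyU hyV
  by_cases hW : y ∈ W
  · rw [Θ.symHat_apply _ hW hyU, Θ.symHat_apply _ hW hyV, h y hyU hyV hyO]
  · rw [Θ.symHat_of_not _ fun h => hW h.1, Θ.symHat_of_not _ fun h => hW h.1]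

/-- The fibres of Sym may be infinite-dimensional, but a section is locally a polynomial in finitely
many sections of E_ℝ^*, each a finite combination of constants with smooth coefficients. -/
theorem finSmoothAt_symHat {U : Opens M} (s : symSections F E d U) {x : M} (hW : x ∈ W)
    (hU : x ∈ U) : FinSmoothAt d (Θ.symHat s) x := by
  obtain ⟨V, h, hx, hV⟩ := s.2 ⟨x, hU⟩
  have h1 : FinSmoothAt d (Θ.symHat (symRestrict F E d h s)) x := by
    refine sym_induction (P := fun t => FinSmoothAt d (Θ.symHat t) x) ?_ ?_ ?_ hV
    · refine (FinSmoothAt.const 1).congr ?_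
      filter_upwards [Opens.eventually_mem hW, Opens.eventually_mem hx] with y hyW hyV
      rw [Θ.symHat_apply _ hyW hyV]
      exact map_one _
    · intro s t hs ht
      rw [symHat_add]
      exact hs.add ht
    · intro b e t _ ht
      rw [symHat_mul]
      refine FinSmoothAt.mul (((Θ.finSmoothAt_hat e hW hx).map (GSym.ofExt V₀)).congr ?_) ht
      filter_upwards [Opens.eventually_mem hW, Opens.eventually_mem hx] with y hyW hyV
      exact Θ.symHat_symSec e hyW hyV
  exact h1.congr (Θ.symHat_congr hx hU hx fun y _ _ _ => rfl)

/-- The graded derivation of `Sym E^*` at `x` with symbol `v` and coordinate matrix `δ`. -/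
def symDer (x : W) {U : Opens M} (hU : (x : M) ∈ U) {k : ℤ} (v : EuclideanSpace ℝ (Fin d))
    {δ : ExtDual V₀ →ₗ[ℝ] ExtDual V₀} (hδ : ExtDual.IsPreDer k δ) :
    symSections F E d U →ₗ[ℝ] SymFibre E (x : M) where
  toFun s := (Θ.symFib x).symm (gderiv d (x : M) v (Θ.symHat s) + GSym.der hδ (Θ.symHat s x))
  map_add' s t := by
    rw [symHat_add, gderiv_add (Θ.finSmoothAt_symHat s x.2 hU) (Θ.finSmoothAt_symHat t x.2 hU),
      ← map_add, map_add (GSym.der hδ)]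
    congr 1; abel
  map_smul' c s := by
    rw [symHat_smul, gderiv_map (Θ.finSmoothAt_symHat s x.2 hU), RingHom.id_apply, ← map_smul]
    change (Θ.symFib x).symm (c • gderiv d (x : M) v (Θ.symHat s) +
      GSym.der hδ (c • Θ.symHat s x)) = _
    rw [map_smul (GSym.der hδ), smul_add]

section

variable (x : W) {U : Opens M} (hU : (x : M) ∈ U) {k : ℤ} {v : EuclideanSpace ℝ (Fin d)}
  {δ : ExtDual V₀ →ₗ[ℝ] ExtDual V₀} (hδ : ExtDual.IsPreDer k δ)

theorem symDer_apply (s : symSections F E d U) : Θ.symDer x hU v hδ s =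
    (Θ.symFib x).symm (gderiv d (x : M) v (Θ.symHat s) + GSym.der hδ (Θ.symHat s x)) := rfl

theorem symDer_symSec (e : ExtSections F E d U) :
    Θ.symDer x hU v hδ (symSec e) = GSym.ofExt _ (Θ.pointDer x hU (v, δ) e) := by
  have h1 : Θ.symHat (symSec e) =ᶠ[𝓝 (x : M)] fun y => GSym.ofExt _ (Θ.hat e y) := by
    filter_upwards [Opens.eventually_mem x.2, Opens.eventually_mem hU] with y hyW hyU
    exact Θ.symHat_symSec e hyW hyU
  rw [symDer_apply, gderiv_congr h1, h1.self_of_nhds, gderiv_map (Θ.finSmoothAt_hat e x.2 hU),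
    GSym.der_ofExt, ← map_add, symFib_symm_ofExt, pointDer_apply]

theorem symDer_mul (hv : v ∈ symbolSpace d k) (s t : symSections F E d U) :
    Θ.symDer x hU v hδ (s * t) = Θ.symDer x hU v hδ s * t.1 ⟨x, hU⟩ +
      GSym.parity _ k (s.1 ⟨x, hU⟩) * Θ.symDer x hU v hδ t := by
  have h1 : ∀ s : symSections F E d U, s.1 ⟨x, hU⟩ = (Θ.symFib x).symm (Θ.symHat s x) := fun s => by
    rw [Θ.symHat_apply s x.2 hU, AlgEquiv.symm_apply_apply]
  -- The directional derivative obeys the unsigned Leibniz rule: the parity operator is trivial for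
  -- k = 0, and for k ≠ 0 the symbol vanishes.
  have h2 : GSym.parity _ k (Θ.symHat s x) * gderiv d (x : M) v (Θ.symHat t) =
      Θ.symHat s x * gderiv d (x : M) v (Θ.symHat t) := by
    by_cases hk : k = 0
    · have h3 : ∀ r, GSym.parity V₀ k r = r := fun r => by
        induction GSym.mem_iSup_deg r using Submodule.iSup_induction' with
        | mem l t ht => rw [GSym.parity_of_mem_deg k ht, hk, zero_mul, zpow_zero, one_smul]
        | zero => rw [map_zero]
        | add t t' _ _ ht ht' => rw [map_add, ht, ht']
      rw [h3]
    · rw [hv hk, gderiv_vec_zero, mul_zero, mul_zero]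
  have h3 : GSym.parity _ k (s.1 ⟨x, hU⟩) = (Θ.symFib x).symm (GSym.parity _ k (Θ.symHat s x)) := by
    rw [symFib_symm_parity]
    exact congrArg _ (h1 s)
  rw [h3, symDer_apply, symDer_apply, symDer_apply, h1 t, symHat_mul,
    gderiv_mul (Θ.finSmoothAt_symHat s x.2 hU) (Θ.finSmoothAt_symHat t x.2 hU), GSym.der_mul,
    ← map_mul, ← map_mul, ← map_add, add_mul, mul_add, h2]
  congr 1; abel

theorem symDer_congr {s t : symSections F E d U} {O : Opens M} (hO : (x : M) ∈ O)
    (h : ∀ y : U, (y : M) ∈ O → s.1 y = t.1 y) : Θ.symDer x hU v hδ s = Θ.symDer x hU v hδ t := by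
  have h1 := Θ.symHat_congr (s := s) (t := t) hO hU hU fun y hU _ hyO => h ⟨y, hU⟩ hyO
  rw [symDer_apply, symDer_apply, gderiv_congr h1, h1.self_of_nhds]

theorem symDer_mem_deg (hv : v ∈ symbolSpace d k) {l : ℤ} {s : symSections F E d U}
    (hs : ∀ y, s.1 y ∈ GSym.deg _ l) : Θ.symDer x hU v hδ s ∈ GSym.deg _ (l + k) := by
  have h1 : ∀ y, Θ.symHat s y ∈ GSym.deg _ l := fun y => by
    by_cases h : y ∈ W ∧ y ∈ U
    · rw [Θ.symHat_apply _ h.1 h.2]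
      exact Θ.symFib_mem_deg _ (hs ⟨y, h.2⟩)
    · rw [Θ.symHat_of_not _ h]
      exact Submodule.zero_mem _
  refine Θ.symFib_symm_mem_deg x (Submodule.add_mem _ ?_ (GSym.der_mem_deg hδ (h1 x)))
  by_cases hk : k = 0
  -- Projection to degree l is linear, so it commutes with the derivative, and it fixes the
  -- coordinates of s; the derivative thus stays in degree l.
  · have h2 := gderiv_map (Θ.finSmoothAt_symHat s x.2 hU) (GSym.proj l) v
    have h3 : (fun y => GSym.proj l (Θ.symHat s y)) = Θ.symHat s :=
      funext fun y => GSym.proj_of_mem_deg (h1 y)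
    rw [h3] at h2
    rw [h2, hk, add_zero]
    exact GSym.proj_mem_deg l _
  · rw [hv hk, gderiv_vec_zero]
    exact Submodule.zero_mem _

end

end LocFrame

/-- In a frame D is a directional derivative plus a matrix δ, and both extend to Sym. Any smooth
frame will do, and different frames never have to be compared: values on sections, Leibniz rule,
locality and degree are all that is used afterwards. -/
theorem exists_symDer {k : ℤ} {U : Opens M} {D : ExtSections F E d U →ₗ[ℝ] ExtSections F E d U}
    (hD : D ∈ derivations F E d k U) (h1 : D (oneSec F E d U) = 0) (x : U) :
    ∃ L : symSections F E d U →ₗ[ℝ] SymFibre E (x : M),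
      (∀ e, L (symSec e) = GSym.ofExt _ ((D e).1 x)) ∧
      (∀ s t, L (s * t) = L s * t.1 x + GSym.parity _ k (s.1 x) * L t) ∧
      (∀ (s t : symSections F E d U) (O : Opens M), (x : M) ∈ O →
        (∀ y : U, (y : M) ∈ O → s.1 y = t.1 y) → L s = L t) ∧
      ∀ (l : ℤ) (s : symSections F E d U), (∀ y, s.1 y ∈ GSym.deg _ l) → L s ∈ GSym.deg _ (l + k) := by
  obtain ⟨W, hW, ⟨Θ⟩⟩ := exists_locFrame (d := d) (V₀ := F) F E (fun _ => rfl) (x : M)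
  obtain ⟨v, hv⟩ := isDerivationAt_of_mem hD x
  have hvk : v ∈ symbolSpace d k := fun hk => eq_zero_of_vderiv_eq_zero x.2 fun f => by
    have h2 : (D (f • oneSec F E d U)).1 x = vderiv d (x : M) v (ext0 f) • ((1, 0) : ExtFibre E (x : M)) +
        f x • (D (oneSec F E d U)).1 x := hv f (oneSec F E d U)
    have h3 := (hD.2 0 (f • oneSec F E d U) (fun y => (oneSec_homog y).smul (f y)) x).1 (by simpa using hk)
    rw [h2, h1] at h3
    change vderiv d (x : M) v (ext0 f) * 1 + f x * 0 = 0 at h3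
    linarith
  obtain ⟨δ, hδ, hδk⟩ := Θ.exists_form x.2 hW (evalSec x ∘ₗ D) v hv
  have hδ' : ∀ e, (D e).1 x = Θ.pointDer ⟨x, hW⟩ x.2 (v, δ) e := hδ
  have hp : ExtDual.IsPreDer k δ := ⟨hδk k fun a e he => hD.2 a e he x, by
    have h2 := hδ' (oneSec F E d U)
    have h3 : Θ.hat (oneSec F E d U) =ᶠ[𝓝 (x : M)] fun _ => (1, 0) := by
      filter_upwards [Opens.eventually_mem hW, Opens.eventually_mem x.2] with y hyW hyU
      exact Θ.hat_oneSec hyW hyU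
    rw [h1, Θ.pointDer_of_eventuallyEq ⟨x, hW⟩ x.2 _ h3] at h2
    exact (Θ.fib ⟨x, hW⟩).symm.injective (h2.symm.trans (map_zero (Θ.fib ⟨(x : M), hW⟩).symm).symm)⟩
  refine ⟨Θ.symDer ⟨x, hW⟩ x.2 v hp, fun e => ?_, Θ.symDer_mul ⟨x, hW⟩ x.2 hp hvk,
    fun s t O hO h => Θ.symDer_congr ⟨x, hW⟩ x.2 hp hO h,
    fun l s hs => Θ.symDer_mem_deg ⟨x, hW⟩ x.2 hp hvk hs⟩
  rw [Θ.symDer_symSec, hδ']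

end SymDerivation

/-! ### Extension of compatible derivations to functions, and surjectivity -/

section Extension

variable {d n : ℕ} {M : Type*} [TopologicalSpace M] [ChartedSpace (EuclideanSpace ℝ (Fin d)) M]
  [T2Space M] [IsManifold (𝓡 d) ∞ M]
  {F : Fin n → Type*} [∀ i, NormedAddCommGroup (F i)] [∀ i, NormedSpace ℝ (F i)]
  {E : Fin n → M → Type*} [∀ i x, AddCommGroup (E i x)] [∀ i x, Module ℝ (E i x)]
  [∀ i x, TopologicalSpace (E i x)] [∀ i, TopologicalSpace (TotalSpace (F i) (E i))]
  [∀ i, FiberBundle (F i) (E i)] [∀ i, VectorBundle ℝ (F i) (E i)]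
  [∀ i, FiniteDimensional ℝ (F i)] [∀ i, ContMDiffVectorBundle ∞ (F i) (E i) (𝓡 d)]

theorem mem_symSections_of_local {U : Opens M} {f : ∀ x : U, SymFibre E (x : M)}
    (h : ∀ x : U, ∃ t ∈ symSections F E d U, ∃ W : Opens M, (x : M) ∈ W ∧
      ∀ y : U, (y : M) ∈ W → f y = t y) : f ∈ symSections F E d U := by
  intro x
  obtain ⟨t, ht, W, hxW, hW⟩ := h x
  obtain ⟨V, hV, hxV, htV⟩ := ht x
  refine ⟨W ⊓ V, inf_le_right.trans hV, ⟨hxW, hxV⟩, ?_⟩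
  convert piRestrict_adjoin F E (inf_le_right : W ⊓ V ≤ V) htV using 1
  funext y
  exact hW _ y.2.1

/-- Near a point s agrees with a polynomial in sections over U. By locality of L only polynomials
matter, and these are handled by `sym_induction`. -/
theorem mem_symSections_of_operator {U : Opens M} (L : ∀ x : U, symSections F E d U → SymFibre E (x : M))
    (hloc : ∀ (x : U) (s t : symSections F E d U) (O : Opens M), (x : M) ∈ O →
      (∀ y : U, (y : M) ∈ O → s.1 y = t.1 y) → L x s = L x t)
    (h1 : (fun x => L x 1) ∈ symSections F E d U)
    (hadd : ∀ x s t, L x (s + t) = L x s + L x t)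
    (hmul : ∀ (b : ℤ) e t, IsHomogSection F E b e → (fun x => L x t) ∈ symSections F E d U →
      (fun x => L x (symSec e * t)) ∈ symSections F E d U) (s : symSections F E d U) :
    (fun x => L x s) ∈ symSections F E d U := by
  refine mem_symSections_of_local fun x => ?_
  obtain ⟨t, ht, W, hWU, hxW, hW⟩ := exists_adjoin_eq_near le_rfl s x
  refine ⟨fun x => L x t, ?_, W, hxW, fun y hy => hloc y s t W hy fun z hz => (hW z hz).symm⟩
  refine sym_induction (P := fun t => (fun x => L x t) ∈ symSections F E d U) h1 ?_ hmul ht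
  intro s t hs ht
  convert add_mem hs ht using 1
  funext x
  exact hadd x s t

theorem parity_symSec_apply (k : ℤ) {U : Opens M} {b : ℤ} {e : ExtSections F E d U}
    (he : IsHomogSection F E b e) (x : U) :
    GSym.parity _ k ((symSec e).1 x) = ((-1 : ℝ) ^ (k * b)) • (symSec e).1 x :=
  GSym.parity_of_mem_deg k (GSym.ofExt_mem_deg (he x))

/-- The signed parity automorphism of the sections of `Sym E^*`. -/
def symParity (k : ℤ) (U : Opens M) : symSections F E d U →ₐ[ℝ] symSections F E d U where
  toFun s := ⟨fun x => GSym.parity _ k (s.1 x), by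
    refine mem_symSections_of_operator (fun x s => GSym.parity _ k (s.1 x)) ?_ ?_ ?_ ?_ s
    · intro x s t O hx h
      exact congrArg _ (h x hx)
    · convert one_mem (symSections F E d U) using 1
      funext x
      exact map_one (GSym.parity (fun i => E i (x : M)) k)
    · intro x s t
      exact map_add (GSym.parity (fun i => E i (x : M)) k) _ _
    · intro b e t he ht
      convert mul_mem (Subalgebra.smul_mem _ (symSec e).2 ((-1 : ℝ) ^ (k * b))) ht using 1
      funext x
      refine (map_mul (GSym.parity (fun i => E i (x : M)) k) ((symSec e).1 x) (t.1 x)).trans ?_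
      rw [parity_symSec_apply k he]
      rfl⟩
  map_one' := Subtype.ext (funext fun _ => map_one _)
  map_mul' _ _ := Subtype.ext (funext fun _ => map_mul _ _ _)
  map_zero' := Subtype.ext (funext fun _ => map_zero _)
  map_add' _ _ := Subtype.ext (funext fun _ => map_add _ _ _)
  commutes' c := Subtype.ext (funext fun _ => AlgHom.commutes _ c)

theorem symParity_eq_smul (k : ℤ) {U : Opens M} {l : ℤ} {s : symSections F E d U}
    (hs : ∀ x, s.1 x ∈ GSym.deg _ l) : symParity k U s = ((-1 : ℝ) ^ (k * l)) • s :=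
  Subtype.ext (funext fun x => GSym.parity_of_mem_deg k (hs x))

theorem symParity_symSec (k : ℤ) {U : Opens M} {b : ℤ} {e : ExtSections F E d U}
    (he : IsHomogSection F E b e) : symParity k U (symSec e) = ((-1 : ℝ) ^ (k * b)) • symSec e :=
  symParity_eq_smul k fun x => GSym.ofExt_mem_deg (he x)

/-- `Δ` is a graded derivation of the sections of `Sym E^*` which extends `D`. -/
structure IsSymExtension (k : ℤ) {U : Opens M} (D : ExtSections F E d U →ₗ[ℝ] ExtSections F E d U)
    (Δ : symSections F E d U →ₗ[ℝ] symSections F E d U) : Prop where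
  symSec : ∀ e, Δ (symSec e) = symSec (D e)
  mul : ∀ s t, Δ (s * t) = Δ s * t + symParity k U s * Δ t
  congr : ∀ (s t : symSections F E d U) (O : Opens M), (∀ y : U, (y : M) ∈ O → s.1 y = t.1 y) →
    ∀ y : U, (y : M) ∈ O → (Δ s).1 y = (Δ t).1 y
  deg : ∀ (l : ℤ) (s : symSections F E d U), (∀ y, s.1 y ∈ GSym.deg _ l) →
    ∀ y, (Δ s).1 y ∈ GSym.deg _ (l + k)

/-- The derivations at the various points are chosen independently of each other. Their values
nevertheless form a section: on generators they are given by D, and the Leibniz rule propagates this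
to polynomials. -/
theorem exists_isSymExtension {k : ℤ} {U : Opens M}
    {D : ExtSections F E d U →ₗ[ℝ] ExtSections F E d U} (hD : D ∈ derivations F E d k U)
    (h1 : D (oneSec F E d U) = 0) : ∃ Δ, IsSymExtension k D Δ := by
  choose L hL hmul hloc hdeg using exists_symDer hD h1
  have hmem : ∀ s, (fun x => L x s) ∈ symSections F E d U := by
    refine mem_symSections_of_operator (fun x s => L x s) hloc ?_ (fun x s t => map_add _ _ _) ?_
    · convert (symSec (D (oneSec F E d U))).2 using 1
      funext x
      rw [← symSec_oneSec]
      exact hL x _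
    · intro b e t he ht
      convert add_mem (mul_mem (symSec (D e)).2 t.2)
        (mul_mem (symParity k U (symSec e)).2 ht) using 1
      funext x
      refine (hmul x _ _).trans ?_
      rw [hL x e]
      rfl
  exact ⟨⟨⟨fun s => ⟨fun x => L x s, hmem s⟩,
    fun s t => Subtype.ext (funext fun x => map_add (L x) s t)⟩,
    fun c s => Subtype.ext (funext fun x => map_smul (L x) c s)⟩,
    fun e => Subtype.ext (funext fun x => hL x e),
    fun s t => Subtype.ext (funext fun x => hmul x s t),
    fun s t O h y hy => hloc y s t O hy h, fun l s hs y => hdeg y l s hs⟩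

theorem TwoSidedIdeal.algebra_smul_mem {R : Type*} [Ring R] [Algebra ℝ R] (I : TwoSidedIdeal R) (c : ℝ)
    {r : R} (hr : r ∈ I) : c • r ∈ I := by
  rw [Algebra.smul_def]
  exact I.mul_mem_left _ _ hr

/-- A section of the dual of `E i` as a section of `E_ℝ^*`. -/
def singleSec {U : Opens M} (i : Fin n) (ξ : ∀ x : U, Module.Dual ℝ (E i x))
    (hξ : IsSmoothCosection F E d i U ξ) : ExtSections F E d U :=
  ⟨fun x => (0, Pi.single i (ξ x)), contMDiff_const, fun j => by
    by_cases hj : j = i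
    · subst hj
      simpa using hξ
    · simp only [Pi.single_eq_of_ne hj]
      exact fun _ _ _ _ => contMDiff_const⟩

theorem singleSec_homog {U : Opens M} (i : Fin n) (ξ : ∀ x : U, Module.Dual ℝ (E i x))
    (hξ : IsSmoothCosection F E d i U ξ) : IsHomogSection F E (i.val + 1) (singleSec i ξ hξ) :=
  fun x => ExtDual.isHomog_single (V := fun i => E i (x : M)) i (ξ x)

namespace CoalgebraBundle

variable (B : CoalgebraBundle F E d)

theorem exists_of_mem_relators {U : Opens M} {s : symSections F E d U} (hs : s ∈ B.relators U) :
    ∃ (a b : ℤ) (e e' : ExtSections F E d U), IsHomogSection F E a e ∧ IsHomogSection F E b e' ∧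
      a + b ≤ n ∧ s = symSec e * symSec e' - symSec (B.mul e e') := by
  obtain ⟨i, j, ξ, η, hij, hξ, hη, hs⟩ := hs
  refine ⟨_, _, singleSec i ξ hξ, singleSec j η hη, singleSec_homog i ξ hξ, singleSec_homog j η hη,
    by omega, Subtype.ext (hs.trans (funext fun x => ?_))⟩
  change _ = GSym.ofExt _ (0, Pi.single i (ξ x)) * GSym.ofExt _ (0, Pi.single j (η x)) -
    GSym.ofExt _ (extMul (B.μ x) (0, Pi.single i (ξ x)) (0, Pi.single j (η x)))
  rw [extMul_single, GSym.ofExt_apply, GSym.ofExt_apply, GSym.ofExt_apply]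
  simp only [map_zero, zero_add]

/-- The sections over V whose germ at x comes from the ideal over U form an ideal, because
coefficients can be extended by `exists_adjoin_eq_near`; it contains the relators over V, whose
factors can be cut off. Operators defined over U can thereby be applied to local members of the
ideal. -/
theorem exists_span_eq_near {U V : Opens M} (h : V ≤ U) {s : symSections F E d V}
    (hs : s ∈ TwoSidedIdeal.span (B.relators V)) (x : V) :
    ∃ r ∈ TwoSidedIdeal.span (B.relators U), ∃ W : Opens M, (x : M) ∈ W ∧
      ∀ y : V, (y : M) ∈ W → r.1 (incl h y) = s.1 y := by
  let A : Set (symSections F E d V) := {s | ∃ r ∈ TwoSidedIdeal.span (B.relators U),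
    ∃ W : Opens M, (x : M) ∈ W ∧ ∀ y : V, (y : M) ∈ W → r.1 (incl h y) = s.1 y}
  let J : TwoSidedIdeal (symSections F E d V) := TwoSidedIdeal.mk' A
    ⟨0, TwoSidedIdeal.zero_mem _, V, x.2, fun _ _ => rfl⟩
    (by
      rintro s t ⟨r, hr, W, hx, hW⟩ ⟨r', hr', W', hx', hW'⟩
      exact ⟨r + r', TwoSidedIdeal.add_mem _ hr hr', W ⊓ W', ⟨hx, hx'⟩, fun y hy =>
        congrArg₂ (· + ·) (hW y hy.1) (hW' y hy.2)⟩)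
    (by
      rintro s ⟨r, hr, W, hx, hW⟩
      exact ⟨-r, TwoSidedIdeal.neg_mem _ hr, W, hx, fun y hy => congrArg (- ·) (hW y hy)⟩)
    (by
      rintro s t ⟨r, hr, W, hx, hW⟩
      obtain ⟨s', -, W', -, hx', hW'⟩ := exists_adjoin_eq_near h s x
      exact ⟨s' * r, TwoSidedIdeal.mul_mem_left _ _ _ hr, W ⊓ W', ⟨hx, hx'⟩, fun y hy =>
        congrArg₂ (· * ·) (hW' y hy.2) (hW y hy.1)⟩)
    (by
      rintro s t ⟨r, hr, W, hx, hW⟩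
      obtain ⟨s', -, W', -, hx', hW'⟩ := exists_adjoin_eq_near h t x
      exact ⟨r * s', TwoSidedIdeal.mul_mem_right _ _ _ hr, W ⊓ W', ⟨hx, hx'⟩, fun y hy =>
        congrArg₂ (· * ·) (hW y hy.1) (hW' y hy.2)⟩)
  have hJ : ∀ s, s ∈ J ↔ s ∈ A := fun s => TwoSidedIdeal.mem_mk' ..
  have h1 : TwoSidedIdeal.span (B.relators V) ≤ J := by
    rw [TwoSidedIdeal.span_le]
    intro t ht
    refine (hJ t).mpr ?_
    obtain ⟨a, b, e, e', he, he', hab, rfl⟩ := B.exists_of_mem_relators ht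
    obtain ⟨ρ, hρ⟩ := exists_isBump (d := d) x.2
    obtain ⟨W, hxW, hWV, hW⟩ := hρ.exists_opens x.2
    refine ⟨_, B.symSec_mul_sub_mem (e := cut hρ U e) (e' := cut hρ U e')
      (cut_homog hρ e he) (cut_homog hρ e' he') hab, W, hxW, fun y hy => ?_⟩
    have h2 : ∀ e : ExtSections F E d V, (cut hρ U e).1 (incl h y) = e.1 y := fun e => restrict_cut_eq hρ h e (hW y hy)
    have h3 : ∀ w w' u u' : ExtFibre E (y : M), w = u → w' = u' →
        GSym.ofExt _ w * GSym.ofExt _ w' - GSym.ofExt _ (extMul (B.μ y) w w') =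
          GSym.ofExt _ u * GSym.ofExt _ u' - GSym.ofExt _ (extMul (B.μ y) u u') := by
      rintro _ _ _ _ rfl rfl
      rfl
    exact h3 _ _ _ _ (h2 e) (h2 e')
  exact (hJ s).mp (h1 hs)

theorem symParity_span (k : ℤ) {U : Opens M} {s : symSections F E d U}
    (hs : s ∈ TwoSidedIdeal.span (B.relators U)) :
    symParity k U s ∈ TwoSidedIdeal.span (B.relators U) := by
  have h1 : TwoSidedIdeal.span (B.relators U) ≤
      (TwoSidedIdeal.span (B.relators U)).comap (symParity (F := F) (E := E) (d := d) k U) := by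
    rw [TwoSidedIdeal.span_le]
    intro t ht
    refine (TwoSidedIdeal.mem_comap _).mpr ?_
    obtain ⟨a, b, e, e', he, he', hab, rfl⟩ := B.exists_of_mem_relators ht
    rw [map_sub, map_mul, symParity_symSec k he, symParity_symSec k he',
      symParity_symSec k (B.mul_homog he he'), smul_mul_smul_comm, mul_add,
      zpow_add₀ (by norm_num : (-1 : ℝ) ≠ 0), ← smul_sub]
    exact TwoSidedIdeal.algebra_smul_mem _ _ (B.symSec_mul_sub_mem he he' hab)
  exact (TwoSidedIdeal.mem_comap _).mp (h1 hs)

section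

variable {k : ℤ} {U : Opens M} {D : ExtSections F E d U →ₗ[ℝ] ExtSections F E d U}
  {Δ : symSections F E d U →ₗ[ℝ] symSections F E d U}

/-- By compatibility of D, the relator of (e, e') goes to that of (D e, e') plus a signed one of (e,
D e'). These have degree a + b + k, still at most n because k ≤ 0. -/
theorem symExtension_span (hk : k ≤ 0) (hΔ : IsSymExtension k D Δ) (hD : D ∈ derivations F E d k U)
    (hc : B.IsCompatible k D) {s : symSections F E d U}
    (hs : s ∈ TwoSidedIdeal.span (B.relators U)) : Δ s ∈ TwoSidedIdeal.span (B.relators U) := by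
  -- Membership of s itself is carried along, since the Leibniz rule for products also yields terms
  -- with s or its parity image as a factor.
  let A : Set (symSections F E d U) :=
    {s | s ∈ TwoSidedIdeal.span (B.relators U) ∧ Δ s ∈ TwoSidedIdeal.span (B.relators U)}
  let J : TwoSidedIdeal (symSections F E d U) := TwoSidedIdeal.mk' A
    ⟨TwoSidedIdeal.zero_mem _, by rw [map_zero]; exact TwoSidedIdeal.zero_mem _⟩
    (fun hs ht => ⟨TwoSidedIdeal.add_mem _ hs.1 ht.1, by
      rw [map_add]; exact TwoSidedIdeal.add_mem _ hs.2 ht.2⟩)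
    (fun hs => ⟨TwoSidedIdeal.neg_mem _ hs.1, by
      rw [map_neg]; exact TwoSidedIdeal.neg_mem _ hs.2⟩)
    (fun ht => ⟨TwoSidedIdeal.mul_mem_left _ _ _ ht.1, by
      rw [hΔ.mul]
      exact TwoSidedIdeal.add_mem _ (TwoSidedIdeal.mul_mem_left _ _ _ ht.1)
        (TwoSidedIdeal.mul_mem_left _ _ _ ht.2)⟩)
    (fun hs => ⟨TwoSidedIdeal.mul_mem_right _ _ _ hs.1, by
      rw [hΔ.mul]
      exact TwoSidedIdeal.add_mem _ (TwoSidedIdeal.mul_mem_right _ _ _ hs.2)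
        (TwoSidedIdeal.mul_mem_right _ _ _ (B.symParity_span k hs.1))⟩)
  have hJ : ∀ s, s ∈ J ↔ s ∈ A := fun s => TwoSidedIdeal.mem_mk' ..
  have h1 : TwoSidedIdeal.span (B.relators U) ≤ J := by
    rw [TwoSidedIdeal.span_le]
    intro t ht
    refine (hJ t).mpr ⟨TwoSidedIdeal.subset_span ht, ?_⟩
    obtain ⟨a, b, e, e', he, he', hab, rfl⟩ := B.exists_of_mem_relators ht
    have h2 : Δ (symSec e * symSec e' - symSec (B.mul e e')) =
        (symSec (D e) * symSec e' - symSec (B.mul (D e) e')) +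
          ((-1 : ℝ) ^ (k * a)) • (symSec e * symSec (D e') - symSec (B.mul e (D e'))) := by
      rw [map_sub, hΔ.mul, hΔ.symSec, hΔ.symSec, hΔ.symSec, hc a b e e' he he' hab, map_add,
        negOnePow_smul, map_smul, symParity_symSec k he, smul_sub, smul_mul_assoc]
      abel
    rw [h2]
    exact TwoSidedIdeal.add_mem _ (B.symSec_mul_sub_mem (hD.2 a e he) he' (by omega))
      (TwoSidedIdeal.algebra_smul_mem _ _ (B.symSec_mul_sub_mem he (hD.2 b e' he') (by omega)))
  exact ((hJ s).mp (h1 hs)).2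

/-- Membership in the ideal sheaf is local, while Δ acts over U. Near x the section is replaced by
an element of the ideal over U, and locality of Δ compares the images. -/
theorem symExtension_idealSheaf (hk : k ≤ 0) (hΔ : IsSymExtension k D Δ)
    (hD : D ∈ derivations F E d k U) (hc : B.IsCompatible k D) {s : symSections F E d U}
    (hs : s ∈ B.idealSheaf U) : Δ s ∈ B.idealSheaf U := by
  refine B.mem_idealSheaf_iff.mpr fun x => ?_
  obtain ⟨V, h, hx, hV⟩ := B.mem_idealSheaf_iff.mp hs x
  obtain ⟨r, hr, W, hxW, hW⟩ := B.exists_span_eq_near h hV ⟨x, hx⟩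
  refine ⟨W ⊓ V, inf_le_right.trans h, ⟨hxW, hx⟩, ?_⟩
  convert B.symRestrict_span (inf_le_right.trans h : W ⊓ V ≤ U)
    (B.symExtension_span hk hΔ hD hc hr) using 1
  refine Subtype.ext (funext fun y => hΔ.congr s r (W ⊓ V) (fun z hz => ?_) _ y.2)
  exact (hW ⟨z, hz.2⟩ hz.1).symm

/-- Compatibility for 1 · 1 = 1, in degree 0 + 0 ≤ n, reads D(1) = D(1) + D(1). -/
theorem eq_zero_of_isCompatible (hc : B.IsCompatible k D) : D (oneSec F E d U) = 0 := by
  have h1 : ∀ e, B.mul (oneSec F E d U) e = e := fun e => ExtSections.ext_eval fun x =>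
    (extMul_scalar (B.μ x) 1 (e.1 x)).trans (one_smul ℝ _)
  have h2 : ∀ e, B.mul e (oneSec F E d U) = e := fun e => ExtSections.ext_eval fun x =>
    (extMul_scalar_right (B.μ x) 1 (e.1 x)).trans (one_smul ℝ _)
  have h3 := hc 0 0 (oneSec F E d U) (oneSec F E d U) oneSec_homog oneSec_homog (by omega)
  rw [h1, h1, h2, mul_zero, Int.negOnePow_zero, one_smul] at h3
  exact left_eq_add.mp h3

theorem exists_vectorField_of_mem (hk : k ≤ 0) (hD : D ∈ B.compatSections k U) :
    ∃ X ∈ B.vectorFields k U, ∀ e, X (B.ofSection U e) = B.ofSection U (D e) := by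
  have hc := (B.mem_compatSections_iff hD.1).mp hD
  obtain ⟨Δ, hΔ⟩ := exists_isSymExtension hD.1 (B.eq_zero_of_isCompatible hc)
  -- The choice q of representatives is merely set-theoretic; since Δ preserves the ideal, the class
  -- of the result does not depend on it, and linearity follows.
  let q := Function.surjInv (B.mkFun_surjective U)
  have hq : ∀ f, B.mkFun U (q f) = f := Function.surjInv_eq (B.mkFun_surjective U)
  have key : ∀ s, B.mkFun U (Δ (q (B.mkFun U s))) = B.mkFun U (Δ s) := fun s => by
    rw [mkFun_eq_iff, ← map_sub]
    exact B.symExtension_idealSheaf hk hΔ hD.1 hc (B.mkFun_eq_iff.mp (hq _))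
  let X : B.Fun U →ₗ[ℝ] B.Fun U :=
    { toFun := fun f => B.mkFun U (Δ (q f))
      map_add' := fun f g => by
        have h1 := key (q f + q g)
        rw [map_add (B.mkFun U), hq, hq] at h1
        rw [← map_add, ← map_add]
        exact h1
      map_smul' := fun c f => by
        have h1 := key (c • q f)
        rw [map_smul (B.mkFun U), hq] at h1
        rw [RingHom.id_apply, ← map_smul, ← map_smul]
        exact h1 }
  have hX : ∀ s, X (B.mkFun U s) = B.mkFun U (Δ s) := key
  refine ⟨X, ?_, fun e => ?_⟩
  · rintro l _ ⟨s, hs, rfl⟩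
    refine ⟨⟨Δ s, hΔ.deg l s hs, hX s⟩, fun g => ?_⟩
    obtain ⟨t, rfl⟩ := B.mkFun_surjective U g
    rw [← map_mul, hX, hX, hX, hΔ.mul, map_add, map_mul, map_mul, symParity_eq_smul k hs, map_smul,
      smul_mul_assoc, negOnePow_smul]
  · rw [ofSection_eq, hX, hΔ.symSec, ofSection_eq]

theorem vfToDer_surjective (hk : k ≤ 0) (U : Opens M) : Function.Surjective (B.vfToDer hk U) := by
  intro D
  obtain ⟨X, hX, h⟩ := B.exists_vectorField_of_mem hk D.2
  refine ⟨⟨X, hX⟩, Subtype.ext (LinearMap.ext fun e => B.ofSection_injective U ?_)⟩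
  rw [ofSection_vfToDer, h]

/-- The vector fields of degree `k ≤ 0` are the derivations of `E_ℝ^*` compatible with the
multiplication. -/
def vfEquivDer (hk : k ≤ 0) (U : Opens M) :
    B.vectorFields k U ≃ₗ[Smooth d U] B.compatSections k U :=
  LinearEquiv.ofBijective (B.vfToDer hk U) ⟨B.vfToDer_injective hk U, B.vfToDer_surjective hk U⟩

/-- Existence and uniqueness are transported from derivations of E_ℝ^*, where the restriction is
`resDer`. -/
theorem existsUnique_isRestrictionVF (hk : k ≤ 0) {U V : Opens M} (h : V ≤ U)
    (X : B.vectorFields k U) : ∃! Y : B.vectorFields k V, B.IsRestrictionVF h X.1 Y.1 := by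
  let D := B.vfToDer hk U X
  obtain ⟨Y, hY⟩ := B.vfToDer_surjective hk V
    ⟨resDer h D.2.1, B.resDer_mem_compatSections h D.2⟩
  refine ⟨Y, (B.isRestrictionVF_iff hk h X Y).mpr ?_, fun Y' hY' => ?_⟩
  · rw [hY]
    exact isRestrictionDer_resDer h D.2.1
  · refine B.vfToDer_injective hk V (Subtype.ext ?_)
    refine IsRestrictionDer.eq ((B.isRestrictionVF_iff hk h X Y').mp hY') ?_
      (B.vfToDer hk V Y').2.1 (B.vfToDer hk V Y).2.1
    rw [hY]
    exact isRestrictionDer_resDer h D.2.1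

end

end CoalgebraBundle

end Extension

/-! ### Degree −n: contraction with sections of the kernel -/

/-- Contraction with v is nonzero only on degree n, so under a + b ≤ n only (a, b) = (n, 0) and (0,
n) contribute, where one factor is a scalar; in the second case the sign is (-1)^0. -/
theorem ExtDual.pairing_compat {n : ℕ} {V : Fin n → Type*} [∀ i, AddCommGroup (V i)]
    [∀ i, Module ℝ (V i)] {p : Fin n} (hp : p.val + 1 = n) (v : V p) {a b : ℤ} {w w' : ExtDual V}
    (h : w.IsHomog a) (h' : w'.IsHomog b) (hab : a + b ≤ n) :
    ((w.1 * w'.2 p v + w'.1 * w.2 p v, 0) : ExtDual V) =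
      w.2 p v • w' + ((-1 : ℝ) ^ (-(n : ℤ) * a)) • w'.2 p v • w := by
  have hz : ∀ (a : ℤ) (w : ExtDual V), w.IsHomog a → a ≠ n → w.2 p v = 0 := fun a w h ha => by
    rw [h.2 p (by omega)]; rfl
  by_cases ha : a = n
  · have h1 : w'.2 = 0 := funext fun i => h'.2 i (by omega)
    rw [h.1 (by omega), hz b w' h' (by omega)]
    refine Prod.ext ?_ ?_
    · simp [mul_comm]
    · simp [h1]
  · rw [hz a w h ha]
    by_cases hb : b = n
    · rw [h'.1 (by omega)]
      by_cases ha0 : a = 0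
      · have h1 : w.2 = 0 := funext fun i => h.2 i (by omega)
        subst ha0
        refine Prod.ext ?_ ?_
        · simp [mul_comm]
        · simp [h1]
      · rw [h.eq_zero (.inl (by omega))]
        simp
    · rw [hz b w' h' hb]
      simp

/-- The functionals ξ ⊗ η span the dual of the tensor square, and on a tensor of degree m only their
components of total degree m matter. -/
theorem eq_zero_of_dualPair_single {n : ℕ} {V : Fin n → Type*} [∀ i, AddCommGroup (V i)]
    [∀ i, Module ℝ (V i)] [∀ i, FiniteDimensional ℝ (V i)] {m : ℕ}
    {t : (∀ i, V i) ⊗[ℝ] (∀ i, V i)} (ht : t ∈ tensorDeg V m)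
    (h : ∀ (i j : Fin n) (ξ : Module.Dual ℝ (V i)) (η : Module.Dual ℝ (V j)),
      (i.val + 1) + (j.val + 1) = m → dualPair (Pi.single i ξ) (Pi.single j η) t = 0) : t = 0 := by
  refine (Module.forall_dual_apply_eq_zero_iff ℝ t).mp fun ψ => ?_
  obtain ⟨r, ξ, c, hψ⟩ := exists_sum_dualPair ψ
  rw [hψ]
  refine Finset.sum_eq_zero fun a _ => Finset.sum_eq_zero fun b _ => mul_eq_zero_of_right _ ?_
  rw [dualPair_eq_sum_comp₂]
  refine Finset.sum_eq_zero fun i _ => Finset.sum_eq_zero fun j _ => ?_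
  by_cases hij : (i.val + 1) + (j.val + 1) = m
  · have h1 := h i j (ξ a i) (ξ b j) hij
    rw [dualPair_eq_sum_comp₂, Finset.sum_eq_single i, Finset.sum_eq_single j, Pi.single_eq_same,
      Pi.single_eq_same] at h1
    · exact h1
    · intro j' _ hj'
      rw [Pi.single_eq_of_ne hj', TensorProduct.map_zero_right, LinearMap.zero_apply, map_zero]
    · exact fun h => absurd (Finset.mem_univ _) h
    · intro i' _ hi'
      refine Finset.sum_eq_zero fun j' _ => ?_
      rw [Pi.single_eq_of_ne hi', TensorProduct.map_zero_left, LinearMap.zero_apply, map_zero]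
    · exact fun h => absurd (Finset.mem_univ _) h
  · rw [ht i j hij, map_zero, map_zero]

section KernelPart

variable {d n : ℕ} {M : Type*} [TopologicalSpace M] [ChartedSpace (EuclideanSpace ℝ (Fin d)) M]
  [T2Space M] [IsManifold (𝓡 d) ∞ M]
  {F : Fin n → Type*} [∀ i, NormedAddCommGroup (F i)] [∀ i, NormedSpace ℝ (F i)]
  {E : Fin n → M → Type*} [∀ i x, AddCommGroup (E i x)] [∀ i x, Module ℝ (E i x)]
  [∀ i x, TopologicalSpace (E i x)] [∀ i, TopologicalSpace (TotalSpace (F i) (E i))]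
  [∀ i, FiberBundle (F i) (E i)] [∀ i, VectorBundle ℝ (F i) (E i)]
  [∀ i, FiniteDimensional ℝ (F i)] [∀ i, ContMDiffVectorBundle ∞ (F i) (E i) (𝓡 d)]

open Classical in
theorem isSmoothSection_of_local {i : Fin n} {U : Opens M} {s : ∀ x : U, E i (x : M)}
    (h : ∀ x : U, ∃ (V : Opens M) (hV : V ≤ U), (x : M) ∈ V ∧
      IsSmoothSection F E d i V fun y => s (incl hV y)) : IsSmoothSection F E d i U s := by
  intro x
  obtain ⟨V, hV, hx, hs⟩ := h x
  -- Smoothness over U and over V is compared through a single map on M; its values outside U are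
  -- irrelevant.
  let f : M → TotalSpace (F i) (E i) := fun y =>
    if h : y ∈ U then TotalSpace.mk' (F i) y (s ⟨y, h⟩) else TotalSpace.mk' (F i) (x : M) (s x)
  have hf : ∀ y (h : y ∈ U), f y = TotalSpace.mk' (F i) y (s ⟨y, h⟩) := fun y h => dif_pos h
  have h1 : ContMDiffAt (𝓡 d) ((𝓡 d).prod 𝓘(ℝ, F i)) ∞ (fun y : V => f y) ⟨x, hx⟩ :=
    (hs ⟨x, hx⟩).congr_of_eventuallyEq (Filter.Eventually.of_forall fun y => hf y (hV y.2))
  have h2 : ContMDiffAt (𝓡 d) ((𝓡 d).prod 𝓘(ℝ, F i)) ∞ (fun y : U => f y) x :=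
    (contMDiffAt_subtype_iff (f := f)).mpr
      ((contMDiffAt_subtype_iff (f := f) (U := V) (x := ⟨x, hx⟩)).mp h1)
  exact h2.congr_of_eventuallyEq (Filter.Eventually.of_forall fun y => (hf y y.2).symm)

theorem exists_section_apply {U : Opens M} (x : U) {a : ℤ} {w : ExtFibre E (x : M)}
    (hw : w.IsHomog a) : ∃ e : ExtSections F E d U, IsHomogSection F E a e ∧ e.1 x = w := by
  obtain ⟨W, hW, ⟨Θ⟩⟩ := exists_locFrame (d := d) (V₀ := F) F E (fun _ => rfl) (x : M)
  obtain ⟨ρ, hρ⟩ := exists_isBump (d := d) hW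
  refine ⟨cut hρ U (Θ.constSec (Θ.fib ⟨x, hW⟩ w)), cut_homog hρ _ fun y => ?_, ?_⟩
  · exact (ExtDual.pullbackEquiv_symm_homog _).mpr ((ExtDual.pullbackEquiv_homog _).mpr hw)
  · rw [cut_apply (U := U) hρ _ (y := x) hW, Θ.constSec_apply]
    refine (congrArg (fun r : ℝ => r • (Θ.fib ⟨x, hW⟩).symm (Θ.fib ⟨x, hW⟩ w)) hρ.apply_self).trans ?_
    rw [one_smul, LinearEquiv.symm_apply_apply]

/-- As n ≥ 1, degree −n forces the symbol to vanish, so D is given at x by a linear map of the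
fibre. It kills all parts of degree < n and sends the part of degree n to a number, so it is an
element of the bidual of the fibre of E p. -/
theorem exists_pairing_eq {p : Fin n} (hp : p.val + 1 = n) {U : Opens M}
    {D : ExtSections F E d U →ₗ[ℝ] ExtSections F E d U}
    (hD : D ∈ derivations F E d (-(n : ℤ)) U) (x : U) :
    ∃ v : E p (x : M), ∀ e, (D e).1 x = ((e.1 x).2 p v, 0) := by
  have hfin := (finiteDimensional_fibre F E p (x : M)).2
  obtain ⟨W, hW, ⟨Θ⟩⟩ := exists_locFrame (d := d) (V₀ := F) F E (fun _ => rfl) (x : M)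
  obtain ⟨v, hv⟩ := isDerivationAt_of_mem hD x
  have hv0 : v = 0 := eq_zero_of_vderiv_eq_zero x.2 fun f => by
    have h2 : (D (f • oneSec F E d U)).1 x = vderiv d (x : M) v (ext0 f) • ((1, 0) : ExtFibre E (x : M)) +
        f x • (D (oneSec F E d U)).1 x := hv f (oneSec F E d U)
    have h3 := (hD.2 0 (f • oneSec F E d U) (fun y => (oneSec_homog y).smul (f y)) x).1 (by omega)
    have h4 := (hD.2 0 (oneSec F E d U) oneSec_homog x).1 (by omega)
    have h5 := congrArg Prod.fst h2
    rw [h3] at h5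
    change (0 : ℝ) = vderiv d (x : M) v (ext0 f) * 1 + f x * ((D (oneSec F E d U)).1 x).1 at h5
    rw [h4] at h5
    linarith
  subst hv0
  obtain ⟨δ, hδ, -⟩ := Θ.exists_form x.2 hW (evalSec x ∘ₗ D) 0 hv
  let l : ExtFibre E (x : M) →ₗ[ℝ] ExtFibre E (x : M) :=
    (Θ.fib ⟨x, hW⟩).symm.toLinearMap ∘ₗ δ ∘ₗ (Θ.fib ⟨x, hW⟩).toLinearMap
  have hl : ∀ e, (D e).1 x = l (e.1 x) := fun e => by
    refine (hδ e).trans ?_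
    rw [gderiv_vec_zero, zero_add, Θ.hat_apply e hW x.2]
    rfl
  let ψ : Module.Dual ℝ (Module.Dual ℝ (E p (x : M))) := LinearMap.fst ℝ ℝ _ ∘ₗ l ∘ₗ
    LinearMap.inr ℝ ℝ _ ∘ₗ LinearMap.single ℝ (fun i => Module.Dual ℝ (E i (x : M))) p
  refine ⟨(Module.evalEquiv ℝ (E p (x : M))).symm ψ, fun e => ?_⟩
  have h1 : D e = D (partSec n e) := by
    conv_lhs => rw [← sum_partSec e, map_sum]
    refine Finset.sum_eq_single n (fun a ha han => ?_) fun h => absurd (Finset.self_mem_range_succ n) h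
    refine CoalgebraBundle.homogSection_eq_zero (hD.2 a _ (partSec_homog a e)) (.inl ?_)
    have := Finset.mem_range.mp ha
    omega
  have h2 : (partSec n e).1 x = (0, Pi.single p ((e.1 x).2 p)) := by
    have h3 := partSec_homog n e x
    have hpn : (n : ℤ) = p.val + 1 := by omega
    rw [hpn] at h3
    refine h3.eq_single.trans ?_
    have h4 : ((partSec n e).1 x).2 p = (e.1 x).2 p := if_pos hp
    rw [h4]
  have h3 := hD.2 n _ (partSec_homog n e) x
  rw [add_neg_cancel] at h3
  rw [h1]
  refine h3.eq_scalar.trans (Prod.ext ?_ rfl)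
  rw [hl, h2]
  exact (Module.apply_evalEquiv_symm_apply ℝ (E p (x : M)) ((e.1 x).2 p) ψ).symm

variable (B : CoalgebraBundle F E d)

namespace CoalgebraBundle

section

variable {p : Fin n} {U : Opens M}

/-- Contraction with a section of `ker μ_p`. -/
def kerDer (s : B.KerSections p U) : ExtSections F E d U →ₗ[ℝ] ExtSections F E d U where
  toFun e := pairing p e s.1 s.2.1
  map_add' _ _ := ExtSections.ext_eval fun _ => Prod.ext rfl (add_zero _).symm
  map_smul' c _ := ExtSections.ext_eval fun _ => Prod.ext rfl (smul_zero c).symm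

theorem kerDer_apply (s : B.KerSections p U) (e : ExtSections F E d U) (x : U) :
    (B.kerDer s e).1 x = ((e.1 x).2 p (s.1 x), 0) := rfl

theorem kerDer_mem_derivations (hp : p.val + 1 = n) (s : B.KerSections p U) :
    B.kerDer s ∈ derivations F E d (-(n : ℤ)) U := by
  refine ⟨⟨0, fun f e x => ?_⟩, fun a e he x => ⟨fun ha => ?_, fun _ _ => rfl⟩⟩
  · change _ = dirDeriv f x 0 • e.1 x + f x • (B.kerDer s e).1 x
    rw [map_zero, zero_smul, zero_add, kerDer_apply]
    exact Prod.ext rfl (smul_zero (f x)).symm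
  · rw [kerDer_apply, (he x).2 p (by omega)]
    rfl

theorem kerDer_mem (hp : p.val + 1 = n) (s : B.KerSections p U) :
    B.kerDer s ∈ B.compatSections (-(n : ℤ)) U := by
  refine (B.mem_compatSections_iff (B.kerDer_mem_derivations hp s)).mpr
    fun a b e e' he he' hab => ExtSections.ext_eval fun x => ?_
  rw [negOnePow_smul]
  change ((extMul (B.μ x) (e.1 x) (e'.1 x)).2 p (s.1 x), 0) =
    extMul (B.μ x) ((e.1 x).2 p (s.1 x), 0) (e'.1 x) + ((-1 : ℝ) ^ (-(n : ℤ) * a)) •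
      extMul (B.μ x) (e.1 x) ((e'.1 x).2 p (s.1 x), 0)
  rw [extMul_scalar, extMul_scalar_right, ← ExtDual.pairing_compat hp (s.1 x) (he x) (he' x) hab]
  refine Prod.ext ?_ rfl
  change (e.1 x).1 * (e'.1 x).2 p (s.1 x) + (e'.1 x).1 * (e.1 x).2 p (s.1 x) +
    dualMul (B.μ x) (e.1 x).2 (e'.1 x).2 p (s.1 x) = _
  rw [dualMul_apply, s.2.2 x, map_zero, add_zero]

/-- Contraction with sections of `ker μ_p`, as a linear map. -/
def kerToDer (hp : p.val + 1 = n) (U : Opens M) :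
    B.KerSections p U →ₗ[Smooth d U] B.compatSections (-(n : ℤ)) U where
  toFun s := ⟨B.kerDer s, B.kerDer_mem hp s⟩
  map_add' s t := Subtype.ext (LinearMap.ext fun e => ExtSections.ext_eval fun x =>
    Prod.ext (map_add ((e.1 x).2 p) (s.1 x) (t.1 x)) (add_zero _).symm)
  map_smul' f s := Subtype.ext (LinearMap.ext fun e => ExtSections.ext_eval fun x =>
    Prod.ext (map_smul ((e.1 x).2 p) (f x) (s.1 x)) (smul_zero (f x)).symm)

theorem eq_of_pairing_eq {x : U} {v v' : E p (x : M)}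
    (h : ∀ e : ExtSections F E d U, (e.1 x).2 p v = (e.1 x).2 p v') : v = v' := by
  have hfin := (finiteDimensional_fibre F E p (x : M)).2
  refine sub_eq_zero.mp ((Module.forall_dual_apply_eq_zero_iff ℝ _).mp fun φ => ?_)
  obtain ⟨e, -, he⟩ := exists_section_apply (F := F) (d := d) x
    (ExtDual.isHomog_single (V := fun i => E i (x : M)) p φ)
  have h1 := h e
  rw [he] at h1
  change Pi.single (M := fun i => Module.Dual ℝ (E i (x : M))) p φ p v =
    Pi.single (M := fun i => Module.Dual ℝ (E i (x : M))) p φ p v' at h1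
  rw [Pi.single_eq_same] at h1
  rw [map_sub, h1, sub_self]

theorem kerToDer_injective (hp : p.val + 1 = n) (U : Opens M) :
    Function.Injective (B.kerToDer hp U) := by
  intro s t h
  refine Subtype.ext (funext fun x => eq_of_pairing_eq (F := F) (d := d) fun e => ?_)
  have h1 : B.kerDer s = B.kerDer t := congrArg Subtype.val h
  have h2 : (B.kerDer s e).1 x = (B.kerDer t e).1 x := by rw [h1]
  exact congrArg Prod.fst h2

theorem kerToDer_surjective (hp : p.val + 1 = n) (U : Opens M) :
    Function.Surjective (B.kerToDer hp U) := by
  rintro ⟨D, hD⟩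
  choose s hs using exists_pairing_eq hp hD.1
  have hsm : IsSmoothSection F E d p U s := by
    refine isSmoothSection_of_local fun x => ?_
    obtain ⟨W, hW, ⟨Θ⟩⟩ := NManifold.exists_locFrame (d := d) (V₀ := F) F E (fun _ => rfl) (x : M)
    obtain ⟨ρ, hρ⟩ := exists_isBump (d := d) hW
    obtain ⟨W', hxW', hW', hρ1⟩ := hρ.exists_opens (V := W ⊓ U) ⟨hW, x.2⟩
    refine ⟨W', hW'.trans inf_le_right, hxW',
      (Θ.restrict (hW'.trans inf_le_left)).isSmoothSection fun φ => ?_⟩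
    -- Near x the pairing of s with the frame cosection of φ is the coordinate φ(s); it equals D e
    -- there and is therefore smooth.
    let e := cut hρ U (Θ.constSec (0, Pi.single p φ))
    refine ((D e).2.1.comp (contMDiff_incl (hW'.trans inf_le_right))).congr fun y => ?_
    change φ ((Θ.toEquiv ⟨y, (hW' y.2).1⟩ p).symm (s ⟨y, (hW' y.2).2⟩)) =
      ((D e).1 ⟨y, (hW' y.2).2⟩).1
    have h1 : e.1 ⟨y, (hW' y.2).2⟩ = (Θ.fib ⟨y, (hW' y.2).1⟩).symm (0, Pi.single p φ) := by
      refine (cut_apply (U := U) hρ _ (y := ⟨y, (hW' y.2).2⟩) (hW' y.2).1).trans ?_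
      rw [hρ1 y y.2, one_smul]
      rfl
    rw [hs, h1]
    change _ = Pi.single (M := fun i => Module.Dual ℝ (F i)) p φ p
      ((Θ.toEquiv ⟨y, (hW' y.2).1⟩ p).symm (s ⟨y, (hW' y.2).2⟩))
    rw [Pi.single_eq_same]
  refine ⟨⟨s, hsm, fun x => ?_⟩, Subtype.ext (LinearMap.ext fun e =>
    ExtSections.ext_eval fun x => (hs x e).symm)⟩
  have hfin := fun i => (finiteDimensional_fibre F E i (x : M)).2
  refine eq_zero_of_dualPair_single (B.degree_preserving x p (s x)) fun i j ξ η hij => ?_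
  obtain ⟨e, he, hex⟩ := exists_section_apply (F := F) (d := d) x
    (ExtDual.isHomog_single (V := fun i => E i (x : M)) i ξ)
  obtain ⟨e', he', hex'⟩ := exists_section_apply (F := F) (d := d) x
    (ExtDual.isHomog_single (V := fun i => E i (x : M)) j η)
  -- Both factors have positive degree and the sum is n, so each has degree < n and is killed by D.
  -- Compatibility then says that s pairs to zero with m(e, e'), that is, (ξ ⊗ η)(μ s) = 0 at x.
  have h1 := (B.mem_compatSections_iff hD.1).mp hD _ _ e e' he he' (by omega)
  rw [homogSection_eq_zero (hD.1.2 _ e he) (.inl (by omega)),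
    homogSection_eq_zero (hD.1.2 _ e' he') (.inl (by omega)), negOnePow_smul] at h1
  have h2 := (hs x (B.mul e e')).symm.trans (congrArg (evalSec x) h1)
  have h3 : ((B.mul e e').1 x).2 p (s x) = 0 := by
    refine (congrArg Prod.fst h2).trans ?_
    change 0 * (e'.1 x).1 + (-1 : ℝ) ^ _ * ((e.1 x).1 * 0) = 0
    ring
  change (extMul (B.μ x) (e.1 x) (e'.1 x)).2 p (s x) = 0 at h3
  rw [hex, hex', extMul_single] at h3
  exact h3

/-- The sections of `ker μ_{-n}` as vector fields of degree `-n`. -/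
def vfEquivKer (hp : p.val + 1 = n) (U : Opens M) :
    B.vectorFields (-(n : ℤ)) U ≃ₗ[Smooth d U] B.KerSections p U :=
  (B.vfEquivDer (by omega) U).trans (LinearEquiv.ofBijective (B.kerToDer hp U)
    ⟨B.kerToDer_injective hp U, B.kerToDer_surjective hp U⟩).symm

theorem kerDer_vfEquivKer (hp : p.val + 1 = n) (X : B.vectorFields (-(n : ℤ)) U) :
    B.kerDer (B.vfEquivKer hp U X) = (B.vfToDer (by omega) U X).1 :=
  congrArg Subtype.val (LinearEquiv.apply_symm_apply (LinearEquiv.ofBijective (B.kerToDer hp U)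
    ⟨B.kerToDer_injective hp U, B.kerToDer_surjective hp U⟩) (B.vfEquivDer (by omega) U X))

theorem isRestrictionVF_iff_ker (hp : p.val + 1 = n) {V : Opens M} (h : V ≤ U)
    (X : B.vectorFields (-(n : ℤ)) U) (Y : B.vectorFields (-(n : ℤ)) V) :
    B.IsRestrictionVF h X.1 Y.1 ↔
      ∀ x : V, (B.vfEquivKer hp V Y).1 x = (B.vfEquivKer hp U X).1 (incl h x) := by
  rw [B.isRestrictionVF_iff (by omega) h X Y, ← B.kerDer_vfEquivKer hp, ← B.kerDer_vfEquivKer hp]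
  constructor
  · intro hr x
    refine eq_of_pairing_eq (F := F) (d := d) (x := incl h x) fun e => ?_
    exact congrArg Prod.fst (congrArg (evalSec x) (hr e))
  · intro hr e
    refine ExtSections.ext_eval fun x => ?_
    change ((e.1 (incl h x)).2 p _, 0) = ((e.1 (incl h x)).2 p _, 0)
    refine Prod.ext ?_ rfl
    exact congrArg ((e.1 (incl h x)).2 p) (hr x)

end

/-- An intertwining frame carries the kernel in the reference fibre isomorphically onto the kernel
at every point, so a basis of the former, kept constant in the frame, is a smooth frame of the
latter. -/
theorem exists_kerFrame (hB : B.IsAdmissible) (p : Fin n) :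
    ∃ r : ℕ, ∀ x₀ : M, ∃ V : Opens M, x₀ ∈ V ∧ ∃ s : Fin r → ∀ x : V, E p (x : M),
      (∀ a, IsSmoothSection F E d p V (s a)) ∧
      ∀ x : V, LinearIndependent ℝ (fun a => s a x) ∧
        Submodule.span ℝ (Set.range fun a => s a x) = B.kerFibre p (x : M) := by
  rcases isEmpty_or_nonempty M with hM | ⟨⟨x₁⟩⟩
  · exact ⟨0, fun x => hM.elim x⟩
  have := fun i => (finiteDimensional_fibre F E i x₁).2
  obtain ⟨r, c, hc, hc2⟩ := exists_basis_family (B.kerFibre p x₁)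
  refine ⟨r, fun x₀ => ?_⟩
  obtain ⟨V, hV, Θ, hΘ⟩ := B.exists_locFrame hB x₁ x₀
  refine ⟨V, hV, fun a x => Θ.toEquiv x p (c a), fun a => Θ.smooth p (c a), fun x => ⟨?_, ?_⟩⟩
  · exact hc.map' _ (Θ.toEquiv x p).ker
  let T := totalMap fun i => (Θ.toEquiv x i).toLinearMap
  let T' := totalMap fun i => (Θ.toEquiv x i).symm.toLinearMap
  have hT : T' ∘ₗ T = LinearMap.id := LinearMap.ext fun v => funext fun i =>
    (Θ.toEquiv x i).symm_apply_apply (v i)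
  have hT2 : ∀ t, TensorProduct.map T T t = 0 → t = 0 := fun t ht => by
    have h1 : TensorProduct.map T' T' (TensorProduct.map T T t) = t := by
      rw [← LinearMap.comp_apply, ← TensorProduct.map_comp, hT, TensorProduct.map_id]
      rfl
    rw [← h1, ht, map_zero]
  have h1 : ∀ u : E p x₁, Θ.toEquiv x p u ∈ B.kerFibre p (x : M) ↔ u ∈ B.kerFibre p x₁ := fun u => by
    have h2 : TensorProduct.map T T (B.μ x₁ (Pi.single p u)) =
        B.μ x (Pi.single p (Θ.toEquiv x p u)) := by
      refine (hΘ x (Pi.single p u)).trans (congrArg (B.μ x) ?_)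
      exact totalMap_single (fun i => (Θ.toEquiv x i).toLinearMap) p u
    change B.μ x (Pi.single p (Θ.toEquiv x p u)) = 0 ↔ B.μ x₁ (Pi.single p u) = 0
    rw [← h2]
    exact ⟨hT2 _, fun h => by rw [h, map_zero]⟩
  have h2 : (Set.range fun a => Θ.toEquiv x p (c a)) = (Θ.toEquiv x p).toLinearMap '' Set.range c := by
    rw [← Set.range_comp]; rfl
  rw [h2, Submodule.span_image, hc2]
  ext v
  constructor
  · rintro ⟨u, hu, rfl⟩
    exact (h1 u).mpr hu
  · intro hv
    refine ⟨(Θ.toEquiv x p).symm v, (h1 _).mp ?_, (Θ.toEquiv x p).apply_symm_apply v⟩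
    rw [LinearEquiv.apply_symm_apply]
    exact hv

end CoalgebraBundle

end KernelPart

end NManifold

end

theorem mainTheorem5 {d n : ℕ} {M : Type*} [TopologicalSpace M]
    [ChartedSpace (EuclideanSpace ℝ (Fin d)) M] [IsManifold (𝓡 d) ∞ M] [T2Space M]
    [SecondCountableTopology M]
    (F : Fin n → Type*) [∀ i, NormedAddCommGroup (F i)] [∀ i, NormedSpace ℝ (F i)]
    [∀ i, FiniteDimensional ℝ (F i)]
    (E : Fin n → M → Type*) [∀ i x, AddCommGroup (E i x)] [∀ i x, Module ℝ (E i x)]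
    [∀ i x, TopologicalSpace (E i x)] [∀ i, TopologicalSpace (TotalSpace (F i) (E i))]
    [∀ i, FiberBundle (F i) (E i)] [∀ i, VectorBundle ℝ (F i) (E i)]
    [∀ i, ContMDiffVectorBundle ∞ (F i) (E i) (𝓡 d)]
    (B : NManifold.CoalgebraBundle F E d) (hB : B.IsAdmissible) :
    -- the canonical maps identify the sections of `(𝐄_ℝ^*)_a` with the functions of degree `a ≤ n`
    (∀ U : Opens M, Function.Injective (B.ofSection U) ∧ ∀ a : ℤ, 0 ≤ a → a ≤ n →
      B.ofSection U '' {e | NManifold.IsHomogSection F E a e} = B.funDeg U a) ∧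
    -- vector fields of degree `k`, for `k = -n, …, 0`
    (∀ k : ℤ, -(n : ℤ) ≤ k → k ≤ 0 →
      -- `Der(𝐄_ℝ^*, m)_k` is a smooth subbundle of `Der(𝐄_ℝ^*)_k`
      (∃ r : ℕ, ∀ x₀ : M, ∃ V : Opens M, x₀ ∈ V ∧
        ∃ D : Fin r → (NManifold.ExtSections F E d V →ₗ[ℝ] NManifold.ExtSections F E d V),
          (∀ a, D a ∈ NManifold.derivations F E d k V) ∧
          ∀ x : V, LinearIndependent ℝ (fun a => NManifold.derAt (D a) x) ∧
            Submodule.span ℝ (Set.range fun a => NManifold.derAt (D a) x) =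
              B.compatFibre k (x : M)) ∧
      -- its sections are exactly the derivations of degree `k` compatible with `m`
      (∀ (U : Opens M), ∀ D ∈ NManifold.derivations F E d k U,
        (D ∈ B.compatSections k U ↔ B.IsCompatible k D)) ∧
      -- vector fields restrict to open subsets
      (∀ (U V : Opens M) (h : V ≤ U) (X : B.vectorFields k U),
        ∃! Y : B.vectorFields k V, B.IsRestrictionVF h X.1 Y.1) ∧
      -- the sheaf of vector fields is the sheaf of sections of `Der(𝐄_ℝ^*, m)_k`
      ∃ Υ : ∀ U : Opens M, B.vectorFields k U ≃ₗ[NManifold.Smooth d U] B.compatSections k U,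
        (∀ (U : Opens M) (X : B.vectorFields k U) (e : NManifold.ExtSections F E d U),
          B.ofSection U ((Υ U X).1 e) = X.1 (B.ofSection U e)) ∧
        ∀ (U V : Opens M) (h : V ≤ U) (X : B.vectorFields k U) (Y : B.vectorFields k V),
          B.IsRestrictionVF h X.1 Y.1 ↔ NManifold.IsRestrictionDer h (Υ U X).1 (Υ V Y).1) ∧
    -- vector fields of degree `-n` (`E p` being the summand of degree `-n`)
    (∀ p : Fin n, p.val + 1 = n →
      -- `ker μ_{-n}` is a smooth subbundle of `E_{-n}`
      (∃ r : ℕ, ∀ x₀ : M, ∃ V : Opens M, x₀ ∈ V ∧ ∃ s : Fin r → ∀ x : V, E p x,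
        (∀ a, NManifold.IsSmoothSection F E d p V (s a)) ∧
        ∀ x : V, LinearIndependent ℝ (fun a => s a x) ∧
          Submodule.span ℝ (Set.range fun a => s a x) = B.kerFibre p (x : M)) ∧
      -- the sheaf of vector fields of degree `-n` is the sheaf of sections of `ker μ_{-n}`
      ∃ Λ : ∀ U : Opens M,
          B.vectorFields (-(n : ℤ)) U ≃ₗ[NManifold.Smooth d U] B.KerSections p U,
        (∀ (U : Opens M) (X : B.vectorFields (-(n : ℤ)) U) (e : NManifold.ExtSections F E d U),
          X.1 (B.ofSection U e) =
            B.ofSection U (NManifold.pairing p e (Λ U X).1 (Λ U X).2.1)) ∧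
        ∀ (U V : Opens M) (h : V ≤ U) (X : B.vectorFields (-(n : ℤ)) U)
          (Y : B.vectorFields (-(n : ℤ)) V),
          B.IsRestrictionVF h X.1 Y.1 ↔
            ∀ x : V, (Λ V Y).1 x = (Λ U X).1 (NManifold.incl h x)) := by
  refine ⟨fun U => ⟨B.ofSection_injective U, fun a _ ha => B.ofSection_image U ha⟩,
    fun k _ hk => ⟨B.exists_frame hB k, fun U D hD => B.mem_compatSections_iff hD,
      fun U V h X => B.existsUnique_isRestrictionVF hk h X, fun U => B.vfEquivDer hk U,
      fun U X e => B.ofSection_vfToDer hk X e, fun U V h X Y => B.isRestrictionVF_iff hk h X Y⟩,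
    fun p hp => ⟨B.exists_kerFrame hB p, fun U => B.vfEquivKer hp U, fun U X e => ?_,
      fun U V h X Y => B.isRestrictionVF_iff_ker hp h X Y⟩⟩
  -- Both sides are images of the same section: the derivation attached to X is contraction with its
  -- kernel section, and this is the pairing by definition.
  rw [← B.ofSection_vfToDer (by omega) X e, ← B.kerDer_vfEquivKer hp X]
  rfl
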